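/- Let $(N,J,\theta)$ be a (smooth, strictly pseudoconvex) pseudohermitian 3-manifold, and use local unitary coframes $\theta^1$, i.e. $d\theta=i\,\theta^1\wedge\theta^{\bar 1}$, with dual frame $(T,Z_1,Z_{\bar 1})$. The connection form $\omega_1^1$, torsion $A_{11}$ and Tanaka–Webster curvature $R$ are given by $d\theta^1=\theta^1\wedge\omega_1^1+\overline{A_{11}}\,\theta\wedge\theta^{\bar 1}$, $\omega_1^1+\overline{\omega_1^1}=0$, $d\omega_1^1=R\,\theta^1\wedge\theta^{\bar 1}\pmod\theta$; indices after a comma denote covariant derivatives for $\omega_1^1$. Put $\square_b f=-(f_{,1\bar 1}+f_{,\bar 1 1})+iTf=-2f_{,\bar 1 1}$ and let $Pf=4\,(f_{,\bar 1 1 1}+iA_{11}f_{,\bar 1})_{,\bar 1}$ be the CR Paneitz operator. On the Heisenberg group $\mathbb H^1=\mathbb C\times\mathbb R\ni(z,t)$ let $\rho^4=|z|^4+t^2$, $\theta_0=dt+iz\,d\bar z-i\bar z\,dz$, $\mathring Z_1=\frac1{\sqrt2}(\partial_z+i\bar z\partial_t)$, $\mathring Z_{\bar 1}=\overline{\mathring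 Z_1}$. Write $f=O(\rho^k)$ if $f$ is smooth near infinity and every composition of $j\ge 0$ of the fields $\mathring Z_1,\mathring Z_{\bar 1}$ applied to $f$ is bounded by a constant times $\rho^{k-j}$ near infinity. $(N,J,\theta)$ is called asymptotically flat if, outside a compact set, it has coordinates (a diffeomorphism onto the complement of a ball $\{\rho\le\rho_0\}$ in $\mathbb H^1$, the part of $N$ outside $\{\rho>\Lambda\}$ being compact for each $\Lambda>\rho_0$) and there a unitary coframe $\theta^1$, such that for some $A\in\mathbb R$ $$\theta=(1+4\pi A\rho^{-2}+O(\rho^{-3}))\theta_0+O(\rho^{-3})dz+O(\rho^{-3})d\bar z,$$ $$\theta^1=O(\rho^{-3})\theta_0+O(\rho^{-4})d\bar z+(1+2\pi A\rho^{-2}+O(\rho^{-3}))\sqrt2\,dz,$$ and $R\in L^1(N,\theta\wedge d\theta)$. With $\omega_1^1$ the connection form of this coframe, its p-mass is $m(J,\theta)=\lim_{\Lambda\to\infty}i\oint_{\{\rho=\Lambda\}}\omega_1^1\wedge\theta$. **Proposition 2.6.** Let $(N,J,\theta)$ be an asymptotically flat pseudohermitian 3-manifold, let $\varepsilon\in(0,1)$,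 and let $\beta:N\to\mathbb C$ be smooth with $$\beta=\bar z+\beta_{-1}+O(\rho^{-2+\varepsilon})\ \text{ near infinity},\qquad \square_b\beta=O(\rho^{-4}),$$ where $\beta_{-1}$ is smooth on $\mathbb H^1\setminus\{0\}$, satisfies $\beta_{-1}(rz,r^2t)=r^{-1}\beta_{-1}(z,t)$ for all $r>0$, and, for some constant $\kappa\in\mathbb C$, $$\mathring Z_{\bar 1}\beta_{-1}=-\frac{2\sqrt2\,\pi A}{\rho^2}+\frac{\kappa}{|z|^2+it}.$$ Then the limit defining $m(J,\theta)$ exists and is real; $|\square_b\beta|^2$, $|\beta_{,\bar1\bar1}|^2$ and $R|\beta_{,\bar1}|^2$ are integrable on $N$ for $\theta\wedge d\theta$; with $N_\Lambda=N\setminus\{\rho>\Lambda\}$ (on which $\bar\beta P\beta$ is integrable), the limit $$\int_N\bar\beta P\beta\;\theta\wedge d\theta:=\lim_{\Lambda\to\infty}\int_{N_\Lambda}\bar\beta P\beta\;\theta\wedge d\theta$$ exists; and $$\tfrac23\,m(J,\theta)=-\int_N|\square_b\beta|^2\,\theta\wedge d\theta+2\int_N|\beta_{,\bar1\bar1}|^2\,\theta\wedge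 d\theta+2\int_N R\,|\beta_{,\bar1}|^2\,\theta\wedge d\theta+\tfrac12\int_N\bar\beta P\beta\;\theta\wedge d\theta .$$ -/

import Mathlib

open scoped Manifold ContDiff Topology ENNReal ComplexConjugate
open MeasureTheory Filter

noncomputable section

namespace CRMass

/-! ### The Heisenberg group -/

/-- The underlying space of the Heisenberg group, with points `(z, t)`. As a real normed space it is
a copy of `ℝ³`, and it also serves as the model space of smooth 3-manifolds. -/
abbrev Heis : Type := ℂ × ℝ

/-- The model (without boundary) for smooth 3-manifolds with charts in `Heis`. -/
abbrev IH : ModelWithCorners ℝ Heis Heis := 𝓘(ℝ, Heis)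

/-- The homogeneous norm `ρ`, with `ρ⁴ = |z|⁴ + t²`. -/
def rho (x : Heis) : ℝ := (‖x.1‖ ^ 4 + x.2 ^ 2) ^ (1 / 4 : ℝ)

/-- The value at `x` of the left invariant field `∂_x + 2 y ∂_t` (where `z = x + i y`). -/
def hX (x : Heis) : Heis := (1, 2 * x.1.im)

/-- The value at `x` of the left invariant field `∂_y - 2 x ∂_t` (where `z = x + i y`). -/
def hY (x : Heis) : Heis := (Complex.I, -(2 * x.1.re))

/-- `∂_t`. -/
def hT : Heis := (0, 1)

/-- The standard field `Z₁ = (1/√2) (∂_z + i z̄ ∂_t)` on functions;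
note `∂_z + i z̄ ∂_t = (hX - i hY) / 2`. -/
def hZ (f : Heis → ℂ) (x : Heis) : ℂ :=
  1 / (2 * (√2 : ℝ)) * (fderiv ℝ f x (hX x) - Complex.I * fderiv ℝ f x (hY x))

/-- The standard field `Z_1̄ = (1/√2) (∂_z̄ - i z ∂_t)` on functions. -/
def hZbar (f : Heis → ℂ) (x : Heis) : ℂ :=
  1 / (2 * (√2 : ℝ)) * (fderiv ℝ f x (hX x) + Complex.I * fderiv ℝ f x (hY x))

/-- The composition of `Z₁` (for `true`) and `Z_1̄` (for `false`) given by a word. -/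
def hWord : List Bool → (Heis → ℂ) → (Heis → ℂ)
  | [], f => f
  | true :: w, f => hZ (hWord w f)
  | false :: w, f => hZbar (hWord w f)

/-- `f = O(ρ^k)` near infinity, in the sense of symbols: `f` is smooth near infinity and every
composition of `j` derivatives along `Z₁`, `Z_1̄` is bounded by a constant times `ρ^(k - j)`
(`∂_t`, a commutator of these, thus counts as two derivatives). -/
def IsSymbolO (k : ℝ) (f : Heis → ℂ) : Prop :=
  (∃ r : ℝ, 0 < r ∧ ContDiffOn ℝ ∞ f {x | r < rho x}) ∧
  ∀ w : List Bool, ∃ C r : ℝ, 0 < r ∧ ∀ x : Heis, r < rho x →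
    ‖hWord w f x‖ ≤ C * rho x ^ (k - w.length)

/-- Parametrization of the Heisenberg sphere `{ρ = Λ}` by a polar angle `τ ∈ [0, π]` and an azimuth
`φ ∈ [0, 2π]`: `z = Λ sin τ e^{iφ}`, `t = Λ² cos τ √(1 + sin² τ)`. The ordered pair `(∂_τ, ∂_φ)`
gives the orientation as boundary of `{ρ < Λ}` with respect to `dx ∧ dy ∧ dt`, that is, to
`θ₀ ∧ dθ₀`. -/
def sphereParam (Λ τ φ : ℝ) : Heis :=
  ((Λ * Real.sin τ : ℝ) * Complex.exp (φ * Complex.I),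
    Λ ^ 2 * Real.cos τ * √(1 + Real.sin τ ^ 2))

/-! ### Pseudohermitian 3-manifolds -/

variable {N : Type*} [TopologicalSpace N] [ChartedSpace Heis N]

/-- Derivative of a complex function `f` at `p` in the direction of the real tangent vector `v`. -/
def dirDeriv (f : N → ℂ) (p : N) (v : TangentSpace IH p) : ℂ := mfderiv IH 𝓘(ℝ, ℂ) f p v

/-- Smoothness of a vector field on a set. -/
def SmoothField [IsManifold IH ∞ N] (X : Π p : N, TangentSpace IH p) (U : Set N) : Prop :=
  ContMDiffOn IH IH.tangent ∞ (fun p => (⟨p, X p⟩ : TangentBundle IH N)) U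

/-- A unitary frame on the open set `U` for a 1-form `θ` and an endomorphism `J` of `ker θ` (the
values of `J` off `ker θ` play no role). Here `T` is the Reeb field, `e₂ = J e₁`, and
`Z₁ = (e₁ - i e₂) / √2`, so `J Z₁ = i Z₁`; `θ₁` is the dual complex form `θ¹`, i.e. `θ¹(T) = 0`,
`θ¹(Z₁) = 1`, `θ¹(Z_1̄) = 0`. Since `dθ(X, Y) = -θ([X, Y])` when `θ(X)` and `θ(Y)` are constant, the
last three conditions say `T ⌟ dθ = 0` and `dθ(e₁, e₂) = 1`, that is, `dθ = i θ¹ ∧ θ^1̄`. -/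
structure UnitaryFrame [IsManifold IH ∞ N] (θ : Π p : N, TangentSpace IH p →L[ℝ] ℝ)
    (J : Π p : N, TangentSpace IH p →ₗ[ℝ] TangentSpace IH p) (U : Set N) where
  T : Π p : N, TangentSpace IH p
  e₁ : Π p : N, TangentSpace IH p
  e₂ : Π p : N, TangentSpace IH p
  θ₁ : Π p : N, TangentSpace IH p →L[ℝ] ℂ
  isOpen : IsOpen U
  smooth_T : SmoothField T U
  smooth_e₁ : SmoothField e₁ U
  smooth_e₂ : SmoothField e₂ U
  θ_T : ∀ p ∈ U, θ p (T p) = 1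
  θ_e₁ : ∀ p ∈ U, θ p (e₁ p) = 0
  θ_e₂ : ∀ p ∈ U, θ p (e₂ p) = 0
  J_e₁ : ∀ p ∈ U, J p (e₁ p) = e₂ p
  J_e₂ : ∀ p ∈ U, J p (e₂ p) = -e₁ p
  θ₁_T : ∀ p ∈ U, θ₁ p (T p) = 0
  θ₁_e₁ : ∀ p ∈ U, θ₁ p (e₁ p) = 1 / (√2 : ℝ)
  θ₁_e₂ : ∀ p ∈ U, θ₁ p (e₂ p) = Complex.I / (√2 : ℝ)
  bracket_T_e₁ : ∀ p ∈ U, θ p (VectorField.mlieBracket IH T e₁ p) = 0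
  bracket_T_e₂ : ∀ p ∈ U, θ p (VectorField.mlieBracket IH T e₂ p) = 0
  bracket_e₁_e₂ : ∀ p ∈ U, θ p (VectorField.mlieBracket IH e₁ e₂ p) = -1

/-- A pseudohermitian structure on the 3-manifold `N`: a contact form `θ` with a strictly
pseudoconvex CR structure `J` on `ker θ` (positive for `θ`), expressed by the existence of unitary
frames near every point. -/
structure Pseudohermitian (N : Type*) [TopologicalSpace N] [ChartedSpace Heis N]
    [IsManifold IH ∞ N] where
  θ : Π p : N, TangentSpace IH p →L[ℝ] ℝ
  J : Π p : N, TangentSpace IH p →ₗ[ℝ] TangentSpace IH p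
  exists_frame : ∀ p : N, ∃ U : Set N, p ∈ U ∧ Nonempty (UnitaryFrame θ J U)

namespace UnitaryFrame

variable [IsManifold IH ∞ N] {θ : Π p : N, TangentSpace IH p →L[ℝ] ℝ}
  {J : Π p : N, TangentSpace IH p →ₗ[ℝ] TangentSpace IH p} {U : Set N}
  (F : UnitaryFrame θ J U)

/-- The derivative `Tf`. -/
def D₀ (f : N → ℂ) (p : N) : ℂ := dirDeriv f p (F.T p)

/-- The derivative `Z₁ f`, where `Z₁ = (e₁ - i e₂) / √2`. -/
def D₁ (f : N → ℂ) (p : N) : ℂ :=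
  1 / (√2 : ℝ) * (dirDeriv f p (F.e₁ p) - Complex.I * dirDeriv f p (F.e₂ p))

/-- The derivative `Z_1̄ f`, where `Z_1̄ = (e₁ + i e₂) / √2`. -/
def D₁bar (f : N → ℂ) (p : N) : ℂ :=
  1 / (√2 : ℝ) * (dirDeriv f p (F.e₁ p) + Complex.I * dirDeriv f p (F.e₂ p))

/-- `θ¹([T, Z₁])`. -/
def θ₁BracketTZ₁ (p : N) : ℂ :=
  1 / (√2 : ℝ) * (F.θ₁ p (VectorField.mlieBracket IH F.T F.e₁ p) -
    Complex.I * F.θ₁ p (VectorField.mlieBracket IH F.T F.e₂ p))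

/-- `θ¹([T, Z_1̄])`. -/
def θ₁BracketTZ₁bar (p : N) : ℂ :=
  1 / (√2 : ℝ) * (F.θ₁ p (VectorField.mlieBracket IH F.T F.e₁ p) +
    Complex.I * F.θ₁ p (VectorField.mlieBracket IH F.T F.e₂ p))

/-- `θ¹([Z₁, Z_1̄])`; note `[Z₁, Z_1̄] = i [e₁, e₂]`. -/
def θ₁BracketZ₁Z₁bar (p : N) : ℂ :=
  Complex.I * F.θ₁ p (VectorField.mlieBracket IH F.e₁ F.e₂ p)

/-! The connection form `ω = ω₁¹` and the torsion are determined by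
`dθ¹ = θ¹ ∧ ω + A¹_1̄ θ ∧ θ^1̄` and `ω + ω̄ = 0`. Evaluating the first equation on pairs of frame
fields, with `dθ¹(X, Y) = -θ¹([X, Y])`, gives `ω(Z_1̄) = -θ¹([Z₁, Z_1̄])`, `ω(T) = θ¹([T, Z₁])`,
`A¹_1̄ = -θ¹([T, Z_1̄])`, and the second one gives `ω(Z₁) = -conj (ω(Z_1̄))`. -/

/-- `ω(Z_1̄)`. -/
def ωZ₁bar (p : N) : ℂ := -F.θ₁BracketZ₁Z₁bar p

/-- `ω(Z₁)`. -/
def ωZ₁ (p : N) : ℂ := -conj (F.ωZ₁bar p)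

/-- `ω(T)`. -/
def ωT (p : N) : ℂ := F.θ₁BracketTZ₁ p

/-- The connection form `ω = ω(Z₁) θ¹ + ω(Z_1̄) θ^1̄ + ω(T) θ`. -/
def connForm (p : N) (v : TangentSpace IH p) : ℂ :=
  F.ωZ₁ p * F.θ₁ p v + F.ωZ₁bar p * conj (F.θ₁ p v) + F.ωT p * (θ p v : ℂ)

/-- The torsion component `A_{11}`, the complex conjugate of `A_{1̄1̄} = A¹_1̄`. -/
def A₁₁ (p : N) : ℂ := conj (-F.θ₁BracketTZ₁bar p)

/-- The Tanaka-Webster curvature `R = dω(Z₁, Z_1̄) = Z₁ (ω(Z_1̄)) - Z_1̄ (ω(Z₁)) - ω([Z₁, Z_1̄])`,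
where `[Z₁, Z_1̄] = -i T - ω(Z_1̄) Z₁ - ω(Z₁) Z_1̄`. Its values are real. -/
def R (p : N) : ℂ :=
  F.D₁ F.ωZ₁bar p - F.D₁bar F.ωZ₁ p + Complex.I * F.ωT p + 2 * F.ωZ₁ p * F.ωZ₁bar p

/-- `f_{,11̄} = Z_1̄ Z₁ f - ω(Z_1̄) Z₁ f`. -/
def hess₁₁bar (f : N → ℂ) (p : N) : ℂ := F.D₁bar (F.D₁ f) p - F.ωZ₁bar p * F.D₁ f p

/-- `f_{,1̄1} = Z₁ Z_1̄ f + ω(Z₁) Z_1̄ f`. -/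
def hess₁bar₁ (f : N → ℂ) (p : N) : ℂ := F.D₁ (F.D₁bar f) p + F.ωZ₁ p * F.D₁bar f p

/-- `f_{,1̄1̄} = Z_1̄ Z_1̄ f + ω(Z_1̄) Z_1̄ f`. -/
def hess₁bar₁bar (f : N → ℂ) (p : N) : ℂ := F.D₁bar (F.D₁bar f) p + F.ωZ₁bar p * F.D₁bar f p

/-- The Kohn Laplacian `□_b f = -Δ_b f + i T f`, where `Δ_b f = f_{,11̄} + f_{,1̄1}`. -/
def boxb (f : N → ℂ) (p : N) : ℂ :=
  -(F.hess₁₁bar f p + F.hess₁bar₁ f p) + Complex.I * F.D₀ f p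

/-- `f_{,1̄11} + i A_{11} f_{,1̄}`, a tensor with one lower index `1`. -/
def paneitz₃ (f : N → ℂ) (p : N) : ℂ :=
  F.D₁ (F.hess₁bar₁ f) p + Complex.I * F.A₁₁ p * F.D₁bar f p

/-- The CR Paneitz operator `P f = 4 (f_{,1̄11} + i A_{11} f_{,1̄})_{,1̄}`. -/
def paneitz (f : N → ℂ) (p : N) : ℂ :=
  4 * (F.D₁bar (F.paneitz₃ f) p - F.ωZ₁bar p * F.paneitz₃ f p)

end UnitaryFrame

namespace Pseudohermitian

variable [IsManifold IH ∞ N] (S : Pseudohermitian N)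

/-- A unitary frame near `p`. The quantities defined from it below do not depend on the choice. -/
def frameAt (p : N) : UnitaryFrame S.θ S.J (S.exists_frame p).choose :=
  (S.exists_frame p).choose_spec.2.some

/-- The Tanaka-Webster curvature. -/
def R (p : N) : ℂ := (S.frameAt p).R p

/-- The Kohn Laplacian. -/
def boxb (f : N → ℂ) (p : N) : ℂ := (S.frameAt p).boxb f p

/-- The CR Paneitz operator. -/
def paneitz (f : N → ℂ) (p : N) : ℂ := (S.frameAt p).paneitz f p

/-- `|f_{,1̄}|²`. -/
def normSqD₁bar (f : N → ℂ) (p : N) : ℝ := ‖(S.frameAt p).D₁bar f p‖ ^ 2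

/-- `|f_{,1̄1̄}|²`. -/
def normSqHess₁bar₁bar (f : N → ℂ) (p : N) : ℝ := ‖(S.frameAt p).hess₁bar₁bar f p‖ ^ 2

/-- `|(θ ∧ dθ)(u, v, w)|`, where `θ ∧ dθ = i θ ∧ θ¹ ∧ θ^1̄ = 2 θ ∧ Re θ¹ ∧ Im θ¹`. -/
def absVol (p : N) (v : Fin 3 → TangentSpace IH p) : ℝ :=
  2 * |Matrix.det (Matrix.of
    ![fun j => S.θ p (v j),
      fun j => ((S.frameAt p).θ₁ p (v j)).re,
      fun j => ((S.frameAt p).θ₁ p (v j)).im])|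

/-- The density of `θ ∧ dθ` with respect to Lebesgue measure `dx dy dt` in the chart `e`. -/
def chartDensity (e : OpenPartialHomeomorph N Heis) (x : Heis) : ℝ≥0∞ :=
  ENNReal.ofReal (S.absVol (e.symm x)
    ![mfderiv IH IH e.symm x ((1, 0) : Heis),
      mfderiv IH IH e.symm x ((Complex.I, 0) : Heis),
      mfderiv IH IH e.symm x ((0, 1) : Heis)])

variable [MeasurableSpace N]

/-- The measure of `θ ∧ dθ` on the domain of the chart `e` (extended by zero). -/
def chartVolume (e : OpenPartialHomeomorph N Heis) : Measure N :=
  Measure.map e.symm ((volume.restrict e.target).withDensity (S.chartDensity e))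

/-- The measure `θ ∧ dθ` on `N`, glued from the charts: the least measure that is at least the
measure of `θ ∧ dθ` on each chart domain. As the latter agree on overlaps, it restricts to each of
them. -/
def volume : Measure N := ⨆ p : N, S.chartVolume (chartAt Heis p)

end Pseudohermitian

/-- Data of an asymptotically flat pseudohermitian structure: outside a compact set, `N` is
identified by asymptotic coordinates with the exterior `{ρ > ρ₀}` of a Heisenberg ball (the part of
`N` outside `{ρ > Λ}` is compact for `Λ > ρ₀`, so `N` has no other end), and with respect to the
coframe `(θ₀, dz, dz̄)`, `θ₀ = dt + i z dz̄ - i z̄ dz`, whose dual frame is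
`(∂_t, (hX - i hY)/2, (hX + i hY)/2)`,
`θ = (1 + 4πAρ⁻² + O(ρ⁻³)) θ₀ + O(ρ⁻³) dz + O(ρ⁻³) dz̄`,
`θ¹ = O(ρ⁻³) θ₀ + O(ρ⁻⁴) dz̄ + (1 + 2πAρ⁻² + O(ρ⁻³)) √2 dz` for some unitary coframe `θ¹`; moreover
the Tanaka-Webster curvature is integrable. -/
structure AsymptoticallyFlat [IsManifold IH ∞ N] [MeasurableSpace N] (S : Pseudohermitian N) where
  ρ₀ : ℝ
  A : ℝ
  coords : OpenPartialHomeomorph N Heis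
  frame : UnitaryFrame S.θ S.J coords.source
  ρ₀_pos : 0 < ρ₀
  coords_mem : coords ∈ IsManifold.maximalAtlas IH ∞ N
  target_eq : coords.target = {x | ρ₀ < rho x}
  isCompact_compl : ∀ Λ : ℝ, ρ₀ < Λ → IsCompact (coords.symm '' {x | Λ < rho x})ᶜ
  θ_t : IsSymbolO (-3) fun x =>
    (S.θ (coords.symm x) (mfderiv IH IH coords.symm x hT) : ℂ)
      - (1 + 4 * (Real.pi : ℂ) * (A : ℂ) * ((rho x ^ (-2 : ℝ) : ℝ) : ℂ))
  θ_z : IsSymbolO (-3) fun x =>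
    1 / 2 * ((S.θ (coords.symm x) (mfderiv IH IH coords.symm x (hX x)) : ℂ)
      - Complex.I * (S.θ (coords.symm x) (mfderiv IH IH coords.symm x (hY x)) : ℂ))
  θ_zbar : IsSymbolO (-3) fun x =>
    1 / 2 * ((S.θ (coords.symm x) (mfderiv IH IH coords.symm x (hX x)) : ℂ)
      + Complex.I * (S.θ (coords.symm x) (mfderiv IH IH coords.symm x (hY x)) : ℂ))
  θ₁_t : IsSymbolO (-3) fun x =>
    frame.θ₁ (coords.symm x) (mfderiv IH IH coords.symm x hT)
  θ₁_zbar : IsSymbolO (-4) fun x =>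
    1 / 2 * (frame.θ₁ (coords.symm x) (mfderiv IH IH coords.symm x (hX x))
      + Complex.I * frame.θ₁ (coords.symm x) (mfderiv IH IH coords.symm x (hY x)))
  θ₁_z : IsSymbolO (-3) fun x =>
    1 / (√2 : ℝ) * (1 / 2 * (frame.θ₁ (coords.symm x) (mfderiv IH IH coords.symm x (hX x))
      - Complex.I * frame.θ₁ (coords.symm x) (mfderiv IH IH coords.symm x (hY x))))
      - (1 + 2 * (Real.pi : ℂ) * (A : ℂ) * ((rho x ^ (-2 : ℝ) : ℝ) : ℂ))
  integrable_R : Integrable S.R S.volume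

namespace AsymptoticallyFlat

variable [IsManifold IH ∞ N] [MeasurableSpace N] {S : Pseudohermitian N}
  (F : AsymptoticallyFlat S)

/-- The part of `N` inside the sphere `S_Λ = {ρ = Λ}` of the asymptotic coordinates. -/
def inside (Λ : ℝ) : Set N := (F.coords.symm '' {x | Λ < rho x})ᶜ

/-- The 2-form `ω₁¹ ∧ θ`, in asymptotic coordinates, at `x`. -/
def ωWedgeθ (x u v : Heis) : ℂ :=
  F.frame.connForm (F.coords.symm x) (mfderiv IH IH F.coords.symm x u) *
      (S.θ (F.coords.symm x) (mfderiv IH IH F.coords.symm x v) : ℂ) -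
    F.frame.connForm (F.coords.symm x) (mfderiv IH IH F.coords.symm x v) *
      (S.θ (F.coords.symm x) (mfderiv IH IH F.coords.symm x u) : ℂ)

/-- `i ∮_{S_Λ} ω₁¹ ∧ θ`; its limit as `Λ → +∞` is the p-mass. -/
def massIntegral (Λ : ℝ) : ℂ :=
  Complex.I * ∫ τ in (0 : ℝ)..Real.pi, ∫ φ in (0 : ℝ)..(2 * Real.pi),
    F.ωWedgeθ (sphereParam Λ τ φ) (deriv (fun s => sphereParam Λ s φ) τ)
      (deriv (fun s => sphereParam Λ τ s) φ)

/-- `m` is the p-mass `m(J, θ) = lim_{Λ → +∞} i ∮_{S_Λ} ω₁¹ ∧ θ`. -/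
def IsPMass (m : ℝ) : Prop := Tendsto F.massIntegral atTop (𝓝 (m : ℂ))

end AsymptoticallyFlat

end CRMass

end

/-!
The right-hand side is the limit of a flux through large spheres, and both that flux and the p-mass
are determined by the constant `A`: the flux tends to `32 π² A` and the p-mass is `48 π² A`.

*Divergence identity.* With `H = β_{,1̄1̄}` and `P₃ = β_{,1̄11} + i A₁₁ β_{,1̄}`, the function
`-|□_b β|² + 2 |H|² + 2 R |β_{,1̄}|² + ½ β̄ Pβ` is the divergence of the vector field with
components `2 β̄ P₃ + 2 H̄ β_{,1̄}` along `Z_1̄` and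
`-2 conj(Z₁β) β_{,1̄1} - 2 i conj(Tβ) β_{,1̄} - 2 conj(β_{,1̄1}) β_{,1̄}` along `Z₁`
(`UnitaryFrame.divergence_identity`; it uses the commutators `[Z₁, Z_1̄]` and `[T, Z_1̄]`). All the
quantities involved are independent of the unitary frame, and the vector field is globally defined.
A partition of unity gives the divergence theorem against compactly supported functions
(`Pseudohermitian.integral_massIntegrand`). The spheres at infinity are replaced by smooth cut-off
functions `χ` at scale `Λ`, so that only integrals over shells `Λ ≤ ρ ≤ 2Λ` occur. That the
cut-off functions are smooth on `N` requires the far region to be closed off from the rest of `N`,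
which is `AsymptoticallyFlat.exists_closure_outside_subset`.

*Asymptotics.* Write `h = 4 π A ρ⁻²`. Duality gives the frame from the coframe, and the structure
equations, applied to the coordinate functions, give the connection and the torsion:
`ω(Z_1̄) = -(3/2) Z̄h + O(ρ⁻⁴)` and `A₁₁ = i ZZh + O(ρ⁻⁵)`. With `β = z̄ + β_{-1} + ...` and the
decay of `□_b β` this yields the leading part of the flux, of order `ρ⁻³`
(`AsymptoticallyFlat.fluxBar_asymptotics`, `AsymptoticallyFlat.flux_asymptotics`). The first two
terms are integrable because `□_b β` and `H` decay, the third because `R` is integrable and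
`β_{,1̄}` bounded.

*The flux.* The leading flux contains the terms `ZZḡ` and `∂_t ḡ` with `g = β_{-1}`. After an
integration by parts against `χ` only `Z̄Zḡ` is left, which is given by the equation for `Z̄g`. There
the term `κ / w`, with `w = |z|² + i t`, disappears, as `Zw = 0`. What remains is the integral of an
explicit function over the shell, which is computed in the polar coordinates `|z|² = ρ² cos θ`,
`t = ρ² sin θ` (`AsymptoticallyFlat.integral_leading_flux`).

*The Paneitz term.* The function `β̄ Pβ` decays only like `ρ⁻⁴`, the critical order. Its leading part
is a multiple of `z Z̄ZZh`, whose angular integral vanishes, so the difference between the cut-off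
integral and the integral over `N_Λ` tends to zero
(`AsymptoticallyFlat.tendsto_integral_paneitz_outside`).

*The p-mass.* On the sphere `ρ = Λ` the leading part of `ω ∧ θ` can be written down explicitly and
does not depend on the radius (`AsymptoticallyFlat.leading_wedge`,
`AsymptoticallyFlat.isPMass`).
-/

noncomputable section

namespace CRMass

set_option linter.unusedSectionVars false

/-! ### Differentiation along vector fields in charts -/

section Calculus

variable {N : Type*} [TopologicalSpace N] [ChartedSpace Heis N]

/-- Smoothness of a complex function at a point of a manifold. -/
abbrev SmoothAt (f : N → ℂ) (p : N) : Prop := ContMDiffAt IH 𝓘(ℝ, ℂ) ∞ f p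

/-- Smoothness of a vector field at a point of a manifold. -/
abbrev FieldAt [IsManifold IH ∞ N] (X : Π p : N, TangentSpace IH p) (p : N) : Prop :=
  ContMDiffAt IH IH.tangent ∞ (fun p => (⟨p, X p⟩ : TangentBundle IH N)) p

section Closure

variable {f g : N → ℂ} {p : N}

lemma SmoothAt.mdiff (hf : SmoothAt f p) : MDifferentiableAt IH 𝓘(ℝ, ℂ) f p :=
  ContMDiffAt.mdifferentiableAt hf (by simp)

lemma smoothAt_const (c : ℂ) : SmoothAt (fun _ : N => c) p := contMDiffAt_const

lemma SmoothAt.add (hf : SmoothAt f p) (hg : SmoothAt g p) :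
    SmoothAt (fun q => f q + g q) p := ContMDiffAt.add hf hg

lemma SmoothAt.sub (hf : SmoothAt f p) (hg : SmoothAt g p) :
    SmoothAt (fun q => f q - g q) p := ContMDiffAt.sub hf hg

lemma SmoothAt.neg (hf : SmoothAt f p) : SmoothAt (fun q => -f q) p := ContMDiffAt.neg hf

lemma SmoothAt.mul (hf : SmoothAt f p) (hg : SmoothAt g p) :
    SmoothAt (fun q => f q * g q) p := by
  have h : ContDiff ℝ ∞ (fun x : ℂ × ℂ => x.1 * x.2) := by fun_prop
  exact h.comp_contMDiffAt (hf.prodMk_space hg)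

lemma SmoothAt.const_mul (c : ℂ) (hf : SmoothAt f p) : SmoothAt (fun q => c * f q) p :=
  (smoothAt_const c).mul hf

lemma SmoothAt.conj (hf : SmoothAt f p) : SmoothAt (fun q => conj (f q)) p := by
  have h : ContDiff ℝ ∞ (fun x : ℂ => conj x) := Complex.conjCLE.contDiff
  exact h.comp_contMDiffAt hf

lemma SmoothAt.congr (hf : SmoothAt f p) (h : g =ᶠ[𝓝 p] f) : SmoothAt g p :=
  ContMDiffAt.congr_of_eventuallyEq hf h

end Closure

section Deriv

variable {f g : N → ℂ} {p : N} (v : TangentSpace IH p)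

lemma dirDeriv_congr (h : f =ᶠ[𝓝 p] g) : dirDeriv f p v = dirDeriv g p v := by
  simp only [dirDeriv, h.mfderiv_eq]; rfl

lemma dirDeriv_const (c : ℂ) : dirDeriv (fun _ : N => c) p v = 0 := by
  simp only [dirDeriv, mfderiv_const]; rfl

lemma dirDeriv_add (hf : SmoothAt f p) (hg : SmoothAt g p) :
    dirDeriv (fun q => f q + g q) p v = dirDeriv f p v + dirDeriv g p v := by
  have := mfderiv_add hf.mdiff hg.mdiff
  have h2 := congrArg (fun L => L v) this
  exact h2

lemma dirDeriv_comp {G : ℂ → ℂ} (hf : SmoothAt f p) (hG : DifferentiableAt ℝ G (f p)) :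
    dirDeriv (fun q => G (f q)) p v = fderiv ℝ G (f p) (dirDeriv f p v) := by
  have := mfderiv_comp (I := IH) (I' := 𝓘(ℝ, ℂ)) (I'' := 𝓘(ℝ, ℂ)) p hG.mdifferentiableAt hf.mdiff
  have h2 := congrArg (fun L => L v) this
  simp only [mfderiv_eq_fderiv] at h2
  exact h2

lemma dirDeriv_clm (L : ℂ →L[ℝ] ℂ) (hf : SmoothAt f p) :
    dirDeriv (fun q => L (f q)) p v = L (dirDeriv f p v) := by
  rw [dirDeriv_comp v hf L.differentiableAt, L.fderiv]

lemma dirDeriv_neg (hf : SmoothAt f p) :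
    dirDeriv (fun q => -f q) p v = -dirDeriv f p v :=
  dirDeriv_clm v (-ContinuousLinearMap.id ℝ ℂ) hf

lemma dirDeriv_sub (hf : SmoothAt f p) (hg : SmoothAt g p) :
    dirDeriv (fun q => f q - g q) p v = dirDeriv f p v - dirDeriv g p v := by
  simp only [sub_eq_add_neg]
  rw [dirDeriv_add v hf hg.neg, dirDeriv_neg v hg]

lemma dirDeriv_const_mul (c : ℂ) (hf : SmoothAt f p) :
    dirDeriv (fun q => c * f q) p v = c * dirDeriv f p v :=
  dirDeriv_clm v (ContinuousLinearMap.mul ℝ ℂ c) hf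

lemma dirDeriv_conj (hf : SmoothAt f p) :
    dirDeriv (fun q => conj (f q)) p v = conj (dirDeriv f p v) :=
  dirDeriv_clm v (Complex.conjCLE : ℂ →L[ℝ] ℂ) hf

lemma dirDeriv_mul (hf : SmoothAt f p) (hg : SmoothAt g p) :
    dirDeriv (fun q => f q * g q) p v = dirDeriv f p v * g p + f p * dirDeriv g p v := by
  have h2 := congrArg (fun L => L v) (hf.mdiff.hasMFDerivAt.mul hg.mdiff.hasMFDerivAt).mfderiv
  refine h2.trans ?_
  change f p * dirDeriv g p v + g p * dirDeriv f p v = _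
  ring

end Deriv

end Calculus

section Chart

variable {N : Type*} [TopologicalSpace N] [ChartedSpace Heis N] [IsManifold IH ∞ N]
  {e : OpenPartialHomeomorph N Heis} (he : e ∈ IsManifold.maximalAtlas IH ∞ N)
  {f : N → ℂ} {x : Heis} {p : N}

/-- The coordinate expression of a vector field in the chart `e`. -/
def push (e : OpenPartialHomeomorph N Heis) (X : Π p : N, TangentSpace IH p) (x : Heis) : Heis :=
  mfderiv IH IH e (e.symm x) (X (e.symm x))

lemma mdifferentiable_of_mem_maximalAtlas (he : e ∈ IsManifold.maximalAtlas IH ∞ N) :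
    e.MDifferentiable IH IH :=
  ⟨(contMDiffOn_of_mem_maximalAtlas he).mdifferentiableOn (by simp),
    (contMDiffOn_symm_of_mem_maximalAtlas he).mdifferentiableOn (by simp)⟩

lemma smoothAt_iff (he : e ∈ IsManifold.maximalAtlas IH ∞ N) (hp : p ∈ e.source) :
    SmoothAt f p ↔ ContDiffAt ℝ ∞ (fun x => f (e.symm x)) (e p) := by
  have h1 := contMDiffAt_of_mem_maximalAtlas he hp
  have h2 := contMDiffAt_symm_of_mem_maximalAtlas he (e.map_source hp)
  constructor
  · intro hf
    have hf' : ContMDiffAt IH 𝓘(ℝ, ℂ) ∞ f (e.symm (e p)) := by rwa [e.left_inv hp]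
    exact (ContMDiffAt.comp (e p) hf' h2).contDiffAt
  · intro hf
    have hf' := ContMDiffAt.comp p hf.contMDiffAt h1
    refine hf'.congr_of_eventuallyEq ?_
    filter_upwards [e.open_source.mem_nhds hp] with q hq
    simp [e.left_inv hq]

lemma smoothAt_symm_iff (he : e ∈ IsManifold.maximalAtlas IH ∞ N) (hx : x ∈ e.target) :
    SmoothAt f (e.symm x) ↔ ContDiffAt ℝ ∞ (fun x => f (e.symm x)) x := by
  rw [smoothAt_iff he (e.map_target hx), e.right_inv hx]

lemma smoothAt_comp_chart (he : e ∈ IsManifold.maximalAtlas IH ∞ N) {g : Heis → ℂ}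
    (hp : p ∈ e.source) (hg : ContDiffAt ℝ ∞ g (e p)) :
    SmoothAt (fun q => g (e q)) p :=
  ContMDiffAt.comp p hg.contMDiffAt (contMDiffAt_of_mem_maximalAtlas he hp)

lemma mfderiv_symm_mfderiv (he : e ∈ IsManifold.maximalAtlas IH ∞ N) (hp : p ∈ e.source)
    (v : TangentSpace IH p) :
    mfderiv IH IH e.symm (e p) (mfderiv IH IH e p v) = v := by
  have := (mdifferentiable_of_mem_maximalAtlas he).symm_comp_deriv hp
  exact congrArg (fun L => L v) this

lemma mfderiv_symm_push (he : e ∈ IsManifold.maximalAtlas IH ∞ N) (X : Π p : N, TangentSpace IH p)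
    (hx : x ∈ e.target) :
    mfderiv IH IH e.symm x (push e X x) = X (e.symm x) := by
  have := mfderiv_symm_mfderiv he (e.map_target hx) (X (e.symm x))
  rw [e.right_inv hx] at this
  exact this

lemma fderiv_comp_symm (he : e ∈ IsManifold.maximalAtlas IH ∞ N) (hx : x ∈ e.target)
    (hf : SmoothAt f (e.symm x)) (v : Heis) :
    fderiv ℝ (fun y => f (e.symm y)) x v = dirDeriv f (e.symm x) (mfderiv IH IH e.symm x v) := by
  have h := mfderiv_comp x hf.mdiff
      ((mdifferentiable_of_mem_maximalAtlas he).mdifferentiableAt_symm hx)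
  rw [mfderiv_eq_fderiv] at h
  exact congrArg (fun L => L v) h

lemma dirDeriv_symm (he : e ∈ IsManifold.maximalAtlas IH ∞ N) (hx : x ∈ e.target)
    (hf : SmoothAt f (e.symm x))
    (X : Π p : N, TangentSpace IH p) :
    dirDeriv f (e.symm x) (X (e.symm x)) = fderiv ℝ (fun y => f (e.symm y)) x (push e X x) := by
  rw [fderiv_comp_symm he hx hf, mfderiv_symm_push he X hx]

lemma dirDeriv_comp_chart (he : e ∈ IsManifold.maximalAtlas IH ∞ N) {g : Heis → ℂ}
    (hp : p ∈ e.source) (hg : ContDiffAt ℝ ∞ g (e p))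
    (v : TangentSpace IH p) :
    dirDeriv (fun q => g (e q)) p v = fderiv ℝ g (e p) (mfderiv IH IH e p v) := by
  have h := mfderiv_comp p (hg.differentiableAt (by simp)).mdifferentiableAt
    ((mdifferentiable_of_mem_maximalAtlas he).mdifferentiableAt hp)
  rw [mfderiv_eq_fderiv] at h
  exact congrArg (fun L => L v) h

lemma push_eq_mpullback (he : e ∈ IsManifold.maximalAtlas IH ∞ N) (X : Π p : N, TangentSpace IH p)
    (hx : x ∈ e.target) :
    push e X x = VectorField.mpullback IH IH e.symm X x := by
  let A : TangentSpace IH x ≃L[ℝ] TangentSpace IH (e.symm x) :=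
    (mdifferentiable_of_mem_maximalAtlas he).symm.mfderiv hx
  have hA : mfderiv IH IH e.symm x = (A : TangentSpace IH x →L[ℝ] TangentSpace IH (e.symm x)) := rfl
  rw [VectorField.mpullback_apply, hA, ContinuousLinearMap.inverse_equiv]
  apply A.injective
  have h1 : A (A.symm (X (e.symm x))) = X (e.symm x) := A.apply_symm_apply _
  refine Eq.trans ?_ h1.symm
  exact mfderiv_symm_push he X hx

lemma isInvertible_mfderiv_symm (he : e ∈ IsManifold.maximalAtlas IH ∞ N) (hx : x ∈ e.target) :
    (mfderiv IH IH e.symm x).IsInvertible :=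
  ⟨(mdifferentiable_of_mem_maximalAtlas he).symm.mfderiv hx, rfl⟩

lemma contDiffAt_push (he : e ∈ IsManifold.maximalAtlas IH ∞ N) {X : Π p : N, TangentSpace IH p}
    (hx : x ∈ e.target) (hX : FieldAt X (e.symm x)) : ContDiffAt ℝ ∞ (push e X) x := by
  have h := ContMDiffAt.mpullback_vectorField_preimage (m := ∞) (n := ∞) hX
    (contMDiffAt_symm_of_mem_maximalAtlas he hx) (isInvertible_mfderiv_symm he hx) (by simp)
  have h2 := contMDiffAt_vectorSpace_iff_contDiffAt.1 h
  refine h2.congr_of_eventuallyEq ?_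
  filter_upwards [e.open_target.mem_nhds hx] with y hy
  exact push_eq_mpullback he X hy

lemma FieldAt.mdiff {X : Π p : N, TangentSpace IH p} (hX : FieldAt X p) :
    MDifferentiableAt IH IH.tangent (fun p => (⟨p, X p⟩ : TangentBundle IH N)) p :=
  ContMDiffAt.mdifferentiableAt hX (by simp)

lemma push_mlieBracket (he : e ∈ IsManifold.maximalAtlas IH ∞ N) {X Y : Π p : N, TangentSpace IH p}
    (hx : x ∈ e.target)
    (hX : FieldAt X (e.symm x)) (hY : FieldAt Y (e.symm x)) :
    push e (VectorField.mlieBracket IH X Y) x =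
      VectorField.lieBracket ℝ (push e X) (push e Y) x := by
  have h2 : (2 : ℕ∞ω) ≤ (∞ : ℕ∞ω) := ENat.LEInfty.out
  have : IsManifold IH (minSmoothness ℝ 2) N :=
    IsManifold.of_le (n := ∞) (by rw [minSmoothness_of_isRCLikeNormedField]; exact h2)
  rw [push_eq_mpullback he _ hx, VectorField.mpullback_mlieBracket (n := ∞) hX.mdiff hY.mdiff
    (contMDiffAt_symm_of_mem_maximalAtlas he hx)
    (by rw [minSmoothness_of_isRCLikeNormedField]; exact h2)]
  have h3 := fun A B : Π x : Heis, TangentSpace IH x => congrFun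
    (VectorField.mlieBracketWithin_eq_lieBracketWithin (V := A) (W := B) (s := Set.univ)) x
  simp only [VectorField.mlieBracketWithin_univ] at h3
  refine (h3 _ _).trans ((congrFun VectorField.lieBracketWithin_univ x).trans ?_)
  have h : ∀ Z : Π p : N, TangentSpace IH p,
      VectorField.mpullback IH IH e.symm Z =ᶠ[𝓝 x] push e Z := fun Z => by
    filter_upwards [e.open_target.mem_nhds hx] with y hy
    exact (push_eq_mpullback he Z hy).symm
  exact (h X).lieBracket_vectorField_eq (h Y)

lemma dirDeriv_symm_eventuallyEq (he : e ∈ IsManifold.maximalAtlas IH ∞ N)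
    {X : Π p : N, TangentSpace IH p} {U : Set N} (hU : IsOpen U) (hx : x ∈ e.target)
    (hxU : e.symm x ∈ U) (hf : ∀ q ∈ U, SmoothAt f q) :
    (fun y => dirDeriv f (e.symm y) (X (e.symm y))) =ᶠ[𝓝 x]
      fun y => fderiv ℝ (fun y => f (e.symm y)) y (push e X y) := by
  filter_upwards [e.open_target.mem_nhds hx,
    (e.continuousAt_symm hx).preimage_mem_nhds (hU.mem_nhds hxU)] with y hy hyU
  exact dirDeriv_symm he hy (hf _ hyU) X

lemma contDiffAt_fderiv_push (he : e ∈ IsManifold.maximalAtlas IH ∞ N)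
    {X : Π p : N, TangentSpace IH p} (hx : x ∈ e.target)
    (hX : FieldAt X (e.symm x)) (hf : SmoothAt f (e.symm x)) :
    ContDiffAt ℝ ∞ (fun y => fderiv ℝ (fun y => f (e.symm y)) y (push e X y)) x :=
  (((smoothAt_symm_iff he hx).1 hf).fderiv_right (m := ∞) (by simp)).clm_apply
    (contDiffAt_push he hx hX)

lemma exists_chart (p : N) : ∃ e ∈ IsManifold.maximalAtlas IH ∞ N, ∃ x ∈ e.target,
    e.symm x = p :=
  ⟨chartAt Heis p, IsManifold.chart_mem_maximalAtlas p, chartAt Heis p p,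
    (chartAt Heis p).map_source (mem_chart_source Heis p),
    (chartAt Heis p).left_inv (mem_chart_source Heis p)⟩

lemma smoothAt_dirDeriv {X : Π p : N, TangentSpace IH p} {U : Set N} (hU : IsOpen U)
    (hp : p ∈ U) (hX : ∀ q ∈ U, FieldAt X q) (hf : ∀ q ∈ U, SmoothAt f q) :
    SmoothAt (fun q => dirDeriv f q (X q)) p := by
  obtain ⟨e, he, x, hx, rfl⟩ := exists_chart p
  rw [smoothAt_symm_iff he hx]
  exact (contDiffAt_fderiv_push he hx (hX _ hp) (hf _ hp)).congr_of_eventuallyEq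
    (dirDeriv_symm_eventuallyEq he hU hx hp hf)

/-- The commutator of the derivatives along two vector fields is the derivative along their
bracket. -/
lemma dirDeriv_mlieBracket {X Y : Π p : N, TangentSpace IH p} {U : Set N} (hU : IsOpen U)
    (hp : p ∈ U) (hX : ∀ q ∈ U, FieldAt X q) (hY : ∀ q ∈ U, FieldAt Y q)
    (hf : ∀ q ∈ U, SmoothAt f q) :
    dirDeriv f p (VectorField.mlieBracket IH X Y p) =
      dirDeriv (fun q => dirDeriv f q (Y q)) p (X p) -
        dirDeriv (fun q => dirDeriv f q (X q)) p (Y p) := by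
  obtain ⟨e, he, x, hx, rfl⟩ := exists_chart p
  have h2 : (2 : ℕ∞ω) ≤ (∞ : ℕ∞ω) := ENat.LEInfty.out
  rw [dirDeriv_symm he hx (hf _ hp), push_mlieBracket he hx (hX _ hp) (hY _ hp),
    VectorField.fderiv_apply_lieBracket (n := ∞) ((smoothAt_symm_iff he hx).1 (hf _ hp))
      (by rw [minSmoothness_of_isRCLikeNormedField]; exact h2)
      ((contDiffAt_push he hx (hY _ hp)).differentiableAt (by simp))
      ((contDiffAt_push he hx (hX _ hp)).differentiableAt (by simp)),
    dirDeriv_symm he hx (smoothAt_dirDeriv hU hp hY hf),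
    dirDeriv_symm he hx (smoothAt_dirDeriv hU hp hX hf),
    (dirDeriv_symm_eventuallyEq he hU hx hp hf).fderiv_eq,
    (dirDeriv_symm_eventuallyEq he hU hx hp hf).fderiv_eq]

end Chart

/-! ### Linear algebra in the model space -/

section Det

/-- The determinant of three vectors of `Heis` in the basis `∂_x, ∂_y, ∂_t`. -/
def det3 (u v w : Heis) : ℝ :=
  u.1.re * (v.1.im * w.2 - v.2 * w.1.im) - u.1.im * (v.1.re * w.2 - v.2 * w.1.re)
    + u.2 * (v.1.re * w.1.im - v.1.im * w.1.re)

lemma finrank_heis : Module.finrank ℝ Heis = 3 := by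
  rw [Module.finrank_prod, Complex.finrank_real_complex, Module.finrank_self]

/-- Three vectors with a dual triple of functionals form a basis. -/
lemma eq_sum_of_dual (L : Fin 3 → Heis →ₗ[ℝ] ℝ) (E : Fin 3 → Heis)
    (h : ∀ i j, L i (E j) = if i = j then 1 else 0) (v : Heis) : v = ∑ j, L j v • E j := by
  let Φ : Heis →ₗ[ℝ] (Fin 3 → ℝ) := LinearMap.pi L
  have hΦ : ∀ c : Fin 3 → ℝ, Φ (∑ j, c j • E j) = c := by
    intro c
    ext i
    simp [Φ, h]
  have hsurj : Function.Surjective Φ := fun c => ⟨_, hΦ c⟩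
  have hinj : Function.Injective Φ :=
    (LinearMap.injective_iff_surjective_of_finrank_eq_finrank
      (by rw [finrank_heis]; simp)).2 hsurj
  apply hinj
  rw [hΦ fun j => L j v]
  rfl

lemma det3_dual (L : Fin 3 → Heis →ₗ[ℝ] ℝ) (E : Fin 3 → Heis)
    (h : ∀ i j, L i (E j) = if i = j then 1 else 0) :
    Matrix.det (Matrix.of fun i k => L i (![((1, 0) : Heis), (Complex.I, 0), (0, 1)] k))
      * det3 (E 0) (E 1) (E 2) = 1 := by
  have hdet : det3 (E 0) (E 1) (E 2) = Matrix.det (Matrix.of fun (k j : Fin 3) =>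
      ![(E j).1.re, (E j).1.im, (E j).2] k) := by
    rw [Matrix.det_fin_three]
    simp [det3]
    ring
  rw [hdet, ← Matrix.det_mul, ← Matrix.det_one (n := Fin 3) (R := ℝ)]
  congr 1
  ext i j
  rw [Matrix.one_apply, ← h i j]
  have hE : E j = (E j).1.re • ((1, 0) : Heis) + (E j).1.im • ((Complex.I, 0) : Heis)
      + (E j).2 • ((0, 1) : Heis) := by
    ext <;> simp
  have hL := congrArg (L i) hE
  rw [map_add, map_add, map_smul, map_smul, map_smul] at hL
  rw [hL]
  simp [Matrix.mul_apply, Fin.sum_univ_three]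
  ring

lemma det3_smul_eq (E : Fin 3 → Heis) (c : Fin 3 → ℝ) (v : Heis) (hv : v = ∑ j, c j • E j) :
    det3 v (E 1) (E 2) = c 0 * det3 (E 0) (E 1) (E 2) ∧
    det3 (E 0) v (E 2) = c 1 * det3 (E 0) (E 1) (E 2) ∧
    det3 (E 0) (E 1) v = c 2 * det3 (E 0) (E 1) (E 2) := by
  subst hv
  simp only [Fin.sum_univ_three, det3, Prod.fst_add, Prod.snd_add, Prod.smul_fst, Prod.smul_snd,
    Complex.add_re, Complex.add_im, Complex.real_smul, Complex.re_ofReal_mul,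
    Complex.im_ofReal_mul, smul_eq_mul]
  refine ⟨?_, ?_, ?_⟩ <;> ring

lemma contDiffAt_det3 {u v w : Heis → Heis} {x : Heis} (hu : ContDiffAt ℝ ∞ u x)
    (hv : ContDiffAt ℝ ∞ v x) (hw : ContDiffAt ℝ ∞ w x) :
    ContDiffAt ℝ ∞ (fun x => det3 (u x) (v x) (w x)) x := by
  have hre : ∀ {g : Heis → Heis}, ContDiffAt ℝ ∞ g x → ContDiffAt ℝ ∞ (fun x => (g x).1.re) x :=
    fun hg => (Complex.reCLM.contDiff.contDiffAt).comp x hg.fst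
  have him : ∀ {g : Heis → Heis}, ContDiffAt ℝ ∞ g x → ContDiffAt ℝ ∞ (fun x => (g x).1.im) x :=
    fun hg => (Complex.imCLM.contDiff.contDiffAt).comp x hg.fst
  unfold det3
  have h1 := hre hu
  have h2 := hre hv
  have h3 := hre hw
  have h4 := him hu
  have h5 := him hv
  have h6 := him hw
  have h7 := hu.snd
  have h8 := hv.snd
  have h9 := hw.snd
  fun_prop

end Det

/-! ### Point derivations -/

section PointDerivation

variable {N : Type*} [TopologicalSpace N] [ChartedSpace Heis N]

/-- A complex derivation at `p` of the algebra of functions smooth at `p`. -/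
structure IsDer (p : N) (D : (N → ℂ) → ℂ) : Prop where
  congr : ∀ {f g : N → ℂ}, f =ᶠ[𝓝 p] g → D f = D g
  const : ∀ c : ℂ, D (fun _ => c) = 0
  add : ∀ {f g : N → ℂ}, SmoothAt f p → SmoothAt g p → D (fun q => f q + g q) = D f + D g
  mul : ∀ {f g : N → ℂ}, SmoothAt f p → SmoothAt g p →
    D (fun q => f q * g q) = D f * g p + f p * D g

namespace IsDer

variable {p : N} {D D' : (N → ℂ) → ℂ} {f g : N → ℂ}

lemma const_mul (h : IsDer p D) (c : ℂ) (hf : SmoothAt f p) :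
    D (fun q => c * f q) = c * D f := by
  rw [h.mul (smoothAt_const c) hf, h.const]; ring

lemma neg (h : IsDer p D) (hf : SmoothAt f p) : D (fun q => -f q) = -D f := by
  have := h.const_mul (-1) hf
  simpa using this

lemma sub (h : IsDer p D) (hf : SmoothAt f p) (hg : SmoothAt g p) :
    D (fun q => f q - g q) = D f - D g := by
  simp only [sub_eq_add_neg]
  rw [h.add hf hg.neg, h.neg hg]

lemma congr_on (h : IsDer p D) {U : Set N} (hU : IsOpen U) (hp : p ∈ U)
    (hfg : ∀ q ∈ U, f q = g q) : D f = D g :=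
  h.congr (by filter_upwards [hU.mem_nhds hp] with q hq using hfg q hq)

lemma dirDeriv (v : TangentSpace IH p) : IsDer p fun f => dirDeriv f p v where
  congr h := dirDeriv_congr v h
  const c := dirDeriv_const v c
  add hf hg := dirDeriv_add v hf hg
  mul hf hg := dirDeriv_mul v hf hg

lemma comb (h : IsDer p D) (h' : IsDer p D') (a b : ℂ) : IsDer p fun f => a * (D f + b * D' f) where
  congr hfg := by simp only [h.congr hfg, h'.congr hfg]
  const c := by simp [h.const, h'.const]
  add hf hg := by simp only [h.add hf hg, h'.add hf hg]; ring
  mul hf hg := by simp only [h.mul hf hg, h'.mul hf hg]; ring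

end IsDer

end PointDerivation

/-! ### Calculus in a unitary frame -/

namespace UnitaryFrame

variable {N : Type*} [TopologicalSpace N] [ChartedSpace Heis N] [IsManifold IH ∞ N]
  {θ : Π p : N, TangentSpace IH p →L[ℝ] ℝ}
  {J : Π p : N, TangentSpace IH p →ₗ[ℝ] TangentSpace IH p} {U : Set N}
  (F : UnitaryFrame θ J U) {p : N} {f g : N → ℂ}

lemma fieldAt_T (hp : p ∈ U) : FieldAt F.T p := F.smooth_T.contMDiffAt (F.isOpen.mem_nhds hp)
lemma fieldAt_e₁ (hp : p ∈ U) : FieldAt F.e₁ p := F.smooth_e₁.contMDiffAt (F.isOpen.mem_nhds hp)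
lemma fieldAt_e₂ (hp : p ∈ U) : FieldAt F.e₂ p := F.smooth_e₂.contMDiffAt (F.isOpen.mem_nhds hp)

/-- The frame `(T, e₁, e₂)`. -/
def vec (j : Fin 3) (p : N) : TangentSpace IH p := ![F.T p, F.e₁ p, F.e₂ p] j

/-- The real coframe `(θ, √2 Re θ¹, √2 Im θ¹)` dual to `(T, e₁, e₂)`. -/
def covec (i : Fin 3) (p : N) : TangentSpace IH p →ₗ[ℝ] ℝ :=
  ![(θ p).toLinearMap, √2 • (Complex.reLm ∘ₗ (F.θ₁ p).toLinearMap),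
    √2 • (Complex.imLm ∘ₗ (F.θ₁ p).toLinearMap)] i

lemma covec_vec (hp : p ∈ U) (i j : Fin 3) :
    F.covec i p (F.vec j p) = if i = j then 1 else 0 := by
  have h2 : √2 ≠ 0 := by positivity
  have a1 : F.θ₁ p (F.e₁ p) = (((√2)⁻¹ : ℝ) : ℂ) := by rw [F.θ₁_e₁ p hp]; push_cast; simp
  have a2 : F.θ₁ p (F.e₂ p) = (((√2)⁻¹ : ℝ) : ℂ) * Complex.I := by
    rw [F.θ₁_e₂ p hp]; push_cast; rw [div_eq_mul_inv, mul_comm]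
  fin_cases i <;> fin_cases j <;>
    simp only [covec, vec, Fin.zero_eta, Fin.mk_one, Fin.reduceFinMk, Matrix.cons_val,
      ContinuousLinearMap.coe_coe, LinearMap.smul_apply, LinearMap.comp_apply, Complex.reLm_coe,
      Complex.imLm_coe, F.θ_T p hp, F.θ_e₁ p hp, F.θ_e₂ p hp, F.θ₁_T p hp, a1, a2,
      Complex.re_ofReal_mul, Complex.im_ofReal_mul, Complex.I_re, Complex.I_im,
      Complex.ofReal_re, Complex.ofReal_im, Complex.zero_re, Complex.zero_im, smul_eq_mul,
      mul_zero, mul_one, mul_inv_cancel₀ h2] <;> simp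

lemma eq_sum (hp : p ∈ U) (v : TangentSpace IH p) : v = ∑ j, F.covec j p v • F.vec j p :=
  eq_sum_of_dual (fun i => F.covec i p) (fun j => F.vec j p) (F.covec_vec hp) v

lemma eq_expand (hp : p ∈ U) (v : TangentSpace IH p) :
    v = θ p v • F.T p + (√2 * (F.θ₁ p v).re) • F.e₁ p + (√2 * (F.θ₁ p v).im) • F.e₂ p := by
  have h := F.eq_sum hp v
  rw [Fin.sum_univ_three] at h
  exact h

lemma dirDeriv_eq (hp : p ∈ U) (v : TangentSpace IH p) :
    dirDeriv f p v = θ p v * F.D₀ f p + F.θ₁ p v * F.D₁ f p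
      + conj (F.θ₁ p v) * F.D₁bar f p := by
  have h2 : ((√2 : ℝ) : ℂ) ≠ 0 := by
    simp
  have h3 : ((√2 : ℝ) : ℂ) * ((√2 : ℝ) : ℂ) = 2 := by
    rw [← Complex.ofReal_mul, Real.mul_self_sqrt (by norm_num)]; norm_num
  have h := congrArg (dirDeriv f p) (F.eq_expand hp v)
  have hlin : ∀ (a b c : ℝ) (x y z : TangentSpace IH p), dirDeriv f p (a • x + b • y + c • z) =
      a * dirDeriv f p x + b * dirDeriv f p y + c * dirDeriv f p z := by
    intro a b c x y z
    have : dirDeriv f p (a • x + b • y + c • z) =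
      a • dirDeriv f p x + b • dirDeriv f p y + c • dirDeriv f p z := by
      unfold dirDeriv
      rw [map_add, map_add, map_smul, map_smul, map_smul]
      rfl
    simpa using this
  rw [hlin] at h
  rw [h, D₀, D₁, D₁bar]
  set z := F.θ₁ p v
  have hz : z = z.re + z.im * Complex.I := (Complex.re_add_im z).symm
  have hz' : conj z = z.re - z.im * Complex.I := by
    apply Complex.ext <;> simp
  rw [hz', hz]
  have hI : Complex.I ^ 2 = -1 := Complex.I_sq
  simp only [Complex.add_re, Complex.ofReal_re, Complex.mul_re, Complex.I_re, Complex.add_im,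
    Complex.ofReal_im, Complex.mul_im, Complex.I_im]
  push_cast
  field_simp
  linear_combination (z.re * dirDeriv f p (F.e₁ p) + z.im * dirDeriv f p (F.e₂ p)) * h3 + 
    (2 * z.im * dirDeriv f p (F.e₂ p)) * hI

lemma isDer₀ (p : N) : IsDer p fun f => F.D₀ f p := IsDer.dirDeriv _

lemma isDer₁ (p : N) : IsDer p fun f => F.D₁ f p := by
  have := (IsDer.dirDeriv (F.e₁ p)).comb (IsDer.dirDeriv (F.e₂ p)) (1 / (√2 : ℝ)) (-Complex.I)
  simpa only [D₁, sub_eq_add_neg, neg_mul] using this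

lemma isDer₁bar (p : N) : IsDer p fun f => F.D₁bar f p :=
  (IsDer.dirDeriv (F.e₁ p)).comb (IsDer.dirDeriv (F.e₂ p)) (1 / (√2 : ℝ)) Complex.I

lemma D₀_conj (hf : SmoothAt f p) : F.D₀ (fun q => conj (f q)) p = conj (F.D₀ f p) :=
  dirDeriv_conj _ hf

lemma D₁_conj (hf : SmoothAt f p) : F.D₁ (fun q => conj (f q)) p = conj (F.D₁bar f p) := by
  simp only [D₁, D₁bar, dirDeriv_conj _ hf]
  simp [sub_eq_add_neg]

lemma D₁bar_conj (hf : SmoothAt f p) : F.D₁bar (fun q => conj (f q)) p = conj (F.D₁ f p) := by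
  simp only [D₁, D₁bar, dirDeriv_conj _ hf]
  simp

lemma smoothAt_D₀ (hp : p ∈ U) (hf : ∀ q ∈ U, SmoothAt f q) : SmoothAt (F.D₀ f) p :=
  smoothAt_dirDeriv F.isOpen hp (fun _ hq => F.fieldAt_T hq) hf

lemma smoothAt_D₁ (hp : p ∈ U) (hf : ∀ q ∈ U, SmoothAt f q) : SmoothAt (F.D₁ f) p :=
  ((smoothAt_dirDeriv F.isOpen hp (fun _ hq => F.fieldAt_e₁ hq) hf).sub
    ((smoothAt_dirDeriv F.isOpen hp (fun _ hq => F.fieldAt_e₂ hq) hf).const_mul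
      Complex.I)).const_mul (1 / (√2 : ℝ))

lemma smoothAt_D₁bar (hp : p ∈ U) (hf : ∀ q ∈ U, SmoothAt f q) : SmoothAt (F.D₁bar f) p :=
  ((smoothAt_dirDeriv F.isOpen hp (fun _ hq => F.fieldAt_e₁ hq) hf).add
    ((smoothAt_dirDeriv F.isOpen hp (fun _ hq => F.fieldAt_e₂ hq) hf).const_mul
      Complex.I)).const_mul (1 / (√2 : ℝ))

end UnitaryFrame

namespace UnitaryFrame

variable {N : Type*} [TopologicalSpace N] [ChartedSpace Heis N] [IsManifold IH ∞ N]
  {θ : Π p : N, TangentSpace IH p →L[ℝ] ℝ}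
  {J : Π p : N, TangentSpace IH p →ₗ[ℝ] TangentSpace IH p} {U : Set N}
  (F : UnitaryFrame θ J U) {p : N} {f g : N → ℂ}
  {e : OpenPartialHomeomorph N Heis} {x : Heis}

lemma push_eq_sum (hp : e.symm x ∈ U) (X : Π p : N, TangentSpace IH p) :
    push e X x = ∑ j, F.covec j (e.symm x) (X (e.symm x)) • push e (F.vec j) x := by
  have h := congrArg (mfderiv IH IH e (e.symm x)) (F.eq_sum hp (X (e.symm x)))
  rw [map_sum] at h
  simp only [map_smul] at h
  exact h

lemma covec_symm_push (he : e ∈ IsManifold.maximalAtlas IH ∞ N) (hx : x ∈ e.target)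
    (hp : e.symm x ∈ U) (i j : Fin 3) :
    (F.covec i (e.symm x) ∘ₗ (mfderiv IH IH e.symm x).toLinearMap) (push e (F.vec j) x) =
      if i = j then 1 else 0 := by
  rw [← F.covec_vec hp i j, ← mfderiv_symm_push he (F.vec j) hx]
  rfl

lemma det3_push_ne_zero (he : e ∈ IsManifold.maximalAtlas IH ∞ N) (hx : x ∈ e.target)
    (hp : e.symm x ∈ U) :
    det3 (push e F.T x) (push e F.e₁ x) (push e F.e₂ x) ≠ 0 := by
  have := det3_dual _ _ (F.covec_symm_push he hx hp)
  intro h0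
  rw [show det3 (push e (F.vec 0) x) (push e (F.vec 1) x) (push e (F.vec 2) x) = 0 from h0,
    mul_zero] at this
  exact zero_ne_one this

lemma smoothAt_covec (he : e ∈ IsManifold.maximalAtlas IH ∞ N) (hx : x ∈ e.target)
    (hp : e.symm x ∈ U) {X : Π p : N, TangentSpace IH p} (hX : ContDiffAt ℝ ∞ (push e X) x)
    (i : Fin 3) : SmoothAt (fun q => ((F.covec i q (X q) : ℝ) : ℂ)) (e.symm x) := by
  rw [smoothAt_symm_iff he hx]
  refine Complex.ofRealCLM.contDiff.contDiffAt.comp x ?_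
  have h0 := contDiffAt_push he hx (F.fieldAt_T hp)
  have h1 := contDiffAt_push he hx (F.fieldAt_e₁ hp)
  have h2 := contDiffAt_push he hx (F.fieldAt_e₂ hp)
  have hd := F.det3_push_ne_zero he hx hp
  have hU : ∀ᶠ y in 𝓝 x, y ∈ e.target ∧ e.symm y ∈ U := by
    filter_upwards [e.open_target.mem_nhds hx,
      (e.continuousAt_symm hx).preimage_mem_nhds (F.isOpen.mem_nhds hp)] with y hy hyU
    exact ⟨hy, hyU⟩
  have key := fun y (hy : y ∈ e.target ∧ e.symm y ∈ U) =>
    det3_smul_eq (fun j => push e (F.vec j) y) _ _ (F.push_eq_sum hy.2 X)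
  have hden := contDiffAt_det3 h0 h1 h2
  fin_cases i
  · refine ((contDiffAt_det3 hX h1 h2).div hden hd).congr_of_eventuallyEq ?_
    filter_upwards [hU] with y hy
    exact (eq_div_iff (F.det3_push_ne_zero he hy.1 hy.2)).2 (key y hy).1.symm
  · refine ((contDiffAt_det3 h0 hX h2).div hden hd).congr_of_eventuallyEq ?_
    filter_upwards [hU] with y hy
    exact (eq_div_iff (F.det3_push_ne_zero he hy.1 hy.2)).2 (key y hy).2.1.symm
  · refine ((contDiffAt_det3 h0 h1 hX).div hden hd).congr_of_eventuallyEq ?_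
    filter_upwards [hU] with y hy
    exact (eq_div_iff (F.det3_push_ne_zero he hy.1 hy.2)).2 (key y hy).2.2.symm

lemma smoothAt_θ₁ (he : e ∈ IsManifold.maximalAtlas IH ∞ N) (hx : x ∈ e.target)
    (hp : e.symm x ∈ U) {X : Π p : N, TangentSpace IH p} (hX : ContDiffAt ℝ ∞ (push e X) x) :
    SmoothAt (fun q => F.θ₁ q (X q)) (e.symm x) := by
  have h2 : ((√2 : ℝ) : ℂ) ≠ 0 := by simp
  have h := (((F.smoothAt_covec he hx hp hX 1).add
    ((F.smoothAt_covec he hx hp hX 2).const_mul Complex.I)).const_mul ((√2 : ℝ) : ℂ)⁻¹)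
  refine h.congr (Eventually.of_forall fun q => ?_)
  change F.θ₁ q (X q) = ((√2 : ℝ) : ℂ)⁻¹ * (((√2 * (F.θ₁ q (X q)).re : ℝ) : ℂ) +
    Complex.I * ((√2 * (F.θ₁ q (X q)).im : ℝ) : ℂ))
  conv_lhs => rw [← Complex.re_add_im (F.θ₁ q (X q))]
  push_cast
  field_simp

lemma smoothAt_θ₁_field (hp : p ∈ U) {X : Π p : N, TangentSpace IH p} (hX : FieldAt X p) :
    SmoothAt (fun q => F.θ₁ q (X q)) p := by
  obtain ⟨e, he, x, hx, rfl⟩ := exists_chart p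
  exact F.smoothAt_θ₁ he hx hp (contDiffAt_push he hx hX)

lemma smoothAt_θ₁_mlieBracket (hp : p ∈ U) {X Y : Π p : N, TangentSpace IH p}
    (hX : ∀ q ∈ U, FieldAt X q) (hY : ∀ q ∈ U, FieldAt Y q) :
    SmoothAt (fun q => F.θ₁ q (VectorField.mlieBracket IH X Y q)) p := by
  obtain ⟨e, he, x, hx, rfl⟩ := exists_chart p
  refine F.smoothAt_θ₁ he hx hp ?_
  have h := (contDiffAt_push he hx (hX _ hp)).lieBracket_vectorField (m := ∞)
    (contDiffAt_push he hx (hY _ hp)) (by simp)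
  refine h.congr_of_eventuallyEq ?_
  filter_upwards [e.open_target.mem_nhds hx,
    (e.continuousAt_symm hx).preimage_mem_nhds (F.isOpen.mem_nhds hp)] with y hy hyU
  exact push_mlieBracket he hy (hX _ hyU) (hY _ hyU)

lemma smoothAt_ωZ₁bar (hp : p ∈ U) : SmoothAt F.ωZ₁bar p :=
  ((F.smoothAt_θ₁_mlieBracket hp (fun _ hq => F.fieldAt_e₁ hq)
    (fun _ hq => F.fieldAt_e₂ hq)).const_mul Complex.I).neg

lemma smoothAt_ωZ₁ (hp : p ∈ U) : SmoothAt F.ωZ₁ p := (F.smoothAt_ωZ₁bar hp).conj.neg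

lemma smoothAt_A₁₁ (hp : p ∈ U) : SmoothAt F.A₁₁ p :=
  (((F.smoothAt_θ₁_mlieBracket hp (fun _ hq => F.fieldAt_T hq)
    (fun _ hq => F.fieldAt_e₁ hq)).add ((F.smoothAt_θ₁_mlieBracket hp (fun _ hq => F.fieldAt_T hq)
    (fun _ hq => F.fieldAt_e₂ hq)).const_mul Complex.I)).const_mul (1 / (√2 : ℝ))).neg.conj

lemma smoothAt_ωT (hp : p ∈ U) : SmoothAt F.ωT p :=
  ((F.smoothAt_θ₁_mlieBracket hp (fun _ hq => F.fieldAt_T hq)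
    (fun _ hq => F.fieldAt_e₁ hq)).sub ((F.smoothAt_θ₁_mlieBracket hp (fun _ hq => F.fieldAt_T hq)
    (fun _ hq => F.fieldAt_e₂ hq)).const_mul Complex.I)).const_mul (1 / (√2 : ℝ))

lemma sqrt_two_mul_self : ((√2 : ℝ) : ℂ) * ((√2 : ℝ) : ℂ) = 2 := by
  rw [← Complex.ofReal_mul, Real.mul_self_sqrt (by norm_num)]; norm_num

lemma sqrt_two_ne_zero : ((√2 : ℝ) : ℂ) ≠ 0 := by simp

/-- The commutator `[e₁, e₂]` in the frame. -/
lemma comm_e₁_e₂ (hp : p ∈ U) (hf : ∀ q ∈ U, SmoothAt f q) :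
    dirDeriv (fun q => dirDeriv f q (F.e₂ q)) p (F.e₁ p) -
        dirDeriv (fun q => dirDeriv f q (F.e₁ q)) p (F.e₂ p) =
      -F.D₀ f p + F.θ₁ p (VectorField.mlieBracket IH F.e₁ F.e₂ p) * F.D₁ f p +
        conj (F.θ₁ p (VectorField.mlieBracket IH F.e₁ F.e₂ p)) * F.D₁bar f p := by
  rw [← dirDeriv_mlieBracket F.isOpen hp (fun _ hq => F.fieldAt_e₁ hq)
    (fun _ hq => F.fieldAt_e₂ hq) hf, F.dirDeriv_eq hp, F.bracket_e₁_e₂ p hp]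
  push_cast
  ring

lemma comm_T_e₁ (hp : p ∈ U) (hf : ∀ q ∈ U, SmoothAt f q) :
    dirDeriv (fun q => dirDeriv f q (F.e₁ q)) p (F.T p) -
        dirDeriv (fun q => dirDeriv f q (F.T q)) p (F.e₁ p) =
      F.θ₁ p (VectorField.mlieBracket IH F.T F.e₁ p) * F.D₁ f p +
        conj (F.θ₁ p (VectorField.mlieBracket IH F.T F.e₁ p)) * F.D₁bar f p := by
  rw [← dirDeriv_mlieBracket F.isOpen hp (fun _ hq => F.fieldAt_T hq)
    (fun _ hq => F.fieldAt_e₁ hq) hf, F.dirDeriv_eq hp, F.bracket_T_e₁ p hp]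
  push_cast
  ring

lemma comm_T_e₂ (hp : p ∈ U) (hf : ∀ q ∈ U, SmoothAt f q) :
    dirDeriv (fun q => dirDeriv f q (F.e₂ q)) p (F.T p) -
        dirDeriv (fun q => dirDeriv f q (F.T q)) p (F.e₂ p) =
      F.θ₁ p (VectorField.mlieBracket IH F.T F.e₂ p) * F.D₁ f p +
        conj (F.θ₁ p (VectorField.mlieBracket IH F.T F.e₂ p)) * F.D₁bar f p := by
  rw [← dirDeriv_mlieBracket F.isOpen hp (fun _ hq => F.fieldAt_T hq)
    (fun _ hq => F.fieldAt_e₂ hq) hf, F.dirDeriv_eq hp, F.bracket_T_e₂ p hp]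
  push_cast
  ring

/-- The commutator `[Z₁, Z_1̄]`. -/
lemma comm₁₁bar (hp : p ∈ U) (hf : ∀ q ∈ U, SmoothAt f q) :
    F.D₁ (F.D₁bar f) p - F.D₁bar (F.D₁ f) p =
      -Complex.I * F.D₀ f p - F.ωZ₁bar p * F.D₁ f p - F.ωZ₁ p * F.D₁bar f p := by
  have s1 : SmoothAt (fun q => dirDeriv f q (F.e₁ q)) p :=
    smoothAt_dirDeriv F.isOpen hp (fun _ hq => F.fieldAt_e₁ hq) hf
  have s2 : SmoothAt (fun q => dirDeriv f q (F.e₂ q)) p :=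
    smoothAt_dirDeriv F.isOpen hp (fun _ hq => F.fieldAt_e₂ hq) hf
  have h := F.comm_e₁_e₂ hp hf
  have hbar : F.D₁bar f = fun q => 1 / (√2 : ℝ) *
      (dirDeriv f q (F.e₁ q) + Complex.I * dirDeriv f q (F.e₂ q)) := rfl
  have h1 : F.D₁ f = fun q => 1 / (√2 : ℝ) *
      (dirDeriv f q (F.e₁ q) - Complex.I * dirDeriv f q (F.e₂ q)) := rfl
  have e1 : ∀ v : TangentSpace IH p, dirDeriv (F.D₁bar f) p v = 1 / (√2 : ℝ) *
      (dirDeriv (fun q => dirDeriv f q (F.e₁ q)) p v +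
        Complex.I * dirDeriv (fun q => dirDeriv f q (F.e₂ q)) p v) := fun v => by
    rw [hbar, dirDeriv_const_mul _ _ (s1.add (s2.const_mul _)), dirDeriv_add _ s1 (s2.const_mul _),
      dirDeriv_const_mul _ _ s2]
  have e2 : ∀ v : TangentSpace IH p, dirDeriv (F.D₁ f) p v = 1 / (√2 : ℝ) *
      (dirDeriv (fun q => dirDeriv f q (F.e₁ q)) p v -
        Complex.I * dirDeriv (fun q => dirDeriv f q (F.e₂ q)) p v) := fun v => by
    rw [h1, dirDeriv_const_mul _ _ (s1.sub (s2.const_mul _)), dirDeriv_sub _ s1 (s2.const_mul _),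
      dirDeriv_const_mul _ _ s2]
  rw [D₁, D₁bar, e1, e1, e2, e2, ωZ₁, ωZ₁bar, θ₁BracketZ₁Z₁bar]
  have h2 := sqrt_two_mul_self
  have h3 := sqrt_two_ne_zero
  have hI := Complex.I_sq
  simp only [map_neg, map_mul, Complex.conj_I]
  field_simp
  linear_combination 2 * Complex.I * h + Complex.I * (F.D₀ f p -
    F.θ₁ p (VectorField.mlieBracket IH F.e₁ F.e₂ p) * F.D₁ f p -
        conj (F.θ₁ p (VectorField.mlieBracket IH F.e₁ F.e₂ p)) * F.D₁bar f p) * h2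

/-- The commutator `[T, Z₁]`. -/
lemma comm₀₁ (hp : p ∈ U) (hf : ∀ q ∈ U, SmoothAt f q) :
    F.D₀ (F.D₁ f) p - F.D₁ (F.D₀ f) p = F.ωT p * F.D₁ f p - F.A₁₁ p * F.D₁bar f p := by
  have s1 : SmoothAt (fun q => dirDeriv f q (F.e₁ q)) p :=
    smoothAt_dirDeriv F.isOpen hp (fun _ hq => F.fieldAt_e₁ hq) hf
  have s2 : SmoothAt (fun q => dirDeriv f q (F.e₂ q)) p :=
    smoothAt_dirDeriv F.isOpen hp (fun _ hq => F.fieldAt_e₂ hq) hf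
  have h1 : F.D₁ f = fun q => 1 / (√2 : ℝ) *
      (dirDeriv f q (F.e₁ q) - Complex.I * dirDeriv f q (F.e₂ q)) := rfl
  have h0 : F.D₀ f = fun q => dirDeriv f q (F.T q) := rfl
  have e2 : ∀ v : TangentSpace IH p, dirDeriv (F.D₁ f) p v = 1 / (√2 : ℝ) *
      (dirDeriv (fun q => dirDeriv f q (F.e₁ q)) p v -
        Complex.I * dirDeriv (fun q => dirDeriv f q (F.e₂ q)) p v) := fun v => by
    rw [h1, dirDeriv_const_mul _ _ (s1.sub (s2.const_mul _)), dirDeriv_sub _ s1 (s2.const_mul _),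
      dirDeriv_const_mul _ _ s2]
  have c1 := F.comm_T_e₁ hp hf
  have c2 := F.comm_T_e₂ hp hf
  rw [D₀, e2, D₁, h0, ωT, A₁₁, θ₁BracketTZ₁, θ₁BracketTZ₁bar]
  simp only [map_neg, map_mul, map_add, map_div₀, map_one, Complex.conj_ofReal, Complex.conj_I]
  linear_combination (1 / ((√2 : ℝ) : ℂ)) * c1 - Complex.I * (1 / ((√2 : ℝ) : ℂ)) * c2

/-- The commutator `[T, Z_1̄]`. -/
lemma comm₀₁bar (hp : p ∈ U) (hf : ∀ q ∈ U, SmoothAt f q) :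
    F.D₀ (F.D₁bar f) p - F.D₁bar (F.D₀ f) p =
      conj (F.ωT p) * F.D₁bar f p - conj (F.A₁₁ p) * F.D₁ f p := by
  have h := congrArg conj (F.comm₀₁ hp (f := fun q => conj (f q)) fun q hq => (hf q hq).conj)
  have e1 : F.D₀ (F.D₁ fun q => conj (f q)) p = conj (F.D₀ (F.D₁bar f) p) := by
    rw [← F.D₀_conj (F.smoothAt_D₁bar hp hf)]
    exact (F.isDer₀ p).congr_on F.isOpen hp fun q hq => F.D₁_conj (hf q hq)
  have e2 : F.D₁ (F.D₀ fun q => conj (f q)) p = conj (F.D₁bar (F.D₀ f) p) := by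
    rw [← F.D₁_conj (F.smoothAt_D₀ hp hf)]
    exact (F.isDer₁ p).congr_on F.isOpen hp fun q hq => F.D₀_conj (hf q hq)
  rw [e1, e2, F.D₁_conj (hf p hp), F.D₁bar_conj (hf p hp)] at h
  simpa using h

end UnitaryFrame

/-! ### Change of unitary frame -/

namespace UnitaryFrame

variable {N : Type*} [TopologicalSpace N] [ChartedSpace Heis N] [IsManifold IH ∞ N]
  {θ : Π p : N, TangentSpace IH p →L[ℝ] ℝ}
  {J : Π p : N, TangentSpace IH p →ₗ[ℝ] TangentSpace IH p} {U : Set N}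

/-- The restriction of a unitary frame to a smaller open set. -/
def restrict (F : UnitaryFrame θ J U) {V : Set N} (hV : IsOpen V) (hVU : V ⊆ U) :
    UnitaryFrame θ J V where
  T := F.T
  e₁ := F.e₁
  e₂ := F.e₂
  θ₁ := F.θ₁
  isOpen := hV
  smooth_T := F.smooth_T.mono hVU
  smooth_e₁ := F.smooth_e₁.mono hVU
  smooth_e₂ := F.smooth_e₂.mono hVU
  θ_T p hp := F.θ_T p (hVU hp)
  θ_e₁ p hp := F.θ_e₁ p (hVU hp)
  θ_e₂ p hp := F.θ_e₂ p (hVU hp)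
  J_e₁ p hp := F.J_e₁ p (hVU hp)
  J_e₂ p hp := F.J_e₂ p (hVU hp)
  θ₁_T p hp := F.θ₁_T p (hVU hp)
  θ₁_e₁ p hp := F.θ₁_e₁ p (hVU hp)
  θ₁_e₂ p hp := F.θ₁_e₂ p (hVU hp)
  bracket_T_e₁ p hp := F.bracket_T_e₁ p (hVU hp)
  bracket_T_e₂ p hp := F.bracket_T_e₂ p (hVU hp)
  bracket_e₁_e₂ p hp := F.bracket_e₁_e₂ p (hVU hp)

/-- The coefficient of the vector field `Z_1̄` in the flux whose divergence is the integrand. -/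
def fluxBar (F : UnitaryFrame θ J U) (f : N → ℂ) (p : N) : ℂ :=
  2 * conj (f p) * F.paneitz₃ f p + 2 * conj (F.hess₁bar₁bar f p) * F.D₁bar f p

/-- The coefficient of the vector field `Z₁` in the flux whose divergence is the integrand. -/
def flux (F : UnitaryFrame θ J U) (f : N → ℂ) (p : N) : ℂ :=
  -2 * conj (F.D₁ f p) * F.hess₁bar₁ f p - 2 * Complex.I * conj (F.D₀ f p) * F.D₁bar f p
    - 2 * conj (F.hess₁bar₁ f p) * F.D₁bar f p

variable (F F' : UnitaryFrame θ J U) {p : N} {f g : N → ℂ}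

/-- A function with prescribed derivatives along the frame at a point. -/
lemma exists_function {e : OpenPartialHomeomorph N Heis} (he : e ∈ IsManifold.maximalAtlas IH ∞ N)
    (hU : U ⊆ e.source) (hp : p ∈ U) (a b d : ℂ) : ∃ f : N → ℂ, (∀ q ∈ U, SmoothAt f q) ∧
      F.D₀ f p = a ∧ F.D₁ f p = b ∧ F.D₁bar f p = d := by
  let ℓ : TangentSpace IH p →L[ℝ] ℂ :=
    a • (Complex.ofRealCLM ∘L θ p) + b • F.θ₁ p + d • ((Complex.conjCLE : ℂ →L[ℝ] ℂ) ∘L F.θ₁ p)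
  let L : Heis →L[ℝ] ℂ := ℓ ∘L (mfderiv IH IH e.symm (e p))
  have hL : ∀ v : TangentSpace IH p, dirDeriv (fun q => L (e q)) p v =
      a * θ p v + b * F.θ₁ p v + d * conj (F.θ₁ p v) := by
    intro v
    rw [dirDeriv_comp_chart he (hU hp) L.contDiff.contDiffAt, L.fderiv]
    change ℓ (mfderiv IH IH e.symm (e p) (mfderiv IH IH e p v)) = _
    rw [mfderiv_symm_mfderiv he (hU hp)]
    rfl
  have h3 := sqrt_two_ne_zero
  have h2 := sqrt_two_mul_self
  have hI := Complex.I_sq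
  refine ⟨fun q => L (e q), fun q hq => smoothAt_comp_chart he (hU hq) L.contDiff.contDiffAt,
    ?_, ?_, ?_⟩
  · rw [D₀, hL, F.θ_T p hp, F.θ₁_T p hp]
    simp
  · rw [D₁, hL, hL, F.θ_e₁ p hp, F.θ_e₂ p hp, F.θ₁_e₁ p hp, F.θ₁_e₂ p hp]
    simp only [map_div₀, map_one, Complex.conj_ofReal, Complex.conj_I, Complex.ofReal_zero]
    field_simp
    linear_combination (-b) * h2 + (d - b) * hI
  · rw [D₁bar, hL, hL, F.θ_e₁ p hp, F.θ_e₂ p hp, F.θ₁_e₁ p hp, F.θ₁_e₂ p hp]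
    simp only [map_div₀, map_one, Complex.conj_ofReal, Complex.conj_I, Complex.ofReal_zero]
    field_simp
    linear_combination (-d) * h2 + (b - d) * hI

/-- The unit complex function relating two unitary frames: `Z₁' = c Z₁`. -/
def rot (q : N) : ℂ := (√2 : ℝ) * F.θ₁ q (F'.e₁ q)

lemma θ₁_J (hp : p ∈ U) {v : TangentSpace IH p} (hv : θ p v = 0) :
    F.θ₁ p (J p v) = Complex.I * F.θ₁ p v := by
  have h2 := sqrt_two_ne_zero
  have h := F.eq_expand hp v
  rw [hv, zero_smul, zero_add] at h
  have hJ : J p v = (√2 * (F.θ₁ p v).re) • F.e₂ p - (√2 * (F.θ₁ p v).im) • F.e₁ p := by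
    conv_lhs => rw [h]
    rw [map_add, map_smul, map_smul, F.J_e₁ p hp, F.J_e₂ p hp, smul_neg, sub_eq_add_neg]
  rw [hJ, map_sub, map_smul, map_smul, F.θ₁_e₁ p hp, F.θ₁_e₂ p hp]
  conv_rhs => rw [← Complex.re_add_im (F.θ₁ p v)]
  rw [Complex.real_smul, Complex.real_smul]
  push_cast
  field_simp
  linear_combination (-((F.θ₁ p v).im : ℂ)) * Complex.I_sq

lemma θ₁_e₂' (hp : p ∈ U) : F.θ₁ p (F'.e₂ p) = Complex.I * F.θ₁ p (F'.e₁ p) := by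
  rw [← F'.J_e₁ p hp, F.θ₁_J hp (F'.θ_e₁ p hp)]

lemma D₁_rot (hp : p ∈ U) : F'.D₁ f p = F.rot F' p * F.D₁ f p := by
  rw [D₁, F.dirDeriv_eq hp, F.dirDeriv_eq hp, F'.θ_e₁ p hp, F'.θ_e₂ p hp, F.θ₁_e₂' F' hp, rot]
  simp only [map_mul, Complex.conj_I, Complex.ofReal_zero]
  have h2 := sqrt_two_mul_self
  have h3 := sqrt_two_ne_zero
  field_simp
  linear_combination (-F.θ₁ p (F'.e₁ p) * F.D₁ f p) * h2 +
    (-F.θ₁ p (F'.e₁ p) * F.D₁ f p + conj (F.θ₁ p (F'.e₁ p)) * F.D₁bar f p) * Complex.I_sq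

lemma D₁bar_rot (hp : p ∈ U) : F'.D₁bar f p = conj (F.rot F' p) * F.D₁bar f p := by
  rw [D₁bar, F.dirDeriv_eq hp, F.dirDeriv_eq hp, F'.θ_e₁ p hp, F'.θ_e₂ p hp, F.θ₁_e₂' F' hp, rot]
  simp only [map_mul, Complex.conj_I, Complex.ofReal_zero, Complex.conj_ofReal]
  have h2 := sqrt_two_mul_self
  have h3 := sqrt_two_ne_zero
  field_simp
  linear_combination (-conj (F.θ₁ p (F'.e₁ p)) * F.D₁bar f p) * h2 +
    (F.θ₁ p (F'.e₁ p) * F.D₁ f p - conj (F.θ₁ p (F'.e₁ p)) * F.D₁bar f p) * Complex.I_sq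

lemma D₀_rot_aux (hp : p ∈ U) : F'.D₀ f p = F.D₀ f p + F.θ₁ p (F'.T p) * F.D₁ f p
    + conj (F.θ₁ p (F'.T p)) * F.D₁bar f p := by
  rw [D₀, F.dirDeriv_eq hp, F'.θ_T p hp]
  push_cast
  ring

lemma smoothAt_rot (hp : p ∈ U) : SmoothAt (F.rot F') p :=
  (F.smoothAt_θ₁_field hp (F'.fieldAt_e₁ hp)).const_mul _

section Chart

variable {e : OpenPartialHomeomorph N Heis} (he : e ∈ IsManifold.maximalAtlas IH ∞ N)
    (hU : U ⊆ e.source)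
include he hU

lemma rot_mul_conj (hp : p ∈ U) : F.rot F' p * conj (F.rot F' p) = 1 := by
  obtain ⟨f, hf, h0, h1, hb⟩ := F.exists_function he hU hp 1 0 0
  have h := F'.comm₁₁bar hp hf
  have e1 : F'.D₁ (F'.D₁bar f) p = F.rot F' p * (conj (F.rot F' p) * F.D₁ (F.D₁bar f) p) := by
    rw [F.D₁_rot F' hp, (F.isDer₁ p).congr_on F.isOpen hp fun q hq => F.D₁bar_rot F' hq,
      (F.isDer₁ p).mul (F.smoothAt_rot F' hp).conj (F.smoothAt_D₁bar hp hf), hb]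
    ring
  have e2 : F'.D₁bar (F'.D₁ f) p = conj (F.rot F' p) * (F.rot F' p * F.D₁bar (F.D₁ f) p) := by
    rw [F.D₁bar_rot F' hp, (F.isDer₁bar p).congr_on F.isOpen hp fun q hq => F.D₁_rot F' hq,
      (F.isDer₁bar p).mul (F.smoothAt_rot F' hp) (F.smoothAt_D₁ hp hf), h1]
    ring
  have hc := F.comm₁₁bar hp hf
  rw [e1, e2, F.D₁_rot F' hp, F.D₁bar_rot F' hp, F.D₀_rot_aux F' hp, h0, h1, hb] at h
  rw [h0, h1, hb] at hc
  have hI : Complex.I ≠ 0 := Complex.I_ne_zero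
  apply mul_left_cancel₀ hI
  linear_combination -h + (F.rot F' p * conj (F.rot F' p)) * hc

lemma θ₁_T' (hp : p ∈ U) : F.θ₁ p (F'.T p) = 0 := by
  obtain ⟨f, hf, h0, h1, hb⟩ := F.exists_function he hU hp 1 0 0
  have h := F'.comm₀₁ hp hf
  have sμ : SmoothAt (fun q => F.θ₁ q (F'.T q)) p := F.smoothAt_θ₁_field hp (F'.fieldAt_T hp)
  have s0 := F.smoothAt_D₀ hp hf
  have s1 := F.smoothAt_D₁ hp hf
  have sb := F.smoothAt_D₁bar hp hf
  have sc := F.smoothAt_rot F' hp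
  have e1 : F'.D₀ (F'.D₁ f) p = F.rot F' p * (F.D₀ (F.D₁ f) p + F.θ₁ p (F'.T p) * F.D₁ (F.D₁ f) p +
      conj (F.θ₁ p (F'.T p)) * F.D₁bar (F.D₁ f) p) := by
    rw [(F'.isDer₀ p).congr_on F.isOpen hp fun q hq => F.D₁_rot F' hq,
      (F'.isDer₀ p).mul sc s1, F.D₀_rot_aux F' hp (f := F.D₁ f), h1]
    ring
  have e2 : F'.D₁ (F'.D₀ f) p = F.rot F' p * (F.D₁ (F.D₀ f) p + F.θ₁ p (F'.T p) * F.D₁ (F.D₁ f) p +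
      conj (F.θ₁ p (F'.T p)) * F.D₁ (F.D₁bar f) p) := by
    rw [F.D₁_rot F' hp, (F.isDer₁ p).congr_on F.isOpen hp fun q hq => F.D₀_rot_aux F' hq,
      (F.isDer₁ p).add (s0.add (sμ.mul s1)) (sμ.conj.mul sb),
      (F.isDer₁ p).add s0 (sμ.mul s1), (F.isDer₁ p).mul sμ s1,
      (F.isDer₁ p).mul sμ.conj sb, h1, hb]
    ring
  have hc := F.comm₁₁bar hp hf
  have hc0 := F.comm₀₁ hp hf
  rw [e1, e2, F.D₁_rot F' hp, F.D₁bar_rot F' hp, h1, hb] at h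
  rw [h0, h1, hb] at hc
  rw [h1, hb] at hc0
  have hn : F.rot F' p ≠ 0 := left_ne_zero_of_mul_eq_one (F.rot_mul_conj F' he hU hp)
  have : F.rot F' p * Complex.I * conj (F.θ₁ p (F'.T p)) = 0 := by
    linear_combination h - (F.rot F' p) * hc0 + (F.rot F' p * conj (F.θ₁ p (F'.T p))) * hc
  have h4 : conj (F.θ₁ p (F'.T p)) = 0 := by
    simpa [hn, Complex.I_ne_zero] using this
  simpa using h4

lemma D₀_rot (hp : p ∈ U) : F'.D₀ f p = F.D₀ f p := by
  rw [F.D₀_rot_aux F' hp, F.θ₁_T' F' he hU hp]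
  simp

lemma ωZ₁bar_rot (hp : p ∈ U) : F'.ωZ₁bar p = conj (F.rot F' p) * F.ωZ₁bar p +
    conj (F.rot F' p) ^ 2 * F.D₁bar (F.rot F') p := by
  obtain ⟨f, hf, h0, h1, hb⟩ := F.exists_function he hU hp 0 1 0
  have h := F'.comm₁₁bar hp hf
  have e1 : F'.D₁ (F'.D₁bar f) p = F.rot F' p * (conj (F.rot F' p) * F.D₁ (F.D₁bar f) p) := by
    rw [F.D₁_rot F' hp, (F.isDer₁ p).congr_on F.isOpen hp fun q hq => F.D₁bar_rot F' hq,
      (F.isDer₁ p).mul (F.smoothAt_rot F' hp).conj (F.smoothAt_D₁bar hp hf), hb]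
    ring
  have e2 : F'.D₁bar (F'.D₁ f) p = conj (F.rot F' p) * (F.D₁bar (F.rot F') p +
      F.rot F' p * F.D₁bar (F.D₁ f) p) := by
    rw [F.D₁bar_rot F' hp, (F.isDer₁bar p).congr_on F.isOpen hp fun q hq => F.D₁_rot F' hq,
      (F.isDer₁bar p).mul (F.smoothAt_rot F' hp) (F.smoothAt_D₁ hp hf), h1]
    ring
  have hc := F.comm₁₁bar hp hf
  rw [e1, e2, F.D₁_rot F' hp, F.D₁bar_rot F' hp, F.D₀_rot F' he hU hp, h0, h1, hb] at h
  rw [h0, h1, hb] at hc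
  have hr := F.rot_mul_conj F' he hU hp
  linear_combination conj (F.rot F' p) * h -
    conj (F.rot F' p) * (F.rot F' p * conj (F.rot F' p)) * hc +
    (-F'.ωZ₁bar p + conj (F.rot F' p) * F.ωZ₁bar p) * hr

lemma ωZ₁_rot (hp : p ∈ U) : F'.ωZ₁ p = F.rot F' p * F.ωZ₁ p -
    F.rot F' p ^ 2 * F.D₁ (fun q => conj (F.rot F' q)) p := by
  rw [ωZ₁, ωZ₁, F.ωZ₁bar_rot F' he hU hp, F.D₁_conj (F.smoothAt_rot F' hp)]
  simp only [map_add, map_mul, map_pow, Complex.conj_conj]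
  ring

lemma ωT_rot (hp : p ∈ U) : F'.ωT p = F.ωT p + conj (F.rot F' p) * F.D₀ (F.rot F') p := by
  obtain ⟨f, hf, h0, h1, hb⟩ := F.exists_function he hU hp 0 1 0
  have h := F'.comm₀₁ hp hf
  have hc := F.comm₀₁ hp hf
  rw [F.D₀_rot F' he hU hp, (F.isDer₀ p).congr_on F.isOpen hp fun q hq => F.D₁_rot F' hq,
    (F.isDer₀ p).mul (F.smoothAt_rot F' hp) (F.smoothAt_D₁ hp hf), F.D₁_rot F' hp,
    (F.isDer₁ p).congr_on F.isOpen hp fun q hq => F.D₀_rot F' he hU hq,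
    F.D₁_rot F' hp, F.D₁bar_rot F' hp, h1, hb] at h
  rw [h1, hb] at hc
  have hr := F.rot_mul_conj F' he hU hp
  linear_combination (-conj (F.rot F' p)) * h + (conj (F.rot F' p) * F.rot F' p) * hc +
    (F.ωT p - F'.ωT p) * hr

lemma A₁₁_rot (hp : p ∈ U) : F'.A₁₁ p = F.rot F' p ^ 2 * F.A₁₁ p := by
  obtain ⟨f, hf, h0, h1, hb⟩ := F.exists_function he hU hp 0 0 1
  have h := F'.comm₀₁ hp hf
  have hc := F.comm₀₁ hp hf
  rw [F.D₀_rot F' he hU hp, (F.isDer₀ p).congr_on F.isOpen hp fun q hq => F.D₁_rot F' hq,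
    (F.isDer₀ p).mul (F.smoothAt_rot F' hp) (F.smoothAt_D₁ hp hf), F.D₁_rot F' hp,
    (F.isDer₁ p).congr_on F.isOpen hp fun q hq => F.D₀_rot F' he hU hq,
    F.D₁_rot F' hp, F.D₁bar_rot F' hp, h1, hb] at h
  rw [h1, hb] at hc
  have hr := F.rot_mul_conj F' he hU hp
  linear_combination F.rot F' p * h - F.rot F' p ^ 2 * hc - F'.A₁₁ p * hr

lemma θ₁_rot (hp : p ∈ U) (v : TangentSpace IH p) : F.θ₁ p v = F.rot F' p * F'.θ₁ p v := by
  conv_lhs => rw [F'.eq_expand hp v]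
  rw [map_add, map_add, map_smul, map_smul, map_smul, F.θ₁_T' F' he hU hp, F.θ₁_e₂' F' hp, rot]
  conv_rhs => rw [← Complex.re_add_im (F'.θ₁ p v)]
  simp only [Complex.real_smul]
  push_cast
  ring

/-- Derivative of `c c̄ = 1`. -/
lemma D₁_rot_conj (hp : p ∈ U) : F.D₁ (fun q => conj (F.rot F' q)) p =
    -conj (F.rot F' p) ^ 2 * F.D₁ (F.rot F') p := by
  have h : F.D₁ (fun q => F.rot F' q * conj (F.rot F' q)) p = 0 := by
    rw [(F.isDer₁ p).congr_on F.isOpen hp fun q hq => F.rot_mul_conj F' he hU hq,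
      (F.isDer₁ p).const]
  rw [(F.isDer₁ p).mul (F.smoothAt_rot F' hp) (F.smoothAt_rot F' hp).conj] at h
  have hr := F.rot_mul_conj F' he hU hp
  linear_combination conj (F.rot F' p) * h - F.D₁ (fun q => conj (F.rot F' q)) p * hr

lemma D₁bar_rot_conj (hp : p ∈ U) : F.D₁bar (fun q => conj (F.rot F' q)) p =
    -conj (F.rot F' p) ^ 2 * F.D₁bar (F.rot F') p := by
  have h : F.D₁bar (fun q => F.rot F' q * conj (F.rot F' q)) p = 0 := by
    rw [(F.isDer₁bar p).congr_on F.isOpen hp fun q hq => F.rot_mul_conj F' he hU hq,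
      (F.isDer₁bar p).const]
  rw [(F.isDer₁bar p).mul (F.smoothAt_rot F' hp) (F.smoothAt_rot F' hp).conj] at h
  have hr := F.rot_mul_conj F' he hU hp
  linear_combination conj (F.rot F' p) * h - F.D₁bar (fun q => conj (F.rot F' q)) p * hr

end Chart

end UnitaryFrame

namespace UnitaryFrame

variable {N : Type*} [TopologicalSpace N] [ChartedSpace Heis N] [IsManifold IH ∞ N]
  {θ : Π p : N, TangentSpace IH p →L[ℝ] ℝ}
  {J : Π p : N, TangentSpace IH p →ₗ[ℝ] TangentSpace IH p} {U : Set N}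

section Tensors

variable (F : UnitaryFrame θ J U) {p : N} {f : N → ℂ}

lemma boxb_eq (hp : p ∈ U) (hf : ∀ q ∈ U, SmoothAt f q) :
    F.boxb f p = -2 * F.hess₁bar₁ f p := by
  have h := F.comm₁₁bar hp hf
  rw [boxb, hess₁₁bar, hess₁bar₁]
  linear_combination h

lemma smoothAt_hess₁bar₁ (hp : p ∈ U) (hf : ∀ q ∈ U, SmoothAt f q) :
    SmoothAt (F.hess₁bar₁ f) p :=
  (F.smoothAt_D₁ hp fun _ hq => F.smoothAt_D₁bar hq hf).add
    ((F.smoothAt_ωZ₁ hp).mul (F.smoothAt_D₁bar hp hf))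

lemma smoothAt_hess₁bar₁bar (hp : p ∈ U) (hf : ∀ q ∈ U, SmoothAt f q) :
    SmoothAt (F.hess₁bar₁bar f) p :=
  (F.smoothAt_D₁bar hp fun _ hq => F.smoothAt_D₁bar hq hf).add
    ((F.smoothAt_ωZ₁bar hp).mul (F.smoothAt_D₁bar hp hf))

lemma smoothAt_paneitz₃ (hp : p ∈ U) (hf : ∀ q ∈ U, SmoothAt f q) :
    SmoothAt (F.paneitz₃ f) p :=
  (F.smoothAt_D₁ hp fun _ hq => F.smoothAt_hess₁bar₁ hq hf).add
    (((F.smoothAt_A₁₁ hp).const_mul Complex.I).mul (F.smoothAt_D₁bar hp hf))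

lemma smoothAt_paneitz (hp : p ∈ U) (hf : ∀ q ∈ U, SmoothAt f q) :
    SmoothAt (F.paneitz f) p :=
  ((F.smoothAt_D₁bar hp fun _ hq => F.smoothAt_paneitz₃ hq hf).sub
    ((F.smoothAt_ωZ₁bar hp).mul (F.smoothAt_paneitz₃ hp hf))).const_mul 4

lemma smoothAt_boxb (hp : p ∈ U) (hf : ∀ q ∈ U, SmoothAt f q) : SmoothAt (F.boxb f) p := by
  refine ((F.smoothAt_hess₁bar₁ hp hf).const_mul (-2)).congr ?_
  filter_upwards [F.isOpen.mem_nhds hp] with q hq using F.boxb_eq hq hf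

lemma smoothAt_fluxBar (hp : p ∈ U) (hf : ∀ q ∈ U, SmoothAt f q) :
    SmoothAt (F.fluxBar f) p :=
  (((hf p hp).conj.const_mul 2).mul (F.smoothAt_paneitz₃ hp hf)).add
    (((F.smoothAt_hess₁bar₁bar hp hf).conj.const_mul 2).mul (F.smoothAt_D₁bar hp hf))

lemma smoothAt_flux (hp : p ∈ U) (hf : ∀ q ∈ U, SmoothAt f q) : SmoothAt (F.flux f) p :=
  ((((F.smoothAt_D₁ hp hf).conj.const_mul (-2)).mul (F.smoothAt_hess₁bar₁ hp hf)).sub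
    (((F.smoothAt_D₀ hp hf).conj.const_mul (2 * Complex.I)).mul (F.smoothAt_D₁bar hp hf))).sub
    (((F.smoothAt_hess₁bar₁ hp hf).conj.const_mul 2).mul (F.smoothAt_D₁bar hp hf))

lemma smoothAt_R (hp : p ∈ U) : SmoothAt F.R p :=
  (((F.smoothAt_D₁ hp fun _ hq => F.smoothAt_ωZ₁bar hq).sub
    (F.smoothAt_D₁bar hp fun _ hq => F.smoothAt_ωZ₁ hq)).add
    ((F.smoothAt_ωT hp).const_mul Complex.I)).add
    (((F.smoothAt_ωZ₁ hp).const_mul 2).mul (F.smoothAt_ωZ₁bar hp))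

/-- The divergence identity: the integrand of the mass formula is the divergence of the vector
field `fluxBar Z_1̄ + flux Z₁`. The commutators are applied to `f` and to `f_{,1̄}`; the torsion
terms cancel, and the curvature enters through `[Z₁, Z_1̄]` acting on `f_{,1̄}`. -/
theorem divergence_identity (hp : p ∈ U) (hf : ∀ q ∈ U, SmoothAt f q) :
    (F.D₁bar (F.fluxBar f) p - F.ωZ₁bar p * F.fluxBar f p) +
      (F.D₁ (F.flux f) p + F.ωZ₁ p * F.flux f p) =
    -(F.boxb f p * conj (F.boxb f p)) + 2 * (F.hess₁bar₁bar f p * conj (F.hess₁bar₁bar f p)) +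
      2 * F.R p * (F.D₁bar f p * conj (F.D₁bar f p)) + 1 / 2 * (conj (f p) * F.paneitz f p) := by
  have sf := hf p hp
  have sb := F.smoothAt_D₁bar hp hf
  have s1 := F.smoothAt_D₁ hp hf
  have s0 := F.smoothAt_D₀ hp hf
  have su := F.smoothAt_hess₁bar₁ hp hf
  have sH := F.smoothAt_hess₁bar₁bar hp hf
  have sp := F.smoothAt_paneitz₃ hp hf
  have sω := F.smoothAt_ωZ₁ hp
  have sωb := F.smoothAt_ωZ₁bar hp
  have sbb := F.smoothAt_D₁bar hp fun _ hq => F.smoothAt_D₁bar hq hf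
  have sb1 := F.smoothAt_D₁ hp fun _ hq => F.smoothAt_D₁bar hq hf
  have d1 := F.isDer₁ p
  have db := F.isDer₁bar p
  have eP : F.D₁bar (F.fluxBar f) p = 2 * conj (F.D₁ f p) * F.paneitz₃ f p +
      2 * conj (f p) * F.D₁bar (F.paneitz₃ f) p +
      2 * conj (F.D₁ (F.hess₁bar₁bar f) p) * F.D₁bar f p +
      2 * conj (F.hess₁bar₁bar f p) * F.D₁bar (F.D₁bar f) p := by
    rw [← F.D₁bar_conj sf, ← F.D₁bar_conj sH, show F.fluxBar f = fun q =>
      2 * conj (f q) * F.paneitz₃ f q + 2 * conj (F.hess₁bar₁bar f q) * F.D₁bar f q from rfl,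
      db.add ((sf.conj.const_mul 2).mul sp) ((sH.conj.const_mul 2).mul sb),
      db.mul (sf.conj.const_mul 2) sp, db.mul (sH.conj.const_mul 2) sb,
      db.const_mul 2 sf.conj, db.const_mul 2 sH.conj]
    ring
  have eQ : F.D₁ (F.flux f) p = -2 * conj (F.D₁bar (F.D₁ f) p) * F.hess₁bar₁ f p
      - 2 * conj (F.D₁ f p) * F.D₁ (F.hess₁bar₁ f) p
      - 2 * Complex.I * conj (F.D₁bar (F.D₀ f) p) * F.D₁bar f p
      - 2 * Complex.I * conj (F.D₀ f p) * F.D₁ (F.D₁bar f) p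
      - 2 * conj (F.D₁bar (F.hess₁bar₁ f) p) * F.D₁bar f p
      - 2 * conj (F.hess₁bar₁ f p) * F.D₁ (F.D₁bar f) p := by
    rw [← F.D₁_conj s1, ← F.D₁_conj s0, ← F.D₁_conj su, show F.flux f = fun q =>
      -2 * conj (F.D₁ f q) * F.hess₁bar₁ f q - 2 * Complex.I * conj (F.D₀ f q) * F.D₁bar f q
      - 2 * conj (F.hess₁bar₁ f q) * F.D₁bar f q from rfl,
      d1.sub (((s1.conj.const_mul (-2)).mul su).sub ((s0.conj.const_mul (2 * Complex.I)).mul sb))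
        ((su.conj.const_mul 2).mul sb),
      d1.sub ((s1.conj.const_mul (-2)).mul su) ((s0.conj.const_mul (2 * Complex.I)).mul sb),
      d1.mul (s1.conj.const_mul (-2)) su, d1.mul (s0.conj.const_mul (2 * Complex.I)) sb,
      d1.mul (su.conj.const_mul 2) sb, d1.const_mul (-2) s1.conj,
      d1.const_mul (2 * Complex.I) s0.conj, d1.const_mul 2 su.conj]
    ring
  have eH : F.D₁ (F.hess₁bar₁bar f) p = F.D₁ (F.D₁bar (F.D₁bar f)) p +
      F.D₁ F.ωZ₁bar p * F.D₁bar f p + F.ωZ₁bar p * F.D₁ (F.D₁bar f) p := by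
    rw [show F.hess₁bar₁bar f = fun q => F.D₁bar (F.D₁bar f) q + F.ωZ₁bar q * F.D₁bar f q from rfl,
      d1.add sbb (sωb.mul sb), d1.mul sωb sb]
    ring
  have eu : F.D₁bar (F.hess₁bar₁ f) p = F.D₁bar (F.D₁ (F.D₁bar f)) p +
      F.D₁bar F.ωZ₁ p * F.D₁bar f p + F.ωZ₁ p * F.D₁bar (F.D₁bar f) p := by
    rw [show F.hess₁bar₁ f = fun q => F.D₁ (F.D₁bar f) q + F.ωZ₁ q * F.D₁bar f q from rfl,
      db.add sb1 (sω.mul sb), db.mul sω sb]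
    ring
  have hbox := F.boxb_eq hp hf
  have hc := F.comm₁₁bar hp hf
  have hcb := F.comm₁₁bar hp fun q hq => F.smoothAt_D₁bar hq hf
  have hc0 := F.comm₀₁bar hp hf
  have hu : F.hess₁bar₁ f p = F.D₁ (F.D₁bar f) p + F.ωZ₁ p * F.D₁bar f p := rfl
  have hH : F.hess₁bar₁bar f p = F.D₁bar (F.D₁bar f) p + F.ωZ₁bar p * F.D₁bar f p := rfl
  have hp3 : F.paneitz₃ f p = F.D₁ (F.hess₁bar₁ f) p + Complex.I * F.A₁₁ p * F.D₁bar f p := rfl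
  have hω : conj (F.ωZ₁ p) = -F.ωZ₁bar p := by simp [ωZ₁]
  have hωb : conj (F.ωZ₁bar p) = -F.ωZ₁ p := by simp [ωZ₁]
  have hdω : conj (F.D₁ F.ωZ₁bar p) = -F.D₁bar F.ωZ₁ p := by
    rw [← F.D₁bar_conj sωb, show F.ωZ₁ = fun q => -conj (F.ωZ₁bar q) from rfl, db.neg sωb.conj]
    ring
  have hdωb : conj (F.D₁bar F.ωZ₁ p) = -F.D₁ F.ωZ₁bar p := by
    have := congrArg conj hdω
    rw [map_neg, Complex.conj_conj] at this
    rw [this, neg_neg]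
  -- with all terms expanded, the identity is a combination of the conjugates of three commutator
  -- formulas: `[Z₁, Z_1̄] f`, `[Z₁, Z_1̄] f_{,1̄}` and `[T, Z_1̄] f`
  rw [eP, eQ, eH, eu, hbox, paneitz, fluxBar, flux, R]
  have kc := congrArg conj hc
  have kcb := congrArg conj hcb
  have kc0 := congrArg conj hc0
  simp only [map_add, map_sub, map_mul, map_neg, Complex.conj_I, Complex.conj_conj, hω, hωb,
    map_ofNat, hdω, hdωb] at kc kcb kc0 ⊢
  have ku := congrArg conj hu
  have kH := congrArg conj hH
  simp only [map_add, map_mul, hω, hωb] at ku kH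
  have hI := Complex.I_sq
  rw [ku, kH, hp3, hu, hH]
  generalize F.D₁ (F.hess₁bar₁ f) p = z1 at *
  generalize F.D₁bar (F.paneitz₃ f) p = z2 at *
  generalize conj (F.D₁ (F.D₁bar (F.D₁bar f)) p) = z3 at *
  generalize conj (F.D₁bar (F.D₁ (F.D₁bar f)) p) = z4 at *
  generalize conj (F.D₀ (F.D₁bar f) p) = z5 at *
  generalize conj (F.D₁bar (F.D₀ f) p) = z6 at *
  generalize conj (F.D₁bar (F.D₁bar f) p) = z7 at *
  generalize conj (F.D₁ (F.D₁bar f) p) = z8 at *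
  generalize conj (F.D₁bar (F.D₁ f) p) = z9 at *
  linear_combination (2 * (F.D₁ (F.D₁bar f) p + F.ωZ₁ p * F.D₁bar f p)) * kc +
    (2 * F.D₁bar f p) * kcb + (2 * Complex.I * F.D₁bar f p) * kc0

end Tensors

section Rotation

variable (F F' : UnitaryFrame θ J U) {p : N} {f : N → ℂ}
  {e : OpenPartialHomeomorph N Heis} (he : e ∈ IsManifold.maximalAtlas IH ∞ N)
    (hU : U ⊆ e.source)
include he hU

lemma hess₁bar₁_rot (hp : p ∈ U) (hf : ∀ q ∈ U, SmoothAt f q) :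
    F'.hess₁bar₁ f p = F.hess₁bar₁ f p := by
  have hr := F.rot_mul_conj F' he hU hp
  have hd := F.D₁_rot_conj F' he hU hp
  rw [hess₁bar₁, hess₁bar₁, F.D₁_rot F' hp,
    (F.isDer₁ p).congr_on F.isOpen hp fun q hq => F.D₁bar_rot F' hq,
    (F.isDer₁ p).mul (F.smoothAt_rot F' hp).conj (F.smoothAt_D₁bar hp hf), F.D₁bar_rot F' hp,
    F.ωZ₁_rot F' he hU hp, hd]
  generalize F.rot F' p = c at *
  linear_combination (F.D₁ (F.D₁bar f) p + F.ωZ₁ p * F.D₁bar f p +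
    F.D₁ (F.rot F') p * F.D₁bar f p * c * conj c ^ 2) * hr

lemma hess₁bar₁bar_rot (hp : p ∈ U) (hf : ∀ q ∈ U, SmoothAt f q) :
    F'.hess₁bar₁bar f p = conj (F.rot F' p) ^ 2 * F.hess₁bar₁bar f p := by
  have hd := F.D₁bar_rot_conj F' he hU hp
  rw [hess₁bar₁bar, hess₁bar₁bar, F.D₁bar_rot F' hp,
    (F.isDer₁bar p).congr_on F.isOpen hp fun q hq => F.D₁bar_rot F' hq,
    (F.isDer₁bar p).mul (F.smoothAt_rot F' hp).conj (F.smoothAt_D₁bar hp hf), F.D₁bar_rot F' hp,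
    F.ωZ₁bar_rot F' he hU hp, hd]
  ring

lemma boxb_rot (hp : p ∈ U) (hf : ∀ q ∈ U, SmoothAt f q) : F'.boxb f p = F.boxb f p := by
  rw [F.boxb_eq hp hf, F'.boxb_eq hp hf, F.hess₁bar₁_rot F' he hU hp hf]

lemma paneitz₃_rot (hp : p ∈ U) (hf : ∀ q ∈ U, SmoothAt f q) :
    F'.paneitz₃ f p = F.rot F' p * F.paneitz₃ f p := by
  have hr := F.rot_mul_conj F' he hU hp
  rw [paneitz₃, paneitz₃, F.D₁_rot F' hp,
    (F.isDer₁ p).congr_on F.isOpen hp fun q hq => F.hess₁bar₁_rot F' he hU hq hf,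
    F.A₁₁_rot F' he hU hp, F.D₁bar_rot F' hp]
  linear_combination (Complex.I * F.rot F' p * F.A₁₁ p * F.D₁bar f p) * hr

lemma paneitz_rot (hp : p ∈ U) (hf : ∀ q ∈ U, SmoothAt f q) : F'.paneitz f p = F.paneitz f p := by
  have hr := F.rot_mul_conj F' he hU hp
  rw [paneitz, paneitz, F.D₁bar_rot F' hp,
    (F.isDer₁bar p).congr_on F.isOpen hp fun q hq => F.paneitz₃_rot F' he hU hq hf,
    (F.isDer₁bar p).mul (F.smoothAt_rot F' hp) (F.smoothAt_paneitz₃ hp hf),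
    F.ωZ₁bar_rot F' he hU hp, F.paneitz₃_rot F' he hU hp hf]
  linear_combination (4 * F.D₁bar (F.paneitz₃ f) p - 4 * F.ωZ₁bar p * F.paneitz₃ f p -
    4 * conj (F.rot F' p) * F.D₁bar (F.rot F') p * F.paneitz₃ f p) * hr

lemma fluxBar_rot (hp : p ∈ U) (hf : ∀ q ∈ U, SmoothAt f q) :
    F'.fluxBar f p = F.rot F' p * F.fluxBar f p := by
  have hr := F.rot_mul_conj F' he hU hp
  rw [fluxBar, fluxBar, F.paneitz₃_rot F' he hU hp hf, F.hess₁bar₁bar_rot F' he hU hp hf,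
    F.D₁bar_rot F' hp]
  simp only [map_mul, map_pow, Complex.conj_conj]
  linear_combination (2 * conj (F.hess₁bar₁bar f p) * F.D₁bar f p * F.rot F' p) * hr

lemma flux_rot (hp : p ∈ U) (hf : ∀ q ∈ U, SmoothAt f q) :
    F'.flux f p = conj (F.rot F' p) * F.flux f p := by
  rw [flux, flux, F.D₁_rot F' hp, F.hess₁bar₁_rot F' he hU hp hf, F.D₀_rot F' he hU hp,
    F.D₁bar_rot F' hp]
  simp only [map_mul]
  ring

lemma fluxPairing_rot {χ : N → ℂ} (hp : p ∈ U) (hf : ∀ q ∈ U, SmoothAt f q) :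
    F'.D₁bar χ p * F'.fluxBar f p + F'.D₁ χ p * F'.flux f p =
      F.D₁bar χ p * F.fluxBar f p + F.D₁ χ p * F.flux f p := by
  have hr := F.rot_mul_conj F' he hU hp
  rw [F.fluxBar_rot F' he hU hp hf, F.flux_rot F' he hU hp hf, F.D₁bar_rot F' hp, F.D₁_rot F' hp]
  linear_combination (F.D₁bar χ p * F.fluxBar f p + F.D₁ χ p * F.flux f p) * hr

lemma R_rot (hp : p ∈ U) : F'.R p = F.R p := by
  have hr := F.rot_mul_conj F' he hU hp
  have sc := F.smoothAt_rot F' hp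
  have hsc : ∀ q ∈ U, SmoothAt (F.rot F') q := fun q hq => F.smoothAt_rot F' hq
  have sω := F.smoothAt_ωZ₁ hp
  have sωb := F.smoothAt_ωZ₁bar hp
  have sx := F.smoothAt_D₁ hp hsc
  have sy := F.smoothAt_D₁bar hp hsc
  have d1 := F.isDer₁ p
  have db := F.isDer₁bar p
  have hX := F.D₁_rot_conj F' he hU hp
  have hY := F.D₁bar_rot_conj F' he hU hp
  have hc := F.comm₁₁bar hp hsc
  -- `c² (c̄)_{,1} = -c_{,1}`, so `ω'(Z₁) = c ω(Z₁) + c_{,1}`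
  have hω' : ∀ q ∈ U, F'.ωZ₁ q = F.rot F' q * F.ωZ₁ q + F.D₁ (F.rot F') q := fun q hq => by
    have hrq := F.rot_mul_conj F' he hU hq
    rw [F.ωZ₁_rot F' he hU hq, F.D₁_rot_conj F' he hU hq]
    linear_combination (F.D₁ (F.rot F') q * (F.rot F' q * conj (F.rot F' q) + 1)) * hrq
  have e1 : F.D₁ F'.ωZ₁bar p = F.D₁ (fun q => conj (F.rot F' q)) p * F.ωZ₁bar p +
      conj (F.rot F' p) * F.D₁ F.ωZ₁bar p +
      2 * conj (F.rot F' p) * F.D₁ (fun q => conj (F.rot F' q)) p * F.D₁bar (F.rot F') p +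
      conj (F.rot F' p) ^ 2 * F.D₁ (F.D₁bar (F.rot F')) p := by
    rw [d1.congr_on F.isOpen hp (g := fun q => conj (F.rot F' q) * F.ωZ₁bar q +
      (conj (F.rot F' q) * conj (F.rot F' q)) * F.D₁bar (F.rot F') q) (fun q hq => by
        rw [F.ωZ₁bar_rot F' he hU hq]; ring),
      d1.add (sc.conj.mul sωb) ((sc.conj.mul sc.conj).mul sy), d1.mul sc.conj sωb,
      d1.mul (sc.conj.mul sc.conj) sy, d1.mul sc.conj sc.conj]
    ring
  have e2 : F.D₁bar F'.ωZ₁ p = F.D₁bar (F.rot F') p * F.ωZ₁ p + F.rot F' p * F.D₁bar F.ωZ₁ p +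
      F.D₁bar (F.D₁ (F.rot F')) p := by
    rw [db.congr_on F.isOpen hp hω', db.add (sc.mul sω) sx, db.mul sc sω]
  rw [R, R, F.D₁_rot F' hp, F.D₁bar_rot F' hp, e1, e2, F.ωT_rot F' he hU hp, hω' p hp,
    F.ωZ₁bar_rot F' he hU hp, hX]
  generalize F.rot F' p = c at *
  generalize F.D₁ (F.D₁bar (F.rot F')) p = s at *
  generalize F.D₁bar (F.D₁ (F.rot F')) p = t at *
  generalize F.D₁ (F.rot F') p = x at *
  generalize F.D₁bar (F.rot F') p = y at *
  generalize F.D₁ F.ωZ₁bar p = z at *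
  generalize F.D₁bar F.ωZ₁ p = w at *
  generalize conj c = d at *
  linear_combination d * hc + (z - w + d * s - d * x * F.ωZ₁bar p + 2 * F.ωZ₁ p * F.ωZ₁bar p +
    2 * d * F.ωZ₁ p * y - 2 * d ^ 2 * x * y) * hr

end Rotation

end UnitaryFrame

/-! ### Frame-independent quantities -/

namespace Pseudohermitian

variable {N : Type*} [TopologicalSpace N] [ChartedSpace Heis N] [IsManifold IH ∞ N]
  (S : Pseudohermitian N) {U : Set N} (F : UnitaryFrame S.θ S.J U) {p : N} {f χ : N → ℂ}

/-- The derivative of `χ` along the vector field whose divergence is the integrand of the mass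
formula. -/
def fluxPairing (f χ : N → ℂ) (p : N) : ℂ :=
  (S.frameAt p).D₁bar χ p * (S.frameAt p).fluxBar f p +
    (S.frameAt p).D₁ χ p * (S.frameAt p).flux f p

/-- Any two frames near a point can be restricted to a common coordinate domain. -/
lemma exists_common (F : UnitaryFrame S.θ S.J U) (hp : p ∈ U) :
    ∃ e ∈ IsManifold.maximalAtlas IH ∞ N, ∃ V : Set N,
    IsOpen V ∧ p ∈ V ∧ V ⊆ e.source ∧ V ⊆ U ∧ V ⊆ (S.exists_frame p).choose :=
  ⟨chartAt Heis p, IsManifold.chart_mem_maximalAtlas p,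
    (chartAt Heis p).source ∩ (U ∩ (S.exists_frame p).choose),
    (chartAt Heis p).open_source.inter (F.isOpen.inter (S.frameAt p).isOpen),
    ⟨mem_chart_source Heis p, hp, (S.exists_frame p).choose_spec.1⟩, fun _ h => h.1,
    fun _ h => h.2.1, fun _ h => h.2.2⟩

lemma boxb_eq (hp : p ∈ U) (hf : ∀ q, SmoothAt f q) : S.boxb f p = F.boxb f p := by
  obtain ⟨e, he, V, hV, hpV, hVe, h1, h2⟩ := S.exists_common F hp
  exact (F.restrict hV h1).boxb_rot ((S.frameAt p).restrict hV h2) he hVe hpV fun q _ => hf q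

lemma paneitz_eq (hp : p ∈ U) (hf : ∀ q, SmoothAt f q) : S.paneitz f p = F.paneitz f p := by
  obtain ⟨e, he, V, hV, hpV, hVe, h1, h2⟩ := S.exists_common F hp
  exact (F.restrict hV h1).paneitz_rot ((S.frameAt p).restrict hV h2) he hVe hpV fun q _ => hf q

lemma R_eq (hp : p ∈ U) : S.R p = F.R p := by
  obtain ⟨e, he, V, hV, hpV, hVe, h1, h2⟩ := S.exists_common F hp
  exact (F.restrict hV h1).R_rot ((S.frameAt p).restrict hV h2) he hVe hpV

lemma fluxPairing_eq (hp : p ∈ U) (hf : ∀ q, SmoothAt f q) :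
    S.fluxPairing f χ p = F.D₁bar χ p * F.fluxBar f p + F.D₁ χ p * F.flux f p := by
  obtain ⟨e, he, V, hV, hpV, hVe, h1, h2⟩ := S.exists_common F hp
  exact (F.restrict hV h1).fluxPairing_rot ((S.frameAt p).restrict hV h2) he hVe hpV fun q _ => hf q

lemma norm_of_mul_conj {c : ℂ} (h : c * conj c = 1) : ‖c‖ = 1 := by
  rw [Complex.mul_conj, ← Complex.ofReal_one, Complex.ofReal_inj, Complex.normSq_eq_norm_sq] at h
  nlinarith [norm_nonneg c]

lemma normSqD₁bar_eq (hp : p ∈ U) : S.normSqD₁bar f p = ‖F.D₁bar f p‖ ^ 2 := by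
  obtain ⟨e, he, V, hV, hpV, hVe, h1, h2⟩ := S.exists_common F hp
  have h := (F.restrict hV h1).D₁bar_rot ((S.frameAt p).restrict hV h2) (f := f) hpV
  have hn := norm_of_mul_conj
    ((F.restrict hV h1).rot_mul_conj ((S.frameAt p).restrict hV h2) he hVe hpV)
  have h' := congrArg (fun z : ℂ => ‖z‖ ^ 2) h
  simp only [norm_mul, RCLike.norm_conj, hn, one_mul] at h'
  exact h'

lemma normSqHess₁bar₁bar_eq (hp : p ∈ U) (hf : ∀ q, SmoothAt f q) :
    S.normSqHess₁bar₁bar f p = ‖F.hess₁bar₁bar f p‖ ^ 2 := by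
  obtain ⟨e, he, V, hV, hpV, hVe, h1, h2⟩ := S.exists_common F hp
  have h := (F.restrict hV h1).hess₁bar₁bar_rot ((S.frameAt p).restrict hV h2) he hVe hpV
    fun q _ => hf q
  have hn := norm_of_mul_conj
    ((F.restrict hV h1).rot_mul_conj ((S.frameAt p).restrict hV h2) he hVe hpV)
  have h' := congrArg (fun z : ℂ => ‖z‖ ^ 2) h
  simp only [norm_mul, norm_pow, RCLike.norm_conj, hn, one_pow, one_mul] at h'
  exact h'

/-- The volume form computed in any unitary frame, as the determinant of the real coframe
`(θ, √2 Re θ¹, √2 Im θ¹)`. -/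
lemma absVol_eq (hp : p ∈ U) (v : Fin 3 → TangentSpace IH p) :
    S.absVol p v = |Matrix.det (Matrix.of fun i k => F.covec i p (v k))| := by
  obtain ⟨e, he, V, hV, hpV, hVe, h1, h2⟩ := S.exists_common F hp
  have hr := (F.restrict hV h1).rot_mul_conj ((S.frameAt p).restrict hV h2) he hVe hpV
  have hθ := (F.restrict hV h1).θ₁_rot ((S.frameAt p).restrict hV h2) he hVe hpV
  set c := (F.restrict hV h1).rot ((S.frameAt p).restrict hV h2) p
  have hθ' : ∀ w, F.θ₁ p w = c * (S.frameAt p).θ₁ p w := hθ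
  have hc : c.re * c.re + c.im * c.im = 1 := by
    have := congrArg Complex.re hr
    simpa using this
  have h2' : √2 * √2 = 2 := Real.mul_self_sqrt (by norm_num)
  have habs : ∀ d : ℝ, 2 * |d| = |2 * d| := fun d => by rw [abs_mul, abs_two]
  rw [absVol, habs]
  congr 1
  rw [Matrix.det_fin_three, Matrix.det_fin_three]
  simp only [UnitaryFrame.covec, Matrix.of_apply, Matrix.cons_val, LinearMap.smul_apply,
    LinearMap.comp_apply, Complex.reLm_coe, Complex.imLm_coe, ContinuousLinearMap.coe_coe, hθ',
    Complex.mul_re, Complex.mul_im, smul_eq_mul]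
  generalize S.θ p (v 0) = t0
  generalize S.θ p (v 1) = t1
  generalize S.θ p (v 2) = t2
  generalize (S.frameAt p).θ₁ p (v 0) = z0
  generalize (S.frameAt p).θ₁ p (v 1) = z1
  generalize (S.frameAt p).θ₁ p (v 2) = z2
  have key : ∀ E : ℝ, 2 * E = √2 * √2 * (c.re * c.re + c.im * c.im) * E := fun E => by
    rw [h2', hc]; ring
  rw [key]
  ring

end Pseudohermitian

/-! ### The volume measure -/

/-- The basis `∂_x, ∂_y, ∂_t` of `Heis`. -/
def heisBasis : Module.Basis (Fin 3) ℝ Heis :=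
  Module.Basis.ofEquivFun
    { toFun := fun v => ![v.1.re, v.1.im, v.2]
      map_add' := fun v w => by ext i; fin_cases i <;> simp
      map_smul' := fun c v => by ext i; fin_cases i <;> simp
      invFun := fun c => (⟨c 0, c 1⟩, c 2)
      left_inv := fun v => by ext <;> simp
      right_inv := fun c => by ext i; fin_cases i <;> simp }

lemma det3_eq_det (E : Fin 3 → Heis) : det3 (E 0) (E 1) (E 2) = heisBasis.det E := by
  rw [Module.Basis.det_apply, Matrix.det_fin_three]
  simp [Module.Basis.toMatrix_apply, heisBasis, det3]
  ring

lemma det3_map (A : Heis →L[ℝ] Heis) (u v w : Heis) :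
    det3 (A u) (A v) (A w) = A.det * det3 u v w := by
  have h1 := det3_eq_det ![u, v, w]
  have h2 := det3_eq_det (A ∘ ![u, v, w])
  have h3 := Module.Basis.det_comp heisBasis (A : Heis →ₗ[ℝ] Heis) ![u, v, w]
  simp only [Matrix.cons_val, Function.comp_apply] at h1 h2
  rw [h2, h1]
  exact h3

instance isAddHaarMeasure_volume_heis : (volume : Measure Heis).IsAddHaarMeasure :=
  inferInstanceAs ((volume : Measure ℂ).prod (volume : Measure ℝ)).IsAddHaarMeasure

namespace Pseudohermitian

variable {N : Type*} [TopologicalSpace N] [ChartedSpace Heis N] [IsManifold IH ∞ N]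
  (S : Pseudohermitian N) {U : Set N} (F : UnitaryFrame S.θ S.J U) {p : N} {x : Heis}
  {e e' : OpenPartialHomeomorph N Heis}

/-- The density of `θ ∧ dθ` in a chart, as a real function. -/
def density (e : OpenPartialHomeomorph N Heis) (x : Heis) : ℝ := (S.chartDensity e x).toReal

lemma ofReal_density : ENNReal.ofReal (S.density e x) = S.chartDensity e x :=
  ENNReal.ofReal_toReal (by simp [chartDensity])

lemma density_eq (he : e ∈ IsManifold.maximalAtlas IH ∞ N) (hx : x ∈ e.target)
    (hp : e.symm x ∈ U) :
    S.density e x = |det3 (push e F.T x) (push e F.e₁ x) (push e F.e₂ x)|⁻¹ := by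
  have h := det3_dual _ _ (F.covec_symm_push he hx hp)
  have h1 : S.density e x = |Matrix.det (Matrix.of fun i k =>
      (F.covec i (e.symm x) ∘ₗ (mfderiv IH IH e.symm x).toLinearMap)
        (![((1, 0) : Heis), (Complex.I, 0), (0, 1)] k))| := by
    rw [density, chartDensity, ENNReal.toReal_ofReal (by unfold absVol; positivity),
      S.absVol_eq F hp]
    congr 2
    ext i k
    fin_cases k <;> rfl
  rw [h1]
  refine eq_inv_of_mul_eq_one_left ?_
  rw [← abs_mul]
  exact (congrArg abs h).trans abs_one

lemma contDiffAt_density (he : e ∈ IsManifold.maximalAtlas IH ∞ N) (hx : x ∈ e.target) :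
    ContDiffAt ℝ ∞ (S.density e) x := by
  set F := S.frameAt (e.symm x)
  have hp : e.symm x ∈ (S.exists_frame (e.symm x)).choose :=
    (S.exists_frame (e.symm x)).choose_spec.1
  have hd := F.det3_push_ne_zero he hx hp
  have h := contDiffAt_det3 (contDiffAt_push he hx (F.fieldAt_T hp))
    (contDiffAt_push he hx (F.fieldAt_e₁ hp)) (contDiffAt_push he hx (F.fieldAt_e₂ hp))
  have h1 : ContDiffAt ℝ ∞ (fun y => |det3 (push e F.T y) (push e F.e₁ y) (push e F.e₂ y)|) x :=
    h.abs hd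
  have h2 := h1.inv (abs_ne_zero.2 hd)
  refine h2.congr_of_eventuallyEq ?_
  filter_upwards [e.open_target.mem_nhds hx,
    (e.continuousAt_symm hx).preimage_mem_nhds (F.isOpen.mem_nhds hp)] with y hy hyU
  exact S.density_eq F he hy hyU

lemma continuousOn_density (he : e ∈ IsManifold.maximalAtlas IH ∞ N) :
    ContinuousOn (S.density e) e.target := fun _ hx =>
  (S.contDiffAt_density he hx).continuousAt.continuousWithinAt

/-- The density transforms by the Jacobian determinant under a change of charts. -/
lemma chartDensity_transition (he : e ∈ IsManifold.maximalAtlas IH ∞ N)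
    (he' : e' ∈ IsManifold.maximalAtlas IH ∞ N) (hx : x ∈ e.target)
    (hx' : e.symm x ∈ e'.source) :
    S.density e x = |(fderiv ℝ (fun y => e' (e.symm y)) x).det| * S.density e' (e' (e.symm x)) := by
  set F := S.frameAt (e.symm x)
  have hp : e.symm x ∈ (S.exists_frame (e.symm x)).choose :=
    (S.exists_frame (e.symm x)).choose_spec.1
  have hp' : e'.symm (e' (e.symm x)) = e.symm x := e'.left_inv hx'
  have hA : ∀ v, fderiv ℝ (fun y => e' (e.symm y)) x v =
      mfderiv IH IH e' (e.symm x) (mfderiv IH IH e.symm x v) := fun v => by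
    have h := mfderiv_comp x ((mdifferentiable_of_mem_maximalAtlas he').mdifferentiableAt hx')
      ((mdifferentiable_of_mem_maximalAtlas he).mdifferentiableAt_symm hx)
    rw [← mfderiv_eq_fderiv]
    exact congrArg (fun L => L v) h
  have hpush : ∀ X : Π p : N, TangentSpace IH p, push e' X (e' (e.symm x)) =
      fderiv ℝ (fun y => e' (e.symm y)) x (push e X x) := fun X => by
    rw [hA, mfderiv_symm_push he X hx]
    unfold push
    rw [hp']
  rw [S.density_eq F he hx hp, S.density_eq F he' (e'.map_source hx') (by rwa [hp']), hpush, hpush,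
    hpush, det3_map, abs_mul, mul_inv, ← mul_assoc, mul_inv_cancel₀, one_mul]
  intro h0
  have := F.det3_push_ne_zero he' (e'.map_source hx') (by rwa [hp'])
  rw [hpush, hpush, hpush, det3_map, abs_eq_zero.1 h0, zero_mul] at this
  exact this rfl

variable [MeasurableSpace N] [BorelSpace N]

lemma aemeasurable_symm (S : Pseudohermitian N)
    (e : OpenPartialHomeomorph N Heis) :
    AEMeasurable e.symm (((MeasureTheory.volume : Measure Heis).restrict e.target).withDensity
        (S.chartDensity e)) :=
  (e.continuousOn_symm.aemeasurable e.open_target.measurableSet).mono_ac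
    (withDensity_absolutelyContinuous _ _)

lemma chartVolume_apply {A : Set N} (hA : MeasurableSet A) :
    S.chartVolume e A = ∫⁻ x in e.symm ⁻¹' A ∩ e.target, S.chartDensity e x := by
  rw [chartVolume, Measure.map_apply_of_aemeasurable (S.aemeasurable_symm e) hA,
    withDensity_apply', Measure.restrict_restrict' e.open_target.measurableSet]

lemma chartVolume_inter {A : Set N} (hA : MeasurableSet A) :
    S.chartVolume e (A ∩ e.source) = S.chartVolume e A := by
  rw [S.chartVolume_apply hA, S.chartVolume_apply (hA.inter e.open_source.measurableSet)]
  congr 2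
  ext x
  constructor
  · exact fun h => ⟨h.1.1, h.2⟩
  · exact fun h => ⟨⟨h.1, e.map_target h.2⟩, h.2⟩

lemma measurableSet_preimage_symm {A : Set N} (hA : MeasurableSet A) :
    MeasurableSet (e.symm ⁻¹' A ∩ e.target) := by
  have h := (continuousOn_iff_continuous_domRestrict.1 e.continuousOn_symm).measurable hA
  have h2 := (MeasurableEmbedding.subtype_coe e.open_target.measurableSet).measurableSet_image.2 h
  convert h2 using 1
  ext x
  simp

/-- Two charts give the same measure to a set contained in both domains. -/
lemma chartVolume_eq (he : e ∈ IsManifold.maximalAtlas IH ∞ N)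
    (he' : e' ∈ IsManifold.maximalAtlas IH ∞ N) {A : Set N} (hA : MeasurableSet A)
    (h1 : A ⊆ e.source) (h2 : A ⊆ e'.source) : S.chartVolume e A = S.chartVolume e' A := by
  rw [S.chartVolume_apply hA, S.chartVolume_apply hA]
  have himg : e'.symm ⁻¹' A ∩ e'.target =
      (fun y => e' (e.symm y)) '' (e.symm ⁻¹' A ∩ e.target) := by
    ext y
    constructor
    · rintro ⟨hy, hyt⟩
      refine ⟨e (e'.symm y), ⟨?_, e.map_source (h1 hy)⟩, ?_⟩
      · simpa [e.left_inv (h1 hy)] using hy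
      · simp [e.left_inv (h1 hy), e'.right_inv hyt]
    · rintro ⟨x, ⟨hx, hxt⟩, rfl⟩
      exact ⟨by simpa [e'.left_inv (h2 hx)] using hx, e'.map_source (h2 hx)⟩
  rw [himg, lintegral_image_eq_lintegral_abs_det_fderiv_mul (f := fun y => e' (e.symm y))
    (f' := fun x => fderiv ℝ (fun y => e' (e.symm y)) x) MeasureTheory.volume
    (measurableSet_preimage_symm (e := e) hA)]
  · refine setLIntegral_congr_fun (measurableSet_preimage_symm hA) fun x hx => ?_
    rw [← S.ofReal_density, ← S.ofReal_density, ← ENNReal.ofReal_mul (abs_nonneg _),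
      ← S.chartDensity_transition he he' hx.2 (h2 hx.1)]
  · intro x hx
    have hd : DifferentiableAt ℝ (fun y => e' (e.symm y)) x := by
      have h := ((mdifferentiable_of_mem_maximalAtlas he').mdifferentiableAt (h2 hx.1)).comp x
        ((mdifferentiable_of_mem_maximalAtlas he).mdifferentiableAt_symm hx.2)
      exact h.differentiableAt
    exact hd.hasFDerivAt.hasFDerivWithinAt
  · intro x hx y hy hxy
    have h3 := e'.injOn (h2 hx.1) (h2 hy.1) hxy
    exact e.symm.injOn hx.2 hy.2 h3

lemma chartVolume_le_volume (p : N) : S.chartVolume (chartAt Heis p) ≤ S.volume :=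
  le_iSup (fun p : N => S.chartVolume (chartAt Heis p)) p

lemma volume_le_chartVolume (he : e ∈ IsManifold.maximalAtlas IH ∞ N) {A : Set N}
    (h1 : A ⊆ e.source) : S.volume A ≤ S.chartVolume e A := by
  -- a measure that is infinite off the chart domain dominates every chart measure
  let ν : Measure N := S.chartVolume e + (⊤ : ℝ≥0∞) • (Measure.count.restrict e.sourceᶜ)
  have hν : S.volume ≤ ν := by
    refine iSup_le fun p => Measure.le_iff.2 fun B hB => ?_
    have hm := IsManifold.chart_mem_maximalAtlas (I := IH) (n := ∞) p
    by_cases hBs : B ⊆ e.source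
    · rw [← S.chartVolume_inter hB, S.chartVolume_eq hm he
        (hB.inter (chartAt Heis p).open_source.measurableSet) (fun _ h => h.2) fun _ h => hBs h.1]
      refine (measure_mono (fun _ h => h.1)).trans ?_
      exact Measure.le_add_right le_rfl B
    · have : ν B = ⊤ := by
        have h0 : Measure.count (B ∩ e.sourceᶜ) ≠ 0 := by
          obtain ⟨q, hq, hq'⟩ := Set.not_subset.1 hBs
          have hne : B ∩ e.sourceᶜ ≠ ∅ := Set.Nonempty.ne_empty ⟨q, hq, hq'⟩
          have hmeas : MeasurableSet (B ∩ e.sourceᶜ) := hB.inter e.open_source.measurableSet.compl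
          rw [Measure.count_apply hmeas]
          simpa using hne
        simp only [ν, Measure.add_apply, Measure.smul_apply, Measure.restrict_apply hB, smul_eq_mul,
          ENNReal.top_mul h0, add_top]
      rw [this]
      exact le_top
  refine (hν A).trans ?_
  have h0 : (Measure.count.restrict e.sourceᶜ) A = 0 := by
    rw [Measure.restrict_apply' e.open_source.measurableSet.compl,
      ← Set.sdiff_eq, Set.sdiff_eq_empty.2 h1, measure_empty]
  simp [ν, h0]

variable [SecondCountableTopology N]

/-- On a chart domain the glued measure is the measure of `θ ∧ dθ` in that chart. -/
theorem volume_restrict_source (he : e ∈ IsManifold.maximalAtlas IH ∞ N) :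
    S.volume.restrict e.source = S.chartVolume e := by
  obtain ⟨s, hs, hsU⟩ := TopologicalSpace.countable_cover_nhds
    fun p : N => (chartAt Heis p).open_source.mem_nhds (mem_chart_source Heis p)
  have : Countable s := hs.to_subtype
  rw [Set.biUnion_eq_iUnion] at hsU
  refine (Measure.ext_iff_of_iUnion_eq_univ hsU).2 fun p => Measure.ext fun A hA => ?_
  have hc : MeasurableSet (chartAt Heis (p : N)).source :=
      (chartAt Heis (p : N)).open_source.measurableSet
  have hm := IsManifold.chart_mem_maximalAtlas (I := IH) (n := ∞) (p : N)
  have hsrc := e.open_source.measurableSet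
  rw [Measure.restrict_apply hA, Measure.restrict_apply hA, Measure.restrict_apply (hA.inter hc),
    ← S.chartVolume_inter (hA.inter hc)]
  have hAm := (hA.inter hc).inter hsrc
  have hsub : A ∩ (chartAt Heis (p : N)).source ∩ e.source ⊆ (chartAt Heis (p : N)).source :=
    fun _ h => h.1.2
  -- it suffices to compare the measures on each of countably many chart domains
  refine le_antisymm (S.volume_le_chartVolume he fun _ h => h.2) ?_
  rw [S.chartVolume_eq he hm hAm (fun _ h => h.2) hsub]
  exact S.chartVolume_le_volume p _

end Pseudohermitian

/-! ### The divergence theorem -/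

lemma fderiv_det3 {u v w : Heis → Heis} {x : Heis} (hu : DifferentiableAt ℝ u x)
    (hv : DifferentiableAt ℝ v x) (hw : DifferentiableAt ℝ w x) (a : Heis) :
    fderiv ℝ (fun y => det3 (u y) (v y) (w y)) x a =
      det3 (fderiv ℝ u x a) (v x) (w x) + det3 (u x) (fderiv ℝ v x a) (w x) +
        det3 (u x) (v x) (fderiv ℝ w x a) := by
  have hre : ∀ {g : Heis → Heis}, DifferentiableAt ℝ g x → HasFDerivAt (fun y => (g y).1.re)
      (Complex.reCLM ∘L ContinuousLinearMap.fst ℝ ℂ ℝ ∘L fderiv ℝ g x) x := fun hg =>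
    ((Complex.reCLM ∘L ContinuousLinearMap.fst ℝ ℂ ℝ).hasFDerivAt).comp x hg.hasFDerivAt
  have him : ∀ {g : Heis → Heis}, DifferentiableAt ℝ g x → HasFDerivAt (fun y => (g y).1.im)
      (Complex.imCLM ∘L ContinuousLinearMap.fst ℝ ℂ ℝ ∘L fderiv ℝ g x) x := fun hg =>
    ((Complex.imCLM ∘L ContinuousLinearMap.fst ℝ ℂ ℝ).hasFDerivAt).comp x hg.hasFDerivAt
  have ht : ∀ {g : Heis → Heis}, DifferentiableAt ℝ g x → HasFDerivAt (fun y => (g y).2)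
      (ContinuousLinearMap.snd ℝ ℂ ℝ ∘L fderiv ℝ g x) x := fun hg =>
    ((ContinuousLinearMap.snd ℝ ℂ ℝ).hasFDerivAt).comp x hg.hasFDerivAt
  have h := (((hre hu).mul (((him hv).mul (ht hw)).sub ((ht hv).mul (him hw)))).sub
    ((him hu).mul (((hre hv).mul (ht hw)).sub ((ht hv).mul (hre hw))))).add
    ((ht hu).mul (((hre hv).mul (him hw)).sub ((him hv).mul (hre hw))))
  refine (congrArg (fun L => L a) h.fderiv).trans ?_
  simp [det3]
  ring

/-- The trace of an endomorphism of `Heis`. -/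
def trace3 (A : Heis →L[ℝ] Heis) : ℝ :=
  (A (1, 0)).1.re + (A (Complex.I, 0)).1.im + (A (0, 1)).2

/-- The derivative of the determinant is the trace. -/
lemma det3_trace (A : Heis →L[ℝ] Heis) (u v w : Heis) :
    det3 (A u) v w + det3 u (A v) w + det3 u v (A w) = trace3 A * det3 u v w := by
  have hA : ∀ v : Heis, A v = v.1.re • A (1, 0) + v.1.im • A (Complex.I, 0) + v.2 • A (0, 1) := by
    intro v
    have hE : v = v.1.re • ((1, 0) : Heis) + v.1.im • ((Complex.I, 0) : Heis)
        + v.2 • ((0, 1) : Heis) := by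
      ext <;> simp
    conv_lhs => rw [hE]
    rw [map_add, map_add, map_smul, map_smul, map_smul]
  rw [hA u, hA v, hA w, trace3]
  simp only [det3, Prod.fst_add, Prod.snd_add, Prod.smul_fst, Prod.smul_snd,
    Complex.add_re, Complex.add_im, Complex.real_smul, Complex.re_ofReal_mul,
    Complex.im_ofReal_mul, smul_eq_mul]
  ring

lemma integral_fderiv_eq_zero {ψ : Heis → ℂ} (hψ : ContDiff ℝ 1 ψ) (hc : HasCompactSupport ψ)
    (v : Heis) : ∫ x, fderiv ℝ ψ x v = 0 := by
  have h1 : Integrable (fun x => fderiv ℝ ψ x v) :=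
    ((hψ.continuous_fderiv (by simp)).clm_apply continuous_const).integrable_of_hasCompactSupport
      (hc.fderiv_apply (𝕜 := ℝ) v)
  have h := integral_mul_fderiv_eq_neg_fderiv_mul_of_integrable (𝕜 := ℂ)
      (μ := (volume : Measure Heis))
    (f := fun _ => (1 : ℂ)) (g := ψ) (v := v) (by simp) (by simpa using h1)
    (by simpa using hψ.continuous.integrable_of_hasCompactSupport hc) (fun x _ => by fun_prop)
    (fun x _ => (hψ.differentiable (by simp)) x)
  simpa using h

namespace UnitaryFrame

variable {N : Type*} [TopologicalSpace N] [ChartedSpace Heis N] [IsManifold IH ∞ N]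
  {θ : Π p : N, TangentSpace IH p →L[ℝ] ℝ}
  {J : Π p : N, TangentSpace IH p →ₗ[ℝ] TangentSpace IH p} {U : Set N}
  (F : UnitaryFrame θ J U) {p : N}
  {e : OpenPartialHomeomorph N Heis} {x : Heis}

lemma fieldAt_vec (hp : p ∈ U) (j : Fin 3) : FieldAt (F.vec j) p := by
  fin_cases j
  exacts [F.fieldAt_T hp, F.fieldAt_e₁ hp, F.fieldAt_e₂ hp]

/-- The divergence of a vector field in terms of its brackets with the frame, up to sign. -/
def bracketTrace (X : Π p : N, TangentSpace IH p) (p : N) : ℝ :=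
  ∑ j, F.covec j p (VectorField.mlieBracket IH X (F.vec j) p)

lemma fderiv_det3_push (he : e ∈ IsManifold.maximalAtlas IH ∞ N) (hx : x ∈ e.target)
    (hp : e.symm x ∈ U) {X : Π p : N, TangentSpace IH p} (hX : FieldAt X (e.symm x)) :
    fderiv ℝ (fun y => det3 (push e F.T y) (push e F.e₁ y) (push e F.e₂ y)) x (push e X x) =
      (trace3 (fderiv ℝ (push e X) x) + F.bracketTrace X (e.symm x)) *
        det3 (push e F.T x) (push e F.e₁ x) (push e F.e₂ x) := by
  have hd : ∀ j, DifferentiableAt ℝ (push e (F.vec j)) x := fun j =>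
    (contDiffAt_push he hx (F.fieldAt_vec hp j)).differentiableAt (by simp)
  have key : ∀ j, fderiv ℝ (push e (F.vec j)) x (push e X x) =
      fderiv ℝ (push e X) x (push e (F.vec j) x) +
      push e (VectorField.mlieBracket IH X (F.vec j)) x := fun j => by
    rw [push_mlieBracket he hx hX (F.fieldAt_vec hp j), VectorField.lieBracket]
    abel
  have hs := fun j => det3_smul_eq (fun j => push e (F.vec j) x) _ _
    (F.push_eq_sum hp (VectorField.mlieBracket IH X (F.vec j)))
  have h0 := (hs 0).1
  have h1 := (hs 1).2.1
  have h2 := (hs 2).2.2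
  have ht := det3_trace (fderiv ℝ (push e X) x) (push e (F.vec 0) x) (push e (F.vec 1) x)
    (push e (F.vec 2) x)
  have hf := fderiv_det3 (hd 0) (hd 1) (hd 2) (push e X x)
  rw [key, key, key] at hf
  have hadd : ∀ a b v w : Heis, det3 (a + b) v w = det3 a v w + det3 b v w ∧
      det3 v (a + b) w = det3 v a w + det3 v b w ∧ det3 v w (a + b) = det3 v w a + det3 v w b := by
    intro a b v w
    simp only [det3, Prod.fst_add, Prod.snd_add, Complex.add_re, Complex.add_im]
    refine ⟨?_, ?_, ?_⟩ <;> ring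
  rw [(hadd _ _ _ _).1, (hadd _ _ _ _).2.1, (hadd _ _ _ _).2.2, h0, h1, h2] at hf
  refine hf.trans ?_
  rw [bracketTrace, Fin.sum_univ_three, add_mul]
  change _ = trace3 _ * det3 (push e (F.vec 0) x) (push e (F.vec 1) x) (push e (F.vec 2) x) +
    _ * det3 (push e (F.vec 0) x) (push e (F.vec 1) x) (push e (F.vec 2) x)
  rw [← ht]
  ring

end UnitaryFrame

namespace Pseudohermitian

variable {N : Type*} [TopologicalSpace N] [ChartedSpace Heis N] [IsManifold IH ∞ N]
  (S : Pseudohermitian N) {U : Set N} (F : UnitaryFrame S.θ S.J U) {p : N} {x : Heis}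
  {e : OpenPartialHomeomorph N Heis}

/-- In coordinates, `div (density · X)` is `-bracketTrace X · density`: the frame has constant volume
for `θ ∧ dθ`, so that only its brackets with `X` contribute. -/
lemma fderiv_density (he : e ∈ IsManifold.maximalAtlas IH ∞ N) (hx : x ∈ e.target)
    (hp : e.symm x ∈ U) {X : Π p : N, TangentSpace IH p} (hX : FieldAt X (e.symm x)) :
    fderiv ℝ (S.density e) x (push e X x) =
      -(trace3 (fderiv ℝ (push e X) x) + F.bracketTrace X (e.symm x)) * S.density e x := by
  have hd := F.det3_push_ne_zero he hx hp
  have h := contDiffAt_det3 (contDiffAt_push he hx (F.fieldAt_T hp))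
    (contDiffAt_push he hx (F.fieldAt_e₁ hp)) (contDiffAt_push he hx (F.fieldAt_e₂ hp))
  have hdiff := h.differentiableAt (by simp)
  have hdens := (S.contDiffAt_density he hx).differentiableAt (by simp)
  have hk := F.fderiv_det3_push he hx hp hX
  have hU : ∀ᶠ y in 𝓝 x, y ∈ e.target ∧ e.symm y ∈ U := by
    filter_upwards [e.open_target.mem_nhds hx,
      (e.continuousAt_symm hx).preimage_mem_nhds (F.isOpen.mem_nhds hp)] with y hy hyU
    exact ⟨hy, hyU⟩
  set d := fun y => det3 (push e F.T y) (push e F.e₁ y) (push e F.e₂ y) with hdd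
  -- near `x` the product of the density and the determinant is the constant sign `s`
  have hsign : ∃ s : ℝ, ∀ᶠ y in 𝓝 x, S.density e y * d y = s := by
    rcases lt_or_gt_of_ne hd with hneg | hpos
    · refine ⟨-1, ?_⟩
      filter_upwards [hU, h.continuousAt.eventually_lt continuousAt_const hneg] with y hy hy'
      rw [S.density_eq F he hy.1 hy.2, abs_of_neg hy']
      have := hy'.ne
      change (-d y)⁻¹ * d y = -1
      field_simp [show d y ≠ 0 from this]
    · refine ⟨1, ?_⟩
      filter_upwards [hU, continuousAt_const.eventually_lt h.continuousAt hpos] with y hy hy'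
      rw [S.density_eq F he hy.1 hy.2, abs_of_pos hy']
      exact inv_mul_cancel₀ hy'.ne'
  obtain ⟨s, hs⟩ := hsign
  have hf : fderiv ℝ (fun y => S.density e y * d y) x = 0 := by
    rw [EventuallyEq.fderiv_eq (f₁ := fun y => S.density e y * d y) (f := fun _ => s) hs]
    simp
  have hm := congrArg (fun L => L (push e X x)) (fderiv_mul (𝕜 := ℝ) hdens hdiff)
  rw [show (fun y => S.density e y * d y) = S.density e * d from rfl] at hf
  rw [hf] at hm
  simp only [_root_.zero_apply, _root_.add_apply,
    _root_.smul_apply, smul_eq_mul] at hm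
  apply mul_right_cancel₀ (show d x ≠ 0 from hd)
  rw [hk] at hm
  linear_combination -hm

end Pseudohermitian

/-! ### Integration on the manifold -/

namespace Pseudohermitian

variable {N : Type*} [TopologicalSpace N] [ChartedSpace Heis N] [IsManifold IH ∞ N]
  [MeasurableSpace N] [BorelSpace N] [SecondCountableTopology N]
  (S : Pseudohermitian N) {U : Set N} (F : UnitaryFrame S.θ S.J U)
  {e : OpenPartialHomeomorph N Heis}

lemma aemeasurable_chartDensity (he : e ∈ IsManifold.maximalAtlas IH ∞ N) :
    AEMeasurable (S.chartDensity e) ((MeasureTheory.volume : Measure Heis).restrict e.target) := by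
  have h := ((S.continuousOn_density he).aemeasurable e.open_target.measurableSet
    (μ := (MeasureTheory.volume : Measure Heis))).ennreal_ofReal
  exact h.congr (Eventually.of_forall fun x => S.ofReal_density)

lemma ae_chartDensity_lt_top :
    ∀ᵐ x ∂((MeasureTheory.volume : Measure Heis).restrict e.target), S.chartDensity e x < ⊤ :=
  Eventually.of_forall fun x => by rw [← S.ofReal_density]; exact ENNReal.ofReal_lt_top

lemma integrableOn_source_iff (he : e ∈ IsManifold.maximalAtlas IH ∞ N) {E : Type*}
    [NormedAddCommGroup E] [NormedSpace ℝ E] {g : N → E}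
    (hg : AEStronglyMeasurable g (S.volume.restrict e.source)) :
    IntegrableOn g e.source S.volume ↔
      IntegrableOn (fun x => S.density e x • g (e.symm x)) e.target := by
  rw [IntegrableOn, IntegrableOn]
  rw [S.volume_restrict_source he] at hg ⊢
  unfold chartVolume at hg ⊢
  rw [integrable_map_measure hg (S.aemeasurable_symm e),
    integrable_withDensity_iff_integrable_smul₀' (S.aemeasurable_chartDensity he)
      S.ae_chartDensity_lt_top]
  rfl

lemma integral_source (he : e ∈ IsManifold.maximalAtlas IH ∞ N) {E : Type*}
    [NormedAddCommGroup E] [NormedSpace ℝ E] {g : N → E}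
    (hg : AEStronglyMeasurable g (S.volume.restrict e.source)) :
    ∫ p in e.source, g p ∂S.volume = ∫ x in e.target, S.density e x • g (e.symm x) := by
  rw [S.volume_restrict_source he] at hg ⊢
  unfold chartVolume at hg ⊢
  rw [integral_map (S.aemeasurable_symm e) hg,
    integral_withDensity_eq_integral_toReal_smul₀ (S.aemeasurable_chartDensity he)
      S.ae_chartDensity_lt_top]
  rfl

lemma integrableOn_iff (he : e ∈ IsManifold.maximalAtlas IH ∞ N) {E : Type*}
    [NormedAddCommGroup E] [NormedSpace ℝ E] {g : N → E} (hg : AEStronglyMeasurable g S.volume)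
    {B : Set N} (hB : MeasurableSet B) (hBe : B ⊆ e.source) :
    IntegrableOn g B S.volume ↔
      IntegrableOn (fun x => S.density e x • g (e.symm x)) (e.symm ⁻¹' B ∩ e.target) := by
  have h := S.integrableOn_source_iff he (g := B.indicator g) (hg.indicator hB).restrict
  rw [IntegrableOn, integrable_indicator_iff hB, IntegrableOn,
    Measure.restrict_restrict_of_subset hBe] at h
  rw [IntegrableOn, h]
  have hm := measurableSet_preimage_symm (e := e) hB
  have h2 : IntegrableOn (fun x => S.density e x • g (e.symm x)) (e.symm ⁻¹' B ∩ e.target) ↔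
      IntegrableOn ((e.symm ⁻¹' B ∩ e.target).indicator
        fun x => S.density e x • g (e.symm x)) e.target := by
    rw [IntegrableOn, IntegrableOn, integrable_indicator_iff hm, IntegrableOn,
      Measure.restrict_restrict_of_subset Set.inter_subset_right]
  rw [h2]
  refine integrableOn_congr_fun (fun x hx => ?_) e.open_target.measurableSet
  by_cases hxB : e.symm x ∈ B
  · simp [Set.indicator, hxB, hx]
  · simp [Set.indicator, hxB]

lemma setIntegral_eq (he : e ∈ IsManifold.maximalAtlas IH ∞ N) {E : Type*}
    [NormedAddCommGroup E] [NormedSpace ℝ E] {g : N → E} (hg : AEStronglyMeasurable g S.volume)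
    {B : Set N} (hB : MeasurableSet B) (hBe : B ⊆ e.source) :
    ∫ p in B, g p ∂S.volume =
      ∫ x in e.symm ⁻¹' B ∩ e.target, S.density e x • g (e.symm x) := by
  have h := S.integral_source he (g := B.indicator g) (hg.indicator hB).restrict
  rw [setIntegral_indicator hB, Set.inter_eq_self_of_subset_right hBe] at h
  rw [h]
  have hm := measurableSet_preimage_symm (e := e) hB
  rw [← Set.inter_eq_self_of_subset_right (Set.inter_subset_right : e.symm ⁻¹' B ∩ e.target ⊆ _),
    ← setIntegral_indicator hm]
  refine setIntegral_congr_fun e.open_target.measurableSet fun x hx => ?_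
  by_cases hxB : e.symm x ∈ B
  · simp [Set.indicator, hxB, hx]
  · simp [Set.indicator, hxB]

instance isFiniteMeasureOnCompacts_volume [T2Space N] : IsFiniteMeasureOnCompacts S.volume := by
  have : IsLocallyFiniteMeasure S.volume := by
    refine ⟨fun p => ?_⟩
    set e := chartAt Heis p
    have he : e ∈ IsManifold.maximalAtlas IH ∞ N := IsManifold.chart_mem_maximalAtlas p
    obtain ⟨r, hr, hball⟩ := Metric.nhds_basis_closedBall.mem_iff.1
      (e.open_target.mem_nhds (e.map_source (mem_chart_source Heis p)))
    have hK : IsCompact (Metric.closedBall (e p) r) := isCompact_closedBall _ _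
    have hopen : IsOpen (e.source ∩ e ⁻¹' Metric.ball (e p) r) :=
      e.isOpen_inter_preimage Metric.isOpen_ball
    refine ⟨e.source ∩ e ⁻¹' Metric.ball (e p) r, hopen.mem_nhds
      ⟨mem_chart_source Heis p, Metric.mem_ball_self hr⟩, ?_⟩
    rw [← Set.inter_eq_self_of_subset_left
        (Set.inter_subset_left : e.source ∩ e ⁻¹' Metric.ball (e p) r ⊆ e.source),
      ← Measure.restrict_apply hopen.measurableSet, S.volume_restrict_source he,
      S.chartVolume_apply hopen.measurableSet]
    have hsub : e.symm ⁻¹' (e.source ∩ e ⁻¹' Metric.ball (e p) r) ∩ e.target ⊆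
        Metric.closedBall (e p) r := by
      rintro x ⟨⟨_, hx⟩, hxt⟩
      rw [Set.mem_preimage, e.right_inv hxt] at hx
      exact Metric.ball_subset_closedBall hx
    refine (lintegral_mono_set hsub).trans_lt ?_
    have hint : IntegrableOn (S.density e) (Metric.closedBall (e p) r) :=
      ((S.continuousOn_density he).mono hball).integrableOn_compact hK
    have h := hint.lintegral_lt_top
    simpa only [S.ofReal_density] using h
  infer_instance

end Pseudohermitian

/-! ### The divergence theorem on the manifold -/

namespace Pseudohermitian

variable {N : Type*} [TopologicalSpace N] [ChartedSpace Heis N] [IsManifold IH ∞ N]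
  [MeasurableSpace N] [BorelSpace N] [SecondCountableTopology N] [T2Space N]
  (S : Pseudohermitian N) {U : Set N} (F : UnitaryFrame S.θ S.J U)
  {e : OpenPartialHomeomorph N Heis} {ψ : N → ℂ}

/-- The divergence theorem for `ψ X`, with `ψ` supported in a coordinate domain with a frame. -/
lemma integral_dirDeriv_sub (he : e ∈ IsManifold.maximalAtlas IH ∞ N)
    (hψ : ∀ q, SmoothAt ψ q) (hc : HasCompactSupport ψ) (hsupp : tsupport ψ ⊆ U ∩ e.source)
    {X : Π p : N, TangentSpace IH p} (hX : ∀ q ∈ U, FieldAt X q)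
    (hg : AEStronglyMeasurable
      (fun q => dirDeriv ψ q (X q) - F.bracketTrace X q * ψ q) S.volume) :
    ∫ q, (dirDeriv ψ q (X q) - F.bracketTrace X q * ψ q) ∂S.volume = 0 := by
  set K : Set Heis := e '' tsupport ψ with hKdef
  have hK : IsCompact K := hc.image_of_continuousOn
    (e.continuousOn.mono fun _ h => (hsupp h).2)
  have hKt : K ⊆ e.target := by
    rintro _ ⟨q, hq, rfl⟩
    exact e.map_source (hsupp hq).2
  have hKU : ∀ x ∈ K, e.symm x ∈ U := by
    rintro _ ⟨q, hq, rfl⟩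
    rw [e.left_inv (hsupp hq).2]
    exact (hsupp hq).1
  have hKψ : ∀ x ∈ e.target, x ∉ K → e.symm x ∉ tsupport ψ := fun x hx hxK h =>
    hxK ⟨e.symm x, h, e.right_inv hx⟩
  -- the density times `ψ`, in coordinates
  set G : Heis → ℂ := e.target.indicator fun x => (S.density e x : ℂ) * ψ (e.symm x) with hG
  have hG0 : ∀ x ∉ K, G x = 0 := fun x hx => by
    by_cases hxt : x ∈ e.target
    · rw [hG, Set.indicator_of_mem hxt, image_eq_zero_of_notMem_tsupport (hKψ x hxt hx), mul_zero]
    · rw [hG, Set.indicator_of_notMem hxt]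
  have hGeq : ∀ x ∈ e.target, G =ᶠ[𝓝 x] fun x => (S.density e x : ℂ) * ψ (e.symm x) :=
    fun x hx => by
      filter_upwards [e.open_target.mem_nhds hx] with y hy
      rw [hG, Set.indicator_of_mem hy]
  have hdens : ∀ x ∈ e.target, ContDiffAt ℝ ∞ (fun x => (S.density e x : ℂ)) x := fun x hx =>
    Complex.ofRealCLM.contDiff.contDiffAt.comp x (S.contDiffAt_density he hx)
  have hψe : ∀ x ∈ e.target, ContDiffAt ℝ ∞ (fun x => ψ (e.symm x)) x := fun x hx =>
    (smoothAt_symm_iff he hx).1 (hψ _)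
  have hGs : ∀ x ∈ e.target, ContDiffAt ℝ ∞ G x := fun x hx =>
    ((hdens x hx).mul (hψe x hx)).congr_of_eventuallyEq (hGeq x hx)
  have hW : ∀ ℓ : Heis →L[ℝ] ℝ, ContDiff ℝ ∞ (fun x => (ℓ (push e X x) : ℂ) * G x) ∧
      HasCompactSupport (fun x => (ℓ (push e X x) : ℂ) * G x) := fun ℓ => by
    refine ⟨contDiff_iff_contDiffAt.2 fun x => ?_, HasCompactSupport.intro hK fun x hx => by
      rw [hG0 x hx, mul_zero]⟩
    by_cases hx : x ∈ K
    · refine ContDiffAt.mul ?_ (hGs x (hKt hx))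
      exact (Complex.ofRealCLM.contDiff.comp ℓ.contDiff).contDiffAt.comp x
        (contDiffAt_push he (hKt hx) (hX _ (hKU x hx)))
    · refine (contDiffAt_const (c := (0 : ℂ))).congr_of_eventuallyEq ?_
      filter_upwards [hK.isClosed.isOpen_compl.mem_nhds hx] with y hy
      rw [hG0 y hy, mul_zero]
  let ℓ₀ : Heis →L[ℝ] ℝ := Complex.reCLM ∘L ContinuousLinearMap.fst ℝ ℂ ℝ
  let ℓ₁ : Heis →L[ℝ] ℝ := Complex.imCLM ∘L ContinuousLinearMap.fst ℝ ℂ ℝ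
  let ℓ₂ : Heis →L[ℝ] ℝ := ContinuousLinearMap.snd ℝ ℂ ℝ
  have hle : (1 : ℕ∞ω) ≤ (∞ : ℕ∞ω) := by simp
  have hint : ∀ (ℓ : Heis →L[ℝ] ℝ) (v : Heis),
      Integrable (fun x => fderiv ℝ (fun x => (ℓ (push e X x) : ℂ) * G x) x v) := fun ℓ v =>
    (((hW ℓ).1.continuous_fderiv (by simp)).clm_apply
      continuous_const).integrable_of_hasCompactSupport
      ((hW ℓ).2.fderiv_apply (𝕜 := ℝ) v)
  have h0 := integral_fderiv_eq_zero ((hW ℓ₀).1.of_le hle) (hW ℓ₀).2 (1, 0)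
  have h1 := integral_fderiv_eq_zero ((hW ℓ₁).1.of_le hle) (hW ℓ₁).2 (Complex.I, 0)
  have h2 := integral_fderiv_eq_zero ((hW ℓ₂).1.of_le hle) (hW ℓ₂).2 (0, 1)
  -- the divergence of `G X` in coordinates integrates to zero, component by component
  have hsum := integral_add ((hint ℓ₀ (1, 0)).add (hint ℓ₁ (Complex.I, 0))) (hint ℓ₂ (0, 1))
  have hsum' := integral_add (hint ℓ₀ (1, 0)) (hint ℓ₁ (Complex.I, 0))
  simp only [Pi.add_apply] at hsum
  rw [hsum', h0, h1, h2, add_zero, add_zero] at hsum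
  have hz : ∀ q ∉ tsupport ψ, dirDeriv ψ q (X q) - F.bracketTrace X q * ψ q = 0 := fun q hq => by
    rw [image_eq_zero_of_notMem_tsupport hq, dirDeriv_congr (g := fun _ => 0) (X q)
      (notMem_tsupport_iff_eventuallyEq.1 hq), dirDeriv_const]
    simp
  rw [← setIntegral_eq_integral_of_forall_compl_eq_zero (s := e.source)
    (fun q hq => hz q fun h => hq (hsupp h).2), S.integral_source he hg.restrict]
  rw [← setIntegral_eq_integral_of_forall_compl_eq_zero (s := e.target)] at hsum
  · rw [← hsum]
    refine setIntegral_congr_fun e.open_target.measurableSet fun x hx => ?_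
    by_cases hxK : x ∈ K
    · have hdG := (hGs x hx).differentiableAt (by simp)
      have hdX := (contDiffAt_push he hx (hX _ (hKU x hxK))).differentiableAt (by simp)
      have hfW : ∀ (ℓ : Heis →L[ℝ] ℝ) (v : Heis),
          fderiv ℝ (fun x => (ℓ (push e X x) : ℂ) * G x) x v =
          (ℓ (fderiv ℝ (push e X) x v) : ℂ) * G x + ((ℓ (push e X x) : ℝ) : ℂ) * fderiv ℝ G x v :=
          fun ℓ v => by
        have h1 : HasFDerivAt (fun x => ((ℓ (push e X x) : ℝ) : ℂ))
            (Complex.ofRealCLM ∘L ℓ ∘L fderiv ℝ (push e X) x) x :=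
          ((Complex.ofRealCLM ∘L ℓ).hasFDerivAt).comp x hdX.hasFDerivAt
        refine (congrArg (fun L => L v) (h1.mul hdG.hasFDerivAt).fderiv).trans ?_
        simp
        ring
      have hGsum : ((ℓ₀ (push e X x) : ℝ) : ℂ) * fderiv ℝ G x (1, 0) +
          ((ℓ₁ (push e X x) : ℝ) : ℂ) * fderiv ℝ G x (Complex.I, 0) +
          ((ℓ₂ (push e X x) : ℝ) : ℂ) * fderiv ℝ G x (0, 1) = fderiv ℝ G x (push e X x) := by
        have hE : push e X x = (push e X x).1.re • ((1, 0) : Heis)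
            + (push e X x).1.im • ((Complex.I, 0) : Heis) + (push e X x).2 • ((0, 1) : Heis) := by
          ext <;> simp
        conv_rhs => rw [hE]
        rw [map_add, map_add, map_smul, map_smul, map_smul]
        simp [ℓ₀, ℓ₁, ℓ₂]
      have hfG : fderiv ℝ G x (push e X x) =
          ((fderiv ℝ (S.density e) x (push e X x) : ℝ) : ℂ) * ψ (e.symm x) +
          (S.density e x : ℂ) * dirDeriv ψ (e.symm x) (X (e.symm x)) := by
        have h1 : HasFDerivAt (fun x => ((S.density e x : ℝ) : ℂ))
            (Complex.ofRealCLM ∘L fderiv ℝ (S.density e) x) x :=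
          (Complex.ofRealCLM.hasFDerivAt).comp x
            ((S.contDiffAt_density he hx).differentiableAt (by simp)).hasFDerivAt
        have h2 := ((hψe x hx).differentiableAt (by simp)).hasFDerivAt
        rw [dirDeriv_symm he hx (hψ _) X, (hGeq x hx).fderiv_eq]
        refine (congrArg (fun L => L (push e X x)) (h1.mul h2).fderiv).trans ?_
        simp
        ring
      have hGx : G x = (S.density e x : ℂ) * ψ (e.symm x) := (hGeq x hx).self_of_nhds
      have hd := S.fderiv_density F he hx (hKU x hxK) (hX _ (hKU x hxK))
      change _ = _
      rw [hfW, hfW, hfW]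
      have htr : ((ℓ₀ (fderiv ℝ (push e X) x (1, 0)) : ℝ) : ℂ) +
          ((ℓ₁ (fderiv ℝ (push e X) x (Complex.I, 0)) : ℝ) : ℂ) +
          ((ℓ₂ (fderiv ℝ (push e X) x (0, 1)) : ℝ) : ℂ) = (trace3 (fderiv ℝ (push e X) x) : ℝ) := by
        simp [trace3, ℓ₀, ℓ₁, ℓ₂]
      rw [hd] at hfG
      rw [Complex.real_smul]
      rw [hfG] at hGsum
      push_cast at hGsum
      linear_combination -hGsum - G x * htr - (trace3 (fderiv ℝ (push e X) x) : ℂ) * hGx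
    · have h0 := hz _ (hKψ x hx hxK)
      change S.density e x • (_ : ℂ) = _
      rw [h0, smul_zero]
      have hz : ∀ (ℓ : Heis →L[ℝ] ℝ) (v : Heis),
          fderiv ℝ (fun x => (ℓ (push e X x) : ℂ) * G x) x v = 0 := fun ℓ v => by
        have : (fun x => (ℓ (push e X x) : ℂ) * G x) =ᶠ[𝓝 x] fun _ => 0 := by
          filter_upwards [hK.isClosed.isOpen_compl.mem_nhds hxK] with y hy
          rw [hG0 y hy, mul_zero]
        rw [this.fderiv_eq]
        simp
      rw [hz, hz, hz]
      simp
  · intro x hx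
    have hz : ∀ (ℓ : Heis →L[ℝ] ℝ) (v : Heis),
        fderiv ℝ (fun x => (ℓ (push e X x) : ℂ) * G x) x v = 0 := fun ℓ v => by
      have : (fun x => (ℓ (push e X x) : ℂ) * G x) =ᶠ[𝓝 x] fun _ => 0 := by
        filter_upwards [hK.isClosed.isOpen_compl.mem_nhds fun h => hx (hKt h)] with y hy
        rw [hG0 y hy, mul_zero]
      rw [this.fderiv_eq]
      simp
    rw [hz, hz, hz]
    simp

end Pseudohermitian

namespace Pseudohermitian

variable {N : Type*} [TopologicalSpace N] [ChartedSpace Heis N] [IsManifold IH ∞ N]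
  [MeasurableSpace N] [BorelSpace N] [SecondCountableTopology N] [T2Space N]
  (S : Pseudohermitian N) {U : Set N} (F : UnitaryFrame S.θ S.J U)
  {e : OpenPartialHomeomorph N Heis} {ψ : N → ℂ}

/-- The divergence of `e₁` is a component of the connection form, without contribution from the
torsion. -/
lemma bracketTrace_e₁ {q : N} (hq : q ∈ U) : F.bracketTrace F.e₁ q = √2 * (F.ωZ₁bar q).re := by
  have h0 : F.covec 0 q (VectorField.mlieBracket IH F.e₁ F.T q) = 0 := by
    rw [VectorField.mlieBracket_swap, Pi.neg_apply, map_neg, neg_eq_zero]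
    exact F.bracket_T_e₁ q hq
  have h1 : F.covec 1 q (VectorField.mlieBracket IH F.e₁ F.e₁ q) = 0 := by
    rw [VectorField.mlieBracket_self]
    exact map_zero _
  have h2 : F.covec 2 q (VectorField.mlieBracket IH F.e₁ F.e₂ q) = √2 * (F.ωZ₁bar q).re := by
    rw [UnitaryFrame.ωZ₁bar, UnitaryFrame.θ₁BracketZ₁Z₁bar]
    change √2 * (F.θ₁ q (VectorField.mlieBracket IH F.e₁ F.e₂ q)).im = _
    simp
  rw [UnitaryFrame.bracketTrace, Fin.sum_univ_three]
  exact (congrArg₂ _ (congrArg₂ _ h0 h1) h2).trans (by simp)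

lemma bracketTrace_e₂ {q : N} (hq : q ∈ U) : F.bracketTrace F.e₂ q = √2 * (F.ωZ₁bar q).im := by
  have h0 : F.covec 0 q (VectorField.mlieBracket IH F.e₂ F.T q) = 0 := by
    rw [VectorField.mlieBracket_swap, Pi.neg_apply, map_neg, neg_eq_zero]
    exact F.bracket_T_e₂ q hq
  have h1 : F.covec 2 q (VectorField.mlieBracket IH F.e₂ F.e₂ q) = 0 := by
    rw [VectorField.mlieBracket_self]
    exact map_zero _
  have h2 : F.covec 1 q (VectorField.mlieBracket IH F.e₂ F.e₁ q) = √2 * (F.ωZ₁bar q).im := by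
    rw [UnitaryFrame.ωZ₁bar, UnitaryFrame.θ₁BracketZ₁Z₁bar, VectorField.mlieBracket_swap,
      Pi.neg_apply, map_neg]
    change -(√2 * (F.θ₁ q (VectorField.mlieBracket IH F.e₁ F.e₂ q)).re) = _
    simp
  rw [UnitaryFrame.bracketTrace, Fin.sum_univ_three]
  exact (congrArg₂ _ (congrArg₂ _ h0 h2) h1).trans (by simp)

/-- A function which is continuous on a neighbourhood of its support is continuous. -/
lemma continuous_of_tsupport {K : Set N} (hK : IsClosed K) {g : N → ℂ}
    (h0 : ∀ q ∉ K, g q = 0) (h : ∀ q ∈ K, ContinuousAt g q) : Continuous g :=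
  continuous_iff_continuousAt.2 fun q => by
    by_cases hq : q ∈ K
    · exact h q hq
    · refine (continuousAt_const (y := (0 : ℂ))).congr ?_
      filter_upwards [hK.isOpen_compl.mem_nhds hq] with y hy
      exact (h0 y hy).symm

/-- The divergences of `ψ Z_1̄` and `ψ Z₁` integrate to zero. -/
lemma integral_D₁bar_sub (he : e ∈ IsManifold.maximalAtlas IH ∞ N)
    (hψ : ∀ q, SmoothAt ψ q) (hc : HasCompactSupport ψ) (hsupp : tsupport ψ ⊆ U ∩ e.source) :
    ∫ q, (F.D₁bar ψ q - F.ωZ₁bar q * ψ q) ∂S.volume = 0 ∧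
      ∫ q, (F.D₁ ψ q + F.ωZ₁ q * ψ q) ∂S.volume = 0 := by
  have hz : ∀ (X : Π p : N, TangentSpace IH p), ∀ q ∉ tsupport ψ,
      dirDeriv ψ q (X q) - F.bracketTrace X q * ψ q = 0 := fun X q hq => by
    rw [image_eq_zero_of_notMem_tsupport hq, dirDeriv_congr (g := fun _ => 0) (X q)
      (notMem_tsupport_iff_eventuallyEq.1 hq), dirDeriv_const]
    simp
  have hcont : ∀ (X : Π p : N, TangentSpace IH p), (∀ q ∈ U, FieldAt X q) →
      (∀ q ∈ U, ContinuousAt (F.bracketTrace X) q) →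
      Continuous (fun q => dirDeriv ψ q (X q) - F.bracketTrace X q * ψ q) := fun X hX hb =>
    continuous_of_tsupport (isClosed_tsupport ψ) (hz X) fun q hq =>
      ((smoothAt_dirDeriv F.isOpen (hsupp hq).1 hX fun q _ => hψ q).continuousAt).sub
        ((Complex.continuous_ofReal.continuousAt.comp (hb q (hsupp hq).1)).mul
          (hψ q).continuousAt)
  have hb₁ : ∀ q ∈ U, ContinuousAt (F.bracketTrace F.e₁) q := fun q hq => by
    refine ContinuousAt.congr (f := fun q => √2 * (F.ωZ₁bar q).re) ?_ ?_
    · exact continuousAt_const.mul (Complex.continuous_re.continuousAt.comp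
        (F.smoothAt_ωZ₁bar hq).continuousAt)
    · filter_upwards [F.isOpen.mem_nhds hq] with y hy using (S.bracketTrace_e₁ F hy).symm
  have hb₂ : ∀ q ∈ U, ContinuousAt (F.bracketTrace F.e₂) q := fun q hq => by
    refine ContinuousAt.congr (f := fun q => √2 * (F.ωZ₁bar q).im) ?_ ?_
    · exact continuousAt_const.mul (Complex.continuous_im.continuousAt.comp
        (F.smoothAt_ωZ₁bar hq).continuousAt)
    · filter_upwards [F.isOpen.mem_nhds hq] with y hy using (S.bracketTrace_e₂ F hy).symm
  have hc₁ := hcont F.e₁ (fun q hq => F.fieldAt_e₁ hq) hb₁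
  have hc₂ := hcont F.e₂ (fun q hq => F.fieldAt_e₂ hq) hb₂
  have hi₁ : Integrable _ S.volume := hc₁.integrable_of_hasCompactSupport
    (HasCompactSupport.intro hc (hz F.e₁))
  have hi₂ : Integrable _ S.volume := hc₂.integrable_of_hasCompactSupport
    (HasCompactSupport.intro hc (hz F.e₂))
  have h₁ := S.integral_dirDeriv_sub F he hψ hc hsupp (fun q hq => F.fieldAt_e₁ hq)
    hi₁.aestronglyMeasurable
  have h₂ := S.integral_dirDeriv_sub F he hψ hc hsupp (fun q hq => F.fieldAt_e₂ hq)
    hi₂.aestronglyMeasurable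
  have hs : ∀ c : ℂ, ∫ q, (1 / (√2 : ℝ) : ℂ) *
      ((dirDeriv ψ q (F.e₁ q) - F.bracketTrace F.e₁ q * ψ q)
      + c * (dirDeriv ψ q (F.e₂ q) - F.bracketTrace F.e₂ q * ψ q)) ∂S.volume = 0 := fun c => by
    rw [integral_const_mul, integral_add hi₁ (hi₂.const_mul c), integral_const_mul, h₁, h₂]
    simp
  have hsq : ((√2 : ℝ) : ℂ) ≠ 0 := by simp
  constructor
  · rw [← hs Complex.I]
    refine integral_congr_ae (Eventually.of_forall fun q => ?_)
    by_cases hq : q ∈ tsupport ψ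
    · have hω : F.ωZ₁bar q = (F.ωZ₁bar q).re + (F.ωZ₁bar q).im * Complex.I :=
        (Complex.re_add_im _).symm
      beta_reduce
      rw [S.bracketTrace_e₁ F (hsupp hq).1, S.bracketTrace_e₂ F (hsupp hq).1, UnitaryFrame.D₁bar]
      conv_lhs => rw [hω]
      push_cast
      field_simp
      ring
    · have h1 := hz F.e₁ q hq
      have h2 := hz F.e₂ q hq
      rw [image_eq_zero_of_notMem_tsupport hq, mul_zero, sub_zero] at h1 h2
      simp [UnitaryFrame.D₁bar, image_eq_zero_of_notMem_tsupport hq, h1, h2]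
  · rw [← hs (-Complex.I)]
    refine integral_congr_ae (Eventually.of_forall fun q => ?_)
    by_cases hq : q ∈ tsupport ψ
    · have hω : F.ωZ₁ q = -((F.ωZ₁bar q).re - (F.ωZ₁bar q).im * Complex.I) := by
        rw [UnitaryFrame.ωZ₁]
        apply Complex.ext <;> simp
      beta_reduce
      rw [S.bracketTrace_e₁ F (hsupp hq).1, S.bracketTrace_e₂ F (hsupp hq).1, UnitaryFrame.D₁, hω]
      push_cast
      field_simp
      ring
    · have h1 := hz F.e₁ q hq
      have h2 := hz F.e₂ q hq
      rw [image_eq_zero_of_notMem_tsupport hq, mul_zero, sub_zero] at h1 h2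
      simp [UnitaryFrame.D₁, image_eq_zero_of_notMem_tsupport hq, h1, h2]

end Pseudohermitian

namespace Pseudohermitian

variable {N : Type*} [TopologicalSpace N] [ChartedSpace Heis N] [IsManifold IH ∞ N]
  (S : Pseudohermitian N) {f χ : N → ℂ}

/-- The integrand of the mass formula: it is the divergence of the flux of `f`. -/
def massIntegrand (f : N → ℂ) (p : N) : ℂ :=
  -((‖S.boxb f p‖ ^ 2 : ℝ) : ℂ) + 2 * (S.normSqHess₁bar₁bar f p : ℂ) +
    2 * (S.R p * (S.normSqD₁bar f p : ℂ)) + 1 / 2 * (conj (f p) * S.paneitz f p)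

lemma massIntegrand_eq {U : Set N} (F : UnitaryFrame S.θ S.J U) {p : N} (hp : p ∈ U)
    (hf : ∀ q, SmoothAt f q) : S.massIntegrand f p =
      F.D₁bar (F.fluxBar f) p - F.ωZ₁bar p * F.fluxBar f p +
        (F.D₁ (F.flux f) p + F.ωZ₁ p * F.flux f p) := by
  have hn : ∀ z : ℂ, ((‖z‖ ^ 2 : ℝ) : ℂ) = z * conj z := fun z => by
    rw [Complex.mul_conj, Complex.normSq_eq_norm_sq]
  rw [F.divergence_identity hp fun q _ => hf q, massIntegrand, S.boxb_eq F hp hf,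
    S.normSqHess₁bar₁bar_eq F hp hf, S.normSqD₁bar_eq F hp, S.paneitz_eq F hp hf, S.R_eq F hp,
    hn, hn, hn]
  ring

lemma mem_frame (p : N) : p ∈ (S.exists_frame p).choose := (S.exists_frame p).choose_spec.1

lemma smoothAt_of_frame {g : N → ℂ} {g' : N → ℂ} {p : N} (hs : SmoothAt g' p)
    (hg : ∀ q ∈ (S.exists_frame p).choose, g q = g' q) : SmoothAt g p :=
  hs.congr (by
    filter_upwards [(S.frameAt p).isOpen.mem_nhds (S.mem_frame p)] with q hq using hg q hq)

lemma smoothAt_boxb (hf : ∀ q, SmoothAt f q) (p : N) : SmoothAt (S.boxb f) p :=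
  S.smoothAt_of_frame ((S.frameAt p).smoothAt_boxb (S.mem_frame p) fun q _ => hf q)
    fun _ hq => S.boxb_eq _ hq hf

lemma smoothAt_paneitz (hf : ∀ q, SmoothAt f q) (p : N) : SmoothAt (S.paneitz f) p :=
  S.smoothAt_of_frame ((S.frameAt p).smoothAt_paneitz (S.mem_frame p) fun q _ => hf q)
    fun _ hq => S.paneitz_eq _ hq hf

lemma smoothAt_R (p : N) : SmoothAt S.R p :=
  S.smoothAt_of_frame ((S.frameAt p).smoothAt_R (S.mem_frame p)) fun _ hq => S.R_eq _ hq

lemma continuous_boxb (hf : ∀ q, SmoothAt f q) : Continuous (S.boxb f) :=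
  continuous_iff_continuousAt.2 fun p => (S.smoothAt_boxb hf p).continuousAt

lemma continuous_paneitz (hf : ∀ q, SmoothAt f q) : Continuous (S.paneitz f) :=
  continuous_iff_continuousAt.2 fun p => (S.smoothAt_paneitz hf p).continuousAt

lemma continuous_R : Continuous S.R :=
  continuous_iff_continuousAt.2 fun p => (S.smoothAt_R p).continuousAt

lemma continuous_normSqD₁bar (hf : ∀ q, SmoothAt f q) : Continuous (S.normSqD₁bar f) :=
  continuous_iff_continuousAt.2 fun p => by
    refine ContinuousAt.congr (f := fun q => ‖(S.frameAt p).D₁bar f q‖ ^ 2)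
      (((S.frameAt p).smoothAt_D₁bar (S.mem_frame p) fun q _ => hf q).continuousAt.norm.pow 2) ?_
    filter_upwards [(S.frameAt p).isOpen.mem_nhds (S.mem_frame p)] with q hq
    exact (S.normSqD₁bar_eq _ hq).symm

lemma continuous_normSqHess₁bar₁bar (hf : ∀ q, SmoothAt f q) :
    Continuous (S.normSqHess₁bar₁bar f) :=
  continuous_iff_continuousAt.2 fun p => by
    refine ContinuousAt.congr (f := fun q => ‖(S.frameAt p).hess₁bar₁bar f q‖ ^ 2)
      (((S.frameAt p).smoothAt_hess₁bar₁bar (S.mem_frame p) fun q _ =>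
        hf q).continuousAt.norm.pow 2) ?_
    filter_upwards [(S.frameAt p).isOpen.mem_nhds (S.mem_frame p)] with q hq
    exact (S.normSqHess₁bar₁bar_eq _ hq hf).symm

lemma continuous_massIntegrand (hf : ∀ q, SmoothAt f q) : Continuous (S.massIntegrand f) := by
  have hfc : Continuous f := continuous_iff_continuousAt.2 fun p => (hf p).continuousAt
  have h1 := S.continuous_boxb hf
  have h2 := S.continuous_normSqHess₁bar₁bar hf
  have h3 := S.continuous_normSqD₁bar hf
  have h4 := S.continuous_R
  have h5 := S.continuous_paneitz hf
  unfold massIntegrand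
  fun_prop

lemma continuous_fluxPairing (hf : ∀ q, SmoothAt f q) (hχ : ∀ q, SmoothAt χ q) :
    Continuous (S.fluxPairing f χ) :=
  continuous_iff_continuousAt.2 fun p => by
    have hs := ((((S.frameAt p).smoothAt_D₁bar (S.mem_frame p) fun q _ => hχ q).mul
      ((S.frameAt p).smoothAt_fluxBar (S.mem_frame p) fun q _ => hf q)).add
      (((S.frameAt p).smoothAt_D₁ (S.mem_frame p) fun q _ => hχ q).mul
      ((S.frameAt p).smoothAt_flux (S.mem_frame p) fun q _ => hf q)))
    exact (S.smoothAt_of_frame hs fun q hq => S.fluxPairing_eq _ hq hf).continuousAt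

lemma fluxPairing_eq_zero {p : N} (hp : p ∉ tsupport χ) : S.fluxPairing f χ p = 0 := by
  have h := notMem_tsupport_iff_eventuallyEq.1 hp
  have h1 := ((S.frameAt p).isDer₁bar p).congr h
  have h2 := ((S.frameAt p).isDer₁ p).congr h
  have h3 := ((S.frameAt p).isDer₁bar p).const 0
  have h4 := ((S.frameAt p).isDer₁ p).const 0
  rw [fluxPairing]
  change (S.frameAt p).D₁bar χ p = (S.frameAt p).D₁bar (fun _ => 0) p at h1
  change (S.frameAt p).D₁ χ p = (S.frameAt p).D₁ (fun _ => 0) p at h2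
  rw [h1, h2, h3, h4]
  simp

variable [MeasurableSpace N] [BorelSpace N] [SecondCountableTopology N] [T2Space N]

/-- The divergence theorem for a test function supported in a coordinate domain with a frame. -/
lemma integral_massIntegrand_local {U : Set N} (F : UnitaryFrame S.θ S.J U)
    {e : OpenPartialHomeomorph N Heis} (he : e ∈ IsManifold.maximalAtlas IH ∞ N)
    (hf : ∀ q, SmoothAt f q) (hχ : ∀ q, SmoothAt χ q)
    (hc : HasCompactSupport χ) (hsupp : tsupport χ ⊆ U ∩ e.source) :
    ∫ p, (χ p * S.massIntegrand f p + S.fluxPairing f χ p) ∂S.volume = 0 := by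
  have hsm : ∀ g : N → ℂ, (∀ q ∈ U, SmoothAt g q) → (∀ q, SmoothAt (fun q => χ q * g q) q) ∧
      HasCompactSupport (fun q => χ q * g q) ∧ tsupport (fun q => χ q * g q) ⊆ U ∩ e.source :=
    fun g hg => by
      refine ⟨fun q => ?_, hc.mul_right, (tsupport_mul_subset_left).trans hsupp⟩
      by_cases hq : q ∈ tsupport χ
      · exact (hχ q).mul (hg q (hsupp hq).1)
      · refine (smoothAt_const 0).congr ?_
        filter_upwards [notMem_tsupport_iff_eventuallyEq.1 hq] with y hy
        simp [hy]
  obtain ⟨a1, a2, a3⟩ := hsm (F.fluxBar f) fun q hq => F.smoothAt_fluxBar hq fun q _ => hf q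
  obtain ⟨b1, b2, b3⟩ := hsm (F.flux f) fun q hq => F.smoothAt_flux hq fun q _ => hf q
  have h1 := (S.integral_D₁bar_sub F he a1 a2 a3).1
  have h2 := (S.integral_D₁bar_sub F he b1 b2 b3).2
  have hχU : ∀ q ∈ U, SmoothAt χ q := fun q _ => hχ q
  have hz : ∀ q ∉ tsupport χ, ∀ g : N → ℂ, F.D₁ (fun q => χ q * g q) q = 0 ∧
      F.D₁bar (fun q => χ q * g q) q = 0 ∧ χ q = 0 := fun q hq g => by
    have h : (fun q => χ q * g q) =ᶠ[𝓝 q] fun _ => 0 := by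
      filter_upwards [notMem_tsupport_iff_eventuallyEq.1 hq] with y hy
      simp [hy]
    exact ⟨((F.isDer₁ q).congr h).trans ((F.isDer₁ q).const 0),
      ((F.isDer₁bar q).congr h).trans ((F.isDer₁bar q).const 0),
      image_eq_zero_of_notMem_tsupport hq⟩
  have i1 : Integrable (fun q => F.D₁bar (fun q => χ q * F.fluxBar f q) q -
      F.ωZ₁bar q * (χ q * F.fluxBar f q)) S.volume := by
    refine (continuous_of_tsupport (isClosed_tsupport χ) (fun q hq => ?_) fun q hq =>
      ?_).integrable_of_hasCompactSupport (HasCompactSupport.intro hc fun q hq => ?_)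
    · simp [hz q hq, image_eq_zero_of_notMem_tsupport hq]
    · exact ((F.smoothAt_D₁bar (hsupp hq).1 fun q _ => a1 q).sub
        ((F.smoothAt_ωZ₁bar (hsupp hq).1).mul (a1 q))).continuousAt
    · simp [hz q hq, image_eq_zero_of_notMem_tsupport hq]
  have i2 : Integrable (fun q => F.D₁ (fun q => χ q * F.flux f q) q +
      F.ωZ₁ q * (χ q * F.flux f q)) S.volume := by
    refine (continuous_of_tsupport (isClosed_tsupport χ) (fun q hq => ?_) fun q hq =>
      ?_).integrable_of_hasCompactSupport (HasCompactSupport.intro hc fun q hq => ?_)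
    · simp [hz q hq, image_eq_zero_of_notMem_tsupport hq]
    · exact ((F.smoothAt_D₁ (hsupp hq).1 fun q _ => b1 q).add
        ((F.smoothAt_ωZ₁ (hsupp hq).1).mul (b1 q))).continuousAt
    · simp [hz q hq, image_eq_zero_of_notMem_tsupport hq]
  have hsum := integral_add i1 i2
  rw [h1, h2, add_zero] at hsum
  rw [← hsum]
  refine integral_congr_ae (Eventually.of_forall fun q => ?_)
  by_cases hq : q ∈ tsupport χ
  · have hqU := (hsupp hq).1
    have d1 := (F.isDer₁bar q).mul (hχ q) (F.smoothAt_fluxBar hqU fun q _ => hf q)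
    have d2 := (F.isDer₁ q).mul (hχ q) (F.smoothAt_flux hqU fun q _ => hf q)
    beta_reduce
    rw [d1, d2, S.massIntegrand_eq F hqU hf, S.fluxPairing_eq F hqU hf]
    ring
  · simp [hz q hq, image_eq_zero_of_notMem_tsupport hq, S.fluxPairing_eq_zero hq]

/-- **Divergence theorem** for the flux of `f`, tested against a compactly supported function. -/
theorem integral_massIntegrand (hf : ∀ q, SmoothAt f q) (hχ : ∀ q, SmoothAt χ q)
    (hc : HasCompactSupport χ) :
    ∫ p, χ p * S.massIntegrand f p ∂S.volume = -∫ p, S.fluxPairing f χ p ∂S.volume := by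
  have : LocallyCompactSpace N := ChartedSpace.locallyCompactSpace Heis N
  have hint : ∀ χ : N → ℂ, (∀ q, SmoothAt χ q) → HasCompactSupport χ →
      Integrable (fun p => χ p * S.massIntegrand f p) S.volume ∧
      Integrable (fun p => S.fluxPairing f χ p) S.volume := fun χ hχ hc => by
    have hχc : Continuous χ := continuous_iff_continuousAt.2 fun p => (hχ p).continuousAt
    exact ⟨(hχc.mul (S.continuous_massIntegrand hf)).integrable_of_hasCompactSupport hc.mul_right,
      (S.continuous_fluxPairing hf hχ).integrable_of_hasCompactSupport
        (HasCompactSupport.intro hc fun q hq => S.fluxPairing_eq_zero hq)⟩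
  -- a partition of unity splits `χ` into finitely many pieces, each supported in the domain of a
  -- frame and a chart
  obtain ⟨ρ, hρ⟩ := SmoothPartitionOfUnity.exists_isSubordinate IH (isClosed_tsupport χ)
    (fun p : N => (S.exists_frame p).choose ∩ (chartAt Heis p).source)
    (fun p => (S.frameAt p).isOpen.inter (chartAt Heis p).open_source)
    (fun p _ => Set.mem_iUnion.2 ⟨p, S.mem_frame p, mem_chart_source Heis p⟩)
  have hfin := ρ.locallyFinite.finite_nonempty_inter_compact hc
  set s := hfin.toFinset
  set χi : N → N → ℂ := fun i p => (ρ i p : ℂ) * χ p with hχi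
  have hsupp : ∀ i, tsupport (χi i) ⊆ tsupport (ρ i) := fun i => by
    refine closure_mono fun p hp h => hp ?_
    simp only [hχi]
    rw [h]
    simp
  have hsm : ∀ i q, SmoothAt (χi i) q := fun i q => by
    refine SmoothAt.mul ?_ (hχ q)
    exact (Complex.ofRealCLM.contMDiff.contMDiffAt).comp q ((ρ i).contMDiff.contMDiffAt)
  have hci : ∀ i, HasCompactSupport (χi i) := fun i => hc.mul_left
  have hloc : ∀ i, ∫ p, (χi i p * S.massIntegrand f p + S.fluxPairing f (χi i) p) ∂S.volume = 0 :=
    fun i => S.integral_massIntegrand_local (S.frameAt i) (IsManifold.chart_mem_maximalAtlas i) hf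
      (hsm i) (hci i) ((hsupp i).trans (hρ i))
  have hsum : ∀ q, χ q = ∑ i ∈ s, χi i q := fun q => by
    by_cases hq : q ∈ tsupport χ
    · have h1 := ρ.sum_eq_one hq
      rw [finsum_eq_sum_of_support_subset (s := s)] at h1
      · simp only [hχi, ← Finset.sum_mul]
        have h2 := congrArg (fun r : ℝ => (r : ℂ)) h1
        push_cast at h2
        rw [h2, one_mul]
      · intro i hi
        exact hfin.mem_toFinset.2 ⟨q, hi, hq⟩
    · simp [hχi, image_eq_zero_of_notMem_tsupport hq]
  have hflux : ∀ q, S.fluxPairing f χ q = ∑ i ∈ s, S.fluxPairing f (χi i) q := fun q => by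
    have hD : ∀ D : (N → ℂ) → ℂ, IsDer q D → D χ = ∑ i ∈ s, D (χi i) := fun D hD => by
      have h0 : χ = fun q => ∑ i ∈ s, χi i q := funext hsum
      have h1 : ∀ t : Finset N, SmoothAt (fun q => ∑ i ∈ t, χi i q) q ∧
          D (fun q => ∑ i ∈ t, χi i q) = ∑ i ∈ t, D (χi i) := fun t => by
        classical
        induction t using Finset.induction_on with
        | empty => exact ⟨by simpa using smoothAt_const 0, by simpa using hD.const 0⟩
        | insert a t ha ih =>
          simp only [Finset.sum_insert ha]
          exact ⟨(hsm a q).add ih.1, by rw [hD.add (hsm a q) ih.1, ih.2]⟩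
      rw [← (h1 s).2, ← h0]
    simp only [fluxPairing]
    have e1 := hD _ ((S.frameAt q).isDer₁bar q)
    have e2 := hD _ ((S.frameAt q).isDer₁ q)
    rw [e1, e2, Finset.sum_add_distrib, Finset.sum_mul, Finset.sum_mul]
  rw [eq_neg_iff_add_eq_zero, ← integral_add (hint χ hχ hc).1 (hint χ hχ hc).2]
  have hrw : (fun p => χ p * S.massIntegrand f p + S.fluxPairing f χ p) =
      fun p => ∑ i ∈ s, (χi i p * S.massIntegrand f p + S.fluxPairing f (χi i) p) := by
    funext p
    rw [hflux, Finset.sum_add_distrib, ← Finset.sum_mul, ← hsum]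
  rw [hrw, integral_finsetSum]
  · exact Finset.sum_eq_zero fun i _ => hloc i
  · exact fun i _ => (hint _ (hsm i) (hci i)).1.add (hint _ (hsm i) (hci i)).2

end Pseudohermitian

/-! ### Calculus on the Heisenberg group -/

/-- The fourth power of the homogeneous norm. -/
def quad (x : Heis) : ℝ := ‖x.1‖ ^ 4 + x.2 ^ 2

lemma quad_nonneg (x : Heis) : 0 ≤ quad x := by unfold quad; positivity

lemma quad_pos {x : Heis} (hx : x ≠ 0) : 0 < quad x := by
  rcases (quad_nonneg x).lt_or_eq with h | h
  · exact h
  · refine absurd (Prod.ext ?_ ?_) hx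
    · have : ‖x.1‖ ^ 4 = 0 := by
        unfold quad at h
        nlinarith [sq_nonneg x.2, pow_nonneg (norm_nonneg x.1) 4]
      simpa using this
    · have : x.2 ^ 2 = 0 := by
        unfold quad at h
        nlinarith [sq_nonneg x.2, pow_nonneg (norm_nonneg x.1) 4]
      simpa using this

lemma quad_zero : quad 0 = 0 := by simp [quad]

lemma rho_eq (x : Heis) : rho x = quad x ^ (1 / 4 : ℝ) := rfl

lemma rho_nonneg (x : Heis) : 0 ≤ rho x := Real.rpow_nonneg (quad_nonneg x) _

lemma rho_pos {x : Heis} (hx : x ≠ 0) : 0 < rho x := Real.rpow_pos_of_pos (quad_pos hx) _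

lemma rho_zero : rho 0 = 0 := by rw [rho_eq, quad_zero, Real.zero_rpow (by norm_num)]

lemma ne_zero_of_rho_pos {x : Heis} (hx : 0 < rho x) : x ≠ 0 := by
  rintro rfl
  rw [rho_zero] at hx
  exact lt_irrefl _ hx

lemma rho_pow_four (x : Heis) : rho x ^ 4 = quad x := by
  rw [rho_eq, ← Real.rpow_natCast, ← Real.rpow_mul (quad_nonneg x)]
  norm_num

lemma rho_rpow (x : Heis) (k : ℝ) : rho x ^ k = quad x ^ (k / 4) := by
  rw [rho_eq, ← Real.rpow_mul (quad_nonneg x)]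
  congr 1
  ring

lemma lt_rho_iff {x : Heis} {r : ℝ} (hr : 0 ≤ r) : r < rho x ↔ r ^ 4 < quad x := by
  rw [← rho_pow_four, pow_lt_pow_iff_left₀ hr (rho_nonneg x) (by norm_num)]

lemma continuous_quad : Continuous quad := by unfold quad; fun_prop

lemma continuous_rho : Continuous rho :=
  continuous_quad.rpow_const fun _ => Or.inr (by norm_num)

lemma norm_fst_le_rho (x : Heis) : ‖x.1‖ ≤ rho x := by
  refine le_of_pow_le_pow_left₀ (n := 4) (by norm_num) (rho_nonneg x) ?_
  rw [rho_pow_four, quad]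
  nlinarith [sq_nonneg x.2]

lemma abs_snd_le_rho_sq (x : Heis) : |x.2| ≤ rho x ^ 2 := by
  refine abs_le_of_sq_le_sq ?_ (by positivity)
  rw [← pow_mul, rho_pow_four, quad]
  nlinarith [pow_nonneg (norm_nonneg x.1) 4]

lemma contDiff_quad : ContDiff ℝ ∞ quad := by
  have : quad = fun x : Heis => (‖x.1‖ ^ 2) ^ 2 + x.2 ^ 2 := by
    funext x; unfold quad; ring
  rw [this]
  exact ((contDiff_fst.norm_sq ℝ).pow 2).add (contDiff_snd.pow 2)

lemma contDiffAt_rho_rpow {x : Heis} (hx : x ≠ 0) (k : ℝ) :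
    ContDiffAt ℝ ∞ (fun x => rho x ^ k) x := by
  simp only [rho_rpow]
  exact contDiff_quad.contDiffAt.rpow_const_of_ne (quad_pos hx).ne'

/-- The Heisenberg dilation `(z, t) ↦ (r z, r² t)`. -/
def dil (r : ℝ) : Heis →L[ℝ] Heis :=
  (r • ContinuousLinearMap.fst ℝ ℂ ℝ).prod (r ^ 2 • ContinuousLinearMap.snd ℝ ℂ ℝ)

lemma dil_apply (r : ℝ) (x : Heis) : dil r x = ((r : ℂ) * x.1, r ^ 2 * x.2) := by
  simp [dil]

lemma quad_dil (r : ℝ) (x : Heis) : quad (dil r x) = r ^ 4 * quad x := by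
  rw [dil_apply, quad, quad]
  simp only [norm_mul, Complex.norm_real, Real.norm_eq_abs, mul_pow]
  rw [Even.pow_abs (by decide)]
  ring

lemma rho_dil {r : ℝ} (hr : 0 ≤ r) (x : Heis) : rho (dil r x) = r * rho x := by
  rw [rho_eq, quad_dil, Real.mul_rpow (by positivity) (quad_nonneg x), ← rho_eq]
  congr 1
  rw [← Real.rpow_natCast, ← Real.rpow_mul hr]
  norm_num

lemma dil_dil (r s : ℝ) (x : Heis) : dil r (dil s x) = dil (r * s) x := by
  simp only [dil_apply, Complex.ofReal_mul, Prod.mk.injEq]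
  constructor <;> ring

lemma dil_one (x : Heis) : dil 1 x = x := by simp [dil_apply]

/-- The filter of neighbourhoods of infinity in the Heisenberg group. -/
def atInf : Filter Heis := comap rho atTop

lemma eventually_atInf {P : Heis → Prop} :
    (∀ᶠ x in atInf, P x) ↔ ∃ r : ℝ, 0 < r ∧ ∀ x, r < rho x → P x := by
  rw [atInf, eventually_comap, eventually_atTop]
  constructor
  · rintro ⟨a, ha⟩
    exact ⟨max a 1, by positivity, fun x hx => ha _ ((le_max_left _ _).trans hx.le) x rfl⟩
  · rintro ⟨r, _, h⟩
    exact ⟨r + 1, fun b hb x hx => h x (by linarith)⟩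

lemma eventually_lt_rho (r : ℝ) : ∀ᶠ x in atInf, r < rho x :=
  eventually_atInf.2 ⟨max r 1, by positivity, fun _ hx => (le_max_left _ _).trans_lt hx⟩

lemma eventually_ne_zero : ∀ᶠ x in atInf, x ≠ 0 :=
  (eventually_lt_rho 0).mono fun _ => ne_zero_of_rho_pos

lemma eventually_nhds_of_atInf {P : Heis → Prop} (h : ∀ᶠ x in atInf, P x) :
    ∀ᶠ x in atInf, ∀ᶠ y in 𝓝 x, P y := by
  obtain ⟨r, hr, h⟩ := eventually_atInf.1 h
  refine eventually_atInf.2 ⟨r, hr, fun x hx => ?_⟩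
  filter_upwards [continuous_rho.continuousAt.eventually_const_lt hx] with y hy using h y hy

lemma smoothAt_heis {f : Heis → ℂ} {x : Heis} : SmoothAt f x ↔ ContDiffAt ℝ ∞ f x :=
  contMDiffAt_iff_contDiffAt

lemma dirDeriv_heis (f : Heis → ℂ) (x v : Heis) : dirDeriv f x v = fderiv ℝ f x v := by
  change mfderiv IH 𝓘(ℝ, ℂ) f x v = _
  rw [mfderiv_eq_fderiv]
  rfl

/-- The derivative along `∂_t`. -/
def hDt (f : Heis → ℂ) (x : Heis) : ℂ := fderiv ℝ f x hT

lemma isDer_hZ (x : Heis) : IsDer x fun f => hZ f x := by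
  have h := (IsDer.dirDeriv (p := x) (hX x)).comb (IsDer.dirDeriv (p := x) (hY x))
    (1 / (2 * (√2 : ℝ))) (-Complex.I)
  refine (congrArg (IsDer x) (funext fun f => ?_)).mp h
  rw [dirDeriv_heis, dirDeriv_heis, hZ]
  ring

lemma isDer_hZbar (x : Heis) : IsDer x fun f => hZbar f x := by
  have h := (IsDer.dirDeriv (p := x) (hX x)).comb (IsDer.dirDeriv (p := x) (hY x))
    (1 / (2 * (√2 : ℝ))) Complex.I
  refine (congrArg (IsDer x) (funext fun f => ?_)).mp h
  rw [dirDeriv_heis, dirDeriv_heis, hZbar]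

lemma isDer_hDt (x : Heis) : IsDer x fun f => hDt f x :=
  (congrArg (IsDer x) (funext fun f => dirDeriv_heis f x hT)).mp (IsDer.dirDeriv (p := x) hT)

lemma fderiv_conj {f : Heis → ℂ} {x : Heis} (hf : DifferentiableAt ℝ f x) (v : Heis) :
    fderiv ℝ (fun y => conj (f y)) x v = conj (fderiv ℝ f x v) := by
  have h := (Complex.conjCLE.toContinuousLinearMap.hasFDerivAt).comp x hf.hasFDerivAt
  exact congrArg (fun L => L v) h.fderiv

lemma hZ_conj {f : Heis → ℂ} {x : Heis} (hf : ContDiffAt ℝ ∞ f x) :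
    hZ (fun y => conj (f y)) x = conj (hZbar f x) := by
  have hd := hf.differentiableAt (by simp)
  rw [hZ, hZbar, fderiv_conj hd, fderiv_conj hd]
  simp [map_ofNat]
  ring

lemma hZbar_conj {f : Heis → ℂ} {x : Heis} (hf : ContDiffAt ℝ ∞ f x) :
    hZbar (fun y => conj (f y)) x = conj (hZ f x) := by
  have hd := hf.differentiableAt (by simp)
  rw [hZ, hZbar, fderiv_conj hd, fderiv_conj hd]
  simp [map_ofNat]

lemma hDt_conj {f : Heis → ℂ} {x : Heis} (hf : ContDiffAt ℝ ∞ f x) :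
    hDt (fun y => conj (f y)) x = conj (hDt f x) := fderiv_conj (hf.differentiableAt (by simp)) _

/-- The coordinate `θ₀(v)` of a tangent vector `v` at `x`. -/
def heisTheta (x v : Heis) : ℝ := v.2 + 2 * (conj x.1 * v.1).im

/-- The differential of a function in the coframe `√2 dz, √2 dz̄, θ₀`. -/
lemma fderiv_eq_heis (f : Heis → ℂ) (x v : Heis) : fderiv ℝ f x v =
    (√2 : ℝ) * v.1 * hZ f x + (√2 : ℝ) * conj v.1 * hZbar f x + heisTheta x v * hDt f x := by
  have hv : v = v.1.re • hX x + v.1.im • hY x + heisTheta x v • hT := by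
    ext <;> simp [hX, hY, hT, heisTheta]
    ring
  conv_lhs => rw [hv]
  rw [map_add, map_add, map_smul, map_smul, map_smul, hZ, hZbar, hDt]
  have h2 : ((√2 : ℝ) : ℂ) ≠ 0 := by simp
  have hre : v.1 = v.1.re + v.1.im * Complex.I := (Complex.re_add_im _).symm
  have hco : conj v.1 = v.1.re - v.1.im * Complex.I := by
    apply Complex.ext <;> simp
  rw [hco]
  clear hv hco
  simp only [Complex.real_smul]
  generalize v.1.re = a at *
  generalize v.1.im = b at *
  rw [hre]
  field_simp
  ring_nf
  rw [Complex.I_sq]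
  ring

lemma contDiffAt_fderiv_apply {f : Heis → ℂ} {x : Heis} (hf : ContDiffAt ℝ ∞ f x)
    {X : Heis → Heis} (hX : ContDiff ℝ ∞ X) : ContDiffAt ℝ ∞ (fun y => fderiv ℝ f y (X y)) x :=
  (hf.fderiv_right (m := ∞) (by simp)).clm_apply hX.contDiffAt

lemma contDiff_hX : ContDiff ℝ ∞ hX := by
  unfold hX
  exact contDiff_const.prodMk (contDiff_const.mul (Complex.imCLM.contDiff.comp contDiff_fst))

lemma contDiff_hY : ContDiff ℝ ∞ hY := by
  unfold hY
  exact contDiff_const.prodMk (contDiff_const.mul (Complex.reCLM.contDiff.comp contDiff_fst)).neg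

lemma contDiffAt_hZ {f : Heis → ℂ} {x : Heis} (hf : ContDiffAt ℝ ∞ f x) :
    ContDiffAt ℝ ∞ (hZ f) x :=
  contDiffAt_const.mul ((contDiffAt_fderiv_apply hf contDiff_hX).sub
    (contDiffAt_const.mul (contDiffAt_fderiv_apply hf contDiff_hY)))

lemma contDiffAt_hZbar {f : Heis → ℂ} {x : Heis} (hf : ContDiffAt ℝ ∞ f x) :
    ContDiffAt ℝ ∞ (hZbar f) x :=
  contDiffAt_const.mul ((contDiffAt_fderiv_apply hf contDiff_hX).add
    (contDiffAt_const.mul (contDiffAt_fderiv_apply hf contDiff_hY)))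

lemma contDiffAt_hDt {f : Heis → ℂ} {x : Heis} (hf : ContDiffAt ℝ ∞ f x) :
    ContDiffAt ℝ ∞ (hDt f) x := contDiffAt_fderiv_apply hf contDiff_const

lemma fderiv_fderiv_apply {f : Heis → ℂ} {x : Heis} (hf : ContDiffAt ℝ ∞ f x)
    {X : Heis → Heis} (hX : ContDiff ℝ ∞ X) (v : Heis) :
    fderiv ℝ (fun y => fderiv ℝ f y (X y)) x v =
      fderiv ℝ (fderiv ℝ f) x v (X x) + fderiv ℝ f x (fderiv ℝ X x v) := by
  have h1 := (hf.fderiv_right (m := ∞) (by simp)).differentiableAt (by simp)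
  have h2 := (hX.differentiable (by simp)) x
  rw [fderiv_clm_apply h1 h2]
  simp
  ring

lemma fderiv_hX (x v : Heis) : fderiv ℝ hX x v = (2 * v.1.im) • hT := by
  have h : HasFDerivAt hX ((0 : Heis →L[ℝ] ℂ).prod
      ((2 : ℝ) • (Complex.imCLM ∘L ContinuousLinearMap.fst ℝ ℂ ℝ))) x :=
    (hasFDerivAt_const _ _).prodMk
      ((Complex.imCLM ∘L ContinuousLinearMap.fst ℝ ℂ ℝ).hasFDerivAt.const_mul 2)
  rw [h.fderiv]
  simp [hT]

lemma fderiv_hY (x v : Heis) : fderiv ℝ hY x v = (-(2 * v.1.re)) • hT := by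
  have h : HasFDerivAt hY ((0 : Heis →L[ℝ] ℂ).prod
      (-((2 : ℝ) • (Complex.reCLM ∘L ContinuousLinearMap.fst ℝ ℂ ℝ)))) x :=
    (hasFDerivAt_const _ _).prodMk
      ((Complex.reCLM ∘L ContinuousLinearMap.fst ℝ ℂ ℝ).hasFDerivAt.const_mul 2).neg
  rw [h.fderiv]
  simp [hT]

section Commutators

variable {f : Heis → ℂ} {x : Heis} (hf : ContDiffAt ℝ ∞ f x)

include hf

lemma isSymm_fderiv (v w : Heis) :
    fderiv ℝ (fderiv ℝ f) x v w = fderiv ℝ (fderiv ℝ f) x w v :=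
  (hf.isSymmSndFDerivAt (by simp [minSmoothness_of_isRCLikeNormedField, ENat.LEInfty.out])) v w

/-- `[Z, Z̄] = -i ∂_t`. -/
lemma hDt_eq : hDt f x = Complex.I * (hZ (hZbar f) x - hZbar (hZ f) x) := by
  have hXs : ContDiffAt ℝ ∞ (fun y => fderiv ℝ f y (hX y)) x :=
    contDiffAt_fderiv_apply hf contDiff_hX
  have hYs : ContDiffAt ℝ ∞ (fun y => fderiv ℝ f y (hY y)) x :=
    contDiffAt_fderiv_apply hf contDiff_hY
  have e1 : ∀ c d : ℂ, ∀ v : Heis,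
      fderiv ℝ (fun y => c * (fderiv ℝ f y (hX y) + d * fderiv ℝ f y (hY y))) x v =
      c * (fderiv ℝ (fderiv ℝ f) x v (hX x) + 2 * v.1.im * hDt f x +
        d * (fderiv ℝ (fderiv ℝ f) x v (hY x) - 2 * v.1.re * hDt f x)) := fun c d v => by
    have h := ((((hXs.differentiableAt (by simp)).hasFDerivAt).add
      (((hYs.differentiableAt (by simp)).hasFDerivAt).const_mul d)).const_mul c).fderiv
    refine (congrArg (fun L => L v) h).trans ?_
    simp only [_root_.smul_apply, _root_.add_apply, smul_eq_mul]
    rw [fderiv_fderiv_apply hf contDiff_hX, fderiv_fderiv_apply hf contDiff_hY, fderiv_hX,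
      fderiv_hY, map_smul, map_smul, hDt]
    simp only [Complex.real_smul, Complex.ofReal_mul, Complex.ofReal_neg, Complex.ofReal_ofNat]
    ring
  have hz : hZ f = fun y => 1 / (2 * (√2 : ℝ)) *
      (fderiv ℝ f y (hX y) + (-Complex.I) * fderiv ℝ f y (hY y)) := by
    funext y; rw [hZ]; ring
  have hzb : hZbar f = fun y => 1 / (2 * (√2 : ℝ)) *
      (fderiv ℝ f y (hX y) + Complex.I * fderiv ℝ f y (hY y)) := rfl
  have h2 : ((√2 : ℝ) : ℂ) ≠ 0 := by simp
  have h22 : ((√2 : ℝ) : ℂ) ^ 2 = 2 := by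
    rw [← Complex.ofReal_pow, Real.sq_sqrt (by norm_num)]; norm_num
  rw [hZ, hZbar, hz, hzb, e1, e1, e1, e1, isSymm_fderiv hf (hY x) (hX x)]
  simp only [hX, hY, Complex.one_im, Complex.one_re, Complex.I_re, Complex.I_im]
  field_simp
  rw [h22]
  push_cast
  linear_combination (8 * hDt f x) * Complex.I_sq

lemma hZ_hDt : hZ (hDt f) x = hDt (hZ f) x := by
  have hXs : ContDiffAt ℝ ∞ (fun y => fderiv ℝ f y (hX y)) x :=
    contDiffAt_fderiv_apply hf contDiff_hX
  have hYs : ContDiffAt ℝ ∞ (fun y => fderiv ℝ f y (hY y)) x :=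
    contDiffAt_fderiv_apply hf contDiff_hY
  have h := ((((hXs.differentiableAt (by simp)).hasFDerivAt).sub
      (((hYs.differentiableAt (by simp)).hasFDerivAt).const_mul Complex.I)).const_mul
      (1 / (2 * (√2 : ℝ)) : ℂ)).fderiv
  have e : hDt (hZ f) x = _ := congrArg (fun L => L hT) h
  have e2 : ∀ v, fderiv ℝ (hDt f) x v = fderiv ℝ (fderiv ℝ f) x v hT := fun v => by
    have := fderiv_fderiv_apply hf (contDiff_const (c := hT)) v
    rw [fderiv_const_apply, _root_.zero_apply, map_zero, add_zero] at this
    exact this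
  rw [e, hZ, e2, e2]
  simp only [_root_.smul_apply, _root_.sub_apply, smul_eq_mul]
  rw [fderiv_fderiv_apply hf contDiff_hX, fderiv_fderiv_apply hf contDiff_hY, fderiv_hX,
    fderiv_hY, isSymm_fderiv hf hT, isSymm_fderiv hf hT]
  simp [hT]

end Commutators

/-! ### Symbols near infinity -/

/-- Symbol estimates of order `k` for at most `n` derivatives along `Z₁` and `Z_1̄`. -/
def SymbolBound : ℕ → ℝ → (Heis → ℂ) → Prop
  | 0, k, f => f =O[atInf] fun x => rho x ^ k
  | n + 1, k, f => (f =O[atInf] fun x => rho x ^ k) ∧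
      SymbolBound n (k - 1) (hZ f) ∧ SymbolBound n (k - 1) (hZbar f)

/-- Smoothness near infinity. -/
def SmoothInf (f : Heis → ℂ) : Prop := ∀ᶠ x in atInf, ContDiffAt ℝ ∞ f x

namespace SmoothInf

variable {f g : Heis → ℂ}

lemma hZ (hf : SmoothInf f) : SmoothInf (hZ f) := hf.mono fun _ => contDiffAt_hZ

lemma hZbar (hf : SmoothInf f) : SmoothInf (hZbar f) := hf.mono fun _ => contDiffAt_hZbar

lemma star (hf : SmoothInf f) : SmoothInf fun x => conj (f x) :=
  hf.mono fun _ h => Complex.conjCLE.contDiff.contDiffAt.comp _ h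

lemma add (hf : SmoothInf f) (hg : SmoothInf g) : SmoothInf fun x => f x + g x := by
  filter_upwards [hf, hg] with x h1 h2 using h1.add h2

lemma mul (hf : SmoothInf f) (hg : SmoothInf g) : SmoothInf fun x => f x * g x := by
  filter_upwards [hf, hg] with x h1 h2 using h1.mul h2

lemma congr (hf : SmoothInf f) (h : f =ᶠ[atInf] g) : SmoothInf g := by
  filter_upwards [hf, eventually_nhds_of_atInf h] with x h1 h2
  exact h1.congr_of_eventuallyEq (h2.mono fun _ h => h.symm)

end SmoothInf

lemma isBigO_mono {f : Heis → ℂ} {k l : ℝ} (hf : f =O[atInf] fun x => rho x ^ k) (h : k ≤ l) :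
    f =O[atInf] fun x => rho x ^ l := by
  refine hf.trans (Asymptotics.IsBigO.of_bound 1 ?_)
  filter_upwards [eventually_lt_rho 1] with x hx
  rw [one_mul, Real.norm_of_nonneg (by positivity), Real.norm_of_nonneg (by positivity)]
  exact Real.rpow_le_rpow_of_exponent_le hx.le h

lemma isBigO_mul {f g : Heis → ℂ} {k l : ℝ} (hf : f =O[atInf] fun x => rho x ^ k)
    (hg : g =O[atInf] fun x => rho x ^ l) :
    (fun x => f x * g x) =O[atInf] fun x => rho x ^ (k + l) := by
  refine (hf.mul hg).congr' (EventuallyEq.refl _ _) ?_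
  filter_upwards [eventually_lt_rho 0] with x hx
  rw [Real.rpow_add hx]

lemma hZ_congr_inf {f g : Heis → ℂ} (h : f =ᶠ[atInf] g) : hZ f =ᶠ[atInf] hZ g :=
  (eventually_nhds_of_atInf h).mono fun x hx => (isDer_hZ x).congr hx

lemma hZbar_congr_inf {f g : Heis → ℂ} (h : f =ᶠ[atInf] g) : hZbar f =ᶠ[atInf] hZbar g :=
  (eventually_nhds_of_atInf h).mono fun x hx => (isDer_hZbar x).congr hx

namespace SymbolBound

variable {f g : Heis → ℂ} {k l : ℝ} {n : ℕ}

lemma of_succ (h : SymbolBound (n + 1) k f) : SymbolBound n k f := by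
  induction n generalizing k f with
  | zero => exact h.1
  | succ n ih => exact ⟨h.1, ih h.2.1, ih h.2.2⟩

lemma mono (h : SymbolBound n k f) (hkl : k ≤ l) : SymbolBound n l f := by
  induction n generalizing k l f with
  | zero => exact isBigO_mono h hkl
  | succ n ih => exact ⟨isBigO_mono h.1 hkl, ih h.2.1 (by linarith), ih h.2.2 (by linarith)⟩

lemma congr (h : SymbolBound n k f) (hfg : f =ᶠ[atInf] g) : SymbolBound n k g := by
  induction n generalizing k f g with
  | zero => exact h.congr' hfg (EventuallyEq.refl _ _)
  | succ n ih => exact ⟨h.1.congr' hfg (EventuallyEq.refl _ _), ih h.2.1 (hZ_congr_inf hfg),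
      ih h.2.2 (hZbar_congr_inf hfg)⟩

lemma add (sf : SmoothInf f) (sg : SmoothInf g) (hf : SymbolBound n k f)
    (hg : SymbolBound n k g) : SymbolBound n k fun x => f x + g x := by
  induction n generalizing k f g with
  | zero => exact Asymptotics.IsBigO.add hf hg
  | succ n ih =>
    refine ⟨Asymptotics.IsBigO.add hf.1 hg.1, (ih sf.hZ sg.hZ hf.2.1 hg.2.1).congr ?_,
      (ih sf.hZbar sg.hZbar hf.2.2 hg.2.2).congr ?_⟩
    · filter_upwards [sf, sg] with x h1 h2
      exact ((isDer_hZ x).add (smoothAt_heis.2 h1) (smoothAt_heis.2 h2)).symm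
    · filter_upwards [sf, sg] with x h1 h2
      exact ((isDer_hZbar x).add (smoothAt_heis.2 h1) (smoothAt_heis.2 h2)).symm

lemma mul (sf : SmoothInf f) (sg : SmoothInf g) (hf : SymbolBound n k f)
    (hg : SymbolBound n l g) : SymbolBound n (k + l) fun x => f x * g x := by
  induction n generalizing k l f g with
  | zero => exact isBigO_mul hf hg
  | succ n ih =>
    refine ⟨isBigO_mul hf.1 hg.1,
      (add (sf.hZ.mul sg) (sf.mul sg.hZ) ((ih sf.hZ sg hf.2.1 hg.of_succ).mono (by linarith))
        ((ih sf sg.hZ hf.of_succ hg.2.1).mono (by linarith))).congr ?_,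
      (add (sf.hZbar.mul sg) (sf.mul sg.hZbar)
        ((ih sf.hZbar sg hf.2.2 hg.of_succ).mono (by linarith))
        ((ih sf sg.hZbar hf.of_succ hg.2.2).mono (by linarith))).congr ?_⟩
    · filter_upwards [sf, sg] with x h1 h2
      exact ((isDer_hZ x).mul (smoothAt_heis.2 h1) (smoothAt_heis.2 h2)).symm
    · filter_upwards [sf, sg] with x h1 h2
      exact ((isDer_hZbar x).mul (smoothAt_heis.2 h1) (smoothAt_heis.2 h2)).symm

lemma star (sf : SmoothInf f) (hf : SymbolBound n k f) :
    SymbolBound n k fun x => conj (f x) := by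
  have hb : ∀ {g : Heis → ℂ} {k : ℝ}, (g =O[atInf] fun x => rho x ^ k) →
      (fun x => starRingEnd ℂ (g x)) =O[atInf] fun x => rho x ^ k := fun h =>
    (Asymptotics.isBigO_norm_left.1 (by simpa using h.norm_left))
  induction n generalizing k f with
  | zero => exact hb hf
  | succ n ih =>
    refine ⟨hb hf.1, (ih sf.hZbar hf.2.2).congr ?_, (ih sf.hZ hf.2.1).congr ?_⟩
    · filter_upwards [sf] with x h1 using (hZ_conj h1).symm
    · filter_upwards [sf] with x h1 using (hZbar_conj h1).symm

lemma zero : SymbolBound n k fun _ => 0 := by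
  induction n generalizing k with
  | zero => exact Asymptotics.isBigO_zero _ _
  | succ n ih =>
    have h1 : hZ (fun _ => 0) = fun _ => 0 := funext fun x => (isDer_hZ x).const 0
    have h2 : hZbar (fun _ => 0) = fun _ => 0 := funext fun x => (isDer_hZbar x).const 0
    exact ⟨Asymptotics.isBigO_zero _ _, by rw [h1]; exact ih, by rw [h2]; exact ih⟩

lemma const (c : ℂ) : SymbolBound n 0 fun _ => c := by
  have hb : (fun _ : Heis => c) =O[atInf] fun x => rho x ^ (0 : ℝ) := by
    simp only [Real.rpow_zero]
    exact Asymptotics.isBigO_const_const _ one_ne_zero _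
  cases n with
  | zero => exact hb
  | succ n =>
    have h1 : hZ (fun _ => c) = fun _ => 0 := funext fun x => (isDer_hZ x).const c
    have h2 : hZbar (fun _ => c) = fun _ => 0 := funext fun x => (isDer_hZbar x).const c
    exact ⟨hb, by rw [h1]; exact zero, by rw [h2]; exact zero⟩

lemma inv (sf : SmoothInf f) (h0 : ∀ᶠ x in atInf, f x ≠ 0)
    (hi : (fun x => (f x)⁻¹) =O[atInf] fun x => rho x ^ (0 : ℝ)) (hf : SymbolBound n 0 f) :
    SymbolBound n 0 fun x => (f x)⁻¹ := by
  have si : SmoothInf fun x => (f x)⁻¹ := by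
    filter_upwards [sf, h0] with x h1 h2 using h1.inv h2
  induction n with
  | zero => exact hi
  | succ n ih =>
    have key : ∀ (D : (Heis → ℂ) → Heis → ℂ), (∀ x, IsDer x fun f => D f x) →
        (fun x => (-1 : ℂ) * (D f x * ((f x)⁻¹ * (f x)⁻¹))) =ᶠ[atInf] D fun x => (f x)⁻¹ := by
      intro D hD
      filter_upwards [sf, si, h0, eventually_nhds_of_atInf h0] with x h1 h2 h3 h4
      have hm := (hD x).mul (smoothAt_heis.2 h1) (smoothAt_heis.2 h2)
      have hc := (hD x).congr (f := fun x => f x * (f x)⁻¹) (g := fun _ => 1)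
        (h4.mono fun y hy => mul_inv_cancel₀ hy)
      rw [hm, (hD x).const] at hc
      apply mul_left_cancel₀ h3
      field_simp
      field_simp at hc
      linear_combination -hc
    have sii : SmoothInf fun x => (f x)⁻¹ * (f x)⁻¹ := si.mul si
    have hii := mul si si (ih hf.of_succ) (ih hf.of_succ)
    have hm : ∀ g : Heis → ℂ, SmoothInf g → SymbolBound n (0 - 1) g →
        SymbolBound n (0 - 1) fun x => (-1 : ℂ) * (g x * ((f x)⁻¹ * (f x)⁻¹)) := fun g sg hg =>
      (mul (Eventually.of_forall fun _ => contDiffAt_const) (sg.mul sii) (const (-1))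
        (mul sg sii hg hii)).mono (by norm_num)
    exact ⟨hi, (hm _ sf.hZ hf.2.1).congr (key hZ isDer_hZ),
      (hm _ sf.hZbar hf.2.2).congr (key hZbar isDer_hZbar)⟩

end SymbolBound

lemma hWord_append (w : List Bool) (b : Bool) (f : Heis → ℂ) :
    hWord (w ++ [b]) f = hWord w (hWord [b] f) := by
  induction w with
  | nil => rfl
  | cons a w ih => cases a <;> simp only [List.cons_append, hWord, ih]

/-- The definition of `O(ρ^k)` by words in the fields, in a form suited to induction on the number
of derivatives. -/
lemma isSymbolO_iff {k : ℝ} {f : Heis → ℂ} :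
    IsSymbolO k f ↔ SmoothInf f ∧ ∀ n, SymbolBound n k f := by
  have hO : ∀ {k : ℝ} {g : Heis → ℂ}, (g =O[atInf] fun x => rho x ^ k) ↔
      ∃ C r : ℝ, 0 < r ∧ ∀ x : Heis, r < rho x → ‖g x‖ ≤ C * rho x ^ k := fun {k g} => by
    rw [Asymptotics.isBigO_iff]
    refine exists_congr fun C => ?_
    rw [eventually_atInf]
    refine exists_congr fun r => and_congr_right fun _ => forall₂_congr fun x _ => ?_
    rw [Real.norm_of_nonneg (Real.rpow_nonneg (rho_nonneg x) _)]
  have hS : (∃ r : ℝ, 0 < r ∧ ContDiffOn ℝ ∞ f {x | r < rho x}) ↔ SmoothInf f := by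
    rw [SmoothInf, eventually_atInf]
    refine exists_congr fun r => and_congr_right fun _ => ?_
    have ho : IsOpen {x | r < rho x} := isOpen_lt continuous_const continuous_rho
    exact ⟨fun h x hx => h.contDiffAt (ho.mem_nhds hx), fun h x hx => (h x hx).contDiffWithinAt⟩
  rw [IsSymbolO, hS]
  clear hS
  refine and_congr_right fun _ => ?_
  constructor
  · intro h n
    clear * - h hO
    induction n generalizing k f with
    | zero =>
      exact hO.2 (by simpa only [hWord, List.length_nil, Nat.cast_zero, sub_zero] using h [])
    | succ n ih =>
      have hb := hO.2 (by simpa only [hWord, List.length_nil, Nat.cast_zero, sub_zero] using h [])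
      have hs : ∀ w : List Bool, ∀ b : Bool, k - ((w ++ [b]).length : ℝ) = k - 1 - w.length :=
        fun w b => by
          rw [List.length_append, List.length_singleton]
          push_cast
          ring
      refine ⟨hb, ih (k := k - 1) fun w => ?_, ih (k := k - 1) fun w => ?_⟩
      · have := h (w ++ [true])
        rw [hs, hWord_append] at this
        exact this
      · have := h (w ++ [false])
        rw [hs, hWord_append] at this
        exact this
  · intro h w
    clear * - h hO
    induction w using List.reverseRecOn generalizing k f with
    | nil => simpa only [hWord, List.length_nil, Nat.cast_zero, sub_zero] using hO.1 (h 0)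
    | append_singleton w b ih =>
      have hs : k - ((w ++ [b]).length : ℝ) = k - 1 - w.length := by
        rw [List.length_append, List.length_singleton]
        push_cast
        ring
      rw [hWord_append, hs]
      cases b with
      | true => exact ih (k := k - 1) (f := hZ f) fun n => (h (n + 1)).2.1
      | false => exact ih (k := k - 1) (f := hZbar f) fun n => (h (n + 1)).2.2

namespace IsSymbolO

variable {f g : Heis → ℂ} {k l m : ℝ}

lemma smooth (hf : IsSymbolO k f) : SmoothInf f := (isSymbolO_iff.1 hf).1

lemma bound (hf : IsSymbolO k f) : f =O[atInf] fun x => rho x ^ k := (isSymbolO_iff.1 hf).2 0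

lemma mono (hf : IsSymbolO k f) (h : k ≤ l) : IsSymbolO l f :=
  isSymbolO_iff.2 ⟨hf.smooth, fun n => ((isSymbolO_iff.1 hf).2 n).mono h⟩

lemma congr (hf : IsSymbolO k f) (h : f =ᶠ[atInf] g) : IsSymbolO k g :=
  isSymbolO_iff.2 ⟨hf.smooth.congr h, fun n => ((isSymbolO_iff.1 hf).2 n).congr h⟩

lemma add (hf : IsSymbolO k f) (hg : IsSymbolO k g) : IsSymbolO k fun x => f x + g x :=
  isSymbolO_iff.2 ⟨hf.smooth.add hg.smooth, fun n =>
    SymbolBound.add hf.smooth hg.smooth ((isSymbolO_iff.1 hf).2 n) ((isSymbolO_iff.1 hg).2 n)⟩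

lemma const (c : ℂ) : IsSymbolO 0 fun _ => c :=
  isSymbolO_iff.2 ⟨Eventually.of_forall fun _ => contDiffAt_const, fun _ => SymbolBound.const c⟩

/-- The product of symbols, with room in the order. -/
lemma mul (hf : IsSymbolO k f) (hg : IsSymbolO l g) (h : k + l ≤ m := by norm_num) :
    IsSymbolO m fun x => f x * g x :=
  isSymbolO_iff.2 ⟨hf.smooth.mul hg.smooth, fun n =>
    (SymbolBound.mul hf.smooth hg.smooth ((isSymbolO_iff.1 hf).2 n)
      ((isSymbolO_iff.1 hg).2 n)).mono h⟩

lemma const_mul (c : ℂ) (hf : IsSymbolO k f) : IsSymbolO k fun x => c * f x :=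
  (const c).mul hf (by simp)

lemma neg (hf : IsSymbolO k f) : IsSymbolO k fun x => -f x := by
  simpa using hf.const_mul (-1)

lemma sub (hf : IsSymbolO k f) (hg : IsSymbolO k g) : IsSymbolO k fun x => f x - g x := by
  simpa [sub_eq_add_neg] using hf.add hg.neg

lemma star (hf : IsSymbolO k f) : IsSymbolO k fun x => conj (f x) :=
  isSymbolO_iff.2 ⟨hf.smooth.star, fun n =>
    SymbolBound.star hf.smooth ((isSymbolO_iff.1 hf).2 n)⟩

lemma hZ (hf : IsSymbolO k f) (h : k - 1 ≤ m := by norm_num) : IsSymbolO m (hZ f) :=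
  isSymbolO_iff.2 ⟨hf.smooth.hZ, fun n => ((isSymbolO_iff.1 hf).2 (n + 1)).2.1.mono h⟩

lemma hZbar (hf : IsSymbolO k f) (h : k - 1 ≤ m := by norm_num) : IsSymbolO m (hZbar f) :=
  isSymbolO_iff.2 ⟨hf.smooth.hZbar, fun n => ((isSymbolO_iff.1 hf).2 (n + 1)).2.2.mono h⟩

lemma hDt (hf : IsSymbolO k f) (h : k - 2 ≤ m := by norm_num) : IsSymbolO m (hDt f) := by
  have hk : k - 1 - 1 ≤ m := by linarith
  refine (((((hf.hZbar le_rfl).hZ hk).sub ((hf.hZ le_rfl).hZbar hk))).const_mul Complex.I).congr ?_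
  filter_upwards [hf.smooth] with x hx using (hDt_eq hx).symm

lemma tendsto_zero (hf : IsSymbolO k f) (hk : k < 0) : Tendsto f atInf (𝓝 0) := by
  refine hf.bound.trans_tendsto ?_
  have : Tendsto rho atInf atTop := tendsto_comap
  have h := (tendsto_rpow_neg_atTop (y := -k) (by linarith)).comp this
  rw [neg_neg] at h
  exact h

/-- The inverse of a function asymptotic to `1`. -/
lemma inv (hf : IsSymbolO k fun x => f x - 1) (hk : k < 0) : IsSymbolO 0 fun x => (f x)⁻¹ := by
  have h1 : IsSymbolO 0 f := ((hf.mono hk.le).add (const 1)).congr (by simp)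
  have ht : Tendsto f atInf (𝓝 1) := by
    have := (hf.tendsto_zero hk).add_const 1
    simpa using this
  have h0 : ∀ᶠ x in atInf, f x ≠ 0 := ht.eventually_ne one_ne_zero
  have hi : (fun x => (f x)⁻¹) =O[atInf] fun x => rho x ^ (0 : ℝ) := by
    simp only [Real.rpow_zero]
    exact (ht.inv₀ one_ne_zero).isBigO_one ℝ
  refine isSymbolO_iff.2 ⟨?_, fun n =>
    SymbolBound.inv h1.smooth h0 hi ((isSymbolO_iff.1 h1).2 n)⟩
  filter_upwards [h1.smooth, h0] with x h1 h2 using h1.inv h2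

end IsSymbolO

/-! ### Homogeneous functions -/

/-- `f` is smooth off the origin and homogeneous of degree `k` for the Heisenberg dilations. -/
def IsHomog (k : ℝ) (f : Heis → ℂ) : Prop :=
  (∀ x, x ≠ 0 → ContDiffAt ℝ ∞ f x) ∧
    ∀ r : ℝ, 0 < r → ∀ x, x ≠ 0 → f (dil r x) = ((r ^ k : ℝ) : ℂ) * f x

lemma isCompact_rho_eq_one : IsCompact {x : Heis | rho x = 1} := by
  refine Metric.isCompact_of_isClosed_isBounded (isClosed_eq continuous_rho continuous_const) ?_
  refine (Metric.isBounded_closedBall (x := (0 : Heis)) (r := 1)).subset fun x hx => ?_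
  have h1 := norm_fst_le_rho x
  have h2 := abs_snd_le_rho_sq x
  rw [Set.mem_ofPred_eq] at hx
  rw [hx] at h1 h2
  rw [mem_closedBall_zero_iff, Prod.norm_def]
  exact max_le h1 (by simpa using h2)

lemma dil_ne_zero {r : ℝ} (hr : 0 < r) {x : Heis} (hx : x ≠ 0) : dil r x ≠ 0 :=
  ne_zero_of_rho_pos (by rw [rho_dil hr.le]; exact mul_pos hr (rho_pos hx))

namespace IsHomog

variable {f g : Heis → ℂ} {k l : ℝ}

lemma fderiv_dil (hf : IsHomog k f) {r : ℝ} (hr : 0 < r) {x : Heis} (hx : x ≠ 0) (v : Heis) :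
    fderiv ℝ f (dil r x) (dil r v) = ((r ^ k : ℝ) : ℂ) * fderiv ℝ f x v := by
  have h1 : HasFDerivAt (fun y => f (dil r y)) (fderiv ℝ f (dil r x) ∘L dil r) x :=
    (((hf.1 _ (dil_ne_zero hr hx)).differentiableAt (by simp)).hasFDerivAt).comp x
      (dil r).hasFDerivAt
  have h2 : (fun y => f (dil r y)) =ᶠ[𝓝 x] fun y => ((r ^ k : ℝ) : ℂ) * f y := by
    filter_upwards [isOpen_ne.mem_nhds hx] with y hy using hf.2 r hr y hy
  have h3 := (((hf.1 x hx).differentiableAt (by simp)).hasFDerivAt.const_mul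
    ((r ^ k : ℝ) : ℂ)).fderiv
  have h4 := h1.fderiv
  rw [h2.fderiv_eq, h3] at h4
  simpa using (congrArg (fun L => L v) h4).symm

lemma dil_hX (r : ℝ) (x : Heis) : r • hX (dil r x) = dil r (hX x) := by
  ext <;> simp [hX, dil_apply]
  ring

lemma dil_hY (r : ℝ) (x : Heis) : r • hY (dil r x) = dil r (hY x) := by
  ext <;> simp [hY, dil_apply]
  ring

lemma hZ_dil (hf : IsHomog k f) {r : ℝ} (hr : 0 < r) {x : Heis} (hx : x ≠ 0) :
    hZ f (dil r x) = ((r ^ (k - 1) : ℝ) : ℂ) * hZ f x ∧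
      hZbar f (dil r x) = ((r ^ (k - 1) : ℝ) : ℂ) * hZbar f x := by
  have e1 := hf.fderiv_dil hr hx (hX x)
  have e2 := hf.fderiv_dil hr hx (hY x)
  have hr' : (r : ℂ) ≠ 0 := by exact_mod_cast hr.ne'
  rw [← dil_hX, map_smul, Complex.real_smul] at e1
  rw [← dil_hY, map_smul, Complex.real_smul] at e2
  have hk : ((r ^ (k - 1) : ℝ) : ℂ) = ((r ^ k : ℝ) : ℂ) * (r : ℂ)⁻¹ := by
    rw [Real.rpow_sub_one hr.ne']
    push_cast
    ring
  rw [hZ, hZ, hZbar, hZbar, hk, eq_comm, eq_comm (a := 1 / (2 * ((√2 : ℝ) : ℂ)) *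
    (fderiv ℝ f (dil r x) (hX (dil r x)) + Complex.I * fderiv ℝ f (dil r x) (hY (dil r x))))]
  have hr2 : (r : ℂ)⁻¹ * r = 1 := inv_mul_cancel₀ hr'
  constructor
  · linear_combination (-(1 / (2 * ((√2 : ℝ) : ℂ))) * (r : ℂ)⁻¹) * (e1 - Complex.I * e2) +
      (1 / (2 * ((√2 : ℝ) : ℂ))) * (fderiv ℝ f (dil r x) (hX (dil r x)) -
        Complex.I * fderiv ℝ f (dil r x) (hY (dil r x))) * hr2
  · linear_combination (-(1 / (2 * ((√2 : ℝ) : ℂ))) * (r : ℂ)⁻¹) * (e1 + Complex.I * e2) +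
      (1 / (2 * ((√2 : ℝ) : ℂ))) * (fderiv ℝ f (dil r x) (hX (dil r x)) +
        Complex.I * fderiv ℝ f (dil r x) (hY (dil r x))) * hr2

lemma hZ (hf : IsHomog k f) : IsHomog (k - 1) (hZ f) :=
  ⟨fun x hx => contDiffAt_hZ (hf.1 x hx), fun _ hr _ hx => (hf.hZ_dil hr hx).1⟩

lemma hZbar (hf : IsHomog k f) : IsHomog (k - 1) (hZbar f) :=
  ⟨fun x hx => contDiffAt_hZbar (hf.1 x hx), fun _ hr _ hx => (hf.hZ_dil hr hx).2⟩

lemma isBigO (hf : IsHomog k f) : f =O[atInf] fun x => rho x ^ k := by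
  obtain ⟨C, hC⟩ := isCompact_rho_eq_one.exists_bound_of_continuousOn (f := f) fun x hx =>
    (hf.1 x (ne_zero_of_rho_pos (by rw [hx]; exact one_pos))).continuousAt.continuousWithinAt
  refine Asymptotics.IsBigO.of_bound C ?_
  filter_upwards [eventually_ne_zero] with x hx
  have hr := rho_pos hx
  have h1 : x = dil (rho x) (dil (rho x)⁻¹ x) := by
    rw [dil_dil, mul_inv_cancel₀ hr.ne', dil_one]
  have h2 : rho (dil (rho x)⁻¹ x) = 1 := by
    rw [rho_dil (inv_pos.2 hr).le, inv_mul_cancel₀ hr.ne']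
  have h3 := hf.2 _ hr _ (dil_ne_zero (inv_pos.2 hr) hx)
  rw [← h1] at h3
  rw [h3, norm_mul, Complex.norm_real, mul_comm]
  exact mul_le_mul_of_nonneg_right (hC _ h2) (norm_nonneg _)

lemma isSymbolO (hf : IsHomog k f) : IsSymbolO k f := by
  refine isSymbolO_iff.2 ⟨eventually_ne_zero.mono hf.1, fun n => ?_⟩
  induction n generalizing k f with
  | zero => exact hf.isBigO
  | succ n ih => exact ⟨hf.isBigO, ih hf.hZ, ih hf.hZbar⟩

end IsHomog

lemma isHomog_rho_rpow (k : ℝ) : IsHomog k fun x => ((rho x ^ k : ℝ) : ℂ) := by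
  refine ⟨fun x hx => Complex.ofRealCLM.contDiff.contDiffAt.comp x (contDiffAt_rho_rpow hx k),
    fun r hr x hx => ?_⟩
  beta_reduce
  rw [rho_dil hr.le, Real.mul_rpow hr.le (rho_nonneg x), Complex.ofReal_mul]

lemma isHomog_fst : IsHomog 1 fun x => x.1 :=
  ⟨fun _ _ => contDiffAt_fst, fun r hr x hx => by simp [dil_apply]⟩

/-! ### The frame in asymptotic coordinates -/

/-- The derivative of `f` along the field `a Z₁ + b Z_1̄ + c ∂_t`. -/
def along (a b c f : Heis → ℂ) (x : Heis) : ℂ := a x * hZ f x + b x * hZbar f x + c x * hDt f x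

lemma isDer_along (a b c : Heis → ℂ) (x : Heis) : IsDer x fun f => along a b c f x where
  congr h := by
    simp only [along, (isDer_hZ x).congr h, (isDer_hZbar x).congr h, (isDer_hDt x).congr h]
  const k := by
    simp only [along, (isDer_hZ x).const, (isDer_hZbar x).const, (isDer_hDt x).const]
    ring
  add hf hg := by
    simp only [along, (isDer_hZ x).add hf hg, (isDer_hZbar x).add hf hg, (isDer_hDt x).add hf hg]
    ring
  mul hf hg := by
    simp only [along, (isDer_hZ x).mul hf hg, (isDer_hZbar x).mul hf hg, (isDer_hDt x).mul hf hg]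
    ring

lemma fderiv_coordZ (x v : Heis) : fderiv ℝ (fun y : Heis => y.1) x v = v.1 := by
  rw [show (fun y : Heis => y.1) = (ContinuousLinearMap.fst ℝ ℂ ℝ : Heis → ℂ) from rfl,
    ContinuousLinearMap.fderiv]
  rfl

lemma fderiv_coordT (x v : Heis) : fderiv ℝ (fun y : Heis => (y.2 : ℂ)) x v = v.2 := by
  have h := ((Complex.ofRealCLM ∘L ContinuousLinearMap.snd ℝ ℂ ℝ).hasFDerivAt (x := x)).fderiv
  exact congrArg (fun L => L v) h

lemma contDiffAt_coordZ (x : Heis) : ContDiffAt ℝ ∞ (fun y : Heis => y.1) x := contDiffAt_fst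

lemma contDiffAt_coordT (x : Heis) : ContDiffAt ℝ ∞ (fun y : Heis => (y.2 : ℂ)) x :=
  (Complex.ofRealCLM.contDiff.comp contDiff_snd).contDiffAt

lemma sqrt_two_sq : ((√2 : ℝ) : ℂ) ^ 2 = 2 := by
  rw [← Complex.ofReal_pow, Real.sq_sqrt (by norm_num)]; norm_num

lemma sqrt_two_cast_ne_zero : ((√2 : ℝ) : ℂ) ≠ 0 := by simp

lemma hZ_coordZ (x : Heis) : hZ (fun y => y.1) x = 1 / (√2 : ℝ) := by
  have h := sqrt_two_cast_ne_zero
  rw [hZ, fderiv_coordZ, fderiv_coordZ, hX, hY]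
  field_simp
  linear_combination -Complex.I_sq

lemma hZbar_coordZ (x : Heis) : hZbar (fun y => y.1) x = 0 := by
  rw [hZbar, fderiv_coordZ, fderiv_coordZ, hX, hY, Complex.I_mul_I]
  simp

lemma hDt_coordZ (x : Heis) : hDt (fun y => y.1) x = 0 := by
  rw [hDt, fderiv_coordZ, hT]

lemma hZ_coordZbar (x : Heis) : hZ (fun y => conj y.1) x = 0 := by
  rw [hZ_conj (contDiffAt_coordZ x), hZbar_coordZ, map_zero]

lemma hZbar_coordZbar (x : Heis) : hZbar (fun y => conj y.1) x = 1 / (√2 : ℝ) := by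
  rw [hZbar_conj (contDiffAt_coordZ x), hZ_coordZ]
  simp

lemma hDt_coordZbar (x : Heis) : hDt (fun y => conj y.1) x = 0 := by
  rw [hDt_conj (contDiffAt_coordZ x), hDt_coordZ, map_zero]

lemma hZ_coordT (x : Heis) : hZ (fun y => (y.2 : ℂ)) x = Complex.I * conj x.1 / (√2 : ℝ) := by
  have h := sqrt_two_cast_ne_zero
  have hc : conj x.1 = x.1.re - x.1.im * Complex.I := by apply Complex.ext <;> simp
  rw [hZ, fderiv_coordT, fderiv_coordT, hX, hY, hc]
  push_cast
  field_simp
  linear_combination (x.1.im : ℂ) * Complex.I_sq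

lemma hZbar_coordT (x : Heis) : hZbar (fun y => (y.2 : ℂ)) x = -(Complex.I * x.1) / (√2 : ℝ) := by
  have e : (fun y : Heis => (y.2 : ℂ)) = fun y => conj (y.2 : ℂ) := by simp
  rw [e, hZbar_conj (contDiffAt_coordT x), hZ_coordT]
  simp

lemma hDt_coordT (x : Heis) : hDt (fun y => (y.2 : ℂ)) x = 1 := by
  rw [hDt, fderiv_coordT, hT]
  simp

lemma along_coordZ (a b c : Heis → ℂ) (x : Heis) :
    along a b c (fun y => y.1) x = a x / (√2 : ℝ) := by
  rw [along, hZ_coordZ, hZbar_coordZ, hDt_coordZ]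
  ring

lemma along_coordZbar (a b c : Heis → ℂ) (x : Heis) :
    along a b c (fun y => conj y.1) x = b x / (√2 : ℝ) := by
  rw [along, hZ_coordZbar, hZbar_coordZbar, hDt_coordZbar]
  ring

lemma along_coordT (a b c : Heis → ℂ) (x : Heis) :
    along a b c (fun y => (y.2 : ℂ)) x =
      c x + Complex.I / (√2 : ℝ) * (conj x.1 * a x - x.1 * b x) := by
  rw [along, hZ_coordT, hZbar_coordT, hDt_coordT]
  ring

namespace AsymptoticallyFlat

variable {N : Type*} [TopologicalSpace N] [ChartedSpace Heis N] [IsManifold IH ∞ N]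
  [MeasurableSpace N] {S : Pseudohermitian N} (F : AsymptoticallyFlat S) {x : Heis} {f : N → ℂ}

/-! The components of `Z₁ = a Z + b Z̄ + c ∂_t` and `T = x Z + x̄ Z̄ + t ∂_t` in the standard
frame. -/

/-- The `Z`-component of `Z₁`. -/
def frA (x : Heis) : ℂ :=
  (push F.coords F.frame.e₁ x).1 - Complex.I * (push F.coords F.frame.e₂ x).1

/-- The `Z̄`-component of `Z₁`. -/
def frB (x : Heis) : ℂ :=
  conj (push F.coords F.frame.e₁ x).1 - Complex.I * conj (push F.coords F.frame.e₂ x).1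

/-- The `∂_t`-component of `Z₁`. -/
def frC (x : Heis) : ℂ := 1 / (√2 : ℝ) * ((heisTheta x (push F.coords F.frame.e₁ x) : ℂ) -
  Complex.I * (heisTheta x (push F.coords F.frame.e₂ x) : ℂ))

/-- The `Z`-component of the Reeb field. -/
def frX (x : Heis) : ℂ := (√2 : ℝ) * (push F.coords F.frame.T x).1

/-- The `∂_t`-component of the Reeb field. -/
def frT (x : Heis) : ℂ := (heisTheta x (push F.coords F.frame.T x) : ℂ)

lemma mem_source (hx : x ∈ F.coords.target) : F.coords.symm x ∈ F.coords.source :=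
  F.coords.map_target hx

lemma D₀_symm (hx : x ∈ F.coords.target) (hf : SmoothAt f (F.coords.symm x)) :
    F.frame.D₀ f (F.coords.symm x) =
      along F.frX (fun y => conj (F.frX y)) F.frT (fun y => f (F.coords.symm y)) x := by
  rw [UnitaryFrame.D₀, dirDeriv_symm F.coords_mem hx hf, fderiv_eq_heis, along, frX, frT]
  simp

lemma D₁_symm (hx : x ∈ F.coords.target) (hf : SmoothAt f (F.coords.symm x)) :
    F.frame.D₁ f (F.coords.symm x) =
      along F.frA F.frB F.frC (fun y => f (F.coords.symm y)) x := by
  have h := sqrt_two_cast_ne_zero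
  rw [UnitaryFrame.D₁, dirDeriv_symm F.coords_mem hx hf, dirDeriv_symm F.coords_mem hx hf,
    fderiv_eq_heis, fderiv_eq_heis, along, frA, frB, frC]
  field_simp
  ring

lemma D₁bar_symm (hx : x ∈ F.coords.target) (hf : SmoothAt f (F.coords.symm x)) :
    F.frame.D₁bar f (F.coords.symm x) =
      along (fun y => conj (F.frB y)) (fun y => conj (F.frA y)) (fun y => conj (F.frC y))
        (fun y => f (F.coords.symm y)) x := by
  have h := sqrt_two_cast_ne_zero
  rw [UnitaryFrame.D₁bar, dirDeriv_symm F.coords_mem hx hf, dirDeriv_symm F.coords_mem hx hf,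
    fderiv_eq_heis, fderiv_eq_heis, along, frA, frB, frC]
  simp only [map_sub, map_mul, Complex.conj_I, Complex.conj_conj, Complex.conj_ofReal, map_div₀,
    map_one]
  field_simp
  ring

/-- The contact form in asymptotic coordinates. -/
def coTheta (x : Heis) : Heis →L[ℝ] ℂ :=
  Complex.ofRealCLM ∘L (S.θ (F.coords.symm x) ∘L mfderiv IH IH F.coords.symm x)

/-- The form `θ¹` in asymptotic coordinates. -/
def coTheta₁ (x : Heis) : Heis →L[ℝ] ℂ :=
  F.frame.θ₁ (F.coords.symm x) ∘L mfderiv IH IH F.coords.symm x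

/-- The value of a real linear form on `Z₁ = (hX - i hY) / (2 √2)`. -/
def onZ (ℓ : Heis →L[ℝ] ℂ) (x : Heis) : ℂ :=
  1 / (2 * (√2 : ℝ)) * (ℓ (hX x) - Complex.I * ℓ (hY x))

/-- The value of a real linear form on `Z_1̄ = (hX + i hY) / (2 √2)`. -/
def onZbar (ℓ : Heis →L[ℝ] ℂ) (x : Heis) : ℂ :=
  1 / (2 * (√2 : ℝ)) * (ℓ (hX x) + Complex.I * ℓ (hY x))

lemma apply_eq (ℓ : Heis →L[ℝ] ℂ) (x v : Heis) :
    ℓ v = (√2 : ℝ) * v.1 * onZ ℓ x + (√2 : ℝ) * conj v.1 * onZbar ℓ x + heisTheta x v * ℓ hT := by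
  have h := fderiv_eq_heis ℓ x v
  rw [hZ, hZbar, hDt, ContinuousLinearMap.fderiv] at h
  exact h

lemma coTheta_push (hx : x ∈ F.coords.target) (X : Π p : N, TangentSpace IH p) :
    F.coTheta x (push F.coords X x) = (S.θ (F.coords.symm x) (X (F.coords.symm x)) : ℂ) :=
  congrArg (fun v => ((S.θ (F.coords.symm x) v : ℝ) : ℂ)) (mfderiv_symm_push F.coords_mem X hx)

lemma coTheta₁_push (hx : x ∈ F.coords.target) (X : Π p : N, TangentSpace IH p) :
    F.coTheta₁ x (push F.coords X x) = F.frame.θ₁ (F.coords.symm x) (X (F.coords.symm x)) :=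
  congrArg (fun v => F.frame.θ₁ (F.coords.symm x) v) (mfderiv_symm_push F.coords_mem X hx)

lemma onZbar_coTheta (x : Heis) : onZbar (F.coTheta x) x = conj (onZ (F.coTheta x) x) := by
  have h : ∀ v, conj (F.coTheta x v) = F.coTheta x v := fun v => Complex.conj_ofReal _
  rw [onZ, onZbar]
  simp only [map_mul, map_div₀, map_sub, map_one, map_ofNat, h, Complex.conj_I,
    Complex.conj_ofReal]
  ring

/-- The frame `Z₁` is dual to the coframe. -/
lemma frame_dual (hx : x ∈ F.coords.target) :
    F.frA x * onZ (F.coTheta x) x + F.frB x * onZbar (F.coTheta x) x +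
      F.frC x * F.coTheta x hT = 0 ∧
    F.frA x * onZ (F.coTheta₁ x) x + F.frB x * onZbar (F.coTheta₁ x) x +
      F.frC x * F.coTheta₁ x hT = 1 ∧
    F.frA x * conj (onZbar (F.coTheta₁ x) x) + F.frB x * conj (onZ (F.coTheta₁ x) x) +
      F.frC x * conj (F.coTheta₁ x hT) = 0 := by
  have h := sqrt_two_cast_ne_zero
  have hs := F.mem_source hx
  have a1 := F.coTheta_push hx F.frame.e₁
  have a2 := F.coTheta_push hx F.frame.e₂
  have b1 := F.coTheta₁_push hx F.frame.e₁
  have b2 := F.coTheta₁_push hx F.frame.e₂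
  rw [F.frame.θ_e₁ _ hs, apply_eq _ x] at a1
  rw [F.frame.θ_e₂ _ hs, apply_eq _ x] at a2
  rw [F.frame.θ₁_e₁ _ hs, apply_eq _ x] at b1
  rw [F.frame.θ₁_e₂ _ hs, apply_eq _ x] at b2
  have c1 := congrArg conj b1
  have c2 := congrArg conj b2
  simp only [map_add, map_mul, map_div₀, map_one, Complex.conj_ofReal, Complex.conj_conj,
    Complex.conj_I] at c1 c2
  rw [Complex.ofReal_zero] at a1 a2
  have h2 := sqrt_two_sq
  refine ⟨?_, ?_, ?_⟩
  · rw [frA, frB, frC]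
    linear_combination (norm := skip) (1 / (√2 : ℝ) : ℂ) * (a1 - Complex.I * a2)
    field_simp
    ring
  · rw [frA, frB, frC]
    linear_combination (norm := skip) (1 / (√2 : ℝ) : ℂ) * (b1 - Complex.I * b2)
    field_simp
    rw [h2]
    ring_nf
    rw [Complex.I_sq]
    ring
  · rw [frA, frB, frC]
    linear_combination (norm := skip) (1 / (√2 : ℝ) : ℂ) * (c1 - Complex.I * c2)
    field_simp
    ring_nf
    rw [Complex.I_sq]
    ring

/-- The Reeb field is dual to the coframe. -/
lemma reeb_dual (hx : x ∈ F.coords.target) :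
    F.frX x * onZ (F.coTheta x) x + conj (F.frX x) * onZbar (F.coTheta x) x +
      F.frT x * F.coTheta x hT = 1 ∧
    F.frX x * onZ (F.coTheta₁ x) x + conj (F.frX x) * onZbar (F.coTheta₁ x) x +
      F.frT x * F.coTheta₁ x hT = 0 ∧
    F.frX x * conj (onZbar (F.coTheta₁ x) x) + conj (F.frX x) * conj (onZ (F.coTheta₁ x) x) +
      F.frT x * conj (F.coTheta₁ x hT) = 0 := by
  have hs := F.mem_source hx
  have a1 := F.coTheta_push hx F.frame.T
  have b1 := F.coTheta₁_push hx F.frame.T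
  rw [F.frame.θ_T _ hs, apply_eq _ x] at a1
  rw [F.frame.θ₁_T _ hs, apply_eq _ x] at b1
  have e2 : F.frX x * onZ (F.coTheta₁ x) x + conj (F.frX x) * onZbar (F.coTheta₁ x) x +
      F.frT x * F.coTheta₁ x hT = 0 := by
    rw [frX, frT, ← b1]
    simp
  refine ⟨?_, e2, ?_⟩
  · rw [frX, frT]
    rw [Complex.ofReal_one] at a1
    rw [← a1]
    simp
  · have h := congrArg conj e2
    simp only [map_add, map_mul, Complex.conj_conj, map_zero] at h
    rw [← h]
    simp only [frT, Complex.conj_ofReal]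
    ring

lemma contDiffAt_frame (hx : x ∈ F.coords.target) : ContDiffAt ℝ ∞ F.frA x ∧
    ContDiffAt ℝ ∞ F.frB x ∧ ContDiffAt ℝ ∞ F.frC x ∧ ContDiffAt ℝ ∞ F.frX x ∧
    ContDiffAt ℝ ∞ F.frT x := by
  have hs := F.mem_source hx
  have h1 := contDiffAt_push F.coords_mem hx (F.frame.fieldAt_e₁ hs)
  have h2 := contDiffAt_push F.coords_mem hx (F.frame.fieldAt_e₂ hs)
  have h3 := contDiffAt_push F.coords_mem hx (F.frame.fieldAt_T hs)
  have hfst : ∀ {X : Heis → Heis}, ContDiffAt ℝ ∞ X x → ContDiffAt ℝ ∞ (fun y => (X y).1) x :=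
    fun h => contDiff_fst.contDiffAt.comp x h
  have hconj : ∀ {g : Heis → ℂ}, ContDiffAt ℝ ∞ g x → ContDiffAt ℝ ∞ (fun y => conj (g y)) x :=
    fun h => Complex.conjCLE.contDiff.contDiffAt.comp x h
  have hth : ∀ {X : Heis → Heis}, ContDiffAt ℝ ∞ X x →
      ContDiffAt ℝ ∞ (fun y => (heisTheta y (X y) : ℂ)) x := fun {X} h => by
    refine Complex.ofRealCLM.contDiff.contDiffAt.comp x ?_
    have hm : ContDiffAt ℝ ∞ (fun y => conj y.1 * (X y).1) x :=
      (hconj contDiffAt_fst).mul (hfst h)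
    exact (contDiff_snd.contDiffAt.comp x h).add
      (contDiffAt_const.mul (Complex.imCLM.contDiff.contDiffAt.comp x hm))
  exact ⟨(hfst h1).sub (contDiffAt_const.mul (hfst h2)),
    (hconj (hfst h1)).sub (contDiffAt_const.mul (hconj (hfst h2))),
    contDiffAt_const.mul ((hth h1).sub (contDiffAt_const.mul (hth h2))),
    contDiffAt_const.mul (hfst h3), hth h3⟩

end AsymptoticallyFlat

namespace AsymptoticallyFlat

variable {N : Type*} [TopologicalSpace N] [ChartedSpace Heis N] [IsManifold IH ∞ N]
  [MeasurableSpace N] {S : Pseudohermitian N} (F : AsymptoticallyFlat S) {x : Heis} {f g : N → ℂ}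

/-- The derivative along `Z₁` in asymptotic coordinates. -/
def opZ : (Heis → ℂ) → Heis → ℂ := along F.frA F.frB F.frC

/-- The derivative along `Z_1̄` in asymptotic coordinates. -/
def opZbar : (Heis → ℂ) → Heis → ℂ :=
  along (fun y => conj (F.frB y)) (fun y => conj (F.frA y)) (fun y => conj (F.frC y))

/-- The derivative along `T` in asymptotic coordinates. -/
def opT : (Heis → ℂ) → Heis → ℂ := along F.frX (fun y => conj (F.frX y)) F.frT

lemma isDer_opZ (x : Heis) : IsDer x fun f => F.opZ f x := isDer_along _ _ _ _

lemma isDer_opZbar (x : Heis) : IsDer x fun f => F.opZbar f x := isDer_along _ _ _ _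

lemma isDer_opT (x : Heis) : IsDer x fun f => F.opT f x := isDer_along _ _ _ _

lemma eventually_target (hx : x ∈ F.coords.target) : ∀ᶠ y in 𝓝 x, y ∈ F.coords.target :=
  F.coords.open_target.mem_nhds hx

lemma eventually_atInf_target : ∀ᶠ x in atInf, x ∈ F.coords.target := by
  rw [F.target_eq]
  exact eventually_lt_rho F.ρ₀

section Compositions

variable (hf : ∀ q ∈ F.coords.source, SmoothAt f q) (hx : x ∈ F.coords.target)

include hf hx

lemma D₁_D₁bar_symm : F.frame.D₁ (F.frame.D₁bar f) (F.coords.symm x) =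
    F.opZ (F.opZbar fun y => f (F.coords.symm y)) x := by
  rw [F.D₁_symm hx (F.frame.smoothAt_D₁bar (F.mem_source hx) hf)]
  refine (F.isDer_opZ x).congr ?_
  filter_upwards [F.eventually_target hx] with y hy using F.D₁bar_symm hy (hf _ (F.mem_source hy))

lemma D₁bar_D₁_symm : F.frame.D₁bar (F.frame.D₁ f) (F.coords.symm x) =
    F.opZbar (F.opZ fun y => f (F.coords.symm y)) x := by
  rw [F.D₁bar_symm hx (F.frame.smoothAt_D₁ (F.mem_source hx) hf)]
  refine (F.isDer_opZbar x).congr ?_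
  filter_upwards [F.eventually_target hx] with y hy using F.D₁_symm hy (hf _ (F.mem_source hy))

lemma D₀_D₁_symm : F.frame.D₀ (F.frame.D₁ f) (F.coords.symm x) =
    F.opT (F.opZ fun y => f (F.coords.symm y)) x := by
  rw [F.D₀_symm hx (F.frame.smoothAt_D₁ (F.mem_source hx) hf)]
  refine (F.isDer_opT x).congr ?_
  filter_upwards [F.eventually_target hx] with y hy using F.D₁_symm hy (hf _ (F.mem_source hy))

lemma D₁_D₀_symm : F.frame.D₁ (F.frame.D₀ f) (F.coords.symm x) =
    F.opZ (F.opT fun y => f (F.coords.symm y)) x := by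
  rw [F.D₁_symm hx (F.frame.smoothAt_D₀ (F.mem_source hx) hf)]
  refine (F.isDer_opZ x).congr ?_
  filter_upwards [F.eventually_target hx] with y hy using F.D₀_symm hy (hf _ (F.mem_source hy))

end Compositions

/-- The connection coefficient `ω(Z_1̄)` in asymptotic coordinates. -/
def conn (x : Heis) : ℂ := F.frame.ωZ₁bar (F.coords.symm x)

/-- The connection coefficient `ω(T)` in asymptotic coordinates. -/
def connT (x : Heis) : ℂ := F.frame.ωT (F.coords.symm x)

/-- The torsion in asymptotic coordinates. -/
def tors (x : Heis) : ℂ := F.frame.A₁₁ (F.coords.symm x)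

/-- The commutator of `T` and `Z₁` on a function of the coordinates. -/
lemma comm_opT_opZ {g : Heis → ℂ} (hg : ∀ x, ContDiffAt ℝ ∞ g x) (hx : x ∈ F.coords.target) :
    F.opT (F.opZ g) x - F.opZ (F.opT g) x =
      F.connT x * F.opZ g x - F.tors x * F.opZbar g x := by
  have hf : ∀ q ∈ F.coords.source, SmoothAt (fun q => g (F.coords q)) q := fun q hq =>
    smoothAt_comp_chart F.coords_mem hq (hg _)
  have e : (fun y => g (F.coords (F.coords.symm y))) =ᶠ[𝓝 x] g := by
    filter_upwards [F.eventually_target hx] with y hy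
    rw [F.coords.right_inv hy]
  have e' := eventually_eventually_nhds.2 e
  have h := F.frame.comm₀₁ (F.mem_source hx) hf
  rw [F.D₀_D₁_symm hf hx, F.D₁_D₀_symm hf hx, F.D₁_symm hx (hf _ (F.mem_source hx)),
    F.D₁bar_symm hx (hf _ (F.mem_source hx))] at h
  have h1 := (F.isDer_opT x).congr (f := F.opZ fun y => g (F.coords (F.coords.symm y)))
    (g := F.opZ g) (e'.mono fun y hy => (F.isDer_opZ y).congr hy)
  have h2 := (F.isDer_opZ x).congr (f := F.opT fun y => g (F.coords (F.coords.symm y)))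
    (g := F.opT g) (e'.mono fun y hy => (F.isDer_opT y).congr hy)
  rw [h1, h2] at h
  have h3 := (F.isDer_opZ x).congr e
  have h4 := (F.isDer_opZbar x).congr e
  rw [← h3, ← h4]
  exact h

/-- The commutator of `Z₁` and `Z_1̄` on a function of the coordinates. -/
lemma comm_opZ_opZbar {g : Heis → ℂ} (hg : ∀ x, ContDiffAt ℝ ∞ g x) (hx : x ∈ F.coords.target) :
    F.opZ (F.opZbar g) x - F.opZbar (F.opZ g) x =
      -Complex.I * F.opT g x - F.conn x * F.opZ g x + conj (F.conn x) * F.opZbar g x := by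
  have hf : ∀ q ∈ F.coords.source, SmoothAt (fun q => g (F.coords q)) q := fun q hq =>
    smoothAt_comp_chart F.coords_mem hq (hg _)
  have e : (fun y => g (F.coords (F.coords.symm y))) =ᶠ[𝓝 x] g := by
    filter_upwards [F.eventually_target hx] with y hy
    rw [F.coords.right_inv hy]
  have e' := eventually_eventually_nhds.2 e
  have h := F.frame.comm₁₁bar (F.mem_source hx) hf
  rw [F.D₁_D₁bar_symm hf hx, F.D₁bar_D₁_symm hf hx, F.D₁_symm hx (hf _ (F.mem_source hx)),
    F.D₁bar_symm hx (hf _ (F.mem_source hx)), F.D₀_symm hx (hf _ (F.mem_source hx))] at h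
  have h1 := (F.isDer_opZ x).congr (f := F.opZbar fun y => g (F.coords (F.coords.symm y)))
    (g := F.opZbar g) (e'.mono fun y hy => (F.isDer_opZbar y).congr hy)
  have h2 := (F.isDer_opZbar x).congr (f := F.opZ fun y => g (F.coords (F.coords.symm y)))
    (g := F.opZ g) (e'.mono fun y hy => (F.isDer_opZ y).congr hy)
  rw [h1, h2, UnitaryFrame.ωZ₁] at h
  have h3 := (F.isDer_opZ x).congr e
  have h4 := (F.isDer_opZbar x).congr e
  have h5 := (F.isDer_opT x).congr e
  rw [← h3, ← h4, ← h5]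
  refine h.trans ?_
  unfold conn opT opZ opZbar
  ring

variable (hx : x ∈ F.coords.target)

include hx

/-- The `Z`- and `Z̄`-components of the structure equation for `[T, Z₁]`. -/
lemma structure_TZ : F.opT F.frA x - F.opZ F.frX x =
      F.connT x * F.frA x - F.tors x * conj (F.frB x) ∧
    F.opT F.frB x - F.opZ (fun y => conj (F.frX y)) x =
      F.connT x * F.frB x - F.tors x * conj (F.frA x) := by
  have h2 := sqrt_two_cast_ne_zero
  obtain ⟨ha, hb, hc, hX, ht⟩ := F.contDiffAt_frame hx
  have hXc : ContDiffAt ℝ ∞ (fun y => conj (F.frX y)) x :=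
    Complex.conjCLE.contDiff.contDiffAt.comp x hX
  have e1 := F.comm_opT_opZ contDiffAt_coordZ hx
  have e2 := F.comm_opT_opZ (g := fun y => conj y.1)
    (fun x => Complex.conjCLE.contDiff.contDiffAt.comp x (contDiffAt_coordZ x)) hx
  have z1 : F.opZ (fun y => y.1) = fun y => (1 / (√2 : ℝ) : ℂ) * F.frA y := funext fun y =>
    (along_coordZ _ _ _ y).trans (by ring)
  have z2 : F.opT (fun y => y.1) = fun y => (1 / (√2 : ℝ) : ℂ) * F.frX y := funext fun y =>
    (along_coordZ _ _ _ y).trans (by ring)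
  have z3 : F.opZbar (fun y => y.1) x = (1 / (√2 : ℝ) : ℂ) * conj (F.frB x) :=
    (along_coordZ _ _ _ x).trans (by ring)
  have w1 : F.opZ (fun y => conj y.1) = fun y => (1 / (√2 : ℝ) : ℂ) * F.frB y := funext fun y =>
    (along_coordZbar _ _ _ y).trans (by ring)
  have w2 : F.opT (fun y => conj y.1) = fun y => (1 / (√2 : ℝ) : ℂ) * conj (F.frX y) :=
    funext fun y => (along_coordZbar _ _ _ y).trans (by ring)
  have w3 : F.opZbar (fun y => conj y.1) x = (1 / (√2 : ℝ) : ℂ) * conj (F.frA x) :=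
    (along_coordZbar _ _ _ x).trans (by ring)
  rw [z1, z2, z3, (F.isDer_opT x).const_mul _ (smoothAt_heis.2 ha),
    (F.isDer_opZ x).const_mul _ (smoothAt_heis.2 hX)] at e1
  rw [w1, w2, w3, (F.isDer_opT x).const_mul _ (smoothAt_heis.2 hb),
    (F.isDer_opZ x).const_mul _ (smoothAt_heis.2 hXc)] at e2
  constructor
  · field_simp at e1
    linear_combination e1
  · field_simp at e2
    linear_combination e2

/-- The `∂_t`-component of the structure equation for `[T, Z₁]`. -/
lemma structure_TZ_t : F.opT F.frC x - F.opZ F.frT x +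
      Complex.I * (F.frA x * conj (F.frX x) - F.frB x * F.frX x) =
    F.connT x * F.frC x - F.tors x * conj (F.frC x) := by
  have h2 := sqrt_two_cast_ne_zero
  have h22 := sqrt_two_sq
  obtain ⟨ha, hb, hc, hX, ht⟩ := F.contDiffAt_frame hx
  obtain ⟨s1, s2⟩ := F.structure_TZ hx
  have hXc : ContDiffAt ℝ ∞ (fun y => conj (F.frX y)) x :=
    Complex.conjCLE.contDiff.contDiffAt.comp x hX
  have sz := smoothAt_heis.2 (contDiffAt_coordZ x)
  have szb : SmoothAt (fun y : Heis => conj y.1) x := sz.conj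
  have sa := smoothAt_heis.2 ha
  have sb := smoothAt_heis.2 hb
  have sc := smoothAt_heis.2 hc
  have sX := smoothAt_heis.2 hX
  have sXc := smoothAt_heis.2 hXc
  have st := smoothAt_heis.2 ht
  have e1 := F.comm_opT_opZ contDiffAt_coordT hx
  have z1 : F.opZ (fun y => (y.2 : ℂ)) = fun y => F.frC y +
      Complex.I / (√2 : ℝ) * (conj y.1 * F.frA y - y.1 * F.frB y) := funext fun y =>
    along_coordT _ _ _ y
  have z2 : F.opT (fun y => (y.2 : ℂ)) = fun y => F.frT y +
      Complex.I / (√2 : ℝ) * (conj y.1 * F.frX y - y.1 * conj (F.frX y)) := funext fun y =>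
    along_coordT _ _ _ y
  have z3 : F.opZbar (fun y => (y.2 : ℂ)) x = conj (F.frC x) +
      Complex.I / (√2 : ℝ) * (conj x.1 * conj (F.frB x) - x.1 * conj (F.frA x)) :=
    along_coordT _ _ _ x
  have dz : ∀ a b c : Heis → ℂ, along a b c (fun y => y.1) x = a x / (√2 : ℝ) := fun a b c =>
    along_coordZ a b c x
  have dzb : ∀ a b c : Heis → ℂ, along a b c (fun y => conj y.1) x = b x / (√2 : ℝ) :=
    fun a b c => along_coordZbar a b c x
  have p1 : F.opT (fun y => y.1) x = F.frX x / (√2 : ℝ) := dz _ _ _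
  have p2 : F.opT (fun y => conj y.1) x = conj (F.frX x) / (√2 : ℝ) := dzb _ _ _
  have p3 : F.opZ (fun y => y.1) x = F.frA x / (√2 : ℝ) := dz _ _ _
  have p4 : F.opZ (fun y => conj y.1) x = F.frB x / (√2 : ℝ) := dzb _ _ _
  rw [z1, z2, z3, (F.isDer_opT x).add sc (((szb.mul sa).sub (sz.mul sb)).const_mul _),
    (F.isDer_opT x).const_mul _ ((szb.mul sa).sub (sz.mul sb)),
    (F.isDer_opT x).sub (szb.mul sa) (sz.mul sb), (F.isDer_opT x).mul szb sa,
    (F.isDer_opT x).mul sz sb,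
    (F.isDer_opZ x).add st (((szb.mul sX).sub (sz.mul sXc)).const_mul _),
    (F.isDer_opZ x).const_mul _ ((szb.mul sX).sub (sz.mul sXc)),
    (F.isDer_opZ x).sub (szb.mul sX) (sz.mul sXc), (F.isDer_opZ x).mul szb sX,
    (F.isDer_opZ x).mul sz sXc, p1, p2, p3, p4] at e1
  have hinv : (1 / ((√2 : ℝ) : ℂ)) * (1 / ((√2 : ℝ) : ℂ)) = 1 / 2 := by
    field_simp
    linear_combination -h22
  linear_combination e1 - Complex.I / (√2 : ℝ) * (conj x.1 * s1 - x.1 * s2) -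
    2 * Complex.I * (F.frA x * conj (F.frX x) - F.frB x * F.frX x) * hinv

/-- The `Z`-component of the structure equation for `[Z₁, Z_1̄]`. -/
lemma structure_ZZbar : F.opZ (fun y => conj (F.frB y)) x - F.opZbar F.frA x =
    -Complex.I * F.frX x - F.conn x * F.frA x + conj (F.conn x) * conj (F.frB x) := by
  have h2 := sqrt_two_cast_ne_zero
  obtain ⟨ha, hb, hc, hX, ht⟩ := F.contDiffAt_frame hx
  have hbc : ContDiffAt ℝ ∞ (fun y => conj (F.frB y)) x :=
    Complex.conjCLE.contDiff.contDiffAt.comp x hb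
  have e1 := F.comm_opZ_opZbar contDiffAt_coordZ hx
  have z1 : F.opZ (fun y => y.1) = fun y => (1 / (√2 : ℝ) : ℂ) * F.frA y := funext fun y =>
    (along_coordZ _ _ _ y).trans (by ring)
  have z2 : F.opT (fun y => y.1) = fun y => (1 / (√2 : ℝ) : ℂ) * F.frX y := funext fun y =>
    (along_coordZ _ _ _ y).trans (by ring)
  have z3 : F.opZbar (fun y => y.1) = fun y => (1 / (√2 : ℝ) : ℂ) * conj (F.frB y) :=
    funext fun y => (along_coordZ _ _ _ y).trans (by ring)
  rw [z1, z2, z3, (F.isDer_opZbar x).const_mul _ (smoothAt_heis.2 ha),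
    (F.isDer_opZ x).const_mul _ (smoothAt_heis.2 hbc)] at e1
  field_simp at e1
  linear_combination e1

end AsymptoticallyFlat

/-! ### Asymptotics of the frame -/

/-- The order of a derivative along `a Z + b Z̄ + c ∂_t`. -/
lemma IsSymbolO.along {a b c f : Heis → ℂ} {m k l : ℝ} (ha : IsSymbolO m a) (hb : IsSymbolO m b)
    (hc : IsSymbolO (m + 1) c) (hf : IsSymbolO k f) (h : m + k - 1 ≤ l := by norm_num) :
    IsSymbolO l (along a b c f) :=
  ((ha.mul (hf.hZ le_rfl) (by linarith)).add (hb.mul (hf.hZbar le_rfl) (by linarith))).add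
    (hc.mul (hf.hDt le_rfl) (by linarith))

namespace AsymptoticallyFlat

variable {N : Type*} [TopologicalSpace N] [ChartedSpace Heis N] [IsManifold IH ∞ N]
  [MeasurableSpace N] {S : Pseudohermitian N} (F : AsymptoticallyFlat S) {x : Heis}

/-- The leading perturbation `4 π A ρ⁻²` of the contact form. -/
def pert (x : Heis) : ℂ := 4 * (Real.pi : ℂ) * (F.A : ℂ) * ((rho x ^ (-2 : ℝ) : ℝ) : ℂ)

lemma isHomog_pert : IsHomog (-2) F.pert := by
  obtain ⟨h1, h2⟩ := isHomog_rho_rpow (-2)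
  refine ⟨fun x hx => contDiffAt_const.mul (h1 x hx), fun r hr x hx => ?_⟩
  have h3 := h2 r hr x hx
  unfold pert
  beta_reduce at h3
  rw [h3]
  ring

lemma isSymbolO_pert : IsSymbolO (-2) F.pert := F.isHomog_pert.isSymbolO

lemma conj_pert (x : Heis) : conj (F.pert x) = F.pert x := by
  simp [pert, map_ofNat]

lemma theta_t : IsSymbolO (-3) fun x => F.coTheta x hT - (1 + F.pert x) := F.θ_t

lemma theta_Z : IsSymbolO (-3) fun x => onZ (F.coTheta x) x := by
  refine (F.θ_z.const_mul (1 / (√2 : ℝ))).congr (Eventually.of_forall fun x => ?_)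
  have h2 := sqrt_two_cast_ne_zero
  change (1 / (√2 : ℝ) : ℂ) * (1 / 2 * (F.coTheta x (hX x) - Complex.I * F.coTheta x (hY x))) = _
  simp only [onZ]
  field_simp

lemma theta_Zbar : IsSymbolO (-3) fun x => onZbar (F.coTheta x) x :=
  F.theta_Z.star.congr (Eventually.of_forall fun x => (F.onZbar_coTheta x).symm)

lemma theta₁_t : IsSymbolO (-3) fun x => F.coTheta₁ x hT := F.θ₁_t

lemma theta₁_Zbar : IsSymbolO (-4) fun x => onZbar (F.coTheta₁ x) x := by
  refine (F.θ₁_zbar.const_mul (1 / (√2 : ℝ))).congr (Eventually.of_forall fun x => ?_)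
  have h2 := sqrt_two_cast_ne_zero
  change (1 / (√2 : ℝ) : ℂ) * (1 / 2 * (F.coTheta₁ x (hX x) + Complex.I * F.coTheta₁ x (hY x))) = _
  simp only [onZbar]
  field_simp

lemma theta₁_Z : IsSymbolO (-3) fun x => onZ (F.coTheta₁ x) x - (1 + F.pert x / 2) := by
  refine F.θ₁_z.congr (Eventually.of_forall fun x => ?_)
  have h2 := sqrt_two_cast_ne_zero
  change 1 / ((√2 : ℝ) : ℂ) * (1 / 2 * (F.coTheta₁ x (hX x) - Complex.I * F.coTheta₁ x (hY x))) -
    _ = _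
  simp only [onZ, pert]
  field_simp
  ring

/-- The frame, to third order, with `h` for `pert`: `a = 1 - h / 2`, `t = 1 - h`, and the other
components are small. -/
lemma frame_asymptotics : IsSymbolO (-3) (fun x => F.frA x - (1 - F.pert x / 2)) ∧
    IsSymbolO (-4) F.frB ∧ IsSymbolO (-3) F.frC ∧ IsSymbolO (-3) F.frX ∧
    IsSymbolO (-3) (fun x => F.frT x - (1 - F.pert x)) := by
  have hh := F.isSymbolO_pert
  set h := F.pert
  have P0 := F.theta_t
  have P1 := F.theta_Z
  have P2 := F.theta_Zbar
  have Q0 := F.theta₁_t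
  have Q1 := F.theta₁_Z
  have Q2 := F.theta₁_Zbar
  have hE : ∀ᶠ x in atInf, x ∈ F.coords.target := F.eventually_atInf_target
  have E := fun x hx => F.frame_dual (x := x) hx
  have R := fun x hx => F.reeb_dual (x := x) hx
  set p0 := fun x => F.coTheta x hT
  set p1 := fun x => onZ (F.coTheta x) x
  set p2 := fun x => onZbar (F.coTheta x) x
  set q0 := fun x => F.coTheta₁ x hT
  set q1 := fun x => onZ (F.coTheta₁ x) x
  set q2 := fun x => onZbar (F.coTheta₁ x) x
  have one : IsSymbolO 0 fun _ : Heis => (1 : ℂ) := IsSymbolO.const 1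
  have p0m : IsSymbolO (-2) fun x => p0 x - 1 :=
    ((P0.mono (by norm_num)).add hh).congr (Eventually.of_forall fun x => by ring)
  have q1m : IsSymbolO (-2) fun x => q1 x - 1 :=
    ((Q1.mono (by norm_num)).add (hh.const_mul (1 / 2))).congr
      (Eventually.of_forall fun x => by ring)
  have p0O : IsSymbolO 0 p0 := ((p0m.mono (by norm_num)).add one).congr
    (Eventually.of_forall fun x => by ring)
  have q1O : IsSymbolO 0 q1 := ((q1m.mono (by norm_num)).add one).congr
    (Eventually.of_forall fun x => by ring)
  have q1c := q1O.star
  have q1cm : IsSymbolO (-2) fun x => conj (q1 x) - 1 := q1m.star.congr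
    (Eventually.of_forall fun x => by simp)
  have q0c := Q0.star
  have q2c := Q2.star
  -- cofactors of the coframe matrix
  have c11 : IsSymbolO 0 fun x => conj (q1 x) * p0 x - conj (q0 x) * p2 x :=
    (q1c.mul p0O).sub (q0c.mul P2)
  have c12 : IsSymbolO (-4) fun x => -(conj (q2 x) * p0 x - conj (q0 x) * p1 x) :=
    ((q2c.mul p0O).sub (q0c.mul P1)).neg
  have c13 : IsSymbolO (-3) fun x => conj (q2 x) * p2 x - conj (q1 x) * p1 x :=
    (q2c.mul P2).sub (q1c.mul P1)
  have c31 : IsSymbolO (-3) fun x => q2 x * conj (q0 x) - q0 x * conj (q1 x) :=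
    (Q2.mul q0c).sub (Q0.mul q1c)
  have c33 : IsSymbolO 0 fun x => q1 x * conj (q1 x) - q2 x * conj (q2 x) :=
    (q1O.mul q1c).sub (Q2.mul q2c)
  set Δ : Heis → ℂ := fun x => q1 x * (conj (q1 x) * p0 x - conj (q0 x) * p2 x) +
    q2 x * (-(conj (q2 x) * p0 x - conj (q0 x) * p1 x)) +
    q0 x * (conj (q2 x) * p2 x - conj (q1 x) * p1 x) with hΔ
  have Δm : IsSymbolO (-2) fun x => Δ x - 1 := by
    have t1 : IsSymbolO (-2) fun x => (q1 x - 1) * (conj (q1 x) * p0 x) :=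
      q1m.mul (q1c.mul p0O : IsSymbolO 0 _)
    have t2 : IsSymbolO (-2) fun x => (conj (q1 x) - 1) * p0 x := q1cm.mul p0O
    have t3 : IsSymbolO (-2) fun x => q1 x * (conj (q0 x) * p2 x) :=
      q1O.mul (q0c.mul P2 : IsSymbolO (-6) _)
    have t4 : IsSymbolO (-2) fun x => q2 x * (-(conj (q2 x) * p0 x - conj (q0 x) * p1 x)) :=
      Q2.mul c12
    have t5 : IsSymbolO (-2) fun x => q0 x * (conj (q2 x) * p2 x - conj (q1 x) * p1 x) :=
      Q0.mul c13
    refine (((((t1.add t2).add p0m).sub t3).add t4).add t5).congr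
      (Eventually.of_forall fun x => ?_)
    simp only [hΔ]
    ring
  have Δi : IsSymbolO 0 fun x => (Δ x)⁻¹ := Δm.inv (by norm_num)
  have Δ0 : ∀ᶠ x in atInf, Δ x ≠ 0 := by
    have := (Δm.tendsto_zero (by norm_num)).add_const 1
    simp only [sub_add_cancel, zero_add] at this
    exact this.eventually_ne one_ne_zero
  have solve : ∀ (u : Heis → ℂ) (c : Heis → ℂ) (k : ℝ), IsSymbolO k c →
      (∀ x ∈ F.coords.target, u x * Δ x = c x) → IsSymbolO k u := fun u c k hc hu => by
    refine (Δi.mul hc (by simp)).congr ?_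
    filter_upwards [hE, Δ0] with x hx hx0
    rw [← hu x hx]
    field_simp
  have aO : IsSymbolO 0 F.frA := solve _ _ 0 c11 fun x hx => by
    obtain ⟨e1, e2, e3⟩ := E x hx
    simp only [hΔ]
    linear_combination (conj (q1 x) * p0 x - conj (q0 x) * p2 x) * e2 -
      (q2 x * p0 x - q0 x * p2 x) * e3 + (q2 x * conj (q0 x) - q0 x * conj (q1 x)) * e1
  have bO : IsSymbolO (-4) F.frB := solve _ _ (-4) c12 fun x hx => by
    obtain ⟨e1, e2, e3⟩ := E x hx
    simp only [hΔ]
    linear_combination (-(conj (q2 x) * p0 x - conj (q0 x) * p1 x)) * e2 +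
      (q1 x * p0 x - q0 x * p1 x) * e3 - (q1 x * conj (q0 x) - q0 x * conj (q2 x)) * e1
  have cO : IsSymbolO (-3) F.frC := solve _ _ (-3) c13 fun x hx => by
    obtain ⟨e1, e2, e3⟩ := E x hx
    simp only [hΔ]
    linear_combination (conj (q2 x) * p2 x - conj (q1 x) * p1 x) * e2 -
      (q1 x * p2 x - q2 x * p1 x) * e3 + (q1 x * conj (q1 x) - q2 x * conj (q2 x)) * e1
  have xO : IsSymbolO (-3) F.frX := solve _ _ (-3) c31 fun x hx => by
    obtain ⟨e1, e2, e3⟩ := R x hx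
    simp only [hΔ]
    linear_combination (conj (q1 x) * p0 x - conj (q0 x) * p2 x) * e2 -
      (q2 x * p0 x - q0 x * p2 x) * e3 + (q2 x * conj (q0 x) - q0 x * conj (q1 x)) * e1
  have q1i : IsSymbolO 0 fun x => (q1 x)⁻¹ := q1m.inv (by norm_num)
  have p0i : IsSymbolO 0 fun x => (p0 x)⁻¹ := p0m.inv (by norm_num)
  have q10 : ∀ᶠ x in atInf, q1 x ≠ 0 := by
    have := (q1m.tendsto_zero (by norm_num)).add_const 1
    simp only [sub_add_cancel, zero_add] at this
    exact this.eventually_ne one_ne_zero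
  have p00 : ∀ᶠ x in atInf, p0 x ≠ 0 := by
    have := (p0m.tendsto_zero (by norm_num)).add_const 1
    simp only [sub_add_cancel, zero_add] at this
    exact this.eventually_ne one_ne_zero
  have hO : IsSymbolO 0 fun x => 1 - h x / 2 :=
    (one.sub ((hh.const_mul (1 / 2)).mono (by norm_num))).congr
      (Eventually.of_forall fun x => by ring)
  have hO' : IsSymbolO 0 fun x => 1 - h x := one.sub (hh.mono (by norm_num))
  have h2 : IsSymbolO (-3) fun x => h x * h x := hh.mul hh
  refine ⟨?_, bO, cO, xO, ?_⟩
  · have s1 : IsSymbolO (-3) fun x => F.frB x * q2 x := bO.mul Q2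
    have s2 : IsSymbolO (-3) fun x => F.frC x * q0 x := cO.mul Q0
    have s3 : IsSymbolO (-3) fun x => (1 - h x / 2) * (q1 x - (1 + h x / 2)) := hO.mul Q1
    refine (q1i.mul ((((h2.const_mul (1 / 4)).sub s1).sub s2).sub s3)
      (by norm_num : (0 : ℝ) + -3 ≤ -3)).congr ?_
    filter_upwards [hE, q10] with x hx hx0
    obtain ⟨e1, e2, e3⟩ := E x hx
    rw [inv_mul_eq_iff_eq_mul₀ hx0]
    linear_combination -e2
  · have s1 : IsSymbolO (-3) fun x => F.frX x * p1 x := xO.mul P1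
    have s2 : IsSymbolO (-3) fun x => conj (F.frX x) * p2 x := xO.star.mul P2
    have s3 : IsSymbolO (-3) fun x => (1 - h x) * (p0 x - (1 + h x)) := hO'.mul P0
    refine (p0i.mul (((h2.sub s1).sub s2).sub s3) (by norm_num : (0 : ℝ) + -3 ≤ -3)).congr ?_
    filter_upwards [hE, p00] with x hx hx0
    obtain ⟨e1, e2, e3⟩ := R x hx
    rw [inv_mul_eq_iff_eq_mul₀ hx0]
    linear_combination -e1

end AsymptoticallyFlat

/-! ### Asymptotics of the connection and the torsion -/

namespace AsymptoticallyFlat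

variable {N : Type*} [TopologicalSpace N] [ChartedSpace Heis N] [IsManifold IH ∞ N]
  [MeasurableSpace N] {S : Pseudohermitian N} (F : AsymptoticallyFlat S) {x : Heis}
  {f : Heis → ℂ} {k l : ℝ}

lemma frA_sub_one : IsSymbolO (-2) fun x => F.frA x - 1 :=
  ((F.frame_asymptotics.1.mono (by norm_num)).sub (F.isSymbolO_pert.const_mul (1 / 2))).congr
    (Eventually.of_forall fun x => by ring)

lemma frT_sub_one : IsSymbolO (-2) fun x => F.frT x - 1 :=
  ((F.frame_asymptotics.2.2.2.2.mono (by norm_num)).sub F.isSymbolO_pert).congr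
    (Eventually.of_forall fun x => by ring)

lemma isSymbolO_frA : IsSymbolO 0 F.frA :=
  ((F.frA_sub_one.mono (by norm_num)).add (IsSymbolO.const 1)).congr
    (Eventually.of_forall fun x => by ring)

lemma isSymbolO_frT : IsSymbolO 0 F.frT :=
  ((F.frT_sub_one.mono (by norm_num)).add (IsSymbolO.const 1)).congr
    (Eventually.of_forall fun x => by ring)

lemma isSymbolO_frB : IsSymbolO (-4) F.frB := F.frame_asymptotics.2.1

lemma isSymbolO_frC : IsSymbolO (-3) F.frC := F.frame_asymptotics.2.2.1

lemma isSymbolO_frX : IsSymbolO (-3) F.frX := F.frame_asymptotics.2.2.2.1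

lemma isSymbolO_opZ (hf : IsSymbolO k f) (h : k - 1 ≤ l := by norm_num) :
    IsSymbolO l (F.opZ f) :=
  IsSymbolO.along F.isSymbolO_frA (F.isSymbolO_frB.mono (by norm_num))
    (F.isSymbolO_frC.mono (by norm_num)) hf (by linarith)

lemma isSymbolO_opZbar (hf : IsSymbolO k f) (h : k - 1 ≤ l := by norm_num) :
    IsSymbolO l (F.opZbar f) :=
  IsSymbolO.along (m := 0) (F.isSymbolO_frB.star.mono (by norm_num)) F.isSymbolO_frA.star
    (F.isSymbolO_frC.star.mono (by norm_num)) hf (by linarith)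

lemma isSymbolO_opT (hf : IsSymbolO k f) (h : k - 2 ≤ l := by norm_num) :
    IsSymbolO l (F.opT f) :=
  IsSymbolO.along (m := -1) (F.isSymbolO_frX.mono (by norm_num))
    (F.isSymbolO_frX.star.mono (by norm_num)) (F.isSymbolO_frT.mono (by norm_num)) hf (by linarith)

lemma isSymbolO_opZ_sub (hf : IsSymbolO k f) (h : k - 3 ≤ l := by norm_num) :
    IsSymbolO l fun x => F.opZ f x - hZ f x :=
  (IsSymbolO.along (m := -2) (F.frA_sub_one) (F.isSymbolO_frB.mono (by norm_num))
    (F.isSymbolO_frC.mono (by norm_num)) hf (by linarith)).congr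
    (Eventually.of_forall fun x => by simp only [opZ, CRMass.along]; ring)

lemma isSymbolO_opZbar_sub (hf : IsSymbolO k f) (h : k - 3 ≤ l := by norm_num) :
    IsSymbolO l fun x => F.opZbar f x - hZbar f x :=
  (IsSymbolO.along (m := -2) (F.isSymbolO_frB.star.mono (by norm_num)) (F.frA_sub_one.star)
    (F.isSymbolO_frC.star.mono (by norm_num)) hf (by linarith)).congr
    (Eventually.of_forall fun x => by
      simp only [opZbar, CRMass.along, map_sub, map_one]; ring)

lemma isSymbolO_opT_sub (hf : IsSymbolO k f) (h : k - 4 ≤ l := by norm_num) :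
    IsSymbolO l fun x => F.opT f x - hDt f x :=
  (IsSymbolO.along (m := -3) F.isSymbolO_frX F.isSymbolO_frX.star
    (F.frT_sub_one.mono (by norm_num)) hf (by linarith)).congr
    (Eventually.of_forall fun x => by simp only [opT, CRMass.along]; ring)

lemma sub_const_congr {D : (Heis → ℂ) → Heis → ℂ} (hD : ∀ x, IsDer x fun f => D f x)
    (hf : SmoothInf f) (c : ℂ) : (D fun x => f x - c) =ᶠ[atInf] D f := by
  filter_upwards [hf] with x hx
  rw [(hD x).sub (smoothAt_heis.2 hx) (smoothAt_const c), (hD x).const, sub_zero]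

/-- `aā - bb̄`, the determinant of the horizontal part of the frame. -/
lemma horizontal_det : IsSymbolO (-2) fun x =>
    (F.frA x * conj (F.frA x) - F.frB x * conj (F.frB x)) - 1 := by
  have t1 : IsSymbolO (-2) fun x => (F.frA x - 1) * conj (F.frA x) :=
    F.frA_sub_one.mul F.isSymbolO_frA.star
  have t2 : IsSymbolO (-2) fun x => F.frB x * conj (F.frB x) :=
    F.isSymbolO_frB.mul F.isSymbolO_frB.star
  refine ((t1.add F.frA_sub_one.star).sub t2).congr (Eventually.of_forall fun x => ?_)
  simp only [map_sub, map_one]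
  ring

/-- Division by the determinant of the horizontal part of the frame. -/
lemma solve_horizontal {u c : Heis → ℂ} (hc : IsSymbolO k c) (hu : ∀ᶠ x in atInf,
    u x * (F.frA x * conj (F.frA x) - F.frB x * conj (F.frB x)) = c x) : IsSymbolO k u := by
  have hi := F.horizontal_det.inv (by norm_num)
  have h0 : ∀ᶠ x in atInf, F.frA x * conj (F.frA x) - F.frB x * conj (F.frB x) ≠ 0 := by
    have := (F.horizontal_det.tendsto_zero (by norm_num)).add_const 1
    simp only [sub_add_cancel, zero_add] at this
    exact this.eventually_ne one_ne_zero
  refine (hi.mul hc (by simp)).congr ?_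
  filter_upwards [hu, h0] with x hx hx0
  rw [← hx]
  field_simp

lemma isSymbolO_opT_frA : IsSymbolO (-4) (F.opT F.frA) :=
  (F.isSymbolO_opT F.frA_sub_one).congr (sub_const_congr F.isDer_opT F.isSymbolO_frA.smooth 1)

/-- The structure equations for `[T, Z₁]` are solved for `ω(T)` and `A₁₁` by Cramer's rule. -/
lemma isSymbolO_connT : IsSymbolO (-4) F.connT := by
  have t1 : IsSymbolO (-4) fun x => conj (F.frA x) * (F.opT F.frA x - F.opZ F.frX x) :=
    F.isSymbolO_frA.star.mul (F.isSymbolO_opT_frA.sub (F.isSymbolO_opZ F.isSymbolO_frX))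
  have t2 : IsSymbolO (-4) fun x => conj (F.frB x) *
      (F.opT F.frB x - F.opZ (fun y => conj (F.frX y)) x) :=
    F.isSymbolO_frB.star.mul ((F.isSymbolO_opT F.isSymbolO_frB (l := -4)).sub
      (F.isSymbolO_opZ F.isSymbolO_frX.star))
  refine F.solve_horizontal (t1.sub t2) ?_
  filter_upwards [F.eventually_atInf_target] with x hx
  obtain ⟨s1, s2⟩ := F.structure_TZ hx
  linear_combination -conj (F.frA x) * s1 + conj (F.frB x) * s2

lemma tors_mul_det (hx : x ∈ F.coords.target) :
    F.tors x * (F.frA x * conj (F.frA x) - F.frB x * conj (F.frB x)) =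
      F.frA x * (F.opZ (fun y => conj (F.frX y)) x - F.opT F.frB x) +
        F.frB x * (F.opT F.frA x - F.opZ F.frX x) := by
  obtain ⟨s1, s2⟩ := F.structure_TZ hx
  linear_combination F.frA x * s2 - F.frB x * s1

lemma isSymbolO_tors : IsSymbolO (-4) F.tors := by
  have t1 : IsSymbolO (-4) fun x => F.frB x * (F.opT F.frA x - F.opZ F.frX x) :=
    F.isSymbolO_frB.mul (F.isSymbolO_opT_frA.sub (F.isSymbolO_opZ F.isSymbolO_frX))
  have t2 : IsSymbolO (-4) fun x => F.frA x *
      (F.opZ (fun y => conj (F.frX y)) x - F.opT F.frB x) :=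
    F.isSymbolO_frA.mul ((F.isSymbolO_opZ F.isSymbolO_frX.star (l := -4)).sub
      (F.isSymbolO_opT F.isSymbolO_frB))
  refine F.solve_horizontal (t2.add t1) ?_
  filter_upwards [F.eventually_atInf_target] with x hx using F.tors_mul_det hx

lemma isSymbolO_opZ_frT : IsSymbolO (-4) fun x => F.opZ F.frT x + hZ F.pert x := by
  have h0 := F.frame_asymptotics.2.2.2.2
  have t1 : IsSymbolO (-4) (F.opZ fun x => F.frT x - (1 - F.pert x)) := F.isSymbolO_opZ h0
  have t2 : IsSymbolO (-4) fun x => F.opZ F.pert x - hZ F.pert x :=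
    F.isSymbolO_opZ_sub F.isSymbolO_pert
  refine (t1.sub t2).congr ?_
  filter_upwards [F.isSymbolO_frT.smooth, F.isSymbolO_pert.smooth] with x h1 h2
  have sp := smoothAt_heis.2 h2
  rw [(F.isDer_opZ x).sub (smoothAt_heis.2 h1) ((smoothAt_const 1).sub sp),
    (F.isDer_opZ x).sub (smoothAt_const 1) sp, (F.isDer_opZ x).const]
  ring

/-- The Reeb field, to fourth order: `x̄ = i Z h`. -/
lemma conj_frX_asymptotics : IsSymbolO (-4) fun x => conj (F.frX x) - Complex.I * hZ F.pert x := by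
  have t1 : IsSymbolO (-4) fun x => F.connT x * F.frC x := F.isSymbolO_connT.mul F.isSymbolO_frC
  have t2 : IsSymbolO (-4) fun x => F.tors x * conj (F.frC x) :=
    F.isSymbolO_tors.mul F.isSymbolO_frC.star
  have t3 : IsSymbolO (-4) fun x => F.frB x * F.frX x := F.isSymbolO_frB.mul F.isSymbolO_frX
  have t4 : IsSymbolO (-4) (F.opT F.frC) := F.isSymbolO_opT F.isSymbolO_frC
  have t5 : IsSymbolO (-4) fun x => (F.frA x - 1) * conj (F.frX x) :=
    F.frA_sub_one.mul F.isSymbolO_frX.star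
  refine ((((((t1.sub t2).add (t3.const_mul Complex.I)).sub t4).add
    F.isSymbolO_opZ_frT).sub (t5.const_mul Complex.I)).const_mul (-Complex.I)).congr ?_
  filter_upwards [F.eventually_atInf_target] with x hx
  have s := F.structure_TZ_t hx
  linear_combination Complex.I * s - conj (F.frX x) * Complex.I_sq

lemma hZbar_pert : ∀ᶠ x in atInf, conj (hZ F.pert x) = hZbar F.pert x := by
  filter_upwards [F.isSymbolO_pert.smooth] with x hx
  rw [← hZbar_conj hx]
  simp only [F.conj_pert]

lemma frX_asymptotics : IsSymbolO (-4) fun x => F.frX x + Complex.I * hZbar F.pert x := by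
  refine F.conj_frX_asymptotics.star.congr ?_
  filter_upwards [F.hZbar_pert] with x hx
  simp only [map_sub, map_mul, Complex.conj_conj, Complex.conj_I, hx]
  ring

/-- The torsion: `A₁₁ = i ZZh`, from the derivative along `Z₁` of the Reeb field. -/
lemma tors_asymptotics : IsSymbolO (-5) fun x => F.tors x - Complex.I * hZ (hZ F.pert) x := by
  have hZ1 : IsSymbolO (-3) (hZ F.pert) := F.isSymbolO_pert.hZ
  have hZZ : IsSymbolO (-4) (hZ (hZ F.pert)) := hZ1.hZ
  have t1 : IsSymbolO (-5) fun x => F.frB x * (F.opT F.frA x - F.opZ F.frX x) :=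
    F.isSymbolO_frB.mul (F.isSymbolO_opT_frA.sub (F.isSymbolO_opZ F.isSymbolO_frX))
  have t2 : IsSymbolO (-5) fun x => F.frA x * F.opT F.frB x :=
    F.isSymbolO_frA.mul (F.isSymbolO_opT F.isSymbolO_frB (l := -5))
  have t3 : IsSymbolO (-5) fun x => (F.frA x - 1) * F.opZ (fun y => conj (F.frX y)) x :=
    F.frA_sub_one.mul (F.isSymbolO_opZ F.isSymbolO_frX.star (l := -4))
  have t4 : IsSymbolO (-5) (F.opZ fun x => conj (F.frX x) - Complex.I * hZ F.pert x) :=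
    F.isSymbolO_opZ F.conj_frX_asymptotics
  have t5 : IsSymbolO (-5) fun x => F.opZ (hZ F.pert) x - hZ (hZ F.pert) x :=
    F.isSymbolO_opZ_sub hZ1
  have t6 : IsSymbolO (-5) fun x => hZ (hZ F.pert) x *
      ((F.frA x * conj (F.frA x) - F.frB x * conj (F.frB x)) - 1) := hZZ.mul F.horizontal_det
  refine F.solve_horizontal (((((t1.sub t2).add t3).add t4).add (t5.const_mul Complex.I)).sub
    (t6.const_mul Complex.I)) ?_
  filter_upwards [F.eventually_atInf_target, F.isSymbolO_frX.smooth, hZ1.smooth] with x hx h1 h2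
  rw [sub_mul, F.tors_mul_det hx,
    (F.isDer_opZ x).sub (smoothAt_heis.2 h1).conj ((smoothAt_heis.2 h2).const_mul Complex.I),
    (F.isDer_opZ x).const_mul Complex.I (smoothAt_heis.2 h2)]
  ring

lemma isSymbolO_conn : IsSymbolO (-3) F.conn := by
  have r : IsSymbolO (-3) fun x => -Complex.I * F.frX x -
      (F.opZ (fun y => conj (F.frB y)) x - F.opZbar F.frA x) := by
    refine (F.isSymbolO_frX.const_mul (-Complex.I)).sub
        ((F.isSymbolO_opZ F.isSymbolO_frB.star).sub ?_)
    exact (F.isSymbolO_opZbar F.frA_sub_one).congr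
      (sub_const_congr F.isDer_opZbar F.isSymbolO_frA.smooth 1)
  have t1 : IsSymbolO (-3) fun x => conj (F.frA x) * (-Complex.I * F.frX x -
      (F.opZ (fun y => conj (F.frB y)) x - F.opZbar F.frA x)) := F.isSymbolO_frA.star.mul r
  have t2 : IsSymbolO (-3) fun x => conj (F.frB x) * conj (-Complex.I * F.frX x -
      (F.opZ (fun y => conj (F.frB y)) x - F.opZbar F.frA x)) := F.isSymbolO_frB.star.mul r.star
  refine F.solve_horizontal (t1.add t2) ?_
  filter_upwards [F.eventually_atInf_target] with x hx
  have s : -Complex.I * F.frX x - (F.opZ (fun y => conj (F.frB y)) x - F.opZbar F.frA x) =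
      F.conn x * F.frA x - conj (F.conn x) * conj (F.frB x) := by
    linear_combination -F.structure_ZZbar hx
  rw [s]
  simp only [map_sub, map_mul, Complex.conj_conj]
  ring

/-- The connection form: `ω(Z_1̄) = -(3/2) Z̄ h`. -/
lemma conn_asymptotics : IsSymbolO (-4) fun x => F.conn x + 3 / 2 * hZbar F.pert x := by
  have h0 := F.frame_asymptotics.1
  have t1 : IsSymbolO (-4) (F.opZ fun y => conj (F.frB y)) := F.isSymbolO_opZ F.isSymbolO_frB.star
  have t2 : IsSymbolO (-4) (F.opZbar fun x => F.frA x - (1 - F.pert x / 2)) :=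
    F.isSymbolO_opZbar h0
  have t3 : IsSymbolO (-4) fun x => F.opZbar F.pert x - hZbar F.pert x :=
    F.isSymbolO_opZbar_sub F.isSymbolO_pert
  have t4 : IsSymbolO (-4) fun x => conj (F.conn x) * conj (F.frB x) :=
    F.isSymbolO_conn.star.mul F.isSymbolO_frB.star
  have t5 : IsSymbolO (-4) fun x => F.conn x * (F.frA x - 1) :=
    F.isSymbolO_conn.mul F.frA_sub_one
  refine ((((((F.frX_asymptotics.const_mul (-Complex.I)).sub t1).add t2).sub
    (t3.const_mul (1 / 2))).add t4).sub t5).congr ?_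
  filter_upwards [F.eventually_atInf_target, F.isSymbolO_frA.smooth, F.isSymbolO_pert.smooth]
    with x hx h1 h2
  have s := F.structure_ZZbar hx
  have sa := smoothAt_heis.2 h1
  have sp := smoothAt_heis.2 h2
  have e : F.opZbar (fun x => F.frA x - (1 - F.pert x / 2)) x =
      F.opZbar F.frA x + 1 / 2 * F.opZbar F.pert x := by
    have e1 : (fun x => F.frA x - (1 - F.pert x / 2)) =
        fun x => (F.frA x + 1 / 2 * F.pert x) - 1 := funext fun x => by ring
    rw [e1, (F.isDer_opZbar x).sub (sa.add (sp.const_mul _)) (smoothAt_const 1),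
      (F.isDer_opZbar x).add sa (sp.const_mul _), (F.isDer_opZbar x).const_mul _ sp,
      (F.isDer_opZbar x).const, sub_zero]
  rw [e]
  linear_combination -s - hZbar F.pert x * Complex.I_sq

end AsymptoticallyFlat

/-! ### Asymptotics of the fluxes -/

namespace AsymptoticallyFlat

variable {N : Type*} [TopologicalSpace N] [ChartedSpace Heis N] [IsManifold IH ∞ N]
  [MeasurableSpace N] {S : Pseudohermitian N} (F : AsymptoticallyFlat S)
  {x : Heis} {β : N → ℂ} {g : Heis → ℂ} {ε : ℝ}

/-- The leading part of the `Z_1̄`-component of the flux of `β = z̄ + g + ...`. -/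
def leadBar (g : Heis → ℂ) (x : Heis) : ℂ :=
  -((√2 : ℝ) : ℂ) * x.1 * hZ (hZ F.pert) x - 2 * hZ F.pert x +
    (√2 : ℝ) * conj (hZbar (hZbar g) x)

/-- The leading part of the `Z₁`-component of the flux of `β = z̄ + g + ...`. -/
def lead (g : Heis → ℂ) (x : Heis) : ℂ :=
  -hZbar F.pert x - (√2 : ℝ) * Complex.I * conj (hDt g x)

lemma isSymbolO_coordZ : IsSymbolO 1 fun x : Heis => x.1 := isHomog_fst.isSymbolO

lemma hZ_pert_symbol : IsSymbolO (-3) (hZ F.pert) := F.isSymbolO_pert.hZ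

lemma hZbar_pert_symbol : IsSymbolO (-3) (hZbar F.pert) := F.isSymbolO_pert.hZbar

lemma hZ_hZ_pert_symbol : IsSymbolO (-4) (hZ (hZ F.pert)) := F.hZ_pert_symbol.hZ

section

variable (hε₀ : 0 < ε) (hε₁ : ε < 1) (hβ : ∀ q, SmoothAt β q) (hg : IsHomog (-1) g)
  (he : IsSymbolO (-2 + ε) fun x => β (F.coords.symm x) - (conj x.1 + g x))

include hε₀ hε₁ hg he

/-- A derivative of `β`, split according to the expansion of `β`. -/
lemma op_expansion {D : (Heis → ℂ) → Heis → ℂ} (hD : ∀ x, IsDer x fun f => D f x) :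
    ∀ᶠ x in atInf, D (fun x => β (F.coords.symm x)) x = D (fun x => conj x.1) x + D g x +
      D (fun x => β (F.coords.symm x) - (conj x.1 + g x)) x := by
  filter_upwards [he.smooth, hg.isSymbolO.smooth] with x h1 h2
  have sz : SmoothAt (fun y : Heis => conj y.1) x := (smoothAt_heis.2 (contDiffAt_coordZ x)).conj
  have s1 := smoothAt_heis.2 h1
  have s2 := smoothAt_heis.2 h2
  rw [← (hD x).add sz s2, ← (hD x).add (sz.add s2) s1]
  exact (hD x).congr (Eventually.of_forall fun y => by ring)

lemma opZbar_asymptotics : IsSymbolO (-3 + ε) fun x => F.opZbar (fun x => β (F.coords.symm x)) x -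
    (1 / (√2 : ℝ) - 1 / (2 * (√2 : ℝ)) * F.pert x + hZbar g x) := by
  have t1 := F.frame_asymptotics.1.star.const_mul (1 / (√2 : ℝ))
  have t2 : IsSymbolO (-3 + ε) fun x => F.opZbar g x - hZbar g x :=
    F.isSymbolO_opZbar_sub hg.isSymbolO (by linarith)
  have t3 : IsSymbolO (-3 + ε) (F.opZbar fun x => β (F.coords.symm x) - (conj x.1 + g x)) :=
    F.isSymbolO_opZbar he (by linarith)
  refine (((t1.mono (by linarith)).add t2).add t3).congr ?_
  filter_upwards [F.op_expansion hε₀ hε₁ hg he F.isDer_opZbar] with x hx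
  have hz : F.opZbar (fun x => conj x.1) x = conj (F.frA x) / (√2 : ℝ) := along_coordZbar _ _ _ x
  rw [hx, hz]
  simp only [map_sub, map_one, map_div₀, F.conj_pert, map_ofNat]
  have h2 := sqrt_two_cast_ne_zero
  field_simp
  ring

lemma opZbar_sub : IsSymbolO (-2) fun x =>
    F.opZbar (fun x => β (F.coords.symm x)) x - 1 / (√2 : ℝ) := by
  have t1 : IsSymbolO (-2) (hZbar g) := hg.isSymbolO.hZbar
  refine ((((F.opZbar_asymptotics hε₀ hε₁ hg he).mono (by linarith)).sub
    (F.isSymbolO_pert.const_mul (1 / (2 * (√2 : ℝ))))).add t1).congr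
    (Eventually.of_forall fun x => by ring)

lemma isSymbolO_opZbar_beta : IsSymbolO 0 (F.opZbar fun x => β (F.coords.symm x)) :=
  (((F.opZbar_sub hε₀ hε₁ hg he).mono (by norm_num)).add (IsSymbolO.const (1 / (√2 : ℝ)))).congr
    (Eventually.of_forall fun x => by ring)

lemma isSymbolO_opZ_beta : IsSymbolO (-2) (F.opZ fun x => β (F.coords.symm x)) := by
  have t1 := (F.isSymbolO_frB.const_mul (1 / (√2 : ℝ))).mono (by norm_num : (-4 : ℝ) ≤ -2)
  have t2 : IsSymbolO (-2) (F.opZ g) := F.isSymbolO_opZ hg.isSymbolO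
  have t3 : IsSymbolO (-2) (F.opZ fun x => β (F.coords.symm x) - (conj x.1 + g x)) :=
    F.isSymbolO_opZ he (by linarith)
  refine ((t1.add t2).add t3).congr ?_
  filter_upwards [F.op_expansion hε₀ hε₁ hg he F.isDer_opZ] with x hx
  have hz : F.opZ (fun x => conj x.1) x = F.frB x / (√2 : ℝ) := along_coordZbar _ _ _ x
  rw [hx, hz]
  ring

/-- The Reeb field has a component of order `-3` along `Z̄`, which contributes on `z̄`. -/
lemma opT_asymptotics : IsSymbolO (-4 + ε) fun x => F.opT (fun x => β (F.coords.symm x)) x -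
    (Complex.I / (√2 : ℝ) * hZ F.pert x + hDt g x) := by
  have t1 := F.conj_frX_asymptotics.const_mul (1 / (√2 : ℝ))
  have t2 : IsSymbolO (-4 + ε) fun x => F.opT g x - hDt g x :=
    F.isSymbolO_opT_sub hg.isSymbolO (by linarith)
  have t3 : IsSymbolO (-4 + ε) (F.opT fun x => β (F.coords.symm x) - (conj x.1 + g x)) :=
    F.isSymbolO_opT he (by linarith)
  refine (((t1.mono (by linarith)).add t2).add t3).congr ?_
  filter_upwards [F.op_expansion hε₀ hε₁ hg he F.isDer_opT] with x hx
  have hz : F.opT (fun x => conj x.1) x = conj (F.frX x) / (√2 : ℝ) := along_coordZbar _ _ _ x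
  rw [hx, hz]
  ring

lemma beta_bound : IsSymbolO (-1) fun x => β (F.coords.symm x) - conj x.1 :=
  ((he.mono (by linarith)).add hg.isSymbolO).congr (Eventually.of_forall fun x => by ring)

include hβ

lemma hess_symm (hx : x ∈ F.coords.target) : F.frame.hess₁bar₁bar β (F.coords.symm x) =
    F.opZbar (F.opZbar fun x => β (F.coords.symm x)) x +
      F.conn x * F.opZbar (fun x => β (F.coords.symm x)) x := by
  have hb : ∀ q ∈ F.coords.source, SmoothAt β q := fun q _ => hβ q
  have h1 := F.D₁bar_symm hx (F.frame.smoothAt_D₁bar (F.mem_source hx) hb)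
  have h2 := F.D₁bar_symm hx (hβ _)
  rw [UnitaryFrame.hess₁bar₁bar, h1, h2]
  have h3 := (F.isDer_opZbar x).congr (f := fun y => F.frame.D₁bar β (F.coords.symm y))
    (g := F.opZbar fun x => β (F.coords.symm x)) (by
      filter_upwards [F.eventually_target hx] with y hy using F.D₁bar_symm hy (hβ _))
  rw [← h3]
  rfl

/-- The frame correction `-h/2` and the connection term `-(3/2) Z̄h`, both acting on `Z̄ z̄ = 1/√2`,
combine to `-√2 Z̄h`. -/
lemma hess_asymptotics : IsSymbolO (-4 + ε) fun x => F.frame.hess₁bar₁bar β (F.coords.symm x) -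
    (-((√2 : ℝ) : ℂ) * hZbar F.pert x + hZbar (hZbar g) x) := by
  have hgz : IsSymbolO (-2) (hZbar g) := hg.isSymbolO.hZbar
  have t1 : IsSymbolO (-4 + ε) (F.opZbar fun x => F.opZbar (fun x => β (F.coords.symm x)) x -
      (1 / (√2 : ℝ) - 1 / (2 * (√2 : ℝ)) * F.pert x + hZbar g x)) :=
    F.isSymbolO_opZbar (F.opZbar_asymptotics hε₀ hε₁ hg he) (by linarith)
  have t2 : IsSymbolO (-4 + ε) fun x => F.opZbar F.pert x - hZbar F.pert x :=
    F.isSymbolO_opZbar_sub F.isSymbolO_pert (by linarith)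
  have t3 : IsSymbolO (-4 + ε) fun x => F.opZbar (hZbar g) x - hZbar (hZbar g) x :=
    F.isSymbolO_opZbar_sub hgz (by linarith)
  have t4 : IsSymbolO (-4 + ε) fun x => F.conn x *
      (F.opZbar (fun x => β (F.coords.symm x)) x - 1 / (√2 : ℝ)) :=
    F.isSymbolO_conn.mul (F.opZbar_sub hε₀ hε₁ hg he) (by linarith)
  have t5 := (F.conn_asymptotics.const_mul (1 / (√2 : ℝ))).mono (by linarith : -4 ≤ -4 + ε)
  refine ((((t1.sub (t2.const_mul (1 / (2 * (√2 : ℝ))))).add t3).add t4).add t5).congr ?_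
  filter_upwards [F.eventually_atInf_target, F.isSymbolO_pert.smooth, hgz.smooth,
    (F.isSymbolO_opZbar_beta hε₀ hε₁ hg he).smooth] with x hx h1 h2 h3
  have s1 := smoothAt_heis.2 h1
  have s2 := smoothAt_heis.2 h2
  have s3 := smoothAt_heis.2 h3
  have d := F.isDer_opZbar x
  rw [F.hess_symm hε₀ hε₁ hβ hg he hx, d.sub s3 (((smoothAt_const _).sub (s1.const_mul _)).add s2),
    d.add ((smoothAt_const _).sub (s1.const_mul _)) s2, d.sub (smoothAt_const _) (s1.const_mul _),
    d.const, d.const_mul _ s1]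
  have h2 := sqrt_two_cast_ne_zero
  have h22 := sqrt_two_sq
  field_simp
  linear_combination (-2 : ℂ) * hZbar F.pert x * h22

lemma isSymbolO_hess : IsSymbolO (-3) fun x => F.frame.hess₁bar₁bar β (F.coords.symm x) := by
  have t1 : IsSymbolO (-3) (hZbar (hZbar g)) := (hg.isSymbolO.hZbar le_rfl).hZbar
  refine (((F.hess_asymptotics hε₀ hε₁ hβ hg he).mono (by linarith)).add
    ((F.hZbar_pert_symbol.const_mul (-((√2 : ℝ) : ℂ))).add t1)).congr
    (Eventually.of_forall fun x => by ring)

variable (hb : IsSymbolO (-4) fun x => S.boxb β (F.coords.symm x))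

include hb

lemma isSymbolO_hess₁bar₁ : IsSymbolO (-4) fun x => F.frame.hess₁bar₁ β (F.coords.symm x) := by
  refine (hb.const_mul (-1 / 2)).congr ?_
  filter_upwards [F.eventually_atInf_target] with x hx
  rw [S.boxb_eq F.frame (F.mem_source hx) hβ, F.frame.boxb_eq (F.mem_source hx) fun q _ => hβ q]
  ring

/-- As `f_{,1̄1} = -□_b f / 2` is small, the torsion term `i A₁₁ f_{,1̄}` dominates. -/
lemma paneitz₃_asymptotics : IsSymbolO (-5) fun x => F.frame.paneitz₃ β (F.coords.symm x) +
    1 / (√2 : ℝ) * hZ (hZ F.pert) x := by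
  have hs : ∀ q ∈ F.coords.source, SmoothAt β q := fun q _ => hβ q
  have t1 : IsSymbolO (-5) (F.opZ fun x => F.frame.hess₁bar₁ β (F.coords.symm x)) :=
    F.isSymbolO_opZ (F.isSymbolO_hess₁bar₁ hε₀ hε₁ hβ hg he hb)
  have t2 : IsSymbolO (-5) fun x => F.tors x *
      (F.opZbar (fun x => β (F.coords.symm x)) x - 1 / (√2 : ℝ)) :=
    F.isSymbolO_tors.mul (F.opZbar_sub hε₀ hε₁ hg he)
  have t3 := F.tors_asymptotics.const_mul (Complex.I / (√2 : ℝ))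
  refine ((t1.add (t2.const_mul Complex.I)).add t3).congr ?_
  filter_upwards [F.eventually_atInf_target] with x hx
  have h1 := F.D₁_symm hx (F.frame.smoothAt_hess₁bar₁ (F.mem_source hx) hs)
  have h2 := F.D₁bar_symm hx (hβ _)
  rw [UnitaryFrame.paneitz₃, h1, h2]
  unfold opZ opZbar tors
  linear_combination (1 / (√2 : ℝ) : ℂ) * -hZ (hZ F.pert) x * Complex.I_sq

lemma isSymbolO_paneitz₃ : IsSymbolO (-4) fun x => F.frame.paneitz₃ β (F.coords.symm x) :=
  (((F.paneitz₃_asymptotics hε₀ hε₁ hβ hg he hb).mono (by norm_num)).sub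
    (F.hZ_hZ_pert_symbol.const_mul (1 / (√2 : ℝ)))).congr
    (Eventually.of_forall fun x => by ring)

/-- The Paneitz operator, to sixth order. -/
lemma paneitz_asymptotics : IsSymbolO (-6) fun x => S.paneitz β (F.coords.symm x) +
    4 / (√2 : ℝ) * hZbar (hZ (hZ F.pert)) x := by
  have hs : ∀ q ∈ F.coords.source, SmoothAt β q := fun q _ => hβ q
  have hp := F.isSymbolO_paneitz₃ hε₀ hε₁ hβ hg he hb
  have t1 : IsSymbolO (-6) (F.opZbar fun x => F.frame.paneitz₃ β (F.coords.symm x) +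
    1 / (√2 : ℝ) * hZ (hZ F.pert) x) :=
    F.isSymbolO_opZbar (F.paneitz₃_asymptotics hε₀ hε₁ hβ hg he hb)
  have t2 : IsSymbolO (-6) fun x => F.opZbar (hZ (hZ F.pert)) x - hZbar (hZ (hZ F.pert)) x :=
    F.isSymbolO_opZbar_sub F.hZ_hZ_pert_symbol
  have t3 : IsSymbolO (-6) fun x => F.conn x * F.frame.paneitz₃ β (F.coords.symm x) :=
    F.isSymbolO_conn.mul hp
  refine (((t1.sub (t2.const_mul (1 / (√2 : ℝ)))).sub t3).const_mul 4).congr ?_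
  filter_upwards [F.eventually_atInf_target, hp.smooth, F.hZ_hZ_pert_symbol.smooth]
    with x hx h1 h2
  have s1 := smoothAt_heis.2 h1
  have s2 := smoothAt_heis.2 h2
  have h3 := F.D₁bar_symm hx (F.frame.smoothAt_paneitz₃ (F.mem_source hx) hs)
  rw [S.paneitz_eq F.frame (F.mem_source hx) hβ, UnitaryFrame.paneitz, h3,
    (F.isDer_opZbar x).add s1 (s2.const_mul _), (F.isDer_opZbar x).const_mul _ s2]
  unfold opZbar conn
  ring

lemma fluxBar_asymptotics : IsSymbolO (-4 + ε) fun x =>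
    F.frame.fluxBar β (F.coords.symm x) - F.leadBar g x := by
  have hH := F.hess_asymptotics hε₀ hε₁ hβ hg he
  have t1 : IsSymbolO (-4 + ε) fun x => conj (β (F.coords.symm x) - conj x.1) *
      F.frame.paneitz₃ β (F.coords.symm x) :=
    (F.beta_bound hε₀ hε₁ hg he).star.mul (F.isSymbolO_paneitz₃ hε₀ hε₁ hβ hg he hb) (by linarith)
  have t2 : IsSymbolO (-4 + ε) fun x => x.1 * (F.frame.paneitz₃ β (F.coords.symm x) +
      1 / (√2 : ℝ) * hZ (hZ F.pert) x) :=
    isSymbolO_coordZ.mul (F.paneitz₃_asymptotics hε₀ hε₁ hβ hg he hb) (by linarith)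
  have t3 : IsSymbolO (-4 + ε) fun x => conj (F.frame.hess₁bar₁bar β (F.coords.symm x)) *
      (F.opZbar (fun x => β (F.coords.symm x)) x - 1 / (√2 : ℝ)) :=
    (F.isSymbolO_hess hε₀ hε₁ hβ hg he).star.mul (F.opZbar_sub hε₀ hε₁ hg he) (by linarith)
  refine ((((t1.add t2).add t3).const_mul 2).add (hH.star.const_mul (2 / (√2 : ℝ)))).congr ?_
  filter_upwards [F.eventually_atInf_target, F.hZbar_pert] with x hx hc
  have hc' : conj (hZbar F.pert x) = hZ F.pert x := by rw [← hc, Complex.conj_conj]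
  have h2 := F.D₁bar_symm hx (hβ _)
  rw [UnitaryFrame.fluxBar, h2, leadBar]
  simp only [map_sub, map_add, map_mul, map_neg, Complex.conj_ofReal, Complex.conj_conj, hc']
  unfold opZbar
  have h2 := sqrt_two_cast_ne_zero
  have h22 := sqrt_two_sq
  have hi : (1 / ((√2 : ℝ) : ℂ)) = (√2 : ℝ) / 2 := by
    field_simp
    linear_combination -h22
  have hi2 : (2 / ((√2 : ℝ) : ℂ)) = (√2 : ℝ) := by
    field_simp
    linear_combination -h22
  rw [hi, hi2]
  linear_combination hZ F.pert x * h22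

lemma flux_asymptotics : IsSymbolO (-4 + ε) fun x =>
    F.frame.flux β (F.coords.symm x) - F.lead g x := by
  have hu := F.isSymbolO_hess₁bar₁ hε₀ hε₁ hβ hg he hb
  have hB := F.isSymbolO_opZbar_beta hε₀ hε₁ hg he
  have t1 : IsSymbolO (-4 + ε) fun x => conj (F.opZ (fun x => β (F.coords.symm x)) x) *
      F.frame.hess₁bar₁ β (F.coords.symm x) :=
    (F.isSymbolO_opZ_beta hε₀ hε₁ hg he).star.mul hu (by linarith)
  have t2 : IsSymbolO (-4 + ε) fun x => conj (F.opT (fun x => β (F.coords.symm x)) x -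
      (Complex.I / (√2 : ℝ) * hZ F.pert x + hDt g x)) *
      F.opZbar (fun x => β (F.coords.symm x)) x :=
    (F.opT_asymptotics hε₀ hε₁ hg he).star.mul hB (by linarith)
  have hd : IsSymbolO (-3) (hDt g) := hg.isSymbolO.hDt
  have t3 : IsSymbolO (-4 + ε) fun x =>
      conj (Complex.I / (√2 : ℝ) * hZ F.pert x + hDt g x) *
      (F.opZbar (fun x => β (F.coords.symm x)) x - 1 / (√2 : ℝ)) :=
    ((F.hZ_pert_symbol.const_mul (Complex.I / (√2 : ℝ))).add hd).star.mul
      (F.opZbar_sub hε₀ hε₁ hg he) (by linarith)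
  have t4 : IsSymbolO (-4 + ε) fun x => conj (F.frame.hess₁bar₁ β (F.coords.symm x)) *
      F.opZbar (fun x => β (F.coords.symm x)) x := hu.star.mul hB (by linarith)
  refine ((((t1.const_mul (-2)).sub (t2.const_mul (2 * Complex.I))).sub
    (t3.const_mul (2 * Complex.I))).sub (t4.const_mul 2)).congr ?_
  filter_upwards [F.eventually_atInf_target, F.hZbar_pert] with x hx hc
  have h1 := F.D₁_symm hx (hβ _)
  have h2 := F.D₁bar_symm hx (hβ _)
  have h3 := F.D₀_symm hx (hβ _)
  rw [UnitaryFrame.flux, h1, h2, h3, lead]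
  simp only [map_sub, map_add, map_mul, map_div₀, Complex.conj_ofReal, Complex.conj_I, hc]
  unfold opZbar opZ opT
  have h2 := sqrt_two_cast_ne_zero
  have h22 := sqrt_two_sq
  have hi : (1 / ((√2 : ℝ) : ℂ)) = (√2 : ℝ) / 2 := by
    field_simp
    linear_combination -h22
  have hi2 : (-Complex.I / ((√2 : ℝ) : ℂ)) = -Complex.I * (√2 : ℝ) / 2 := by
    rw [div_eq_mul_one_div, hi]
    ring
  rw [hi, hi2]
  linear_combination (-(Complex.I ^ 2) / 2 * hZbar F.pert x) * h22 - hZbar F.pert x * Complex.I_sq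

end

end AsymptoticallyFlat

/-! ### The volume form near infinity -/

/-- `det3` in terms of the horizontal components and the values of `θ₀`. -/
lemma det3_eq_heisTheta (x u v w : Heis) : (det3 u v w : ℂ) =
    heisTheta x u * ((conj v.1 * w.1 - v.1 * conj w.1) / (2 * Complex.I)) +
    heisTheta x v * ((conj w.1 * u.1 - w.1 * conj u.1) / (2 * Complex.I)) +
    heisTheta x w * ((conj u.1 * v.1 - u.1 * conj v.1) / (2 * Complex.I)) := by
  have key : ∀ p q : ℂ, (conj p * q - p * conj q) / (2 * Complex.I) =
      ((p.re * q.im - p.im * q.re : ℝ) : ℂ) := fun p q => by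
    rw [div_eq_iff (by simp)]
    apply Complex.ext
    · simp
      try ring
    · simp
      try ring
  rw [key, key, key]
  norm_cast
  simp only [det3, heisTheta, Complex.mul_im, Complex.conj_re, Complex.conj_im]
  ring

namespace AsymptoticallyFlat

variable {N : Type*} [TopologicalSpace N] [ChartedSpace Heis N] [IsManifold IH ∞ N]
  [MeasurableSpace N] {S : Pseudohermitian N} (F : AsymptoticallyFlat S) {x : Heis}

/-- The determinant of the frame in asymptotic coordinates. -/
def frDet (x : Heis) : ℝ :=
  det3 (push F.coords F.frame.T x) (push F.coords F.frame.e₁ x) (push F.coords F.frame.e₂ x)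

lemma frDet_asymptotics : IsSymbolO (-2) fun x => 4 * (F.frDet x : ℂ) - 1 := by
  have a0 := F.isSymbolO_frA
  have b0 : IsSymbolO 0 fun x => conj (F.frB x) := F.isSymbolO_frB.star.mono (by norm_num)
  set E1 : Heis → ℂ := fun x => 1 / 2 * (F.frA x + conj (F.frB x)) with hE1
  set E2 : Heis → ℂ := fun x => Complex.I / 2 * (F.frA x - conj (F.frB x)) with hE2
  set X : Heis → ℂ := fun x => 1 / (√2 : ℝ) * F.frX x with hX
  set t1 : Heis → ℂ := fun x => 1 / (√2 : ℝ) * (F.frC x + conj (F.frC x)) with ht1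
  set t2 : Heis → ℂ := fun x => Complex.I / (√2 : ℝ) * (F.frC x - conj (F.frC x)) with ht2
  have s1 : IsSymbolO 0 E1 := (a0.add b0).const_mul _
  have s2 : IsSymbolO 0 E2 := (a0.sub b0).const_mul _
  have s3 : IsSymbolO (-3) X := F.isSymbolO_frX.const_mul _
  have s4 : IsSymbolO (-3) t1 := (F.isSymbolO_frC.add F.isSymbolO_frC.star).const_mul _
  have s5 : IsSymbolO (-3) t2 := (F.isSymbolO_frC.sub F.isSymbolO_frC.star).const_mul _
  have u1 : IsSymbolO (-2) fun x => t1 x * (conj (E2 x) * X x - E2 x * conj (X x)) :=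
    s4.mul ((s2.star.mul s3 : IsSymbolO (-3) _).sub (s2.mul s3.star))
  have u2 : IsSymbolO (-2) fun x => t2 x * (conj (X x) * E1 x - X x * conj (E1 x)) :=
    s5.mul ((s3.star.mul s1 : IsSymbolO (-3) _).sub (s3.mul s1.star))
  have u3 : IsSymbolO (-2) fun x => F.frT x *
      ((F.frA x * conj (F.frA x) - F.frB x * conj (F.frB x)) - 1) :=
    F.isSymbolO_frT.mul F.horizontal_det
  refine (((u3.add F.frT_sub_one).add (u1.const_mul (2 / Complex.I))).add
    (u2.const_mul (2 / Complex.I))).congr (Eventually.of_forall fun x => ?_)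
  have h2 := sqrt_two_cast_ne_zero
  have h22 := sqrt_two_sq
  have r1 : (push F.coords F.frame.e₁ x).1 = E1 x := by
    simp only [hE1, frA, frB, map_sub, map_mul, Complex.conj_I, Complex.conj_conj]
    ring
  have r2 : (push F.coords F.frame.e₂ x).1 = E2 x := by
    simp only [hE2, frA, frB, map_sub, map_mul, Complex.conj_I, Complex.conj_conj]
    linear_combination (push F.coords F.frame.e₂ x).1 * Complex.I_sq
  have r3 : (push F.coords F.frame.T x).1 = X x := by
    simp only [hX, frX]
    field_simp
  have r4 : (heisTheta x (push F.coords F.frame.e₁ x) : ℂ) = t1 x := by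
    simp only [ht1, frC, map_sub, map_mul, map_div₀, map_one, Complex.conj_I, Complex.conj_ofReal]
    field_simp
    linear_combination (heisTheta x (push F.coords F.frame.e₁ x) : ℂ) * h22
  have r5 : (heisTheta x (push F.coords F.frame.e₂ x) : ℂ) = t2 x := by
    simp only [ht2, frC, map_sub, map_mul, map_div₀, map_one, Complex.conj_I, Complex.conj_ofReal]
    field_simp
    linear_combination (heisTheta x (push F.coords F.frame.e₂ x) : ℂ) * h22 +
      2 * (heisTheta x (push F.coords F.frame.e₂ x) : ℂ) * Complex.I_sq
  simp only [frDet]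
  rw [det3_eq_heisTheta x, r1, r2, r3, r4, r5]
  have r6 : (heisTheta x (push F.coords F.frame.T x) : ℂ) = F.frT x := rfl
  have r7 : (conj (E1 x) * E2 x - E1 x * conj (E2 x)) / (2 * Complex.I) =
      1 / 4 * (F.frA x * conj (F.frA x) - F.frB x * conj (F.frB x)) := by
    have hI := Complex.I_ne_zero
    simp only [hE1, hE2, map_sub, map_add, map_mul, map_div₀, map_one, Complex.conj_I,
      Complex.conj_conj, map_ofNat]
    field_simp
    ring
  rw [r6, r7]
  field_simp
  ring

/-- The density of `θ ∧ dθ` tends to `4`. -/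
lemma density_asymptotics : IsSymbolO (-2) fun x => (S.density F.coords x : ℂ) - 4 := by
  have h := F.frDet_asymptotics
  have hi := h.inv (by norm_num)
  have t : IsSymbolO (-2) fun x => (4 * (F.frDet x : ℂ))⁻¹ * (4 * (F.frDet x : ℂ) - 1) :=
    hi.mul h
  have hlim := (h.tendsto_zero (by norm_num)).add_const 1
  simp only [sub_add_cancel, zero_add] at hlim
  have hre : Tendsto (fun x => 4 * F.frDet x) atInf (𝓝 1) := by
    have := (Complex.continuous_re.tendsto _).comp hlim
    refine this.congr fun x => ?_
    simp
  refine (t.const_mul (-4)).congr ?_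
  filter_upwards [F.eventually_atInf_target, hre.eventually (lt_mem_nhds one_half_lt_one)]
    with x hx hpos
  have hd : 0 < F.frDet x := by linarith
  have e : S.density F.coords x = (F.frDet x)⁻¹ := by
    rw [S.density_eq F.frame F.coords_mem hx (F.mem_source hx)]
    change |F.frDet x|⁻¹ = _
    rw [abs_of_pos hd]
  have hd' : (F.frDet x : ℂ) ≠ 0 := by exact_mod_cast hd.ne'
  rw [e]
  push_cast
  field_simp
  ring

lemma isSymbolO_density : IsSymbolO 0 fun x => (S.density F.coords x : ℂ) :=
  ((F.density_asymptotics.mono (by norm_num)).add (IsSymbolO.const 4)).congr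
    (Eventually.of_forall fun x => by ring)

lemma eventually_two_le_density : ∀ᶠ x in atInf, 2 ≤ S.density F.coords x := by
  have hlim := (F.density_asymptotics.tendsto_zero (by norm_num)).add_const 4
  simp only [sub_add_cancel, zero_add] at hlim
  have hre : Tendsto (fun x => S.density F.coords x) atInf (𝓝 4) := by
    have := (Complex.continuous_re.tendsto _).comp hlim
    refine this.congr fun x => ?_
    simp
  exact (hre.eventually (lt_mem_nhds (by norm_num : (2 : ℝ) < 4))).mono fun _ h => le_of_lt h

end AsymptoticallyFlat

/-! ### Integrability near infinity -/

lemma integrableOn_rho_rpow {s : ℝ} (hs : 4 < s) :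
    IntegrableOn (fun x => rho x ^ (-s)) {x : Heis | 1 < rho x} := by
  have h1 : Integrable (fun z : ℂ => (1 + ‖z‖) ^ (-(s / 2))) :=
    integrable_one_add_norm (by simp; linarith)
  have h2 : Integrable (fun t : ℝ => (1 + ‖t‖) ^ (-(s / 4))) :=
    integrable_one_add_norm (by simp; linarith)
  have h3 : Integrable (fun x : Heis => 2 ^ s *
      ((1 + ‖x.1‖) ^ (-(s / 2)) * (1 + ‖x.2‖) ^ (-(s / 4)))) :=
    (h1.mul_prod h2).const_mul _
  have hm : MeasurableSet {x : Heis | 1 < rho x} :=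
    (isOpen_lt continuous_const continuous_rho).measurableSet
  refine Integrable.mono' h3.integrableOn ?_ ?_
  · refine ContinuousOn.aestronglyMeasurable (fun x hx => ?_) hm
    exact (contDiffAt_rho_rpow (ne_zero_of_rho_pos (zero_lt_one.trans hx))
      _).continuousAt.continuousWithinAt
  · refine (ae_restrict_iff' hm).2 (Eventually.of_forall fun x hx => ?_)
    have hx : 1 < rho x := hx
    have h0 : 0 < rho x := zero_lt_one.trans hx
    rw [Real.norm_of_nonneg (Real.rpow_nonneg h0.le _)]
    have e1 : 1 + ‖x.1‖ ≤ 2 * rho x := by linarith [norm_fst_le_rho x]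
    have e2 : 1 + ‖x.2‖ ≤ 2 * rho x ^ 2 := by
      have := abs_snd_le_rho_sq x
      rw [Real.norm_eq_abs]
      nlinarith
    have f1 : (2 * rho x) ^ (-(s / 2)) ≤ (1 + ‖x.1‖) ^ (-(s / 2)) :=
      Real.rpow_le_rpow_of_nonpos (by positivity) e1 (by linarith)
    have f2 : (2 * rho x ^ 2) ^ (-(s / 4)) ≤ (1 + ‖x.2‖) ^ (-(s / 4)) :=
      Real.rpow_le_rpow_of_nonpos (by positivity) e2 (by linarith)
    have f3 := mul_le_mul f1 f2 (by positivity) (by positivity)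
    have f4 : (2 * rho x) ^ (-(s / 2)) * (2 * rho x ^ 2) ^ (-(s / 4)) =
        2 ^ (-(s / 2) + -(s / 4)) * rho x ^ (-s) := by
      rw [Real.mul_rpow (by norm_num) h0.le, Real.mul_rpow (by norm_num) (by positivity),
        ← Real.rpow_natCast, ← Real.rpow_mul h0.le, Real.rpow_add (by norm_num : (0 : ℝ) < 2),
        show -s = -(s / 2) + ((2 : ℕ) : ℝ) * -(s / 4) by push_cast; ring, Real.rpow_add h0]
      ring
    rw [f4] at f3
    have f5 : rho x ^ (-s) ≤ 2 ^ s * (2 ^ (-(s / 2) + -(s / 4)) * rho x ^ (-s)) := by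
      rw [← mul_assoc, ← Real.rpow_add (by norm_num : (0 : ℝ) < 2)]
      have : (1 : ℝ) ≤ 2 ^ (s + (-(s / 2) + -(s / 4))) :=
        Real.one_le_rpow (by norm_num) (by linarith)
      nlinarith [Real.rpow_nonneg h0.le (-s)]
    exact f5.trans (mul_le_mul_of_nonneg_left f3 (by positivity))

lemma integrableOn_of_isBigO {f : Heis → ℂ} {s r : ℝ} (hs : 4 < s)
    (hf : f =O[atInf] fun x => rho x ^ (-s)) (hc : ContinuousOn f {x | r < rho x}) :
    ∃ R, r ≤ R ∧ IntegrableOn f {x | R < rho x} := by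
  obtain ⟨C, hC⟩ := hf.bound
  obtain ⟨R, hR, hb⟩ := eventually_atInf.1 hC
  refine ⟨max r (max R 1), le_max_left _ _, ?_⟩
  have hm : MeasurableSet {x : Heis | max r (max R 1) < rho x} :=
    (isOpen_lt continuous_const continuous_rho).measurableSet
  have hi : IntegrableOn (fun x => C * rho x ^ (-s)) {x : Heis | max r (max R 1) < rho x} :=
    IntegrableOn.mono_set (t := {x : Heis | 1 < rho x})
      (Integrable.const_mul (integrableOn_rho_rpow hs) C)
      (show {x : Heis | max r (max R 1) < rho x} ⊆ {x | 1 < rho x} from fun x hx =>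
        ((le_max_right R 1).trans (le_max_right _ _)).trans_lt hx)
  refine Integrable.mono' hi ?_ ?_
  · refine ContinuousOn.aestronglyMeasurable (hc.mono fun x hx => ?_) hm
    exact (le_max_left r (max R 1)).trans_lt hx
  · refine (ae_restrict_iff' hm).2 (Eventually.of_forall fun x hx => ?_)
    have := hb x (((le_max_left R 1).trans (le_max_right _ _)).trans_lt hx)
    rwa [Real.norm_of_nonneg (Real.rpow_nonneg (rho_nonneg x) _)] at this

/-- The integral over the far region of an integrable function tends to zero. -/
lemma tendsto_setIntegral_rho {f : Heis → ℝ} {R : ℝ} (hf : IntegrableOn f {x | R < rho x}) :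
    Tendsto (fun Λ : ℝ => ∫ x in {x | Λ < rho x}, f x) atTop (𝓝 0) := by
  have hm : ∀ Λ : ℝ, MeasurableSet {x : Heis | Λ < rho x} := fun Λ =>
    (isOpen_lt continuous_const continuous_rho).measurableSet
  have h := tendsto_setIntegral_of_antitone (μ := (volume : Measure Heis)) (f := f)
    (s := fun Λ : ℝ => {x | Λ < rho x}) hm
    (fun a b hab x hx => lt_of_le_of_lt hab hx) ⟨R, hf⟩
  have : (⋂ Λ : ℝ, {x : Heis | Λ < rho x}) = ∅ := by
    ext x
    simp only [Set.mem_iInter, Set.mem_empty_iff_false, iff_false, not_forall]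
    exact ⟨rho x, fun h : rho x < rho x => lt_irrefl _ h⟩
  rwa [this, setIntegral_empty] at h

/-! ### The end of the manifold and cut-off functions -/

lemma isPreconnected_exterior (Λ : ℝ) (hΛ : 0 ≤ Λ) : IsPreconnected {x : Heis | Λ < rho x} := by
  -- polar coordinates `(ρ, t / ρ², arg z)` parametrize the exterior by a connected set
  set f : ℝ × ℝ × ℝ → Heis := fun p =>
    ((p.1 * √(√(1 - p.2.1 ^ 2)) : ℝ) * Complex.exp (p.2.2 * Complex.I), p.1 ^ 2 * p.2.1) with hf
  have hc : Continuous f := by fun_prop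
  have hs : IsPreconnected (Set.Ioi Λ ×ˢ Set.Icc (-1 : ℝ) 1 ×ˢ (Set.univ : Set ℝ)) :=
    isPreconnected_Ioi.prod (isPreconnected_Icc.prod isPreconnected_univ)
  have hq : ∀ p : ℝ × ℝ × ℝ, p.2.1 ∈ Set.Icc (-1 : ℝ) 1 → quad (f p) = p.1 ^ 4 := fun p hp => by
    have h1 : 0 ≤ 1 - p.2.1 ^ 2 := by nlinarith [hp.1, hp.2]
    have h2 : √(√(1 - p.2.1 ^ 2)) ^ 4 = 1 - p.2.1 ^ 2 := by
      rw [show 4 = 2 * 2 by rfl, pow_mul, Real.sq_sqrt (Real.sqrt_nonneg _), Real.sq_sqrt h1]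
    simp only [hf, quad, norm_mul, Complex.norm_exp_ofReal_mul_I, mul_one, Complex.norm_real,
      Real.norm_eq_abs]
    rw [← abs_mul, (show Even 4 by decide).pow_abs, mul_pow, h2]
    ring
  convert hs.image f hc.continuousOn using 1
  ext x
  constructor
  · intro hx
    have hx : Λ < rho x := hx
    have h0 : 0 < rho x := hΛ.trans_lt hx
    have h4 := rho_pow_four x
    set s := x.2 / rho x ^ 2 with hsdef
    have hst : rho x ^ 2 * s = x.2 := by rw [hsdef]; field_simp
    have hs1 : |s| ≤ 1 := by
      rw [hsdef, abs_div, abs_of_pos (pow_pos h0 2), div_le_one (pow_pos h0 2)]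
      exact abs_snd_le_rho_sq x
    refine ⟨(rho x, s, Complex.arg x.1), ⟨hx, abs_le.1 hs1, trivial⟩, ?_⟩
    have hz : rho x * √(√(1 - s ^ 2)) = ‖x.1‖ := by
      refine (pow_left_inj₀ (by positivity) (norm_nonneg _) (by norm_num : 4 ≠ 0)).1 ?_
      have h1 : 0 ≤ 1 - s ^ 2 := by nlinarith [abs_le.1 hs1]
      have h2 : √(√(1 - s ^ 2)) ^ 4 = 1 - s ^ 2 := by
        rw [show 4 = 2 * 2 by rfl, pow_mul, Real.sq_sqrt (Real.sqrt_nonneg _), Real.sq_sqrt h1]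
      rw [mul_pow, h2]
      rw [quad] at h4
      linear_combination h4 - (rho x ^ 2 * s + x.2) * hst
    refine Prod.ext ?_ hst
    simp only [hf]
    rw [hz]
    exact Complex.norm_mul_exp_arg_mul_I x.1
  · rintro ⟨p, ⟨hp1, hp2, -⟩, rfl⟩
    have hp1 : Λ < p.1 := hp1
    refine (lt_rho_iff hΛ).2 ?_
    rw [hq p hp2]
    gcongr

lemma volume_exterior (Λ : ℝ) : MeasureTheory.volume {x : Heis | Λ < rho x} = ⊤ := by
  have h : (Metric.ball (0 : ℂ) 1) ×ˢ Set.Ioi (Λ ^ 2) ⊆ {x : Heis | Λ < rho x} := by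
    rintro x ⟨-, hx⟩
    have hx : Λ ^ 2 < x.2 := hx
    have := (le_abs_self x.2).trans (abs_snd_le_rho_sq x)
    exact lt_of_pow_lt_pow_left₀ 2 (rho_nonneg x) (hx.trans_le this)
  refine top_unique (le_trans ?_ (measure_mono h))
  rw [Measure.volume_eq_prod, Measure.prod_prod, Real.volume_Ioi, ENNReal.mul_top]
  exact (Metric.measure_ball_pos _ _ one_pos).ne'

namespace AsymptoticallyFlat

variable {N : Type*} [TopologicalSpace N] [ChartedSpace Heis N] [IsManifold IH ∞ N]
  [MeasurableSpace N] {S : Pseudohermitian N} (F : AsymptoticallyFlat S) {x : Heis} {Λ : ℝ}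

/-- The part of `N` outside the sphere `{ρ = Λ}` of the asymptotic coordinates. -/
def outside (Λ : ℝ) : Set N := F.coords.symm '' {x | Λ < rho x}

lemma compl_inside (Λ : ℝ) : (F.inside Λ)ᶜ = F.outside Λ := compl_compl _

lemma mem_target (hΛ : F.ρ₀ ≤ Λ) (hx : Λ < rho x) : x ∈ F.coords.target := by
  rw [F.target_eq]
  exact hΛ.trans_lt hx

lemma outside_eq (hΛ : F.ρ₀ ≤ Λ) :
    F.outside Λ = F.coords.source ∩ F.coords ⁻¹' {x | Λ < rho x} := by
  exact F.coords.symm_image_eq_source_inter_preimage fun x hx => F.mem_target hΛ hx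

lemma outside_subset (hΛ : F.ρ₀ ≤ Λ) : F.outside Λ ⊆ F.coords.source := by
  rw [F.outside_eq hΛ]
  exact Set.inter_subset_left

lemma isOpen_outside (hΛ : F.ρ₀ ≤ Λ) : IsOpen (F.outside Λ) := by
  rw [F.outside_eq hΛ]
  exact F.coords.isOpen_inter_preimage (isOpen_lt continuous_const continuous_rho)

lemma preimage_outside (hΛ : F.ρ₀ ≤ Λ) :
    F.coords.symm ⁻¹' F.outside Λ ∩ F.coords.target = {x | Λ < rho x} := by
  ext x
  constructor
  · rintro ⟨hx, hxt⟩
    rw [Set.mem_preimage, F.outside_eq hΛ] at hx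
    have := hx.2
    rwa [Set.mem_preimage, F.coords.right_inv hxt] at this
  · intro hx
    exact ⟨⟨x, hx, rfl⟩, F.mem_target hΛ hx⟩

lemma outside_anti {Λ' : ℝ} (h : Λ ≤ Λ') : F.outside Λ' ⊆ F.outside Λ :=
  Set.image_mono fun _ hx => lt_of_le_of_lt h hx

lemma isCompact_inside (hΛ : F.ρ₀ < Λ) : IsCompact (F.inside Λ) := F.isCompact_compl Λ hΛ

variable [T2Space N] [SecondCountableTopology N] [BorelSpace N]

/-- The end of `N` is a genuine end: the far region stays away from the complement of the
coordinate domain. If it did not, then, being connected, it would lie in a compact set; but its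
volume is infinite. -/
theorem exists_closure_outside_subset :
    ∃ Λ, F.ρ₀ < Λ ∧ closure (F.outside Λ) ⊆ F.coords.source := by
  have : LocallyCompactSpace N := ChartedSpace.locallyCompactSpace Heis N
  have hK : IsCompact (F.coords.sourceᶜ) := by
    refine (F.isCompact_inside (lt_add_one F.ρ₀)).of_isClosed_subset
      F.coords.open_source.isClosed_compl ?_
    rw [← Set.compl_subset_compl, compl_compl, F.compl_inside]
    exact F.outside_subset (by linarith)
  obtain ⟨C, hC, hKC⟩ := exists_compact_superset hK
  have hfr : IsCompact (frontier C) := hC.of_isClosed_subset isClosed_frontier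
    (frontier_subset_iff_isClosed.2 hC.isClosed)
  have hfs : frontier C ⊆ F.coords.source := fun p hp => by
    by_contra h
    exact hp.2 (hKC h)
  obtain ⟨M, hM⟩ := (hfr.image_of_continuousOn
    (continuous_rho.comp_continuousOn (F.coords.continuousOn.mono hfs))).bddAbove
  obtain ⟨R, hR, hd⟩ := eventually_atInf.1 F.eventually_two_le_density
  set Λ := max (F.ρ₀ + 1) (max M R) with hΛdef
  have hρ : F.ρ₀ < Λ := by linarith [le_max_left (F.ρ₀ + 1) (max M R)]
  have hMΛ : M ≤ Λ := (le_max_left M R).trans (le_max_right _ _)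
  have hRΛ : R ≤ Λ := (le_max_right M R).trans (le_max_right _ _)
  refine ⟨Λ, hρ, ?_⟩
  have hconn : IsPreconnected (F.outside Λ) :=
    (isPreconnected_exterior Λ (F.ρ₀_pos.trans hρ).le).image _
      (F.coords.continuousOn_symm.mono fun x hx => F.mem_target hρ.le hx)
  have hdisj : F.outside Λ ∩ frontier C = ∅ := by
    ext p
    simp only [Set.mem_inter_iff, Set.mem_empty_iff_false, iff_false, not_and]
    intro hp hpf
    rw [F.outside_eq hρ.le] at hp
    have h1 : Λ < rho (F.coords p) := hp.2
    have h2 : rho (F.coords p) ≤ M := hM ⟨p, hpf, rfl⟩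
    linarith
  have hcov : F.outside Λ ⊆ interior C ∪ Cᶜ := fun p hp => by
    by_contra h
    simp only [Set.mem_union, not_or, Set.mem_compl_iff, not_not] at h
    have : p ∈ F.outside Λ ∩ frontier C := ⟨hp, subset_closure h.2, h.1⟩
    rw [hdisj] at this
    exact this
  have hdis2 : Disjoint (interior C) Cᶜ :=
    Set.disjoint_left.2 fun p h1 h2 => h2 (interior_subset h1)
  -- `outside Λ` is connected and misses the boundary of the compact set `C`, a neighbourhood of the
  -- complement of the coordinate domain; so it lies inside `C`, or away from it
  rcases hconn.subset_or_subset isOpen_interior hC.isClosed.isOpen_compl hdis2 hcov with h | h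
  · exfalso
    have hfin : IntegrableOn (fun _ : N => (1 : ℝ)) (F.outside Λ) S.volume :=
      (continuousOn_const.integrableOn_compact hC).mono_set (h.trans interior_subset)
    rw [S.integrableOn_iff F.coords_mem aestronglyMeasurable_const
      (F.isOpen_outside hρ.le).measurableSet (F.outside_subset hρ.le),
      F.preimage_outside hρ.le] at hfin
    have h1 : IntegrableOn (fun _ : Heis => (1 : ℝ)) {x | Λ < rho x} := by
      refine Integrable.mono' hfin aestronglyMeasurable_const ?_
      refine (ae_restrict_iff' (isOpen_lt continuous_const continuous_rho).measurableSet).2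
        (Eventually.of_forall fun x hx => ?_)
      have hx : Λ < rho x := hx
      have := hd x (hRΛ.trans_lt hx)
      simp only [norm_one, smul_eq_mul, mul_one]
      linarith
    rw [integrableOn_const_iff] at h1
    rcases h1 with h1 | h1
    · simp at h1
    · rw [volume_exterior] at h1
      exact lt_irrefl _ h1
  · have h1 : closure (F.outside Λ) ⊆ (interior C)ᶜ :=
      closure_minimal (h.trans (Set.compl_subset_compl.2 interior_subset))
        isOpen_interior.isClosed_compl
    intro p hp
    by_contra hps
    exact h1 hp (hKC hps)

end AsymptoticallyFlat

/-- A smooth function equal to `1` on `(-∞, 1]` and to `0` on `[2, ∞)`. -/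
def profile (s : ℝ) : ℝ := Real.smoothTransition (2 - s)

lemma contDiff_profile : ContDiff ℝ ∞ profile :=
  Real.smoothTransition.contDiff.comp (contDiff_const.sub contDiff_id)

lemma profile_one {s : ℝ} (hs : s ≤ 1) : profile s = 1 :=
  Real.smoothTransition.one_of_one_le (by linarith)

lemma profile_zero {s : ℝ} (hs : 2 ≤ s) : profile s = 0 :=
  Real.smoothTransition.zero_of_nonpos (by linarith)

lemma profile_nonneg (s : ℝ) : 0 ≤ profile s := Real.smoothTransition.nonneg _

lemma profile_le_one (s : ℝ) : profile s ≤ 1 := Real.smoothTransition.le_one _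

lemma continuous_deriv_profile : Continuous (deriv profile) :=
  contDiff_profile.continuous_deriv (by simp)

lemma deriv_profile_eq_zero {s : ℝ} (hs : s ∉ Set.Ioo (1 : ℝ) 2) : deriv profile s = 0 := by
  have h : ∀ s ∈ Set.Iio (1 : ℝ) ∪ Set.Ioi 2, deriv profile s = 0 := by
    rintro s (hs | hs)
    · have : profile =ᶠ[𝓝 s] fun _ => 1 := by
        filter_upwards [Iio_mem_nhds hs] with u hu using profile_one (le_of_lt hu)
      rw [this.deriv_eq, deriv_const]
    · have : profile =ᶠ[𝓝 s] fun _ => 0 := by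
        filter_upwards [Ioi_mem_nhds hs] with u hu using profile_zero (le_of_lt hu)
      rw [this.deriv_eq, deriv_const]
  have hcl : IsClosed {s | deriv profile s = 0} :=
    isClosed_eq continuous_deriv_profile continuous_const
  have h2 : closure (Set.Iio (1 : ℝ) ∪ Set.Ioi 2) ⊆ {s | deriv profile s = 0} :=
    closure_minimal h hcl
  refine h2 ?_
  rw [closure_union, closure_Iio, closure_Ioi]
  simp only [Set.mem_Ioo, not_and_or, not_lt] at hs
  exact hs

lemma exists_deriv_profile_bound : ∃ M, 0 ≤ M ∧ ∀ s, |deriv profile s| ≤ M := by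
  obtain ⟨M, hM⟩ := isCompact_Icc.exists_bound_of_continuousOn (s := Set.Icc (1 : ℝ) 2)
    continuous_deriv_profile.continuousOn
  refine ⟨max M 0, le_max_right _ _, fun s => ?_⟩
  by_cases hs : s ∈ Set.Ioo (1 : ℝ) 2
  · exact (hM s (Set.Ioo_subset_Icc_self hs)).trans (le_max_left _ _)
  · rw [deriv_profile_eq_zero hs]
    simp

/-- The cut-off at scale `Λ` on the Heisenberg group. -/
def cut (Λ : ℝ) (x : Heis) : ℂ := (profile (quad x / Λ ^ 4) : ℝ)

lemma contDiff_cut (Λ : ℝ) : ContDiff ℝ ∞ (cut Λ) :=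
  Complex.ofRealCLM.contDiff.comp (contDiff_profile.comp (contDiff_quad.div_const _))

lemma cut_one {Λ : ℝ} (hΛ : 0 < Λ) {x : Heis} (hx : ¬ Λ < rho x) : cut Λ x = 1 := by
  rw [lt_rho_iff hΛ.le, not_lt] at hx
  rw [cut, profile_one ((div_le_one (by positivity)).2 hx), Complex.ofReal_one]

lemma cut_zero {Λ : ℝ} (hΛ : 0 < Λ) {x : Heis} (hx : 2 * Λ < rho x) : cut Λ x = 0 := by
  rw [lt_rho_iff (by positivity)] at hx
  rw [cut, profile_zero, Complex.ofReal_zero]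
  rw [le_div_iff₀ (by positivity)]
  nlinarith [pow_pos hΛ 4]

namespace AsymptoticallyFlat

variable {N : Type*} [TopologicalSpace N] [ChartedSpace Heis N] [IsManifold IH ∞ N]
  [MeasurableSpace N] {S : Pseudohermitian N} (F : AsymptoticallyFlat S) {x : Heis} {Λ : ℝ}

open Classical in
/-- The cut-off at scale `Λ` on `N`. -/
def cutoff (Λ : ℝ) (p : N) : ℂ := if p ∈ F.coords.source then cut Λ (F.coords p) else 1

lemma cutoff_symm (hx : x ∈ F.coords.target) : F.cutoff Λ (F.coords.symm x) = cut Λ x := by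
  rw [cutoff, if_pos (F.mem_source hx), F.coords.right_inv hx]

lemma cutoff_inside (hΛ : F.ρ₀ < Λ) {p : N} (hp : p ∈ F.inside Λ) : F.cutoff Λ p = 1 := by
  rw [cutoff]
  split_ifs with h
  · refine cut_one (F.ρ₀_pos.trans hΛ) fun h2 => hp ?_
    change p ∈ F.outside Λ
    rw [F.outside_eq hΛ.le]
    exact ⟨h, h2⟩
  · rfl

lemma cutoff_outside (hΛ : F.ρ₀ < Λ) {p : N} (hp : p ∈ F.outside (2 * Λ)) :
    F.cutoff Λ p = 0 := by
  obtain ⟨x, hx, rfl⟩ := hp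
  have h0 := F.ρ₀_pos
  have hx : 2 * Λ < rho x := hx
  rw [F.cutoff_symm (F.mem_target le_rfl (by linarith)), cut_zero (by linarith) hx]

lemma hasCompactSupport_cutoff [T2Space N] (hΛ : F.ρ₀ < Λ) : HasCompactSupport (F.cutoff Λ) := by
  have h0 := F.ρ₀_pos
  refine HasCompactSupport.intro (F.isCompact_inside (Λ := 2 * Λ) (by linarith)) fun p hp => ?_
  refine F.cutoff_outside hΛ ?_
  rw [← F.compl_inside]
  exact hp

lemma norm_cutoff_le (p : N) : ‖F.cutoff Λ p‖ ≤ 1 := by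
  rw [cutoff]
  split_ifs
  · rw [cut, Complex.norm_real, Real.norm_of_nonneg (profile_nonneg _)]
    exact profile_le_one _
  · simp

lemma smoothAt_cutoff {Λ₁ : ℝ} (h₁ : F.ρ₀ < Λ₁)
    (hcl : closure (F.outside Λ₁) ⊆ F.coords.source) (hΛ : Λ₁ ≤ Λ) (p : N) :
    SmoothAt (F.cutoff Λ) p := by
  by_cases hp : p ∈ F.coords.source
  · have h1 : ContMDiffAt IH IH ∞ F.coords p :=
      contMDiffAt_of_mem_maximalAtlas F.coords_mem hp
    have h2 : SmoothAt (fun q => cut Λ (F.coords q)) p :=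
      (contDiff_cut Λ).contMDiff.contMDiffAt.comp p h1
    refine h2.congr_of_eventuallyEq ?_
    filter_upwards [F.coords.open_source.mem_nhds hp] with q hq
    rw [cutoff, if_pos hq]
  · have h : (closure (F.outside Λ₁))ᶜ ∈ 𝓝 p :=
      isClosed_closure.isOpen_compl.mem_nhds fun h => hp (hcl h)
    refine (smoothAt_const 1).congr_of_eventuallyEq ?_
    filter_upwards [h] with q hq
    refine F.cutoff_inside (h₁.trans_le hΛ) fun h2 => hq (subset_closure ?_)
    exact F.outside_anti hΛ h2

end AsymptoticallyFlat

/-! ### Integration by parts on the Heisenberg group -/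

lemma integral_hDt_eq_zero {ψ : Heis → ℂ} (hψ : ContDiff ℝ ∞ ψ) (hc : HasCompactSupport ψ) :
    ∫ x, hDt ψ x = 0 :=
  integral_fderiv_eq_zero (hψ.of_le (by simp)) hc hT

/-- The fields `hX` and `hY` are divergence free, as their coefficients of `∂_t` do not depend on `t`
and the others are constant. -/
lemma integral_hX_hY {ψ : Heis → ℂ} (hψ : ContDiff ℝ ∞ ψ) (hc : HasCompactSupport ψ) :
    (Integrable (fun x => fderiv ℝ ψ x (hX x)) ∧ ∫ x, fderiv ℝ ψ x (hX x) = 0) ∧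
      Integrable (fun x => fderiv ℝ ψ x (hY x)) ∧ ∫ x, fderiv ℝ ψ x (hY x) = 0 := by
  have key : ∀ (u : Heis) (c : Heis → ℝ), ContDiff ℝ ∞ c → (∀ x, fderiv ℝ c x hT = 0) →
      Integrable (fun x => fderiv ℝ ψ x (u + c x • hT)) ∧
        ∫ x, fderiv ℝ ψ x (u + c x • hT) = 0 := fun u c hcd hct => by
    have hs : ContDiff ℝ ∞ fun x => (c x : ℂ) * ψ x :=
      (Complex.ofRealCLM.contDiff.comp hcd).mul hψ
    have hs2 : HasCompactSupport fun x => (c x : ℂ) * ψ x := hc.mul_left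
    have h1 : ∀ φ : Heis → ℂ, ContDiff ℝ ∞ φ → HasCompactSupport φ → ∀ v,
        Integrable fun x => fderiv ℝ φ x v := fun φ hφ hφc v =>
      ((hφ.continuous_fderiv (by simp)).clm_apply continuous_const).integrable_of_hasCompactSupport
        (hφc.fderiv_apply (𝕜 := ℝ) v)
    have e : (fun x => fderiv ℝ ψ x (u + c x • hT)) =
        fun x => fderiv ℝ ψ x u + fderiv ℝ (fun x => (c x : ℂ) * ψ x) x hT := by
      ext x
      have d1 : HasFDerivAt (fun x => (c x : ℂ)) (Complex.ofRealCLM ∘L fderiv ℝ c x) x :=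
        Complex.ofRealCLM.hasFDerivAt.comp x (hcd.differentiable (by simp) x).hasFDerivAt
      have d2 := (hψ.differentiable (by simp) x).hasFDerivAt
      have d3 : fderiv ℝ (fun x => (c x : ℂ) * ψ x) x = _ := (d1.mul d2).fderiv
      rw [d3]
      simp [hct]
    rw [e]
    refine ⟨(h1 ψ hψ hc u).add (h1 _ hs hs2 hT), ?_⟩
    rw [integral_add (h1 ψ hψ hc u) (h1 _ hs hs2 hT),
      integral_fderiv_eq_zero (hψ.of_le (by simp)) hc,
      integral_fderiv_eq_zero (hs.of_le (by simp)) hs2, add_zero]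
  have hre : ∀ L : ℂ →L[ℝ] ℝ, (ContDiff ℝ ∞ fun x : Heis => L x.1) ∧
      ∀ x, fderiv ℝ (fun x : Heis => L x.1) x hT = 0 := fun L => by
    refine ⟨L.contDiff.comp contDiff_fst, fun x => ?_⟩
    have : HasFDerivAt (fun x : Heis => L x.1) (L ∘L ContinuousLinearMap.fst ℝ ℂ ℝ) x :=
      L.hasFDerivAt.comp x hasFDerivAt_fst
    rw [this.fderiv]
    simp [hT]
  have k1 := key (1, 0) (fun x => ((2 : ℝ) • Complex.imCLM) x.1) (hre _).1 (hre _).2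
  have k2 := key (Complex.I, 0) (fun x => ((-2 : ℝ) • Complex.reCLM) x.1) (hre _).1 (hre _).2
  have e1 : ∀ x, ((1, 0) : Heis) + (((2 : ℝ) • Complex.imCLM) x.1) • hT = hX x := fun x => by
    ext <;> simp [hX, hT]
  have e2 : ∀ x, ((Complex.I, 0) : Heis) + (((-2 : ℝ) • Complex.reCLM) x.1) • hT = hY x :=
    fun x => by ext <;> simp [hY, hT]
  simp only [e1] at k1
  simp only [e2] at k2
  exact ⟨k1, k2⟩

lemma integral_hZ_eq_zero {ψ : Heis → ℂ} (hψ : ContDiff ℝ ∞ ψ) (hc : HasCompactSupport ψ) :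
    ∫ x, hZ ψ x = 0 := by
  obtain ⟨⟨i1, e1⟩, i2, e2⟩ := integral_hX_hY hψ hc
  unfold hZ
  rw [integral_const_mul, integral_sub i1 (i2.const_mul _), integral_const_mul, e1, e2]
  simp

lemma integral_hZbar_eq_zero {ψ : Heis → ℂ} (hψ : ContDiff ℝ ∞ ψ) (hc : HasCompactSupport ψ) :
    ∫ x, hZbar ψ x = 0 := by
  obtain ⟨⟨i1, e1⟩, i2, e2⟩ := integral_hX_hY hψ hc
  unfold hZbar
  rw [integral_const_mul, integral_add i1 (i2.const_mul _), integral_const_mul, e1, e2]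
  simp

/-! ### Functions supported in a shell -/

lemma isCompact_rho_le (r : ℝ) : IsCompact {x : Heis | rho x ≤ r} := by
  refine Metric.isCompact_of_isClosed_isBounded (isClosed_le continuous_rho continuous_const) ?_
  refine (Metric.isBounded_closedBall (x := (0 : Heis)) (r := max r (r ^ 2))).subset fun x hx => ?_
  have hx : rho x ≤ r := hx
  have h1 := norm_fst_le_rho x
  have h2 := abs_snd_le_rho_sq x
  have h3 := rho_nonneg x
  rw [mem_closedBall_zero_iff, Prod.norm_def, Real.norm_eq_abs]
  exact max_le_max (h1.trans hx) (h2.trans (by gcongr))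

/-- A family of smooth functions `u Λ`, supported in the shells `{Λ ≤ ρ ≤ 2Λ}` and uniformly
bounded by a multiple of `ρ^(-j)`. -/
structure IsShellFamily (j : ℝ) (u : ℝ → Heis → ℂ) : Prop where
  contDiff : ∀ Λ, 0 < Λ → ContDiff ℝ ∞ (u Λ)
  zero_in : ∀ Λ, 0 < Λ → ∀ x, rho x ≤ Λ → u Λ x = 0
  zero_out : ∀ Λ, 0 < Λ → ∀ x, 2 * Λ < rho x → u Λ x = 0
  bound : ∃ C, ∀ Λ, 0 < Λ → ∀ x, Λ < rho x → ‖u Λ x‖ ≤ C * rho x ^ (-j)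

namespace IsShellFamily

variable {j k : ℝ} {u : ℝ → Heis → ℂ} {G : Heis → ℂ}

lemma hasCompactSupport (hu : IsShellFamily j u) {Λ : ℝ} (hΛ : 0 < Λ) :
    HasCompactSupport (u Λ) :=
  HasCompactSupport.intro (isCompact_rho_le (2 * Λ)) fun x hx =>
    hu.zero_out Λ hΛ x (not_le.1 hx)

lemma contDiff_mul (hu : IsShellFamily j u) {Λ R : ℝ} (hΛ : 0 < Λ) (hR : R < Λ)
    (hG : ∀ x, R < rho x → ContDiffAt ℝ ∞ G x) : ContDiff ℝ ∞ fun x => u Λ x * G x := by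
  refine contDiff_iff_contDiffAt.2 fun x => ?_
  by_cases hx : R < rho x
  · exact (hu.contDiff Λ hΛ).contDiffAt.mul (hG x hx)
  · have : (fun x => u Λ x * G x) =ᶠ[𝓝 x] fun _ => 0 := by
      filter_upwards [continuous_rho.continuousAt.eventually
        (gt_mem_nhds ((not_lt.1 hx).trans_lt hR))] with y hy
      rw [hu.zero_in Λ hΛ y hy.le, zero_mul]
    exact contDiffAt_const.congr_of_eventuallyEq this

lemma integrable (hu : IsShellFamily j u) (hG : SmoothInf G) :
    ∀ᶠ Λ in atTop, Integrable fun x => u Λ x * G x := by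
  obtain ⟨R, hR, h⟩ := eventually_atInf.1 hG
  filter_upwards [eventually_gt_atTop R, eventually_gt_atTop 0] with Λ h1 h2
  exact (hu.contDiff_mul h2 h1 h).continuous.integrable_of_hasCompactSupport
    (hu.hasCompactSupport h2).mul_right

/-- The shell `{Λ ≤ ρ ≤ 2Λ}` has volume `O(Λ⁴)`, so factors of total order below `-4` contribute
nothing in the limit. -/
lemma tendsto_zero (hu : IsShellFamily j u) (hG : G =O[atInf] fun x => rho x ^ k)
    (hk : k - j < -4) : Tendsto (fun Λ => ∫ x, u Λ x * G x) atTop (𝓝 0) := by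
  obtain ⟨C, hC⟩ := hu.bound
  obtain ⟨M, hM⟩ := hG.bound
  obtain ⟨R, hR, hb⟩ := eventually_atInf.1 hM
  have hi : IntegrableOn (fun x => |C| * |M| * rho x ^ (-(j - k))) {x : Heis | 1 < rho x} :=
    Integrable.const_mul (integrableOn_rho_rpow (by linarith)) _
  refine squeeze_zero_norm' ?_ (tendsto_setIntegral_rho hi)
  filter_upwards [eventually_ge_atTop R, eventually_ge_atTop 1] with Λ h1 h2
  have h0 : 0 < Λ := by linarith
  have hm : MeasurableSet {x : Heis | Λ < rho x} :=
    (isOpen_lt continuous_const continuous_rho).measurableSet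
  rw [← setIntegral_eq_integral_of_forall_compl_eq_zero (s := {x | Λ < rho x})
    fun x hx => by rw [hu.zero_in Λ h0 x (not_lt.1 hx), zero_mul]]
  refine norm_integral_le_of_norm_le (hi.mono_set fun x hx => h2.trans_lt hx) ?_
  refine (ae_restrict_iff' hm).2 (Eventually.of_forall fun x hx => ?_)
  have hx : Λ < rho x := hx
  have hp : 0 < rho x := h0.trans hx
  have b1 := hC Λ h0 x hx
  have b2 := hb x (h1.trans_lt hx)
  rw [Real.norm_of_nonneg (Real.rpow_nonneg hp.le _)] at b2
  have p1 := Real.rpow_nonneg hp.le (-j)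
  have p2 := Real.rpow_nonneg hp.le k
  rw [norm_mul]
  calc ‖u Λ x‖ * ‖G x‖ ≤ (|C| * rho x ^ (-j)) * (|M| * rho x ^ k) := by
        refine mul_le_mul (b1.trans ?_) (b2.trans ?_) (norm_nonneg _) (by positivity)
        · exact mul_le_mul_of_nonneg_right (le_abs_self C) p1
        · exact mul_le_mul_of_nonneg_right (le_abs_self M) p2
    _ = |C| * |M| * rho x ^ (-(j - k)) := by
        rw [show -(j - k) = -j + k by ring, Real.rpow_add hp]
        ring

end IsShellFamily

/-! ### Derivatives of functions of the homogeneous norm -/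

/-- `|z|² + i t`; it satisfies `Z₁ w = 0` and `|w|² = ρ⁴`. -/
def gauge (x : Heis) : ℂ := (‖x.1‖ ^ 2 : ℝ) + x.2 * Complex.I

lemma gauge_eq (x : Heis) : gauge x = x.1 * conj x.1 + x.2 * Complex.I := by
  rw [gauge, Complex.mul_conj, Complex.normSq_eq_norm_sq]

lemma conj_gauge_eq (x : Heis) : conj (gauge x) = x.1 * conj x.1 - x.2 * Complex.I := by
  rw [gauge_eq]
  simp
  ring

lemma gauge_mul_conj (x : Heis) : gauge x * conj (gauge x) = quad x := by
  simp only [gauge, quad, map_add, map_mul, Complex.conj_ofReal, Complex.conj_I]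
  push_cast
  linear_combination (-(x.2 : ℂ) ^ 2) * Complex.I_sq

lemma contDiff_gauge : ContDiff ℝ ∞ gauge := by
  have : gauge = fun x => x.1 * conj x.1 + (x.2 : ℂ) * Complex.I := funext gauge_eq
  rw [this]
  exact (contDiff_fst.mul (Complex.conjCLE.contDiff.comp contDiff_fst)).add
    ((Complex.ofRealCLM.contDiff.comp contDiff_snd).mul contDiff_const)

section

variable (x : Heis)

lemma smoothAt_coordZ : SmoothAt (fun y : Heis => y.1) x := smoothAt_heis.2 (contDiffAt_coordZ x)

lemma smoothAt_coordT : SmoothAt (fun y : Heis => (y.2 : ℂ)) x :=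
  smoothAt_heis.2 (contDiffAt_coordT x)

lemma smoothAt_gauge : SmoothAt gauge x := smoothAt_heis.2 contDiff_gauge.contDiffAt

lemma der_gauge {D : (Heis → ℂ) → ℂ} (hD : IsDer x D) : D gauge = D (fun y => y.1) * conj x.1 +
    x.1 * D (fun y => conj y.1) + D (fun y => (y.2 : ℂ)) * Complex.I := by
  rw [show gauge = fun x => x.1 * conj x.1 + (x.2 : ℂ) * Complex.I from funext gauge_eq,
    hD.add ((smoothAt_coordZ x).mul (smoothAt_coordZ x).conj)
      ((smoothAt_coordT x).mul (smoothAt_const _)),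
    hD.mul (smoothAt_coordZ x) (smoothAt_coordZ x).conj,
    hD.mul (smoothAt_coordT x) (smoothAt_const _), hD.const]
  ring

lemma hZ_gauge : hZ gauge x = 0 := by
  rw [der_gauge x (isDer_hZ x), hZ_coordZ, hZ_coordZbar, hZ_coordT]
  have h2 := sqrt_two_cast_ne_zero
  field_simp
  linear_combination conj x.1 * Complex.I_sq

lemma hZbar_gauge : hZbar gauge x = (√2 : ℝ) * x.1 := by
  rw [der_gauge x (isDer_hZbar x), hZbar_coordZ, hZbar_coordZbar, hZbar_coordT]
  have h2 := sqrt_two_cast_ne_zero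
  have h22 := sqrt_two_sq
  field_simp
  linear_combination (-x.1) * Complex.I_sq - x.1 * h22

lemma hDt_gauge : hDt gauge x = Complex.I := by
  rw [der_gauge x (isDer_hDt x), hDt_coordZ, hDt_coordZbar, hDt_coordT]
  ring

lemma hZ_conj_gauge : hZ (fun y => conj (gauge y)) x = (√2 : ℝ) * conj x.1 := by
  rw [hZ_conj contDiff_gauge.contDiffAt, hZbar_gauge]
  simp

lemma hZbar_conj_gauge : hZbar (fun y => conj (gauge y)) x = 0 := by
  rw [hZbar_conj contDiff_gauge.contDiffAt, hZ_gauge]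
  simp

lemma hDt_conj_gauge : hDt (fun y => conj (gauge y)) x = -Complex.I := by
  rw [hDt_conj contDiff_gauge.contDiffAt, hDt_gauge]
  simp

lemma hZ_quad : hZ (fun y => (quad y : ℂ)) x = (√2 : ℝ) * conj x.1 * gauge x := by
  rw [show (fun y => (quad y : ℂ)) = fun y => gauge y * conj (gauge y) from
    funext fun y => (gauge_mul_conj y).symm,
    (isDer_hZ x).mul (smoothAt_gauge x) (smoothAt_gauge x).conj, hZ_gauge, hZ_conj_gauge]
  ring

lemma hZbar_quad : hZbar (fun y => (quad y : ℂ)) x = (√2 : ℝ) * x.1 * conj (gauge x) := by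
  rw [show (fun y => (quad y : ℂ)) = fun y => gauge y * conj (gauge y) from
    funext fun y => (gauge_mul_conj y).symm,
    (isDer_hZbar x).mul (smoothAt_gauge x) (smoothAt_gauge x).conj, hZbar_gauge, hZbar_conj_gauge]
  ring

lemma hDt_quad : hDt (fun y => (quad y : ℂ)) x = 2 * x.2 := by
  rw [show (fun y => (quad y : ℂ)) = fun y => gauge y * conj (gauge y) from
    funext fun y => (gauge_mul_conj y).symm,
    (isDer_hDt x).mul (smoothAt_gauge x) (smoothAt_gauge x).conj, hDt_gauge, hDt_conj_gauge,
    conj_gauge_eq, gauge_eq]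
  linear_combination (-2 * (x.2 : ℂ)) * Complex.I_sq

lemma fderiv_comp_quad {φ : ℝ → ℝ} {d : ℝ} (hφ : HasDerivAt φ d (quad x)) (v : Heis) :
    fderiv ℝ (fun y => (φ (quad y) : ℂ)) x v = d * fderiv ℝ (fun y => (quad y : ℂ)) x v := by
  have hq : HasFDerivAt quad (fderiv ℝ quad x) x :=
    (contDiff_quad.differentiable (by simp) x).hasFDerivAt
  have h1 : HasFDerivAt (fun y => (φ (quad y) : ℂ))
      (Complex.ofRealCLM ∘L (d • fderiv ℝ quad x)) x :=
    Complex.ofRealCLM.hasFDerivAt.comp x (hφ.comp_hasFDerivAt x hq)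
  have h2 : HasFDerivAt (fun y => (quad y : ℂ)) (Complex.ofRealCLM ∘L fderiv ℝ quad x) x :=
    Complex.ofRealCLM.hasFDerivAt.comp x hq
  rw [h1.fderiv, h2.fderiv]
  simp

variable {x} {φ : ℝ → ℝ} {d : ℝ}

lemma hZ_comp_quad (hφ : HasDerivAt φ d (quad x)) :
    hZ (fun y => (φ (quad y) : ℂ)) x = d * ((√2 : ℝ) * conj x.1 * gauge x) := by
  rw [← hZ_quad, hZ, hZ, fderiv_comp_quad x hφ, fderiv_comp_quad x hφ]
  ring

lemma hZbar_comp_quad (hφ : HasDerivAt φ d (quad x)) :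
    hZbar (fun y => (φ (quad y) : ℂ)) x = d * ((√2 : ℝ) * x.1 * conj (gauge x)) := by
  rw [← hZbar_quad, hZbar, hZbar, fderiv_comp_quad x hφ, fderiv_comp_quad x hφ]
  ring

lemma hDt_comp_quad (hφ : HasDerivAt φ d (quad x)) :
    hDt (fun y => (φ (quad y) : ℂ)) x = d * (2 * x.2) := by
  rw [← hDt_quad, hDt, hDt, fderiv_comp_quad x hφ]

end

/-! ### The derivatives of the cut-off -/

lemma hasDerivAt_cut (Λ s : ℝ) : HasDerivAt (fun s => profile (s / Λ ^ 4))
    (deriv profile (s / Λ ^ 4) / Λ ^ 4) s := by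
  have h1 := (contDiff_profile.differentiable (by simp) (s / Λ ^ 4)).hasDerivAt
  have h2 : HasDerivAt (fun s => profile (s / Λ ^ 4)) (deriv profile (s / Λ ^ 4) * (1 / Λ ^ 4)) s :=
    HasDerivAt.comp (h₂ := profile) (h := fun s => s / Λ ^ 4) s h1
      ((hasDerivAt_id s).div_const (Λ ^ 4))
  rwa [mul_one_div] at h2

lemma hZ_cut (Λ : ℝ) (x : Heis) : hZ (cut Λ) x =
    ((deriv profile (quad x / Λ ^ 4) / Λ ^ 4 : ℝ) : ℂ) * ((√2 : ℝ) * conj x.1 * gauge x) :=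
  hZ_comp_quad (hasDerivAt_cut Λ _)

lemma hZbar_cut (Λ : ℝ) (x : Heis) : hZbar (cut Λ) x =
    ((deriv profile (quad x / Λ ^ 4) / Λ ^ 4 : ℝ) : ℂ) * ((√2 : ℝ) * x.1 * conj (gauge x)) :=
  hZbar_comp_quad (hasDerivAt_cut Λ _)

lemma hDt_cut (Λ : ℝ) (x : Heis) : hDt (cut Λ) x =
    ((deriv profile (quad x / Λ ^ 4) / Λ ^ 4 : ℝ) : ℂ) * (2 * x.2) :=
  hDt_comp_quad (hasDerivAt_cut Λ _)

lemma norm_gauge (x : Heis) : ‖gauge x‖ = rho x ^ 2 := by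
  refine (pow_left_inj₀ (norm_nonneg _) (by positivity) two_ne_zero).1 ?_
  rw [← Complex.normSq_eq_norm_sq, ← pow_mul, rho_pow_four]
  have := gauge_mul_conj x
  rw [Complex.mul_conj] at this
  exact_mod_cast this

/-- A derivative of the cut-off has the form of a shell family. -/
lemma isShellFamily_of_deriv {u : ℝ → Heis → ℂ} {v : Heis → ℂ} {j K : ℝ}
    (hs : ∀ Λ, 0 < Λ → ContDiff ℝ ∞ (u Λ))
    (hu : ∀ Λ x, u Λ x = ((deriv profile (quad x / Λ ^ 4) / Λ ^ 4 : ℝ) : ℂ) * v x)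
    (hv : ∀ x, 0 < rho x → ‖v x‖ ≤ K * rho x ^ (4 - j)) : IsShellFamily j u := by
  obtain ⟨M, hM0, hM⟩ := exists_deriv_profile_bound
  have hin : ∀ Λ, 0 < Λ → ∀ x, (rho x ≤ Λ ∨ 2 * Λ ^ 4 ≤ quad x) → u Λ x = 0 := by
    intro Λ hΛ x hx
    rw [hu, deriv_profile_eq_zero, zero_div, Complex.ofReal_zero, zero_mul]
    rintro ⟨h1, h2⟩
    rw [one_lt_div (by positivity), ← lt_rho_iff hΛ.le] at h1
    rw [div_lt_iff₀ (by positivity)] at h2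
    rcases hx with hx | hx <;> linarith
  refine ⟨hs, fun Λ hΛ x hx => hin Λ hΛ x (Or.inl hx), fun Λ hΛ x hx => hin Λ hΛ x (Or.inr ?_),
    2 * M * K, fun Λ hΛ x hx => ?_⟩
  · rw [lt_rho_iff (by positivity)] at hx
    nlinarith [pow_pos hΛ 4]
  · have hp : 0 < rho x := hΛ.trans hx
    have hv0 := hv x hp
    have hKp : 0 ≤ K * rho x ^ (4 - j) := (norm_nonneg _).trans hv0
    have e : rho x ^ (4 - j) = quad x * rho x ^ (-j) := by
      rw [sub_eq_add_neg, Real.rpow_add hp, ← rho_pow_four]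
      norm_cast
    by_cases h2 : 2 * Λ ^ 4 ≤ quad x
    · rw [hin Λ hΛ x (Or.inr h2), norm_zero]
      have hpj := Real.rpow_pos_of_pos hp (-j)
      have hK : 0 ≤ K := nonneg_of_mul_nonneg_left hKp (Real.rpow_pos_of_pos hp _)
      positivity
    · have h2 := not_le.1 h2
      rw [hu, norm_mul, Complex.norm_real, Real.norm_eq_abs, abs_div, abs_of_pos (pow_pos hΛ 4)]
      have b1 : |deriv profile (quad x / Λ ^ 4)| / Λ ^ 4 ≤ M / Λ ^ 4 := by
        gcongr
        exact hM _
      have b3 : K * rho x ^ (4 - j) ≤ 2 * Λ ^ 4 * (K * rho x ^ (-j)) := by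
        have hK : 0 ≤ K := nonneg_of_mul_nonneg_left hKp (Real.rpow_pos_of_pos hp _)
        have hpj := Real.rpow_nonneg hp.le (-j)
        rw [e]
        have : quad x * (K * rho x ^ (-j)) ≤ 2 * Λ ^ 4 * (K * rho x ^ (-j)) :=
          mul_le_mul_of_nonneg_right h2.le (by positivity)
        linarith
      calc _ ≤ M / Λ ^ 4 * (2 * Λ ^ 4 * (K * rho x ^ (-j))) :=
            mul_le_mul b1 (hv0.trans b3) (norm_nonneg _) (by positivity)
        _ = 2 * M * K * rho x ^ (-j) := by
            field_simp

lemma contDiff_hZ {f : Heis → ℂ} (hf : ContDiff ℝ ∞ f) : ContDiff ℝ ∞ (hZ f) :=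
  contDiff_iff_contDiffAt.2 fun _ => contDiffAt_hZ hf.contDiffAt

lemma contDiff_hZbar {f : Heis → ℂ} (hf : ContDiff ℝ ∞ f) : ContDiff ℝ ∞ (hZbar f) :=
  contDiff_iff_contDiffAt.2 fun _ => contDiffAt_hZbar hf.contDiffAt

lemma contDiff_hDt {f : Heis → ℂ} (hf : ContDiff ℝ ∞ f) : ContDiff ℝ ∞ (hDt f) :=
  contDiff_iff_contDiffAt.2 fun _ => contDiffAt_hDt hf.contDiffAt

lemma isShellFamily_hZ_cut : IsShellFamily 1 fun Λ => hZ (cut Λ) := by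
  refine isShellFamily_of_deriv (K := √2) (fun Λ _ => contDiff_hZ (contDiff_cut Λ)) hZ_cut
    fun x hx => ?_
  rw [norm_mul, norm_mul, norm_gauge, Complex.norm_conj, Complex.norm_real,
    Real.norm_of_nonneg (Real.sqrt_nonneg 2), show (4 : ℝ) - 1 = ((3 : ℕ) : ℝ) by norm_num,
    Real.rpow_natCast, mul_assoc]
  have := norm_fst_le_rho x
  gcongr
  nlinarith [sq_nonneg (rho x)]

lemma isShellFamily_hZbar_cut : IsShellFamily 1 fun Λ => hZbar (cut Λ) := by
  refine isShellFamily_of_deriv (K := √2) (fun Λ _ => contDiff_hZbar (contDiff_cut Λ)) hZbar_cut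
    fun x hx => ?_
  rw [norm_mul, norm_mul, Complex.norm_conj, norm_gauge, Complex.norm_real,
    Real.norm_of_nonneg (Real.sqrt_nonneg 2), show (4 : ℝ) - 1 = ((3 : ℕ) : ℝ) by norm_num,
    Real.rpow_natCast, mul_assoc]
  have := norm_fst_le_rho x
  gcongr
  nlinarith [sq_nonneg (rho x)]

lemma isShellFamily_hDt_cut : IsShellFamily 2 fun Λ => hDt (cut Λ) := by
  refine isShellFamily_of_deriv (K := 2) (fun Λ _ => contDiff_hDt (contDiff_cut Λ)) hDt_cut
    fun x hx => ?_
  rw [norm_mul, Complex.norm_real, Real.norm_eq_abs, show (4 : ℝ) - 2 = ((2 : ℕ) : ℝ) by norm_num,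
    Real.rpow_natCast]
  have := abs_snd_le_rho_sq x
  simpa using this

/-! ### Integration in polar coordinates -/

/-- Polar coordinates in `ℂ` with `s = |z|²` as the radial variable. -/
lemma integral_norm_sq (g : ℝ → ℂ) :
    ∫ z : ℂ, g (‖z‖ ^ 2) = (Real.pi : ℂ) * ∫ s in Set.Ioi (0 : ℝ), g s := by
  have h1 := integral_fun_norm_addHaar (volume : Measure ℂ) fun y => g (y ^ 2)
  have h2 := integral_comp_rpow_Ioi_of_pos (g := g) (p := 2) two_pos
  have hv : (volume : Measure ℂ).real (Metric.ball 0 1) = Real.pi := by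
    simp [Measure.real]
  rw [h1, hv, ← h2, Complex.finrank_real_complex, nsmul_eq_mul, Complex.real_smul,
    ← integral_const_mul, ← integral_const_mul, ← integral_const_mul]
  refine setIntegral_congr_fun measurableSet_Ioi fun y _ => ?_
  have e1 : y ^ (2 : ℝ) = y ^ 2 := by norm_cast
  have e2 : y ^ ((2 : ℝ) - 1) = y := by norm_num
  simp only [e1, e2, Complex.real_smul]
  push_cast
  ring

/-- Polar coordinates in the half-plane of the values of `(|z|², t)`, with `r² = |z|⁴ + t² = ρ⁴`. -/
lemma integral_half_plane {k : ℝ → ℝ} {P : ℝ × ℝ → ℂ}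
    (hP : ∀ r c s : ℝ, P (r * c, r * s) = (r : ℂ) ^ 3 * P (c, s)) :
    ∫ p in Set.Ioi (0 : ℝ) ×ˢ (Set.univ : Set ℝ), (k (p.1 ^ 2 + p.2 ^ 2) : ℂ) * P p =
      (∫ r in Set.Ioi (0 : ℝ), ((r ^ 4 * k (r ^ 2) : ℝ) : ℂ)) *
        ∫ θ in (-(Real.pi / 2))..(Real.pi / 2), P (Real.cos θ, Real.sin θ) := by
  have hpi := Real.pi_pos
  have hm : MeasurableSet (Set.Ioi (0 : ℝ) ×ˢ (Set.univ : Set ℝ)) :=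
    measurableSet_Ioi.prod MeasurableSet.univ
  rw [← integral_indicator hm, ← integral_comp_polarCoord_symm]
  have e : ∀ p ∈ polarCoord.target, p.1 • (Set.Ioi (0 : ℝ) ×ˢ (Set.univ : Set ℝ)).indicator
      (fun p : ℝ × ℝ => (k (p.1 ^ 2 + p.2 ^ 2) : ℂ) * P p) (polarCoord.symm p) =
      ((p.1 ^ 4 * k (p.1 ^ 2) : ℝ) : ℂ) *
        (Set.Ioo (-(Real.pi / 2)) (Real.pi / 2)).indicator
          (fun θ => P (Real.cos θ, Real.sin θ)) p.2 := by
    rintro ⟨r, θ⟩ ⟨hr, hθ⟩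
    have hr : 0 < r := hr
    have hθ : -Real.pi < θ ∧ θ < Real.pi := hθ
    rw [polarCoord_symm_apply]
    have e1 : (r * Real.cos θ) ^ 2 + (r * Real.sin θ) ^ 2 = r ^ 2 := by
      linear_combination r ^ 2 * Real.sin_sq_add_cos_sq θ
    by_cases hc : 0 < Real.cos θ
    · have hθ2 : θ ∈ Set.Ioo (-(Real.pi / 2)) (Real.pi / 2) := by
        by_contra h
        rw [Set.mem_Ioo, not_and_or, not_lt, not_lt] at h
        rcases h with h | h
        · have := Real.cos_nonpos_of_pi_div_two_le_of_le (x := -θ) (by linarith) (by linarith)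
          rw [Real.cos_neg] at this
          linarith
        · linarith [Real.cos_nonpos_of_pi_div_two_le_of_le h (by linarith)]
      have hmem : (r * Real.cos θ, r * Real.sin θ) ∈ Set.Ioi (0 : ℝ) ×ˢ (Set.univ : Set ℝ) :=
        ⟨mul_pos hr hc, trivial⟩
      rw [Set.indicator_of_mem hmem, Set.indicator_of_mem hθ2, hP, e1, Complex.real_smul]
      push_cast
      ring
    · have hmem : (r * Real.cos θ, r * Real.sin θ) ∉ Set.Ioi (0 : ℝ) ×ˢ (Set.univ : Set ℝ) :=
        fun h => hc (pos_of_mul_pos_right h.1 hr.le)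
      rw [Set.indicator_of_notMem hmem, smul_zero, Set.indicator_of_notMem, mul_zero]
      exact fun h => hc (Real.cos_pos_of_mem_Ioo h)
  rw [setIntegral_congr_fun polarCoord.open_target.measurableSet e, polarCoord_target,
    Measure.volume_eq_prod]
  refine (setIntegral_prod_mul (fun r : ℝ => ((r ^ 4 * k (r ^ 2) : ℝ) : ℂ))
    ((Set.Ioo (-(Real.pi / 2)) (Real.pi / 2)).indicator fun θ => P (Real.cos θ, Real.sin θ))
    (Set.Ioi 0) (Set.Ioo (-Real.pi) Real.pi)).trans ?_
  rw [setIntegral_indicator measurableSet_Ioo, Set.inter_eq_self_of_subset_right,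
    intervalIntegral.integral_of_le (by linarith),
    integral_Ioc_eq_integral_Ioo]
  exact Set.Ioo_subset_Ioo (by linarith) (by linarith)

lemma integrable_radial_mul {X : Type*} [TopologicalSpace X] [MeasurableSpace X] [BorelSpace X]
    [T2Space X] {μ : Measure X} [IsFiniteMeasureOnCompacts μ] {k : ℝ → ℝ} {M B : ℝ}
    (hk : Measurable k) (hM : ∀ s, |k s| ≤ M) (hB : ∀ s, B < s → k s = 0) {n : X → ℝ} {p : X → ℂ}
    (hn : Continuous n) (hp : Continuous p) (hc : IsCompact {x | n x ≤ B}) :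
    Integrable (fun x => (k (n x) : ℂ) * p x) μ := by
  have h1 : Integrable ({x | n x ≤ B}.indicator p) μ :=
    (integrable_indicator_iff hc.measurableSet).2 (hp.continuousOn.integrableOn_compact hc)
  have h2 := h1.bdd_mul (f := fun x => (k (n x) : ℂ)) (c := M)
    (Complex.measurable_ofReal.comp (hk.comp hn.measurable)).aestronglyMeasurable
    (Eventually.of_forall fun x => by
      rw [Complex.norm_real]
      exact hM _)
  refine h2.congr (Eventually.of_forall fun x => ?_)
  by_cases hx : n x ≤ B
  · simp only [Set.indicator_of_mem (show x ∈ {x | n x ≤ B} from hx)]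
  · simp only [hB _ (not_le.1 hx), Complex.ofReal_zero, zero_mul]

lemma isCompact_quad_le (B : ℝ) : IsCompact {x : Heis | quad x ≤ B} := by
  refine (isCompact_rho_le (max B 1)).of_isClosed_subset
    (isClosed_le continuous_quad continuous_const) fun x hx => ?_
  have hx : quad x ≤ B := hx
  have h1 : (1 : ℝ) ≤ max B 1 := le_max_right _ _
  by_contra h
  have h : max B 1 < rho x := not_le.1 h
  rw [lt_rho_iff (by linarith)] at h
  have h2 := pow_le_pow_right₀ h1 (show 1 ≤ 4 by norm_num)
  linarith [le_max_left B 1]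

lemma isCompact_sq_add_sq_le (B : ℝ) : IsCompact {p : ℝ × ℝ | p.1 ^ 2 + p.2 ^ 2 ≤ B} := by
  refine Metric.isCompact_of_isClosed_isBounded
    (isClosed_le (by fun_prop) continuous_const) ?_
  refine (Metric.isBounded_closedBall (x := (0 : ℝ × ℝ)) (r := max B 1)).subset fun p hp => ?_
  have hp : p.1 ^ 2 + p.2 ^ 2 ≤ B := hp
  have h1 := le_max_left B 1
  have h2 := le_max_right B 1
  rw [mem_closedBall_zero_iff, Prod.norm_def, Real.norm_eq_abs, Real.norm_eq_abs]
  refine max_le ?_ ?_ <;> refine abs_le_of_sq_le_sq ?_ (by linarith) <;>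
    nlinarith [sq_nonneg p.1, sq_nonneg p.2]

/-- The integral of a function of `(|z|², t)` which is the product of a radial function and a
homogeneous polynomial of degree three. -/
theorem integral_radial_mul {k : ℝ → ℝ} {P : ℝ × ℝ → ℂ} {M B : ℝ} (hk : Measurable k)
    (hM : ∀ s, |k s| ≤ M) (hB : ∀ s, B < s → k s = 0) (hPc : Continuous P)
    (hP : ∀ r c s : ℝ, P (r * c, r * s) = (r : ℂ) ^ 3 * P (c, s)) :
    ∫ x : Heis, (k (quad x) : ℂ) * P (‖x.1‖ ^ 2, x.2) =
      Real.pi * ((∫ r in Set.Ioi (0 : ℝ), ((r ^ 4 * k (r ^ 2) : ℝ) : ℂ)) *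
        ∫ θ in (-(Real.pi / 2))..(Real.pi / 2), P (Real.cos θ, Real.sin θ)) := by
  have i1 : Integrable (fun x : Heis => (k (quad x) : ℂ) * P (‖x.1‖ ^ 2, x.2)) :=
    integrable_radial_mul hk hM hB continuous_quad (by fun_prop) (isCompact_quad_le B)
  have i2 : Integrable (fun p : ℝ × ℝ => (k (p.1 ^ 2 + p.2 ^ 2) : ℂ) * P p) :=
    integrable_radial_mul (n := fun p : ℝ × ℝ => p.1 ^ 2 + p.2 ^ 2) hk hM hB (by fun_prop) hPc
      (isCompact_sq_add_sq_le B)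
  have i3 : IntegrableOn (fun p : ℝ × ℝ => (k (p.1 ^ 2 + p.2 ^ 2) : ℂ) * P p)
      (Set.Ioi (0 : ℝ) ×ˢ (Set.univ : Set ℝ)) := i2.integrableOn
  rw [Measure.volume_eq_prod] at i1
  rw [IntegrableOn, Measure.volume_eq_prod, ← Measure.prod_restrict, Measure.restrict_univ] at i3
  have e1 := integral_prod_symm _ i1
  have e2 := integral_prod_symm _ i3
  rw [← integral_half_plane hP, Measure.volume_eq_prod, Measure.volume_eq_prod, e1,
    ← Measure.prod_restrict, Measure.restrict_univ, e2, ← integral_const_mul]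
  congr 1
  ext t
  rw [← integral_norm_sq fun s => (k (s ^ 2 + t ^ 2) : ℂ) * P (s, t)]
  congr 1
  ext z
  rw [quad, ← pow_mul]

lemma integral_trig (a b c : ℂ) :
    ∫ θ in (-(Real.pi / 2))..(Real.pi / 2), (a * Real.cos θ + b * (Real.cos θ * Real.sin θ ^ 2) +
      c * (Real.cos θ ^ 2 * Real.sin θ)) = 2 * a + 2 / 3 * b := by
  have hd : ∀ θ ∈ Set.uIcc (-(Real.pi / 2)) (Real.pi / 2), HasDerivAt (fun θ : ℝ =>
      a * (Real.sin θ : ℂ) + b / 3 * (Real.sin θ : ℂ) ^ 3 - c / 3 * (Real.cos θ : ℂ) ^ 3)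
      (a * Real.cos θ + b * (Real.cos θ * Real.sin θ ^ 2) +
        c * (Real.cos θ ^ 2 * Real.sin θ)) θ := fun θ _ => by
    have hs := (Real.hasDerivAt_sin θ).ofReal_comp
    have hc := (Real.hasDerivAt_cos θ).ofReal_comp
    refine (((hs.const_mul a).add ((hs.pow 3).const_mul (b / 3))).sub
      ((hc.pow 3).const_mul (c / 3))).congr_deriv ?_
    push_cast
    ring
  rw [intervalIntegral.integral_eq_sub_of_hasDerivAt hd (by
    refine Continuous.intervalIntegrable ?_ _ _
    fun_prop)]
  simp
  ring

/-! ### Derivatives of the leading perturbation -/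

/-- The power `ρ^(4 k)`, with complex values. -/
def quadPow (k : ℝ) (x : Heis) : ℂ := (quad x ^ k : ℝ)

section

variable {x : Heis} (hx : x ≠ 0) (k : ℝ)

include hx

lemma hasDerivAt_quad_rpow : HasDerivAt (fun s : ℝ => s ^ k) (k * quad x ^ (k - 1)) (quad x) :=
  Real.hasDerivAt_rpow_const (Or.inl (quad_pos hx).ne')

lemma hZ_quadPow : hZ (quadPow k) x = k * quadPow (k - 1) x * ((√2 : ℝ) * conj x.1 * gauge x) := by
  refine (hZ_comp_quad (hasDerivAt_quad_rpow hx k)).trans ?_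
  rw [quadPow]
  push_cast
  ring

lemma hZbar_quadPow :
    hZbar (quadPow k) x = k * quadPow (k - 1) x * ((√2 : ℝ) * x.1 * conj (gauge x)) := by
  refine (hZbar_comp_quad (hasDerivAt_quad_rpow hx k)).trans ?_
  rw [quadPow]
  push_cast
  ring

lemma smoothAt_quadPow : SmoothAt (quadPow k) x := smoothAt_heis.2 <|
  Complex.ofRealCLM.contDiff.contDiffAt.comp x
    (contDiff_quad.contDiffAt.rpow_const_of_ne (quad_pos hx).ne')

lemma quadPow_mul_gauge : quadPow (k - 1) x * (gauge x * conj (gauge x)) = quadPow k x := by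
  rw [gauge_mul_conj, quadPow, quadPow, ← Complex.ofReal_mul, Real.rpow_sub_one (quad_pos hx).ne',
    div_mul_cancel₀ _ (quad_pos hx).ne']

end

namespace AsymptoticallyFlat

variable {N : Type*} [TopologicalSpace N] [ChartedSpace Heis N] [IsManifold IH ∞ N]
  [MeasurableSpace N] {S : Pseudohermitian N} (F : AsymptoticallyFlat S) {x : Heis}

/-- The coefficient of the leading perturbation. -/
def coeff : ℂ := 4 * (Real.pi : ℂ) * (F.A : ℂ)

lemma pert_eq : F.pert = fun x => F.coeff * quadPow (-(1 / 2)) x := by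
  ext x
  rw [pert, coeff, quadPow, rho_rpow]
  norm_num

lemma hZ_pert_eq (hx : x ≠ 0) : hZ F.pert x =
    -(F.coeff * (√2 : ℝ) / 2) * (quadPow (-(3 / 2)) x * (conj x.1 * gauge x)) := by
  rw [F.pert_eq, (isDer_hZ x).const_mul _ (smoothAt_quadPow hx _), hZ_quadPow hx]
  norm_num
  ring

lemma hZbar_pert_eq (hx : x ≠ 0) : hZbar F.pert x =
    -(F.coeff * (√2 : ℝ) / 2) * (quadPow (-(3 / 2)) x * (x.1 * conj (gauge x))) := by
  rw [F.pert_eq, (isDer_hZbar x).const_mul _ (smoothAt_quadPow hx _), hZbar_quadPow hx]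
  norm_num
  ring

lemma hZ_hZ_pert_eq (hx : x ≠ 0) : hZ (hZ F.pert) x =
    3 / 2 * F.coeff * (quadPow (-(5 / 2)) x * (conj x.1 * conj x.1 * (gauge x * gauge x))) := by
  have e : hZ F.pert =ᶠ[𝓝 x] fun y =>
      -(F.coeff * (√2 : ℝ) / 2) * (quadPow (-(3 / 2)) y * (conj y.1 * gauge y)) := by
    filter_upwards [isOpen_ne.mem_nhds hx] with y hy using F.hZ_pert_eq hy
  have d := isDer_hZ x
  have s1 := smoothAt_quadPow hx (-(3 / 2))
  have s2 := (smoothAt_coordZ x).conj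
  have s3 := smoothAt_gauge x
  rw [d.congr e, d.const_mul _ (s1.mul (s2.mul s3)), d.mul s1 (s2.mul s3), d.mul s2 s3, hZ_gauge,
    hZ_coordZbar, hZ_quadPow hx]
  have h22 := sqrt_two_sq
  norm_num
  linear_combination (3 / 4 * F.coeff * (quadPow (-(5 / 2)) x *
    (conj x.1 * conj x.1 * (gauge x * gauge x)))) * h22

lemma hZbar_hZ_hZ_pert_eq (hx : x ≠ 0) : hZbar (hZ (hZ F.pert)) x =
    3 / 2 * F.coeff * (√2 : ℝ) * (quadPow (-(5 / 2)) x * (conj x.1 * gauge x *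
      (gauge x - x.1 * conj x.1 / 2))) := by
  have e : hZ (hZ F.pert) =ᶠ[𝓝 x] fun y =>
      3 / 2 * F.coeff * (quadPow (-(5 / 2)) y * (conj y.1 * conj y.1 * (gauge y * gauge y))) := by
    filter_upwards [isOpen_ne.mem_nhds hx] with y hy using F.hZ_hZ_pert_eq hy
  have d := isDer_hZbar x
  have s1 := smoothAt_quadPow hx (-(5 / 2))
  have s2 := (smoothAt_coordZ x).conj
  have s3 := smoothAt_gauge x
  rw [d.congr e, d.const_mul _ (s1.mul ((s2.mul s2).mul (s3.mul s3))),
    d.mul s1 ((s2.mul s2).mul (s3.mul s3)), d.mul (s2.mul s2) (s3.mul s3), d.mul s2 s2, d.mul s3 s3,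
    hZbar_gauge, hZbar_coordZbar, hZbar_quadPow hx]
  have hs : 1 / ((√2 : ℝ) : ℂ) = (√2 : ℝ) / 2 := by
    rw [div_eq_div_iff sqrt_two_cast_ne_zero two_ne_zero]
    linear_combination -sqrt_two_sq
  have hq := quadPow_mul_gauge hx (-(5 / 2))
  push_cast
  linear_combination (3 / 2 * F.coeff * (-(5 / 2)) * (√2 : ℝ) * x.1 * conj x.1 ^ 2 * gauge x) * hq +
    (3 * F.coeff * quadPow (-(5 / 2)) x * conj x.1 * gauge x ^ 2) * hs

/-! ### The two explicit integrals -/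

lemma norm_sq_eq_mul_conj (z : ℂ) : ((‖z‖ ^ 2 : ℝ) : ℂ) = z * conj z := by
  rw [Complex.mul_conj, Complex.normSq_eq_norm_sq]

/-- The leading part of `β̄ P β` integrates to zero against radial functions. -/
lemma integral_radial_mul_leading {Λ : ℝ} (hΛ : 0 < Λ) :
    ∫ x in {x : Heis | Λ < rho x}, cut Λ x * (x.1 * hZbar (hZ (hZ F.pert)) x) = 0 := by
  have hm : MeasurableSet {x : Heis | Λ < rho x} :=
    (isOpen_lt continuous_const continuous_rho).measurableSet
  set k : ℝ → ℝ := (Set.Ioi (Λ ^ 4)).indicator fun s => profile (s / Λ ^ 4) * s ^ (-(5 / 2) : ℝ)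
    with hk
  -- the integrand is a multiple of `k(ρ⁴) P(|z|², t)`, with `P` from `hZbar_hZ_hZ_pert_eq`
  set P : ℝ × ℝ → ℂ := fun p => (p.1 : ℂ) * ((p.1 + p.2 * Complex.I) * (p.1 / 2 + p.2 * Complex.I))
    with hP
  have hp4 : 0 < Λ ^ 4 := by positivity
  have e : ∫ x in {x : Heis | Λ < rho x}, cut Λ x * (x.1 * hZbar (hZ (hZ F.pert)) x) =
      3 / 2 * F.coeff * (√2 : ℝ) * ∫ x : Heis, (k (quad x) : ℂ) * P (‖x.1‖ ^ 2, x.2) := by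
    rw [← integral_indicator hm, ← integral_const_mul]
    congr 1
    ext x
    by_cases hx : x ∈ {x : Heis | Λ < rho x}
    · have hx2 : quad x ∈ Set.Ioi (Λ ^ 4) := (lt_rho_iff hΛ.le).1 hx
      have h0 : x ≠ 0 := ne_zero_of_rho_pos (hΛ.trans hx)
      rw [Set.indicator_of_mem hx, F.hZbar_hZ_hZ_pert_eq h0, hk, Set.indicator_of_mem hx2, hP, cut,
        quadPow, gauge_eq]
      beta_reduce
      rw [norm_sq_eq_mul_conj]
      push_cast
      ring
    · have hx2 : quad x ∉ Set.Ioi (Λ ^ 4) := fun h => hx ((lt_rho_iff hΛ.le).2 h)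
      rw [Set.indicator_of_notMem hx, hk, Set.indicator_of_notMem hx2]
      simp
  have hmk : Measurable k := by
    refine Measurable.indicator ?_ measurableSet_Ioi
    exact (contDiff_profile.continuous.measurable.comp (measurable_id.div_const _)).mul
      (measurable_id.pow_const _)
  have hbk : ∀ s, |k s| ≤ (Λ ^ 4) ^ (-(5 / 2) : ℝ) := fun s => by
    have hp := Real.rpow_nonneg hp4.le (-(5 / 2))
    by_cases hs : s ∈ Set.Ioi (Λ ^ 4)
    · have hs' : Λ ^ 4 < s := hs
      have h1 : s ^ (-(5 / 2) : ℝ) ≤ (Λ ^ 4) ^ (-(5 / 2) : ℝ) :=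
        Real.rpow_le_rpow_of_nonpos hp4 hs'.le (by norm_num)
      have h2 := Real.rpow_nonneg (hp4.trans hs').le (-(5 / 2))
      rw [hk, Set.indicator_of_mem hs, abs_of_nonneg (mul_nonneg (profile_nonneg _) h2)]
      have := mul_le_mul (profile_le_one (s / Λ ^ 4)) h1 h2 zero_le_one
      linarith
    · rw [hk, Set.indicator_of_notMem hs, abs_zero]
      exact hp
  have hzk : ∀ s, 2 * Λ ^ 4 < s → k s = 0 := fun s hs => by
    have hs' : s ∈ Set.Ioi (Λ ^ 4) := by
      rw [Set.mem_Ioi]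
      linarith
    rw [hk, Set.indicator_of_mem hs', profile_zero, zero_mul]
    rw [le_div_iff₀ hp4]
    exact hs.le
  rw [e, integral_radial_mul hmk hbk hzk (by fun_prop) fun r c s => by
    simp only [hP]
    push_cast
    ring]
  have ha : (fun θ : ℝ => P (Real.cos θ, Real.sin θ)) = fun θ : ℝ => (1 / 2) * (Real.cos θ : ℂ) +
      (-(3 / 2)) * (Real.cos θ * Real.sin θ ^ 2) +
        (3 / 2 * Complex.I) * (Real.cos θ ^ 2 * Real.sin θ) := by
    ext θ
    have h1 : (Real.cos θ : ℂ) ^ 2 = 1 - (Real.sin θ : ℂ) ^ 2 := by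
      exact_mod_cast Real.cos_sq' θ
    simp only [hP]
    linear_combination (1 / 2 * (Real.cos θ : ℂ)) * h1 +
      (Real.cos θ : ℂ) * (Real.sin θ : ℂ) ^ 2 * Complex.I_sq
  -- the angular integral is `2 · 1/2 + (2/3) · (-3/2) = 0`
  rw [ha, integral_trig]
  ring

lemma integral_deriv_profile {Λ : ℝ} (hΛ : 0 < Λ) :
    ∫ r in Set.Ioi (0 : ℝ), r * (deriv profile (r ^ 2 / Λ ^ 4) / Λ ^ 4) = -(1 / 2) := by
  have hp4 : 0 < Λ ^ 4 := by positivity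
  have hd : ∀ r ∈ Set.Ioi (0 : ℝ), HasDerivAt (fun r => 1 / 2 * profile (r ^ 2 / Λ ^ 4))
      (r * (deriv profile (r ^ 2 / Λ ^ 4) / Λ ^ 4)) r := fun r _ => by
    have h1 : HasDerivAt (fun r : ℝ => profile (r ^ 2 / Λ ^ 4)) _ r :=
      HasDerivAt.comp (h₂ := fun s => profile (s / Λ ^ 4)) (h := fun r : ℝ => r ^ 2) r
        (hasDerivAt_cut Λ (r ^ 2)) (hasDerivAt_pow 2 r)
    refine (h1.const_mul (1 / 2)).congr_deriv ?_
    push_cast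
    ring
  have hz : ∀ r : ℝ, 2 * Λ ^ 2 < r → 2 ≤ r ^ 2 / Λ ^ 4 := fun r hr => by
    rw [le_div_iff₀ hp4]
    nlinarith [pow_pos hΛ 2]
  have hc : Continuous fun r => r * (deriv profile (r ^ 2 / Λ ^ 4) / Λ ^ 4) :=
    continuous_id.mul ((continuous_deriv_profile.comp (by fun_prop)).div_const _)
  have hi : IntegrableOn (fun r => r * (deriv profile (r ^ 2 / Λ ^ 4) / Λ ^ 4)) (Set.Ioi 0) := by
    refine (Continuous.integrable_of_hasCompactSupport hc ?_).integrableOn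
    refine HasCompactSupport.intro (isCompact_Icc (a := -(2 * Λ ^ 2)) (b := 2 * Λ ^ 2))
      fun r hr => ?_
    have hr2 : 2 * Λ ^ 2 < |r| := by
      rw [Set.mem_Icc, ← abs_le] at hr
      exact not_le.1 hr
    have := hz |r| hr2
    rw [sq_abs] at this
    rw [deriv_profile_eq_zero fun h => not_lt.2 this h.2]
    simp
  have hl : Tendsto (fun r => 1 / 2 * profile (r ^ 2 / Λ ^ 4)) atTop (𝓝 0) := by
    refine tendsto_const_nhds.congr' ?_
    filter_upwards [eventually_gt_atTop (2 * Λ ^ 2)] with r hr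
    rw [profile_zero (hz r hr), mul_zero]
  have hcont : Continuous fun r : ℝ => 1 / 2 * profile (r ^ 2 / Λ ^ 4) :=
    continuous_const.mul (contDiff_profile.continuous.comp (by fun_prop))
  rw [integral_Ioi_of_hasDerivAt_of_tendsto hcont.continuousWithinAt hd hi hl]
  simp [profile_one]

/-- The flux of the leading terms through the shell. -/
lemma integral_leading_flux {Λ : ℝ} (hΛ : 0 < Λ) :
    ∫ x, (hZbar (cut Λ) x * ((√2 : ℝ) * x.1 * hZ (hZ F.pert) x + 2 * hZ F.pert x) +
      2 * (hZ (cut Λ) x * hZbar F.pert x)) = 8 * (Real.pi : ℂ) ^ 2 * F.A := by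
  set k : ℝ → ℝ := fun s => deriv profile (s / Λ ^ 4) / Λ ^ 4 * s ^ (-(3 / 2) : ℝ) with hk
  set P : ℝ × ℝ → ℂ := fun p => 3 * (p.1 : ℂ) ^ 2 * (p.1 + p.2 * Complex.I) -
    4 * (p.1 : ℂ) * ((p.1 : ℂ) ^ 2 + (p.2 : ℂ) ^ 2) with hP
  have hp4 : 0 < Λ ^ 4 := by positivity
  have e : ∫ x, (hZbar (cut Λ) x * ((√2 : ℝ) * x.1 * hZ (hZ F.pert) x + 2 * hZ F.pert x) +
      2 * (hZ (cut Λ) x * hZbar F.pert x)) =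
      F.coeff * ∫ x : Heis, (k (quad x) : ℂ) * P (‖x.1‖ ^ 2, x.2) := by
    rw [← integral_const_mul]
    congr 1
    ext x
    by_cases h0 : x = 0
    · subst h0
      simp [hZ_cut, hZbar_cut, gauge, hP]
    · rw [F.hZ_pert_eq h0, F.hZbar_pert_eq h0, F.hZ_hZ_pert_eq h0, hZ_cut, hZbar_cut, hP, hk]
      have h3 := quadPow_mul_gauge h0 (-(3 / 2))
      have h5 : quadPow (-(3 / 2)) x = ((quad x ^ (-(3 / 2) : ℝ) : ℝ) : ℂ) := rfl
      have h6 : quadPow (-(3 / 2) - 1) x = quadPow (-(5 / 2)) x := by norm_num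
      have h22 := sqrt_two_sq
      have hg := gauge_eq x
      have hcg := conj_gauge_eq x
      rw [h6] at h3
      beta_reduce
      rw [norm_sq_eq_mul_conj]
      push_cast
      rw [← h5]
      set d : ℂ := ((deriv profile (quad x / Λ ^ 4) : ℝ) : ℂ) / (Λ : ℂ) ^ 4
      set z := x.1
      set c := F.coeff
      set q := quadPow (-(3 / 2)) x
      linear_combination (3 / 2 * d * c * (√2 : ℝ) ^ 2 * z ^ 2 * conj z ^ 2 * gauge x) * h3 +
        (3 / 2 * d * c * z ^ 2 * conj z ^ 2 * gauge x * q -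
          2 * d * c * q * z * conj z * gauge x * conj (gauge x)) * h22 +
        (3 * d * c * q * z ^ 2 * conj z ^ 2 - 4 * d * c * q * z * conj z * conj (gauge x)) * hg +
        (-4 * d * c * q * z * conj z * (z * conj z + x.2 * Complex.I)) * hcg +
        (4 * d * c * q * z * conj z * (x.2 : ℂ) ^ 2) * Complex.I_sq
  have hbk : ∃ M, ∀ s, |k s| ≤ M := by
    obtain ⟨M, hM0, hM⟩ := exists_deriv_profile_bound
    refine ⟨M / Λ ^ 4 * (Λ ^ 4) ^ (-(3 / 2) : ℝ), fun s => ?_⟩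
    have hp := Real.rpow_nonneg hp4.le (-(3 / 2))
    by_cases hs : s / Λ ^ 4 ∈ Set.Ioo (1 : ℝ) 2
    · have hs' : Λ ^ 4 < s := by
        have := hs.1
        rwa [one_lt_div hp4] at this
      have h1 : s ^ (-(3 / 2) : ℝ) ≤ (Λ ^ 4) ^ (-(3 / 2) : ℝ) :=
        Real.rpow_le_rpow_of_nonpos hp4 hs'.le (by norm_num)
      have h2 := Real.rpow_nonneg (hp4.trans hs').le (-(3 / 2))
      rw [hk]
      beta_reduce
      rw [abs_mul, abs_of_nonneg h2, abs_div, abs_of_pos hp4]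
      have := hM (s / Λ ^ 4)
      gcongr
    · rw [hk]
      beta_reduce
      rw [deriv_profile_eq_zero hs]
      simp only [zero_div, zero_mul, abs_zero]
      positivity
  obtain ⟨M, hM⟩ := hbk
  have hmk : Measurable k :=
    ((continuous_deriv_profile.measurable.comp (measurable_id.div_const _)).div_const _).mul
      (measurable_id.pow_const _)
  have hzk : ∀ s, 2 * Λ ^ 4 < s → k s = 0 := fun s hs => by
    rw [hk]
    beta_reduce
    rw [deriv_profile_eq_zero, zero_div, zero_mul]
    rintro ⟨-, h⟩
    rw [div_lt_iff₀ hp4] at h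
    linarith
  rw [e, integral_radial_mul hmk hM hzk (by fun_prop) fun r c s => by
    simp only [hP]
    push_cast
    ring]
  have ha : (fun θ : ℝ => P (Real.cos θ, Real.sin θ)) = fun θ : ℝ => (-1) * (Real.cos θ : ℂ) +
      (-3) * (Real.cos θ * Real.sin θ ^ 2) + (3 * Complex.I) * (Real.cos θ ^ 2 * Real.sin θ) := by
    ext θ
    have h1 : (Real.cos θ : ℂ) ^ 2 = 1 - (Real.sin θ : ℂ) ^ 2 := by
      exact_mod_cast Real.cos_sq' θ
    simp only [hP]
    linear_combination (-(Real.cos θ : ℂ)) * h1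
  have hr : ∫ r in Set.Ioi (0 : ℝ), ((r ^ 4 * k (r ^ 2) : ℝ) : ℂ) = ((-(1 / 2) : ℝ) : ℂ) := by
    rw [← integral_deriv_profile hΛ, ← integral_complex_ofReal]
    refine setIntegral_congr_fun measurableSet_Ioi fun r hr => ?_
    have hr : 0 < r := hr
    have h1 : (r ^ 2) ^ (-(3 / 2) : ℝ) * r ^ 3 = 1 := by
      rw [← Real.rpow_natCast r 2, ← Real.rpow_mul hr.le, ← Real.rpow_natCast r 3,
        ← Real.rpow_add hr]
      norm_num
    simp only [hk]
    congr 1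
    linear_combination (r * (deriv profile (r ^ 2 / Λ ^ 4) / Λ ^ 4)) * h1
  -- the angular integral is `-2 - 2 = -4`, the radial one `-1/2`
  rw [ha, integral_trig, hr, coeff]
  push_cast
  ring

end AsymptoticallyFlat

/-! ### The limit of the flux -/

lemma hasCompactSupport_der {D : (Heis → ℂ) → Heis → ℂ} (hD : ∀ x, IsDer x fun f => D f x)
    {ψ : Heis → ℂ} (hc : HasCompactSupport ψ) : HasCompactSupport (D ψ) := by
  refine HasCompactSupport.intro hc fun x hx => ?_
  have h := (hD x).congr (notMem_tsupport_iff_eventuallyEq.1 hx)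
  exact h.trans ((hD x).const 0)

namespace AsymptoticallyFlat

variable {N : Type*} [TopologicalSpace N] [ChartedSpace Heis N] [IsManifold IH ∞ N]
  [MeasurableSpace N] {S : Pseudohermitian N} (F : AsymptoticallyFlat S)
  {x : Heis} {β : N → ℂ} {g : Heis → ℂ} {ε : ℝ} {κ : ℂ}

lemma isSymbolO_leadBar (hg : IsHomog (-1) g) : IsSymbolO (-3) (F.leadBar g) := by
  have t1 : IsSymbolO (-3) fun x => x.1 * hZ (hZ F.pert) x :=
    isSymbolO_coordZ.mul F.hZ_hZ_pert_symbol
  have t2 : IsSymbolO (-3) (hZbar (hZbar g)) := (hg.isSymbolO.hZbar le_rfl).hZbar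
  refine (((t1.const_mul (-((√2 : ℝ) : ℂ))).sub (F.hZ_pert_symbol.const_mul 2)).add
    (t2.star.const_mul (√2 : ℝ))).congr (Eventually.of_forall fun x => ?_)
  rw [leadBar]
  ring

lemma isSymbolO_lead (hg : IsHomog (-1) g) : IsSymbolO (-3) (F.lead g) := by
  have t2 : IsSymbolO (-3) (hDt g) := hg.isSymbolO.hDt
  refine (F.hZbar_pert_symbol.neg.sub (t2.star.const_mul ((√2 : ℝ) * Complex.I))).congr
    (Eventually.of_forall fun x => ?_)
  rw [lead]

section Leading

variable (hg : IsHomog (-1) g)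
  (hgZ : ∀ x, x ≠ 0 → hZbar g x = -((√2 : ℝ) / 2) * F.pert x + κ / gauge x)

include hg hgZ

lemma hZ_conj_eq (hx : x ≠ 0) : hZ (fun y => conj (g y)) x =
    -((√2 : ℝ) / 2) * F.pert x + conj κ * (conj (gauge x))⁻¹ := by
  rw [hZ_conj (hg.1 x hx), hgZ x hx]
  simp only [map_add, map_mul, map_neg, map_div₀, F.conj_pert, Complex.conj_ofReal, map_ofNat]
  ring

/-- Conjugating the equation for `g` and using `Z_1̄ w̄ = 0`, the term with `κ` drops out. -/
lemma hZbar_hZ_conj_eq (hx : x ≠ 0) : hZbar (hZ fun y => conj (g y)) x =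
    -((√2 : ℝ) / 2) * hZbar F.pert x := by
  have d := isDer_hZbar x
  have hw : conj (gauge x) ≠ 0 := by
    rw [← norm_ne_zero_iff, Complex.norm_conj, norm_gauge]
    exact (pow_pos (rho_pos hx) 2).ne'
  have e : (hZ fun y => conj (g y)) =ᶠ[𝓝 x] fun y =>
      -((√2 : ℝ) / 2) * F.pert y + conj κ * (conj (gauge y))⁻¹ := by
    filter_upwards [isOpen_ne.mem_nhds hx] with y hy using F.hZ_conj_eq hg hgZ hy
  have s1 : SmoothAt F.pert x := smoothAt_heis.2 (F.isHomog_pert.1 x hx)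
  have s2 : SmoothAt (fun y => conj (gauge y)) x := (smoothAt_gauge x).conj
  have s3 : SmoothAt (fun y => (conj (gauge y))⁻¹) x :=
    smoothAt_heis.2 ((smoothAt_heis.1 s2).inv hw)
  have h1 : hZbar (fun y => conj (gauge y) * (conj (gauge y))⁻¹) x = 0 := by
    have hc : (fun y => conj (gauge y) * (conj (gauge y))⁻¹) =ᶠ[𝓝 x] fun _ => 1 := by
      filter_upwards [(smoothAt_heis.1 s2).continuousAt.eventually_ne hw] with y hy
      exact mul_inv_cancel₀ hy
    rw [d.congr hc, d.const]
  rw [d.mul s2 s3, hZbar_conj_gauge, zero_mul, zero_add] at h1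
  have h2 : hZbar (fun y => (conj (gauge y))⁻¹) x = 0 := (mul_eq_zero.1 h1).resolve_left hw
  rw [d.congr e, d.add (s1.const_mul _) (s3.const_mul _), d.const_mul _ s1, d.const_mul _ s3, h2,
    mul_zero, add_zero]

/-- The leading flux through the shell. The terms with second derivatives of `g` form a
divergence, up to a term which only involves `Z_1̄ g`. -/
lemma integral_lead {Λ : ℝ} (hΛ : 0 < Λ) :
    ∫ x, (hZbar (cut Λ) x * F.leadBar g x + hZ (cut Λ) x * F.lead g x) =
      -(8 * (Real.pi : ℂ) ^ 2 * F.A) := by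
  set G : Heis → ℂ := fun y => conj (g y) with hG
  have hGs : ∀ x, x ≠ 0 → ContDiffAt ℝ ∞ G x := fun x hx =>
    smoothAt_heis.1 (smoothAt_heis.2 (hg.1 x hx)).conj
  have off : ∀ {f : Heis → ℂ}, (∀ x, x ≠ 0 → ContDiffAt ℝ ∞ f x) →
      ∀ x, 0 < rho x → ContDiffAt ℝ ∞ f x := fun hf x hx => hf x (ne_zero_of_rho_pos hx)
  have hps : ∀ x, x ≠ 0 → ContDiffAt ℝ ∞ F.pert x := F.isHomog_pert.1
  have z1 := isShellFamily_hZ_cut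
  have z2 := isShellFamily_hZbar_cut
  have z3 := isShellFamily_hDt_cut
  -- with `G = ḡ`, the terms with `g` are `Z̄χ · ZZG - i Zχ · ∂_t G` up to a factor; integrating by
  -- parts with these four functions leaves only `Zχ · Z̄ZG`, which is known
  set ψ₁ : Heis → ℂ := fun x => hZbar (cut Λ) x * hZ G x with hψ₁
  set ψ₂ : Heis → ℂ := fun x => hZ (cut Λ) x * hZ G x with hψ₂
  set ψ₃ : Heis → ℂ := fun x => hDt (cut Λ) x * G x with hψ₃
  set ψ₄ : Heis → ℂ := fun x => hZ (cut Λ) x * G x with hψ₄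
  have c1 : ContDiff ℝ ∞ ψ₁ := z2.contDiff_mul hΛ hΛ (off fun x hx => contDiffAt_hZ (hGs x hx))
  have c2 : ContDiff ℝ ∞ ψ₂ := z1.contDiff_mul hΛ hΛ (off fun x hx => contDiffAt_hZ (hGs x hx))
  have c3 : ContDiff ℝ ∞ ψ₃ := z3.contDiff_mul hΛ hΛ (off hGs)
  have c4 : ContDiff ℝ ∞ ψ₄ := z1.contDiff_mul hΛ hΛ (off hGs)
  have k1 : HasCompactSupport ψ₁ := (z2.hasCompactSupport hΛ).mul_right
  have k2 : HasCompactSupport ψ₂ := (z1.hasCompactSupport hΛ).mul_right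
  have k3 : HasCompactSupport ψ₃ := (z3.hasCompactSupport hΛ).mul_right
  have k4 : HasCompactSupport ψ₄ := (z1.hasCompactSupport hΛ).mul_right
  have i1 : Integrable (hZ ψ₁) := (contDiff_hZ c1).continuous.integrable_of_hasCompactSupport
    (hasCompactSupport_der isDer_hZ k1)
  have i2 : Integrable (hZbar ψ₂) := (contDiff_hZbar c2).continuous.integrable_of_hasCompactSupport
    (hasCompactSupport_der isDer_hZbar k2)
  have i3 : Integrable (hZ ψ₃) := (contDiff_hZ c3).continuous.integrable_of_hasCompactSupport
    (hasCompactSupport_der isDer_hZ k3)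
  have i4 : Integrable (hDt ψ₄) := (contDiff_hDt c4).continuous.integrable_of_hasCompactSupport
    (hasCompactSupport_der isDer_hDt k4)
  set E : Heis → ℂ := fun x => hZbar (cut Λ) x * ((√2 : ℝ) * x.1 * hZ (hZ F.pert) x +
    2 * hZ F.pert x) + 2 * (hZ (cut Λ) x * hZbar F.pert x) with hE
  have iE : Integrable E := by
    refine Integrable.add ?_ (Integrable.const_mul ?_ 2)
    · refine (z2.contDiff_mul hΛ hΛ (off fun x hx => ?_)).continuous.integrable_of_hasCompactSupport
        (z2.hasCompactSupport hΛ).mul_right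
      have h1 := contDiffAt_hZ (hps x hx)
      exact ((contDiffAt_const.mul contDiffAt_fst).mul (contDiffAt_hZ h1)).add
        (contDiffAt_const.mul h1)
    · exact (z1.contDiff_mul hΛ hΛ (off fun x hx =>
        contDiffAt_hZbar (hps x hx))).continuous.integrable_of_hasCompactSupport
        (z1.hasCompactSupport hΛ).mul_right
  have key : ∀ x, hZbar (cut Λ) x * F.leadBar g x + hZ (cut Λ) x * F.lead g x =
      -E x + (√2 : ℝ) * ((hZ ψ₁ x - hZbar ψ₂ x) + Complex.I * (hZ ψ₃ x - hDt ψ₄ x)) := fun x => by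
    by_cases hx : x = 0
    · have hz : ∀ᶠ y in 𝓝 x, rho y < Λ := by
        refine continuous_rho.continuousAt.eventually (gt_mem_nhds ?_)
        rw [hx, rho_zero]
        exact hΛ
      have hxρ : rho x ≤ Λ := hz.self_of_nhds.le
      have e1 : ψ₁ =ᶠ[𝓝 x] fun _ => 0 := hz.mono fun y hy => by
        simp only [hψ₁, z2.zero_in Λ hΛ y hy.le, zero_mul]
      have e2 : ψ₂ =ᶠ[𝓝 x] fun _ => 0 := hz.mono fun y hy => by
        simp only [hψ₂, z1.zero_in Λ hΛ y hy.le, zero_mul]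
      have e3 : ψ₃ =ᶠ[𝓝 x] fun _ => 0 := hz.mono fun y hy => by
        simp only [hψ₃, z3.zero_in Λ hΛ y hy.le, zero_mul]
      have e4 : ψ₄ =ᶠ[𝓝 x] fun _ => 0 := hz.mono fun y hy => by
        simp only [hψ₄, z1.zero_in Λ hΛ y hy.le, zero_mul]
      rw [(isDer_hZ x).congr e1, (isDer_hZbar x).congr e2, (isDer_hZ x).congr e3,
        (isDer_hDt x).congr e4, (isDer_hZ x).const, (isDer_hZbar x).const, (isDer_hDt x).const]
      have b1 := z1.zero_in Λ hΛ x hxρ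
      have b2 := z2.zero_in Λ hΛ x hxρ
      simp only [hE]
      rw [b1, b2]
      ring
    · have sG := smoothAt_heis.2 (hGs x hx)
      have sZG := smoothAt_heis.2 (contDiffAt_hZ (hGs x hx))
      have hcd := (contDiff_cut Λ).contDiffAt (x := x)
      have s1 := smoothAt_heis.2 (contDiffAt_hZ hcd)
      have s2 := smoothAt_heis.2 (contDiffAt_hZbar hcd)
      have s3 := smoothAt_heis.2 (contDiffAt_hDt hcd)
      have e1 : conj (hZbar (hZbar g) x) = hZ (hZ G) x := by
        rw [← hZ_conj (contDiffAt_hZbar (hg.1 x hx))]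
        refine (isDer_hZ x).congr ?_
        filter_upwards [isOpen_ne.mem_nhds hx] with y hy using (hZ_conj (hg.1 y hy)).symm
      have e2 : conj (hDt g x) = hDt G x := (hDt_conj (hg.1 x hx)).symm
      have e3 := F.hZbar_hZ_conj_eq hg hgZ hx
      have e4 := hDt_eq hcd
      have e5 := hZ_hDt hcd
      rw [leadBar, lead, e1, e2, (isDer_hZ x).mul s2 sZG, (isDer_hZbar x).mul s1 sZG,
        (isDer_hZ x).mul s3 sG, (isDer_hDt x).mul s1 sG, e3, e5, e4]
      have h22 := sqrt_two_sq
      simp only [hE]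
      linear_combination (-(1 / 2) * (hZ (cut Λ) x * hZbar F.pert x)) * h22 -
        (√2 : ℝ) * (hZ (hZbar (cut Λ)) x - hZbar (hZ (cut Λ)) x) * hZ G x * Complex.I_sq
  have hsum : ∫ x, (-E x + (√2 : ℝ) * ((hZ ψ₁ x - hZbar ψ₂ x) +
      Complex.I * (hZ ψ₃ x - hDt ψ₄ x))) = -∫ x, E x := by
    have j1 : Integrable fun x => hZ ψ₁ x - hZbar ψ₂ x := i1.sub i2
    have j2 : Integrable fun x => Complex.I * (hZ ψ₃ x - hDt ψ₄ x) := (i3.sub i4).const_mul _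
    have j3 : Integrable fun x => ((√2 : ℝ) : ℂ) * ((hZ ψ₁ x - hZbar ψ₂ x) +
      Complex.I * (hZ ψ₃ x - hDt ψ₄ x)) := (j1.add j2).const_mul _
    have j4 : Integrable fun x => -E x := iE.neg
    rw [integral_add j4 j3, integral_neg, integral_const_mul, integral_add j1 j2,
      integral_const_mul, integral_sub i1 i2, integral_sub i3 i4, integral_hZ_eq_zero c1 k1,
      integral_hZbar_eq_zero c2 k2, integral_hZ_eq_zero c3 k3, integral_hDt_eq_zero c4 k4]
    ring
  rw [integral_congr_ae (Eventually.of_forall key), hsum, F.integral_leading_flux hΛ]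

end Leading

section Limit

variable [T2Space N] [SecondCountableTopology N] [BorelSpace N]
  (hε₀ : 0 < ε) (hε₁ : ε < 1) (hβ : ∀ q, SmoothAt β q) (hg : IsHomog (-1) g)
  (he : IsSymbolO (-2 + ε) fun x => β (F.coords.symm x) - (conj x.1 + g x))
  (hb : IsSymbolO (-4) fun x => S.boxb β (F.coords.symm x))

/-- The coefficient of `Z` in the flux of `β`, times the volume density. -/
def fluxZ (β : N → ℂ) (x : Heis) : ℂ := S.density F.coords x *
  (conj (F.frB x) * F.frame.fluxBar β (F.coords.symm x) +
    F.frA x * F.frame.flux β (F.coords.symm x))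

/-- The coefficient of `Z̄` in the flux of `β`, times the volume density. -/
def fluxZbar (β : N → ℂ) (x : Heis) : ℂ := S.density F.coords x *
  (conj (F.frA x) * F.frame.fluxBar β (F.coords.symm x) +
    F.frB x * F.frame.flux β (F.coords.symm x))

/-- The coefficient of `∂_t` in the flux of `β`, times the volume density. -/
def fluxT (β : N → ℂ) (x : Heis) : ℂ := S.density F.coords x *
  (conj (F.frC x) * F.frame.fluxBar β (F.coords.symm x) +
    F.frC x * F.frame.flux β (F.coords.symm x))

include hβ in
/-- The integrated flux in asymptotic coordinates. -/
lemma integral_fluxPairing {Λ₁ Λ : ℝ} (h₁ : F.ρ₀ < Λ₁)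
    (hcl : closure (F.outside Λ₁) ⊆ F.coords.source) (hΛ : Λ₁ ≤ Λ) :
    ∫ p, S.fluxPairing β (F.cutoff Λ) p ∂S.volume = ∫ x, (hZ (cut Λ) x * F.fluxZ β x +
      hZbar (cut Λ) x * F.fluxZbar β x + hDt (cut Λ) x * F.fluxT β x) := by
  have hsm : ∀ q, SmoothAt (F.cutoff Λ) q := F.smoothAt_cutoff h₁ hcl hΛ
  have hΛ0 : 0 < Λ := (F.ρ₀_pos.trans h₁).trans_le hΛ
  have hmeas : AEStronglyMeasurable (S.fluxPairing β (F.cutoff Λ)) S.volume :=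
    (S.continuous_fluxPairing hβ hsm).aestronglyMeasurable
  have hoff : ∀ p ∉ F.coords.source, S.fluxPairing β (F.cutoff Λ) p = 0 := fun p hp => by
    have hc : F.cutoff Λ =ᶠ[𝓝 p] fun _ => 1 := by
      filter_upwards [isClosed_closure.isOpen_compl.mem_nhds
        (show p ∈ (closure (F.outside Λ₁))ᶜ from fun h => hp (hcl h))] with q hq
      refine F.cutoff_inside (h₁.trans_le hΛ) fun h2 => hq (subset_closure ?_)
      exact F.outside_anti hΛ h2
    rw [S.fluxPairing_eq (S.frameAt p) (S.mem_frame p) hβ, ((S.frameAt p).isDer₁ p).congr hc,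
      ((S.frameAt p).isDer₁bar p).congr hc, ((S.frameAt p).isDer₁ p).const,
      ((S.frameAt p).isDer₁bar p).const]
    ring
  rw [← setIntegral_eq_integral_of_forall_compl_eq_zero (s := F.coords.source) hoff,
    S.setIntegral_eq F.coords_mem hmeas F.coords.open_source.measurableSet subset_rfl]
  have hset : F.coords.symm ⁻¹' F.coords.source ∩ F.coords.target = F.coords.target :=
    Set.inter_eq_self_of_subset_right fun x hx => F.mem_source hx
  have e : ∀ x ∈ F.coords.target, S.density F.coords x •
      S.fluxPairing β (F.cutoff Λ) (F.coords.symm x) = hZ (cut Λ) x * F.fluxZ β x +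
      hZbar (cut Λ) x * F.fluxZbar β x + hDt (cut Λ) x * F.fluxT β x := fun x hx => by
    have hc : (fun y => F.cutoff Λ (F.coords.symm y)) =ᶠ[𝓝 x] cut Λ := by
      filter_upwards [F.eventually_target hx] with y hy using F.cutoff_symm hy
    rw [S.fluxPairing_eq F.frame (F.mem_source hx) hβ, F.D₁_symm hx (hsm _),
      F.D₁bar_symm hx (hsm _)]
    have e1 := (isDer_hZ x).congr hc
    have e2 := (isDer_hZbar x).congr hc
    have e3 := (isDer_hDt x).congr hc
    simp only [along, e1, e2, e3, fluxZ, fluxZbar, fluxT, Complex.real_smul]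
    ring
  rw [hset, setIntegral_congr_fun F.coords.open_target.measurableSet e]
  refine setIntegral_eq_integral_of_forall_compl_eq_zero fun x hx => ?_
  have hx : rho x ≤ Λ := by
    rw [F.target_eq] at hx
    have : rho x ≤ F.ρ₀ := not_lt.1 hx
    linarith
  rw [isShellFamily_hZ_cut.zero_in Λ hΛ0 x hx, isShellFamily_hZbar_cut.zero_in Λ hΛ0 x hx,
    isShellFamily_hDt_cut.zero_in Λ hΛ0 x hx]
  ring

include hε₀ hε₁ hβ hg he hb

lemma isSymbolO_fluxBar : IsSymbolO (-3) fun x => F.frame.fluxBar β (F.coords.symm x) :=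
  (((F.fluxBar_asymptotics hε₀ hε₁ hβ hg he hb).mono (by linarith)).add
    (F.isSymbolO_leadBar hg)).congr (Eventually.of_forall fun x => by ring)

lemma isSymbolO_flux : IsSymbolO (-3) fun x => F.frame.flux β (F.coords.symm x) :=
  (((F.flux_asymptotics hε₀ hε₁ hβ hg he hb).mono (by linarith)).add
    (F.isSymbolO_lead hg)).congr (Eventually.of_forall fun x => by ring)

lemma fluxZ_asymptotics : IsSymbolO (-4 + ε) fun x => F.fluxZ β x - 4 * F.lead g x := by
  have hd := F.isSymbolO_density
  have h1 := F.isSymbolO_fluxBar hε₀ hε₁ hβ hg he hb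
  have h2 := F.isSymbolO_flux hε₀ hε₁ hβ hg he hb
  have t1 : IsSymbolO (-7) fun x => conj (F.frB x) * F.frame.fluxBar β (F.coords.symm x) :=
    F.isSymbolO_frB.star.mul h1
  have t2 : IsSymbolO (-4 + ε) fun x => (S.density F.coords x : ℂ) *
      (conj (F.frB x) * F.frame.fluxBar β (F.coords.symm x)) := hd.mul t1 (by linarith)
  have t3 : IsSymbolO (-5) fun x => (F.frA x - 1) * F.frame.flux β (F.coords.symm x) :=
    F.frA_sub_one.mul h2
  have t4 : IsSymbolO (-4 + ε) fun x => (S.density F.coords x : ℂ) *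
      ((F.frA x - 1) * F.frame.flux β (F.coords.symm x)) := hd.mul t3 (by linarith)
  have t5 : IsSymbolO (-4 + ε) fun x => ((S.density F.coords x : ℂ) - 4) *
      F.frame.flux β (F.coords.symm x) := F.density_asymptotics.mul h2 (by linarith)
  refine (((t2.add t4).add t5).add ((F.flux_asymptotics hε₀ hε₁ hβ hg he hb).const_mul 4)).congr
    (Eventually.of_forall fun x => ?_)
  simp only [fluxZ]
  ring

lemma fluxZbar_asymptotics : IsSymbolO (-4 + ε) fun x => F.fluxZbar β x - 4 * F.leadBar g x := by
  have hd := F.isSymbolO_density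
  have h1 := F.isSymbolO_fluxBar hε₀ hε₁ hβ hg he hb
  have h2 := F.isSymbolO_flux hε₀ hε₁ hβ hg he hb
  have t1 : IsSymbolO (-7) fun x => F.frB x * F.frame.flux β (F.coords.symm x) :=
    F.isSymbolO_frB.mul h2
  have t2 : IsSymbolO (-4 + ε) fun x => (S.density F.coords x : ℂ) *
      (F.frB x * F.frame.flux β (F.coords.symm x)) := hd.mul t1 (by linarith)
  have t3 : IsSymbolO (-5) fun x => conj (F.frA x - 1) *
      F.frame.fluxBar β (F.coords.symm x) := F.frA_sub_one.star.mul h1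
  have t4 : IsSymbolO (-4 + ε) fun x => (S.density F.coords x : ℂ) *
      (conj (F.frA x - 1) * F.frame.fluxBar β (F.coords.symm x)) := hd.mul t3 (by linarith)
  have t5 : IsSymbolO (-4 + ε) fun x => ((S.density F.coords x : ℂ) - 4) *
      F.frame.fluxBar β (F.coords.symm x) := F.density_asymptotics.mul h1 (by linarith)
  refine (((t2.add t4).add t5).add
    ((F.fluxBar_asymptotics hε₀ hε₁ hβ hg he hb).const_mul 4)).congr
    (Eventually.of_forall fun x => ?_)
  simp only [fluxZbar, map_sub, map_one]
  ring

lemma isSymbolO_fluxT : IsSymbolO (-6) (F.fluxT β) := by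
  have h1 := F.isSymbolO_fluxBar hε₀ hε₁ hβ hg he hb
  have h2 := F.isSymbolO_flux hε₀ hε₁ hβ hg he hb
  have t1 : IsSymbolO (-6) fun x => conj (F.frC x) * F.frame.fluxBar β (F.coords.symm x) :=
    F.isSymbolO_frC.star.mul h1
  have t2 : IsSymbolO (-6) fun x => F.frC x * F.frame.flux β (F.coords.symm x) :=
    F.isSymbolO_frC.mul h2
  have t : IsSymbolO (-6) fun x => (S.density F.coords x : ℂ) *
      (conj (F.frC x) * F.frame.fluxBar β (F.coords.symm x) +
        F.frC x * F.frame.flux β (F.coords.symm x)) := F.isSymbolO_density.mul (t1.add t2)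
  exact t

/-- The limit of the flux through the shells. -/
theorem tendsto_integral_fluxPairing
    (hgZ : ∀ x, x ≠ 0 → hZbar g x = -((√2 : ℝ) / 2) * F.pert x + κ / gauge x) :
    Tendsto (fun Λ => ∫ p, S.fluxPairing β (F.cutoff Λ) p ∂S.volume) atTop
      (𝓝 (-(32 * (Real.pi : ℂ) ^ 2 * F.A))) := by
  obtain ⟨Λ₁, h₁, hcl⟩ := F.exists_closure_outside_subset
  have a1 := F.fluxZ_asymptotics hε₀ hε₁ hβ hg he hb
  have a2 := F.fluxZbar_asymptotics hε₀ hε₁ hβ hg he hb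
  have a3 := F.isSymbolO_fluxT hε₀ hε₁ hβ hg he hb
  have l1 := isShellFamily_hZ_cut.tendsto_zero a1.bound (by linarith)
  have l2 := isShellFamily_hZbar_cut.tendsto_zero a2.bound (by linarith)
  have l3 := isShellFamily_hDt_cut.tendsto_zero a3.bound (by linarith)
  have hl := ((l1.add l2).add l3).add_const (4 * -(8 * (Real.pi : ℂ) ^ 2 * F.A))
  rw [show (0 : ℂ) + 0 + 0 + 4 * -(8 * (Real.pi : ℂ) ^ 2 * F.A) =
    -(32 * (Real.pi : ℂ) ^ 2 * F.A) by ring] at hl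
  refine hl.congr' ?_
  filter_upwards [isShellFamily_hZ_cut.integrable a1.smooth,
    isShellFamily_hZbar_cut.integrable a2.smooth, isShellFamily_hDt_cut.integrable a3.smooth,
    isShellFamily_hZ_cut.integrable (F.isSymbolO_lead hg).smooth,
    isShellFamily_hZbar_cut.integrable (F.isSymbolO_leadBar hg).smooth,
    eventually_ge_atTop Λ₁] with Λ i1 i2 i3 i4 i5 hΛ
  have hΛ0 : 0 < Λ := (F.ρ₀_pos.trans h₁).trans_le hΛ
  rw [F.integral_fluxPairing hβ h₁ hcl hΛ, ← F.integral_lead hg hgZ hΛ0, ← integral_const_mul,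
    ← integral_add i1 i2]
  have i12 : Integrable fun x => hZ (cut Λ) x * (F.fluxZ β x - 4 * F.lead g x) +
    hZbar (cut Λ) x * (F.fluxZbar β x - 4 * F.leadBar g x) := i1.add i2
  rw [← integral_add i12 i3]
  have i123 : Integrable fun x => hZ (cut Λ) x * (F.fluxZ β x - 4 * F.lead g x) +
    hZbar (cut Λ) x * (F.fluxZbar β x - 4 * F.leadBar g x) + hDt (cut Λ) x * F.fluxT β x :=
    i12.add i3
  have i45 : Integrable fun x => 4 * (hZbar (cut Λ) x * F.leadBar g x +
    hZ (cut Λ) x * F.lead g x) := (i5.add i4).const_mul 4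
  rw [← integral_add i123 i45]
  congr 1
  ext x
  ring

end Limit

end AsymptoticallyFlat

/-! ### Integrability and the Paneitz term -/

namespace AsymptoticallyFlat

variable {N : Type*} [TopologicalSpace N] [ChartedSpace Heis N] [IsManifold IH ∞ N]
  [MeasurableSpace N] {S : Pseudohermitian N} (F : AsymptoticallyFlat S)
  {x : Heis} {β : N → ℂ} {g : Heis → ℂ} {ε : ℝ}
  [T2Space N] [SecondCountableTopology N] [BorelSpace N]

/-- A continuous function on `N` which decays faster than `ρ⁻⁴` is integrable. -/
theorem integrable_of_isBigO {f : N → ℂ} (hf : Continuous f) {s : ℝ} (hs : 4 < s)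
    (ho : (fun x => f (F.coords.symm x)) =O[atInf] fun x => rho x ^ (-s)) :
    Integrable f S.volume := by
  have hd := isBigO_mul F.isSymbolO_density.bound ho
  rw [zero_add] at hd
  have hc : ContinuousOn (fun x => (S.density F.coords x : ℂ) * f (F.coords.symm x))
      {x | F.ρ₀ < rho x} := by
    rw [← F.target_eq]
    exact (Complex.continuous_ofReal.comp_continuousOn (S.continuousOn_density F.coords_mem)).mul
      (hf.comp_continuousOn F.coords.continuousOn_symm)
  obtain ⟨R, hR, hi⟩ := integrableOn_of_isBigO hs hd hc
  have hρ : F.ρ₀ < R + 1 := by linarith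
  have h1 : IntegrableOn f (F.inside (R + 1)) S.volume :=
    hf.continuousOn.integrableOn_compact (F.isCompact_inside hρ)
  have h2 : IntegrableOn f (F.outside (R + 1)) S.volume := by
    rw [S.integrableOn_iff F.coords_mem hf.aestronglyMeasurable
      (F.isOpen_outside hρ.le).measurableSet (F.outside_subset hρ.le), F.preimage_outside hρ.le]
    refine IntegrableOn.mono_set (t := {x | R < rho x}) ?_ fun x hx => ?_
    · simpa only [Complex.real_smul] using hi
    · have hx : R + 1 < rho x := hx
      exact (lt_add_one R).trans hx
  rw [← integrableOn_univ, ← Set.union_compl_self (F.inside (R + 1)), F.compl_inside]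
  exact h1.union h2

lemma integrable_of_isBigO_real {f : N → ℝ} (hf : Continuous f) {s : ℝ} (hs : 4 < s)
    (ho : (fun x => (f (F.coords.symm x) : ℂ)) =O[atInf] fun x => rho x ^ (-s)) :
    Integrable f S.volume := by
  have h := F.integrable_of_isBigO (f := fun p => (f p : ℂ))
    (Complex.continuous_ofReal.comp hf) hs ho
  simpa using h.re

/-- A continuous function on `N` which is bounded near infinity is bounded. -/
lemma exists_bound {f : N → ℂ} (hf : Continuous f)
    (ho : (fun x => f (F.coords.symm x)) =O[atInf] fun x => rho x ^ (0 : ℝ)) :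
    ∃ C, ∀ p, ‖f p‖ ≤ C := by
  obtain ⟨C, hC⟩ := ho.bound
  obtain ⟨R, hR, hb⟩ := eventually_atInf.1 hC
  have hρ : F.ρ₀ < max R F.ρ₀ + 1 := by linarith [le_max_right R F.ρ₀]
  obtain ⟨D, hD⟩ := (F.isCompact_inside hρ).exists_bound_of_continuousOn hf.continuousOn
  refine ⟨max C D, fun p => ?_⟩
  by_cases hp : p ∈ F.inside (max R F.ρ₀ + 1)
  · exact (hD p hp).trans (le_max_right _ _)
  · have hp : p ∈ F.outside (max R F.ρ₀ + 1) := by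
      rw [← F.compl_inside]
      exact hp
    obtain ⟨x, hx, rfl⟩ := hp
    have hx : max R F.ρ₀ + 1 < rho x := hx
    have := hb x (by linarith [le_max_left R F.ρ₀])
    simp only [Real.rpow_zero, norm_one, mul_one] at this
    exact this.trans (le_max_left _ _)

section

variable (hε₀ : 0 < ε) (hε₁ : ε < 1) (hβ : ∀ q, SmoothAt β q) (hg : IsHomog (-1) g)
  (he : IsSymbolO (-2 + ε) fun x => β (F.coords.symm x) - (conj x.1 + g x))
  (hb : IsSymbolO (-4) fun x => S.boxb β (F.coords.symm x))

include hβ hb in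
lemma integrable_normSq_boxb : Integrable (fun p => ‖S.boxb β p‖ ^ 2) S.volume := by
  have hc := S.continuous_boxb hβ
  refine F.integrable_of_isBigO_real (s := 8) (by fun_prop) (by norm_num) ?_
  have t : IsSymbolO (-8) fun x => S.boxb β (F.coords.symm x) *
      conj (S.boxb β (F.coords.symm x)) := hb.mul hb.star
  refine t.bound.congr_left fun x => ?_
  exact (norm_sq_eq_mul_conj _).symm

include hε₀ hε₁ hβ hg he

lemma integrable_normSqHess : Integrable (fun p => S.normSqHess₁bar₁bar β p) S.volume := by
  refine F.integrable_of_isBigO_real (s := 6) (S.continuous_normSqHess₁bar₁bar hβ)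
    (by norm_num) ?_
  have hh := F.isSymbolO_hess hε₀ hε₁ hβ hg he
  have t : IsSymbolO (-6) fun x => F.frame.hess₁bar₁bar β (F.coords.symm x) *
      conj (F.frame.hess₁bar₁bar β (F.coords.symm x)) := hh.mul hh.star
  refine t.bound.congr' ?_ EventuallyEq.rfl
  filter_upwards [F.eventually_atInf_target] with x hx
  rw [S.normSqHess₁bar₁bar_eq F.frame (F.mem_source hx) hβ, norm_sq_eq_mul_conj]

/-- `R` is integrable and `β_{,1̄}` is bounded. -/
lemma integrable_R_mul : Integrable (fun p => S.R p * (S.normSqD₁bar β p : ℂ)) S.volume := by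
  have hc : Continuous fun p => (S.normSqD₁bar β p : ℂ) :=
    Complex.continuous_ofReal.comp (S.continuous_normSqD₁bar hβ)
  have hh := F.isSymbolO_opZbar_beta hε₀ hε₁ hg he
  have t : IsSymbolO 0 fun x => F.opZbar (fun x => β (F.coords.symm x)) x *
      conj (F.opZbar (fun x => β (F.coords.symm x)) x) := hh.mul hh.star
  obtain ⟨C, hC⟩ := F.exists_bound hc (t.bound.congr' (by
    filter_upwards [F.eventually_atInf_target] with x hx
    rw [S.normSqD₁bar_eq F.frame (F.mem_source hx), norm_sq_eq_mul_conj,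
      F.D₁bar_symm hx (hβ _)]
    rfl) EventuallyEq.rfl)
  exact F.integrable_R.mul_bdd hc.aestronglyMeasurable (Eventually.of_forall hC)

include hb

/-- The Paneitz term is not integrable a priori: its leading part has the critical order `-4`. -/
lemma paneitz_term_asymptotics : IsSymbolO (-5) fun x => (S.density F.coords x : ℂ) *
    (conj (β (F.coords.symm x)) * S.paneitz β (F.coords.symm x)) +
    16 / (√2 : ℝ) * (x.1 * hZbar (hZ (hZ F.pert)) x) := by
  have hP := F.paneitz_asymptotics hε₀ hε₁ hβ hg he hb
  have hZZZ : IsSymbolO (-5) (hZbar (hZ (hZ F.pert))) := F.hZ_hZ_pert_symbol.hZbar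
  have hP5 : IsSymbolO (-5) fun x => S.paneitz β (F.coords.symm x) :=
    ((hP.mono (by norm_num)).sub (hZZZ.const_mul (4 / (√2 : ℝ)))).congr
      (Eventually.of_forall fun x => by ring)
  have hz : IsSymbolO 1 fun x : Heis => x.1 := isSymbolO_coordZ
  have hB := (F.beta_bound hε₀ hε₁ hg he).star
  have t1 : IsSymbolO (-5) fun x => conj (β (F.coords.symm x) - conj x.1) *
      S.paneitz β (F.coords.symm x) := hB.mul hP5
  have t2 : IsSymbolO (-4) fun x => x.1 * S.paneitz β (F.coords.symm x) := hz.mul hP5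
  have t3 : IsSymbolO (-5) fun x => ((S.density F.coords x : ℂ) - 4) *
      (x.1 * S.paneitz β (F.coords.symm x)) := F.density_asymptotics.mul t2
  have t4 : IsSymbolO (-5) fun x => (S.density F.coords x : ℂ) *
      (conj (β (F.coords.symm x) - conj x.1) * S.paneitz β (F.coords.symm x)) :=
    F.isSymbolO_density.mul t1
  have t5 : IsSymbolO (-5) fun x => x.1 * (S.paneitz β (F.coords.symm x) +
      4 / (√2 : ℝ) * hZbar (hZ (hZ F.pert)) x) := hz.mul hP
  refine ((t3.add t4).add (t5.const_mul 4)).congr (Eventually.of_forall fun x => ?_)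
  simp only [map_sub, Complex.conj_conj]
  ring

/-- The Paneitz term, cut off outside a large sphere, tends to zero: its leading part integrates
to zero against radial functions. -/
lemma tendsto_integral_paneitz_outside :
    Tendsto (fun Λ => ∫ p in F.outside Λ, F.cutoff Λ p * (conj (β p) * S.paneitz β p) ∂S.volume)
      atTop (𝓝 0) := by
  obtain ⟨Λ₁, h₁, hcl⟩ := F.exists_closure_outside_subset
  have hW := F.paneitz_term_asymptotics hε₀ hε₁ hβ hg he hb
  set W : Heis → ℂ := fun x => (S.density F.coords x : ℂ) *
    (conj (β (F.coords.symm x)) * S.paneitz β (F.coords.symm x)) +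
    16 / (√2 : ℝ) * (x.1 * hZbar (hZ (hZ F.pert)) x)
  obtain ⟨r, hr, hs⟩ := eventually_atInf.1 hW.smooth
  obtain ⟨R, hR, hi⟩ := integrableOn_of_isBigO (r := r) (by norm_num) hW.bound
    fun x hx => (hs x hx).continuousAt.continuousWithinAt
  have hβc : Continuous β := continuous_iff_continuousAt.2 fun p => (hβ p).continuousAt
  have hPc := S.continuous_paneitz hβ
  refine squeeze_zero_norm' ?_ (tendsto_setIntegral_rho hi.norm)
  filter_upwards [eventually_ge_atTop Λ₁, eventually_ge_atTop R] with Λ hΛ hRΛ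
  have hρ : F.ρ₀ < Λ := h₁.trans_le hΛ
  have hΛ0 : 0 < Λ := F.ρ₀_pos.trans hρ
  have hm : MeasurableSet {x : Heis | Λ < rho x} :=
    (isOpen_lt continuous_const continuous_rho).measurableSet
  have hχ : Continuous (F.cutoff Λ) :=
    continuous_iff_continuousAt.2 fun p => (F.smoothAt_cutoff h₁ hcl hΛ p).continuousAt
  have hprod : Continuous fun p => F.cutoff Λ p * (conj (β p) * S.paneitz β p) := by fun_prop
  have hint : Integrable (fun p => F.cutoff Λ p * (conj (β p) * S.paneitz β p)) S.volume := by
    have : LocallyCompactSpace N := ChartedSpace.locallyCompactSpace Heis N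
    exact hprod.integrable_of_hasCompactSupport (F.hasCompactSupport_cutoff hρ).mul_right
  have hon := hint.integrableOn (s := F.outside Λ)
  rw [S.integrableOn_iff F.coords_mem hprod.aestronglyMeasurable
    (F.isOpen_outside hρ.le).measurableSet (F.outside_subset hρ.le), F.preimage_outside hρ.le]
    at hon
  rw [S.setIntegral_eq F.coords_mem hprod.aestronglyMeasurable
    (F.isOpen_outside hρ.le).measurableSet (F.outside_subset hρ.le), F.preimage_outside hρ.le]
  have e : ∀ x ∈ {x : Heis | Λ < rho x}, S.density F.coords x •
      (F.cutoff Λ (F.coords.symm x) *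
        (conj (β (F.coords.symm x)) * S.paneitz β (F.coords.symm x))) =
      cut Λ x * W x - 16 / (√2 : ℝ) * (cut Λ x * (x.1 * hZbar (hZ (hZ F.pert)) x)) :=
    fun x hx => by
      rw [F.cutoff_symm (F.mem_target hρ.le hx), Complex.real_smul]
      ring
  have hiΛ : IntegrableOn W {x | Λ < rho x} :=
    hi.mono_set fun x hx => lt_of_le_of_lt hRΛ hx
  have hcb : ∀ x, ‖cut Λ x‖ ≤ 1 := fun x => by
    rw [cut, Complex.norm_real, Real.norm_of_nonneg (profile_nonneg _)]
    exact profile_le_one _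
  have i1 : IntegrableOn (fun x => cut Λ x * W x) {x | Λ < rho x} :=
    hiΛ.bdd_mul (contDiff_cut Λ).continuous.aestronglyMeasurable (Eventually.of_forall hcb)
  have i2 : IntegrableOn (fun x => 16 / ((√2 : ℝ) : ℂ) *
      (cut Λ x * (x.1 * hZbar (hZ (hZ F.pert)) x))) {x | Λ < rho x} := by
    refine (i1.sub (hon.congr_fun e hm)).congr_fun (fun x _ => ?_) hm
    simp only [Pi.sub_apply]
    ring
  rw [setIntegral_congr_fun hm e, integral_sub i1 i2, integral_const_mul,
    F.integral_radial_mul_leading hΛ0, mul_zero, sub_zero]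
  refine norm_integral_le_of_norm_le hiΛ.norm (Eventually.of_forall fun x => ?_)
  rw [norm_mul]
  exact mul_le_of_le_one_left (norm_nonneg _) (hcb x)

end

end AsymptoticallyFlat

/-! ### The p-mass -/

/-- The height of the unit Heisenberg sphere as a function of the polar angle. -/
def height (τ : ℝ) : ℝ := Real.cos τ * √(1 + Real.sin τ ^ 2)

/-- The derivative of `height`. -/
def heightDeriv (τ : ℝ) : ℝ := -(2 * Real.sin τ ^ 3) / √(1 + Real.sin τ ^ 2)

lemma sqrt_one_add_sq_pos (τ : ℝ) : 0 < √(1 + Real.sin τ ^ 2) := Real.sqrt_pos.2 (by positivity)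

lemma sq_sqrt_one_add_sq (τ : ℝ) : √(1 + Real.sin τ ^ 2) ^ 2 = 1 + Real.sin τ ^ 2 :=
  Real.sq_sqrt (by positivity)

lemma hasDerivAt_height (τ : ℝ) : HasDerivAt height (heightDeriv τ) τ := by
  have h0 := sqrt_one_add_sq_pos τ
  have h1 := sq_sqrt_one_add_sq τ
  have h2 := Real.sin_sq_add_cos_sq τ
  have d0 : HasDerivAt (fun τ => 1 + Real.sin τ ^ 2) (2 * Real.sin τ * Real.cos τ) τ := by
    simpa using ((Real.hasDerivAt_sin τ).pow 2).const_add 1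
  have d1 := d0.sqrt (by positivity)
  refine ((Real.hasDerivAt_cos τ).mul d1).congr_deriv ?_
  have e : 2 * Real.sin τ * Real.cos τ / (2 * √(1 + Real.sin τ ^ 2)) * √(1 + Real.sin τ ^ 2) =
      Real.sin τ * Real.cos τ := by
    field_simp
  rw [heightDeriv, eq_div_iff h0.ne']
  linear_combination Real.cos τ * e - Real.sin τ * h1 + Real.sin τ * h2

lemma continuous_heightDeriv : Continuous heightDeriv := by
  unfold heightDeriv
  exact Continuous.div (by fun_prop) (by fun_prop) fun τ => (sqrt_one_add_sq_pos τ).ne'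

lemma abs_heightDeriv_le (τ : ℝ) : |heightDeriv τ| ≤ 2 := by
  have h0 := sqrt_one_add_sq_pos τ
  have h1 : 1 ≤ √(1 + Real.sin τ ^ 2) := Real.one_le_sqrt.2 (by nlinarith [sq_nonneg (Real.sin τ)])
  have h3 : |Real.sin τ| ^ 3 ≤ 1 := pow_le_one₀ (abs_nonneg _) (Real.abs_sin_le_one τ)
  rw [heightDeriv, abs_div, abs_of_pos h0, abs_neg, abs_mul, abs_pow, abs_two, div_le_iff₀ h0]
  linarith

lemma integral_heightDeriv : ∫ τ in (0 : ℝ)..Real.pi, heightDeriv τ = -2 := by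
  rw [intervalIntegral.integral_eq_sub_of_hasDerivAt (fun τ _ => hasDerivAt_height τ)
    (continuous_heightDeriv.intervalIntegrable _ _)]
  simp [height]
  norm_num

lemma norm_exp_azimuth (φ : ℝ) : ‖Complex.exp (φ * Complex.I)‖ = 1 :=
  Complex.norm_exp_ofReal_mul_I φ

lemma conj_exp_mul_exp (φ : ℝ) :
    conj (Complex.exp (φ * Complex.I)) * Complex.exp (φ * Complex.I) = 1 := by
  rw [mul_comm, Complex.mul_conj, Complex.normSq_eq_norm_sq, norm_exp_azimuth]
  simp

lemma rho_sphereParam {Λ : ℝ} (hΛ : 0 ≤ Λ) (τ φ : ℝ) : rho (sphereParam Λ τ φ) = Λ := by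
  have hq : quad (sphereParam Λ τ φ) = Λ ^ 4 := by
    have h1 := sq_sqrt_one_add_sq τ
    have h2 := Real.sin_sq_add_cos_sq τ
    rw [quad, sphereParam, norm_mul, norm_exp_azimuth, Complex.norm_real, Real.norm_eq_abs, mul_one,
      (show Even 4 by decide).pow_abs]
    linear_combination Λ ^ 4 * Real.cos τ ^ 2 * h1 +
      Λ ^ 4 * (1 + Real.sin τ ^ 2) * h2
  refine (pow_left_inj₀ (rho_nonneg _) hΛ (by norm_num : 4 ≠ 0)).1 ?_
  rw [rho_pow_four, hq]

/-- The tangent vector `∂_τ` of `sphereParam`. -/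
def sphereTau (Λ τ φ : ℝ) : Heis :=
  ((Λ * Real.cos τ : ℝ) * Complex.exp (φ * Complex.I), Λ ^ 2 * heightDeriv τ)

/-- The tangent vector `∂_φ` of `sphereParam`. -/
def spherePhi (Λ τ φ : ℝ) : Heis :=
  ((Λ * Real.sin τ : ℝ) * Complex.exp (φ * Complex.I) * Complex.I, 0)

lemma deriv_sphereParam_tau (Λ τ φ : ℝ) :
    deriv (fun s => sphereParam Λ s φ) τ = sphereTau Λ τ φ := by
  have h1 : HasDerivAt (fun s : ℝ => ((Λ * Real.sin s : ℝ) : ℂ) * Complex.exp (φ * Complex.I))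
      (((Λ * Real.cos τ : ℝ) : ℂ) * Complex.exp (φ * Complex.I)) τ :=
    (((Real.hasDerivAt_sin τ).const_mul Λ).ofReal_comp).mul_const _
  have h2 : HasDerivAt (fun s => Λ ^ 2 * Real.cos s * √(1 + Real.sin s ^ 2))
      (Λ ^ 2 * heightDeriv τ) τ := by
    refine ((hasDerivAt_height τ).const_mul (Λ ^ 2)).congr_of_eventuallyEq
      (Eventually.of_forall fun s => ?_)
    simp only [height]
    ring
  exact (h1.prodMk h2).deriv

lemma deriv_sphereParam_phi (Λ τ φ : ℝ) :
    deriv (fun s => sphereParam Λ τ s) φ = spherePhi Λ τ φ := by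
  have h0 : HasDerivAt (fun s : ℝ => Complex.exp ((s : ℂ) * Complex.I))
      (Complex.exp (φ * Complex.I) * Complex.I) φ := by
    have := ((hasDerivAt_id φ).ofReal_comp.mul_const Complex.I).cexp
    simpa using this
  have h1 := h0.const_mul ((Λ * Real.sin τ : ℝ) : ℂ)
  have h2 := h1.prodMk (hasDerivAt_const φ (Λ ^ 2 * Real.cos τ * √(1 + Real.sin τ ^ 2)))
  refine h2.deriv.trans ?_
  rw [spherePhi, mul_assoc]

lemma heisTheta_sphereTau (Λ τ φ : ℝ) :
    heisTheta (sphereParam Λ τ φ) (sphereTau Λ τ φ) = Λ ^ 2 * heightDeriv τ := by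
  have h : conj (sphereParam Λ τ φ).1 * (sphereTau Λ τ φ).1 =
      ((Λ ^ 2 * (Real.sin τ * Real.cos τ) : ℝ) : ℂ) := by
    simp only [sphereParam, sphereTau, map_mul, Complex.conj_ofReal]
    push_cast
    linear_combination (Λ ^ 2 * Complex.sin τ * Complex.cos τ : ℂ) * conj_exp_mul_exp φ
  rw [heisTheta, h, Complex.ofReal_im, sphereTau]
  ring

lemma conj_mul_spherePhi (Λ τ φ : ℝ) : conj (sphereParam Λ τ φ).1 * (spherePhi Λ τ φ).1 =
    ((Λ ^ 2 * Real.sin τ ^ 2 : ℝ) : ℂ) * Complex.I := by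
  simp only [sphereParam, spherePhi, map_mul, Complex.conj_ofReal]
  push_cast
  linear_combination (Λ ^ 2 * Complex.sin τ ^ 2 * Complex.I : ℂ) * conj_exp_mul_exp φ

lemma heisTheta_spherePhi (Λ τ φ : ℝ) :
    heisTheta (sphereParam Λ τ φ) (spherePhi Λ τ φ) = 2 * (Λ ^ 2 * Real.sin τ ^ 2) := by
  rw [heisTheta, conj_mul_spherePhi, spherePhi, Complex.im_ofReal_mul, Complex.I_im]
  ring

lemma norm_sphereTau_fst_le (Λ τ φ : ℝ) : ‖(sphereTau Λ τ φ).1‖ ≤ |Λ| := by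
  rw [sphereTau, norm_mul, norm_exp_azimuth, Complex.norm_real, Real.norm_eq_abs, mul_one, abs_mul]
  exact mul_le_of_le_one_right (abs_nonneg _) (Real.abs_cos_le_one τ)

lemma norm_spherePhi_fst_le (Λ τ φ : ℝ) : ‖(spherePhi Λ τ φ).1‖ ≤ |Λ| := by
  rw [spherePhi, norm_mul, norm_mul, norm_exp_azimuth, Complex.norm_real, Real.norm_eq_abs,
    Complex.norm_I, mul_one, mul_one, abs_mul]
  exact mul_le_of_le_one_right (abs_nonneg _) (Real.abs_sin_le_one τ)

/-- Uniform bounds on large spheres: `f (Λ, τ, φ) = O(Λ^k)`, uniformly in the angles. -/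
def IsSphereO (k : ℝ) (f : ℝ × ℝ × ℝ → ℂ) : Prop :=
  f =O[atTop ×ˢ (⊤ : Filter (ℝ × ℝ))] fun p => p.1 ^ k

/-- The restriction of a function to the spheres. -/
def onSphere (f : Heis → ℂ) (p : ℝ × ℝ × ℝ) : ℂ := f (sphereParam p.1 p.2.1 p.2.2)

lemma tendsto_sphereParam : Tendsto (fun p : ℝ × ℝ × ℝ => sphereParam p.1 p.2.1 p.2.2)
    (atTop ×ˢ (⊤ : Filter (ℝ × ℝ))) atInf := by
  rw [atInf, tendsto_comap_iff]
  refine tendsto_fst.congr' ?_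
  filter_upwards [tendsto_fst.eventually (eventually_ge_atTop 0)] with p hp
  exact (rho_sphereParam hp _ _).symm

lemma eventually_fst_pos :
    ∀ᶠ p : ℝ × ℝ × ℝ in atTop ×ˢ (⊤ : Filter (ℝ × ℝ)), 1 < p.1 :=
  tendsto_fst.eventually (eventually_gt_atTop 1)

namespace IsSphereO

variable {k l m : ℝ} {f g : ℝ × ℝ × ℝ → ℂ}

lemma of_symbol {f : Heis → ℂ} (hf : IsSymbolO k f) : IsSphereO k (onSphere f) := by
  refine (hf.bound.comp_tendsto tendsto_sphereParam).congr' EventuallyEq.rfl ?_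
  filter_upwards [eventually_fst_pos] with p hp
  simp only [Function.comp_apply, rho_sphereParam (zero_lt_one.trans hp).le]

lemma add (hf : IsSphereO k f) (hg : IsSphereO k g) : IsSphereO k fun p => f p + g p :=
  Asymptotics.IsBigO.add hf hg

lemma sub (hf : IsSphereO k f) (hg : IsSphereO k g) : IsSphereO k fun p => f p - g p :=
  Asymptotics.IsBigO.sub hf hg

lemma const_mul (c : ℂ) (hf : IsSphereO k f) : IsSphereO k fun p => c * f p :=
  Asymptotics.IsBigO.const_mul_left hf c

lemma star (hf : IsSphereO k f) : IsSphereO k fun p => conj (f p) :=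
  Asymptotics.IsBigO.congr_left (Asymptotics.IsBigO.of_norm_left (by simpa using hf.norm_left))
    fun _ => rfl

lemma mul (hf : IsSphereO k f) (hg : IsSphereO l g) (h : k + l ≤ m := by norm_num) :
    IsSphereO m fun p => f p * g p := by
  refine (Asymptotics.IsBigO.mul hf hg).trans (Asymptotics.IsBigO.of_bound 1 ?_)
  filter_upwards [eventually_fst_pos] with p hp
  have h0 : 0 < p.1 := zero_lt_one.trans hp
  rw [← Real.rpow_add h0, one_mul, Real.norm_of_nonneg (by positivity),
    Real.norm_of_nonneg (by positivity)]
  exact Real.rpow_le_rpow_of_exponent_le hp.le h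

lemma mono (hf : IsSphereO k f) (h : k ≤ l := by norm_num) : IsSphereO l f := by
  refine Asymptotics.IsBigO.trans hf (Asymptotics.IsBigO.of_bound 1 ?_)
  filter_upwards [eventually_fst_pos] with p hp
  have h0 : 0 < p.1 := zero_lt_one.trans hp
  rw [one_mul, Real.norm_of_nonneg (by positivity), Real.norm_of_nonneg (by positivity)]
  exact Real.rpow_le_rpow_of_exponent_le hp.le h

lemma congr (hf : IsSphereO k f) (h : ∀ᶠ p in atTop ×ˢ (⊤ : Filter (ℝ × ℝ)), f p = g p) :
    IsSphereO k g :=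
  Asymptotics.IsBigO.congr' hf h EventuallyEq.rfl

lemma of_le {C : ℝ} {n : ℕ} (h : ∀ p, 0 < p.1 → ‖f p‖ ≤ C * p.1 ^ n) : IsSphereO n f := by
  refine Asymptotics.IsBigO.of_bound C ?_
  filter_upwards [eventually_fst_pos] with p hp
  have h0 : 0 < p.1 := zero_lt_one.trans hp
  rw [Real.norm_of_nonneg (by positivity), Real.rpow_natCast]
  exact h p h0

end IsSphereO

lemma continuous_sphereParam (Λ : ℝ) :
    Continuous fun p : ℝ × ℝ => sphereParam Λ p.1 p.2 := by
  unfold sphereParam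
  fun_prop

lemma SmoothInf.continuous_sphere {f : Heis → ℂ} (hf : SmoothInf f) :
    ∀ᶠ Λ in atTop, Continuous fun p : ℝ × ℝ => f (sphereParam Λ p.1 p.2) := by
  obtain ⟨r, hr, h⟩ := eventually_atInf.1 hf
  filter_upwards [eventually_gt_atTop r] with Λ hΛ
  refine continuous_iff_continuousAt.2 fun p => ?_
  exact ContinuousAt.comp (f := fun p : ℝ × ℝ => sphereParam Λ p.1 p.2)
    (h _ (by rwa [rho_sphereParam (hr.trans hΛ).le])).continuousAt
    (continuous_sphereParam Λ).continuousAt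

namespace AsymptoticallyFlat

variable {N : Type*} [TopologicalSpace N] [ChartedSpace Heis N] [IsManifold IH ∞ N]
  [MeasurableSpace N] {S : Pseudohermitian N} (F : AsymptoticallyFlat S)

/-- The connection form, without its component along `θ`, in asymptotic coordinates. -/
def connHor (x v : Heis) : ℂ :=
  F.conn x * conj (F.coTheta₁ x v) - conj (F.conn x) * F.coTheta₁ x v

lemma ωWedgeθ_eq (x u v : Heis) : F.ωWedgeθ x u v =
    F.connHor x u * F.coTheta x v - F.connHor x v * F.coTheta x u := by
  change (-conj (F.conn x) * F.coTheta₁ x u + F.conn x * conj (F.coTheta₁ x u) +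
      F.connT x * F.coTheta x u) * F.coTheta x v -
    (-conj (F.conn x) * F.coTheta₁ x v + F.conn x * conj (F.coTheta₁ x v) +
      F.connT x * F.coTheta x v) * F.coTheta x u = _
  rw [connHor, connHor]
  ring

/-- The leading part of the connection form. -/
def connLead (x v : Heis) : ℂ :=
  -(3 / 2) * (√2 : ℝ) * (hZbar F.pert x * conj v.1 - conj (hZbar F.pert x) * v.1)

/-- For `x` on a sphere the leading part is `-12 π i A ρ⁻⁶ Im (z̄ w dz)`. -/
lemma connLead_eq {x : Heis} (hx : x ≠ 0) (v : Heis) : F.connLead x v =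
    -(12 * (Real.pi : ℂ) * F.A * Complex.I) * (quadPow (-(3 / 2)) x *
      ((conj x.1 * v.1 * gauge x).im : ℂ)) := by
  have h22 := sqrt_two_sq
  have hc : conj F.coeff = F.coeff := by
    simp [coeff, map_ofNat]
  have hq : conj (quadPow (-(3 / 2)) x) = quadPow (-(3 / 2)) x := Complex.conj_ofReal _
  have him : ((conj x.1 * v.1 * gauge x).im : ℂ) * (2 * Complex.I) =
      conj x.1 * v.1 * gauge x - x.1 * conj v.1 * conj (gauge x) := by
    have := Complex.sub_conj (conj x.1 * v.1 * gauge x)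
    simp only [map_mul, Complex.conj_conj] at this
    rw [this]
    push_cast
    ring
  rw [connLead, F.hZbar_pert_eq hx]
  simp only [map_mul, map_neg, map_div₀, hc, hq, Complex.conj_conj, Complex.conj_ofReal, map_ofNat]
  rw [coeff]
  linear_combination (3 * Real.pi * F.A * quadPow (-(3 / 2)) x *
    (x.1 * conj v.1 * conj (gauge x) - conj x.1 * v.1 * gauge x)) * h22 +
    (6 * Real.pi * F.A * quadPow (-(3 / 2)) x) * him

/-- The leading part of `ω ∧ θ` on the spheres is independent of the azimuth and exact in the
polar angle. -/
lemma leading_wedge {Λ : ℝ} (hΛ : 0 < Λ) (τ φ : ℝ) :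
    F.connLead (sphereParam Λ τ φ) (sphereTau Λ τ φ) *
        heisTheta (sphereParam Λ τ φ) (spherePhi Λ τ φ) -
      F.connLead (sphereParam Λ τ φ) (spherePhi Λ τ φ) *
        heisTheta (sphereParam Λ τ φ) (sphereTau Λ τ φ) =
      12 * (Real.pi : ℂ) * F.A * Complex.I * heightDeriv τ := by
  have hρ := rho_sphereParam hΛ.le τ φ
  have hx : sphereParam Λ τ φ ≠ 0 := ne_zero_of_rho_pos (by rwa [hρ])
  have h0 := sqrt_one_add_sq_pos τ
  have h1 := sq_sqrt_one_add_sq τ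
  have h2 := Real.sin_sq_add_cos_sq τ
  have hq : quadPow (-(3 / 2)) (sphereParam Λ τ φ) = ((Λ ^ 6)⁻¹ : ℝ) := by
    rw [quadPow, ← rho_pow_four, hρ, ← Real.rpow_natCast, ← Real.rpow_mul hΛ.le,
      ← Real.rpow_natCast, ← Real.rpow_neg hΛ.le]
    norm_num
  have hz : conj (sphereParam Λ τ φ).1 * (sphereTau Λ τ φ).1 =
      ((Λ ^ 2 * (Real.sin τ * Real.cos τ) : ℝ) : ℂ) := by
    simp only [sphereParam, sphereTau, map_mul, Complex.conj_ofReal]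
    push_cast
    linear_combination (Λ ^ 2 * Complex.sin τ * Complex.cos τ : ℂ) * conj_exp_mul_exp φ
  have hw : gauge (sphereParam Λ τ φ) = ((Λ ^ 2 * Real.sin τ ^ 2 : ℝ) : ℂ) +
      ((Λ ^ 2 * height τ : ℝ) : ℂ) * Complex.I := by
    rw [gauge, sphereParam, norm_mul, norm_exp_azimuth, Complex.norm_real, Real.norm_eq_abs,
      mul_one, sq_abs, height]
    push_cast
    ring
  have e1 : (conj (sphereParam Λ τ φ).1 * (sphereTau Λ τ φ).1 * gauge (sphereParam Λ τ φ)).im =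
      Λ ^ 4 * (Real.sin τ * Real.cos τ * height τ) := by
    rw [hz, hw, Complex.im_ofReal_mul, Complex.add_im, Complex.ofReal_im, Complex.im_ofReal_mul,
      Complex.I_im]
    ring
  have e2 : (conj (sphereParam Λ τ φ).1 * (spherePhi Λ τ φ).1 * gauge (sphereParam Λ τ φ)).im =
      Λ ^ 4 * Real.sin τ ^ 4 := by
    rw [conj_mul_spherePhi, hw, mul_assoc, Complex.im_ofReal_mul, Complex.I_mul_im, Complex.add_re,
      Complex.ofReal_re, Complex.re_ofReal_mul, Complex.I_re]
    ring
  have key : 2 * Real.sin τ ^ 3 * Real.cos τ * height τ - Real.sin τ ^ 4 * heightDeriv τ =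
      -heightDeriv τ := by
    rw [height, heightDeriv]
    field_simp
    rw [h1]
    linear_combination (Real.sin τ ^ 3 * (1 + Real.sin τ ^ 2)) * h2
  have key' := congrArg (fun r : ℝ => (r : ℂ)) key
  push_cast at key'
  rw [F.connLead_eq hx, F.connLead_eq hx, e1, e2, hq, heisTheta_sphereTau, heisTheta_spherePhi]
  have hΛc : (Λ : ℂ) ≠ 0 := by exact_mod_cast hΛ.ne'
  have hu : ((Λ : ℂ) ^ 6)⁻¹ * (Λ : ℂ) ^ 6 = 1 := inv_mul_cancel₀ (pow_ne_zero 6 hΛc)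
  push_cast
  linear_combination (-(12 * Real.pi * F.A * Complex.I) * (((Λ : ℂ) ^ 6)⁻¹ * (Λ : ℂ) ^ 6)) * key' +
    (12 * Real.pi * F.A * Complex.I * heightDeriv τ) * hu

end AsymptoticallyFlat

namespace AsymptoticallyFlat

variable {N : Type*} [TopologicalSpace N] [ChartedSpace Heis N] [IsManifold IH ∞ N]
  [MeasurableSpace N] {S : Pseudohermitian N} (F : AsymptoticallyFlat S)

lemma theta_t_sub_one : IsSymbolO (-2) fun x => F.coTheta x hT - 1 :=
  ((F.theta_t.mono (by norm_num)).add F.isSymbolO_pert).congr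
    (Eventually.of_forall fun x => by ring)

lemma theta₁_Z_sub_one : IsSymbolO (-2) fun x => onZ (F.coTheta₁ x) x - 1 :=
  ((F.theta₁_Z.mono (by norm_num)).add (F.isSymbolO_pert.const_mul (1 / 2))).congr
    (Eventually.of_forall fun x => by ring)

/-- On the spheres `ω` and `θ` agree with their leading parts, to the relevant order, on tangent
vectors `v` with `dz(v) = O(ρ)` and `θ₀(v) = O(ρ²)`. -/
lemma sphere_asymptotics {v : ℝ → ℝ → ℝ → Heis}
    (h1 : IsSphereO 1 fun p => (v p.1 p.2.1 p.2.2).1)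
    (h2 : IsSphereO 2 fun p => (heisTheta (sphereParam p.1 p.2.1 p.2.2) (v p.1 p.2.1 p.2.2) : ℂ)) :
    IsSphereO (-3) (fun p => F.connHor (sphereParam p.1 p.2.1 p.2.2) (v p.1 p.2.1 p.2.2) -
        F.connLead (sphereParam p.1 p.2.1 p.2.2) (v p.1 p.2.1 p.2.2)) ∧
      IsSphereO (-2) (fun p => F.connLead (sphereParam p.1 p.2.1 p.2.2) (v p.1 p.2.1 p.2.2)) ∧
      IsSphereO 0 (fun p => F.coTheta (sphereParam p.1 p.2.1 p.2.2) (v p.1 p.2.1 p.2.2) -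
        heisTheta (sphereParam p.1 p.2.1 p.2.2) (v p.1 p.2.1 p.2.2)) ∧
      IsSphereO 2 (fun p => F.coTheta (sphereParam p.1 p.2.1 p.2.2) (v p.1 p.2.1 p.2.2)) := by
  have q1 := IsSphereO.of_symbol F.theta₁_Z_sub_one
  have q2 := IsSphereO.of_symbol F.theta₁_Zbar
  have q3 := IsSphereO.of_symbol F.theta₁_t
  have p1 := IsSphereO.of_symbol F.theta_Z
  have p2 := IsSphereO.of_symbol F.theta_Zbar
  have p3 := IsSphereO.of_symbol F.theta_t_sub_one
  have c1 := IsSphereO.of_symbol F.isSymbolO_conn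
  have c2 := IsSphereO.of_symbol F.conn_asymptotics
  have c3 := IsSphereO.of_symbol F.hZbar_pert_symbol
  set x : ℝ × ℝ × ℝ → Heis := fun p => sphereParam p.1 p.2.1 p.2.2 with hxdef
  set V : ℝ × ℝ × ℝ → Heis := fun p => v p.1 p.2.1 p.2.2 with hV
  have hQ : IsSphereO (-1) fun p => F.coTheta₁ (x p) (V p) - (√2 : ℝ) * (V p).1 := by
    have t1 : IsSphereO (-1) fun p => (V p).1 * onSphere (fun x => onZ (F.coTheta₁ x) x - 1) p :=
      h1.mul q1
    have t2 : IsSphereO (-1) fun p =>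
        conj (V p).1 * onSphere (fun x => onZbar (F.coTheta₁ x) x) p :=
      h1.star.mul q2
    have t3 : IsSphereO (-1) fun p => (heisTheta (x p) (V p) : ℂ) *
        onSphere (fun x => F.coTheta₁ x hT) p := h2.mul q3
    refine (((t1.const_mul (√2 : ℝ)).add (t2.const_mul (√2 : ℝ))).add t3).congr
      (Eventually.of_forall fun p => ?_)
    rw [apply_eq (F.coTheta₁ (x p)) (x p) (V p)]
    simp only [onSphere, hxdef]
    ring
  have hP : IsSphereO 0 fun p => F.coTheta (x p) (V p) - heisTheta (x p) (V p) := by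
    have t1 : IsSphereO 0 fun p => (V p).1 * onSphere (fun x => onZ (F.coTheta x) x) p :=
      h1.mul p1
    have t2 : IsSphereO 0 fun p => conj (V p).1 * onSphere (fun x => onZbar (F.coTheta x) x) p :=
      h1.star.mul p2
    have t3 : IsSphereO 0 fun p => (heisTheta (x p) (V p) : ℂ) *
        onSphere (fun x => F.coTheta x hT - 1) p := h2.mul p3
    refine (((t1.const_mul (√2 : ℝ)).add (t2.const_mul (√2 : ℝ))).add t3).congr
      (Eventually.of_forall fun p => ?_)
    rw [apply_eq (F.coTheta (x p)) (x p) (V p)]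
    simp only [onSphere, hxdef]
    ring
  refine ⟨?_, ?_, hP, ?_⟩
  · have t1 : IsSphereO (-3) fun p => onSphere F.conn p *
        conj (F.coTheta₁ (x p) (V p) - (√2 : ℝ) * (V p).1) := c1.mul hQ.star
    have t2 : IsSphereO (-3) fun p => conj (onSphere F.conn p) *
        (F.coTheta₁ (x p) (V p) - (√2 : ℝ) * (V p).1) := c1.star.mul hQ
    have t3 : IsSphereO (-3) fun p => onSphere (fun x => F.conn x + 3 / 2 * hZbar F.pert x) p *
        conj (V p).1 := c2.mul h1.star
    have t4 : IsSphereO (-3) fun p =>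
        conj (onSphere (fun x => F.conn x + 3 / 2 * hZbar F.pert x) p) * (V p).1 := c2.star.mul h1
    refine ((t1.sub t2).add ((t3.sub t4).const_mul (√2 : ℝ))).congr
      (Eventually.of_forall fun p => ?_)
    simp only [onSphere, connHor, connLead, hxdef, map_sub, map_mul, map_add, map_div₀,
      Complex.conj_ofReal, map_ofNat]
    ring
  · have t3 : IsSphereO (-2) fun p => onSphere (hZbar F.pert) p * conj (V p).1 := c3.mul h1.star
    have t4 : IsSphereO (-2) fun p => conj (onSphere (hZbar F.pert) p) * (V p).1 := c3.star.mul h1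
    exact (t3.sub t4).const_mul (-(3 / 2) * (√2 : ℝ))
  · refine ((hP.mono (l := 2)).add h2).congr (Eventually.of_forall fun p => ?_)
    simp only [hxdef, hV]
    ring

lemma wedge_asymptotics : IsSphereO (-1) fun p =>
    F.ωWedgeθ (sphereParam p.1 p.2.1 p.2.2) (sphereTau p.1 p.2.1 p.2.2)
      (spherePhi p.1 p.2.1 p.2.2) - 12 * (Real.pi : ℂ) * F.A * Complex.I * heightDeriv p.2.1 := by
  have b1 : ∀ (v : ℝ → ℝ → ℝ → Heis), (∀ Λ τ φ, ‖(v Λ τ φ).1‖ ≤ |Λ|) →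
      IsSphereO 1 fun p => (v p.1 p.2.1 p.2.2).1 := fun v hv => by
    have := IsSphereO.of_le (f := fun p => (v p.1 p.2.1 p.2.2).1) (C := 1) (n := 1) fun p hp => by
      rw [pow_one, one_mul]
      exact (hv _ _ _).trans_eq (abs_of_pos hp)
    simpa using this
  have a1 : IsSphereO 2 fun p => (heisTheta (sphereParam p.1 p.2.1 p.2.2)
      (sphereTau p.1 p.2.1 p.2.2) : ℂ) := by
    refine IsSphereO.of_le (C := 2) (n := 2) fun p hp => ?_
    rw [heisTheta_sphereTau, Complex.norm_real, Real.norm_eq_abs, abs_mul,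
      abs_of_pos (pow_pos hp 2), mul_comm]
    exact mul_le_mul_of_nonneg_right (abs_heightDeriv_le _) (pow_pos hp 2).le
  have a2 : IsSphereO 2 fun p => (heisTheta (sphereParam p.1 p.2.1 p.2.2)
      (spherePhi p.1 p.2.1 p.2.2) : ℂ) := by
    refine IsSphereO.of_le (C := 2) (n := 2) fun p hp => ?_
    rw [heisTheta_spherePhi, Complex.norm_real, Real.norm_of_nonneg (by positivity)]
    have := Real.sin_sq_le_one p.2.1
    have h2 := pow_pos hp 2
    nlinarith
  obtain ⟨u1, u2, u3, u4⟩ := F.sphere_asymptotics (b1 sphereTau norm_sphereTau_fst_le) a1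
  obtain ⟨v1, v2, v3, v4⟩ := F.sphere_asymptotics (b1 spherePhi norm_spherePhi_fst_le) a2
  refine (((u1.mul v4 : IsSphereO (-1) _).add ((u2.mul v3 : IsSphereO (-2) _).mono)).sub
    ((v1.mul u4 : IsSphereO (-1) _).add ((v2.mul u3 : IsSphereO (-2) _).mono))).congr ?_
  filter_upwards [eventually_fst_pos] with p hp
  rw [← F.leading_wedge (zero_lt_one.trans hp) p.2.1 p.2.2, F.ωWedgeθ_eq]
  ring

lemma continuous_wedge : ∀ᶠ Λ in atTop, Continuous fun p : ℝ × ℝ =>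
    F.ωWedgeθ (sphereParam Λ p.1 p.2) (sphereTau Λ p.1 p.2) (spherePhi Λ p.1 p.2) := by
  have sub_one : ∀ {f : Heis → ℂ}, IsSymbolO (-2) (fun x => f x - 1) → SmoothInf f := fun h =>
    ((h.mono (by norm_num)).add (IsSymbolO.const 1)).smooth.congr
      (Eventually.of_forall fun x => by ring)
  filter_upwards [(sub_one F.theta₁_Z_sub_one).continuous_sphere,
    F.theta₁_Zbar.smooth.continuous_sphere, F.theta₁_t.smooth.continuous_sphere,
    F.theta_Z.smooth.continuous_sphere, F.theta_Zbar.smooth.continuous_sphere,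
    (sub_one F.theta_t_sub_one).continuous_sphere, F.isSymbolO_conn.smooth.continuous_sphere]
    with Λ q1 q2 q3 p1 p2 p3 c
  have hs := continuous_sphereParam Λ
  have app : ∀ (ℓ : Heis → Heis →L[ℝ] ℂ) (v : ℝ → ℝ → Heis),
      (Continuous fun p : ℝ × ℝ => onZ (ℓ (sphereParam Λ p.1 p.2)) (sphereParam Λ p.1 p.2)) →
      (Continuous fun p : ℝ × ℝ => onZbar (ℓ (sphereParam Λ p.1 p.2)) (sphereParam Λ p.1 p.2)) →
      (Continuous fun p : ℝ × ℝ => ℓ (sphereParam Λ p.1 p.2) hT) →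
      (Continuous fun p : ℝ × ℝ => v p.1 p.2) →
      Continuous fun p : ℝ × ℝ => ℓ (sphereParam Λ p.1 p.2) (v p.1 p.2) :=
    fun ℓ v k1 k2 k3 hv => by
      have e : ∀ p : ℝ × ℝ, ℓ (sphereParam Λ p.1 p.2) (v p.1 p.2) = _ := fun p =>
        apply_eq (ℓ (sphereParam Λ p.1 p.2)) (sphereParam Λ p.1 p.2) (v p.1 p.2)
      simp only [e]
      have hv1 : Continuous fun p : ℝ × ℝ => (v p.1 p.2).1 := continuous_fst.comp hv
      have hv2 : Continuous fun p : ℝ × ℝ => (v p.1 p.2).2 := continuous_snd.comp hv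
      have hs1 : Continuous fun p : ℝ × ℝ => (sphereParam Λ p.1 p.2).1 := continuous_fst.comp hs
      have hθ : Continuous fun p : ℝ × ℝ =>
          (heisTheta (sphereParam Λ p.1 p.2) (v p.1 p.2) : ℂ) :=
        Complex.continuous_ofReal.comp (hv2.add (continuous_const.mul
          (Complex.continuous_im.comp ((Complex.continuous_conj.comp hs1).mul hv1))))
      exact (((continuous_const.mul hv1).mul k1).add
        ((continuous_const.mul (Complex.continuous_conj.comp hv1)).mul k2)).add (hθ.mul k3)
  have ht : Continuous fun p : ℝ × ℝ => sphereTau Λ p.1 p.2 := by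
    have := continuous_heightDeriv
    unfold sphereTau
    fun_prop
  have hp : Continuous fun p : ℝ × ℝ => spherePhi Λ p.1 p.2 := by
    unfold spherePhi
    fun_prop
  have t1 := app F.coTheta₁ _ q1 q2 q3 ht
  have t2 := app F.coTheta₁ _ q1 q2 q3 hp
  have t3 := app F.coTheta _ p1 p2 p3 ht
  have t4 := app F.coTheta _ p1 p2 p3 hp
  simp only [ωWedgeθ_eq, connHor]
  fun_prop

/-- If `f Λ τ φ = L τ + O(Λ⁻¹)` uniformly, the integrals of `f Λ` over a rectangle converge. -/
lemma tendsto_integral_rectangle {f : ℝ → ℝ → ℝ → ℂ} {L : ℝ → ℂ} (a b : ℝ)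
    (hL : Continuous L)
    (hc : ∀ᶠ Λ in atTop, Continuous fun p : ℝ × ℝ => f Λ p.1 p.2)
    (hb : IsSphereO (-1) fun p => f p.1 p.2.1 p.2.2 - L p.2.1) :
    Tendsto (fun Λ => ∫ τ in (0 : ℝ)..a, ∫ φ in (0 : ℝ)..b, f Λ τ φ) atTop
      (𝓝 (∫ τ in (0 : ℝ)..a, ∫ _ in (0 : ℝ)..b, L τ)) := by
  obtain ⟨C, hC⟩ := hb.bound
  have hev : ∀ᶠ Λ : ℝ in atTop, ∀ τ φ, ‖f Λ τ φ - L τ‖ ≤ C * ‖Λ ^ (-1 : ℝ)‖ := by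
    obtain ⟨pa, ha, pb, hb, h⟩ := eventually_prod_iff.1 hC
    rw [eventually_top] at hb
    filter_upwards [ha] with Λ hΛ τ φ using h hΛ (hb (τ, φ))
  have hz : Tendsto (fun Λ : ℝ => C * ‖Λ ^ (-1 : ℝ)‖ * |b - 0| * |a - 0|) atTop (𝓝 0) := by
    have h1 : Tendsto (fun Λ : ℝ => Λ ^ (-1 : ℝ)) atTop (𝓝 0) := tendsto_rpow_neg_atTop one_pos
    have h2 := ((h1.norm.const_mul C).mul_const |b - 0|).mul_const |a - 0|
    simpa using h2
  have hLc : Continuous fun p : ℝ × ℝ => L p.1 := hL.comp continuous_fst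
  refine tendsto_sub_nhds_zero_iff.1 (squeeze_zero_norm' ?_ hz)
  filter_upwards [hev, hc] with Λ hΛ hc
  have i1 : ∀ τ, IntervalIntegrable (fun φ => f Λ τ φ) volume 0 b := fun τ =>
    (hc.comp (Continuous.prodMk_right τ)).intervalIntegrable _ _
  have i2 : ∀ τ, IntervalIntegrable (fun _ : ℝ => L τ) volume 0 b := fun τ =>
    continuous_const.intervalIntegrable _ _
  have j1 := (intervalIntegral.continuous_parametric_intervalIntegral_of_continuous'
    (f := f Λ) (μ := volume) hc 0 b).intervalIntegrable (μ := volume) 0 a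
  have j2 := (intervalIntegral.continuous_parametric_intervalIntegral_of_continuous'
    (f := fun τ (_ : ℝ) => L τ) (μ := volume) hLc 0 b).intervalIntegrable (μ := volume) 0 a
  rw [← intervalIntegral.integral_sub j1 j2]
  refine intervalIntegral.norm_integral_le_of_norm_le_const fun τ _ => ?_
  rw [← intervalIntegral.integral_sub (i1 τ) (i2 τ)]
  exact intervalIntegral.norm_integral_le_of_norm_le_const fun φ _ => hΛ τ φ

lemma integral_leading_wedge (a : ℂ) :
    ∫ τ in (0 : ℝ)..Real.pi, ∫ _ in (0 : ℝ)..(2 * Real.pi), a * (heightDeriv τ : ℂ) =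
      -(4 * (Real.pi : ℂ) * a) := by
  have h := congrArg (fun r : ℝ => (r : ℂ)) integral_heightDeriv
  beta_reduce at h
  rw [← intervalIntegral.integral_ofReal] at h
  simp only [intervalIntegral.integral_const, Complex.real_smul]
  rw [intervalIntegral.integral_const_mul, intervalIntegral.integral_const_mul, h]
  push_cast
  ring

/-- The p-mass is determined by the leading perturbation of the contact form. -/
theorem isPMass : F.IsPMass (48 * Real.pi ^ 2 * F.A) := by
  have hL : Continuous fun τ => 12 * (Real.pi : ℂ) * F.A * Complex.I * (heightDeriv τ : ℂ) :=
    continuous_const.mul (Complex.continuous_ofReal.comp continuous_heightDeriv)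
  have h := (tendsto_integral_rectangle
    (f := fun Λ τ φ => F.ωWedgeθ (sphereParam Λ τ φ) (sphereTau Λ τ φ) (spherePhi Λ τ φ))
    Real.pi (2 * Real.pi) hL F.continuous_wedge
    F.wedge_asymptotics).const_mul Complex.I
  rw [integral_leading_wedge] at h
  have e : Complex.I * -(4 * (Real.pi : ℂ) * (12 * (Real.pi : ℂ) * F.A * Complex.I)) =
      ((48 * Real.pi ^ 2 * F.A : ℝ) : ℂ) := by
    push_cast
    linear_combination (-(48 * (Real.pi : ℂ) ^ 2 * F.A)) * Complex.I_sq
  rw [e] at h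
  refine h.congr fun Λ => ?_
  simp only [massIntegral, deriv_sphereParam_tau, deriv_sphereParam_phi]

end AsymptoticallyFlat

/-! ### The mass formula -/

namespace AsymptoticallyFlat

variable {N : Type*} [TopologicalSpace N] [ChartedSpace Heis N] [IsManifold IH ∞ N]
  [MeasurableSpace N] {S : Pseudohermitian N} (F : AsymptoticallyFlat S)
  {β : N → ℂ} {g : Heis → ℂ} {ε : ℝ} {κ : ℂ}
  [T2Space N] [SecondCountableTopology N] [BorelSpace N]

lemma eventually_mem_inside (p : N) : ∀ᶠ Λ in atTop, p ∈ F.inside Λ := by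
  by_cases hp : p ∈ F.coords.source
  · filter_upwards [eventually_ge_atTop F.ρ₀, eventually_ge_atTop (rho (F.coords p))] with Λ h1 h2 h
    change p ∈ F.outside Λ at h
    rw [F.outside_eq h1] at h
    exact not_lt.2 h2 h.2
  · filter_upwards [eventually_ge_atTop F.ρ₀] with Λ h1 h
    exact hp (F.outside_subset h1 h)

lemma tendsto_integral_cutoff_mul {f : N → ℂ} (hf : Integrable f S.volume) :
    Tendsto (fun Λ => ∫ p, F.cutoff Λ p * f p ∂S.volume) atTop (𝓝 (∫ p, f p ∂S.volume)) := by
  obtain ⟨Λ₁, h₁, hcl⟩ := F.exists_closure_outside_subset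
  refine tendsto_integral_filter_of_dominated_convergence (fun p => ‖f p‖) ?_ ?_ hf.norm ?_
  · filter_upwards [eventually_ge_atTop Λ₁] with Λ hΛ
    have hχ : Continuous (F.cutoff Λ) :=
      continuous_iff_continuousAt.2 fun p => (F.smoothAt_cutoff h₁ hcl hΛ p).continuousAt
    exact hχ.aestronglyMeasurable.mul hf.aestronglyMeasurable
  · refine Eventually.of_forall fun Λ => Eventually.of_forall fun p => ?_
    rw [norm_mul]
    exact mul_le_of_le_one_left (norm_nonneg _) (F.norm_cutoff_le p)
  · refine Eventually.of_forall fun p => tendsto_const_nhds.congr' ?_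
    filter_upwards [F.eventually_mem_inside p, eventually_gt_atTop F.ρ₀] with Λ h1 h2
    rw [F.cutoff_inside h2 h1, one_mul]

/-- The divergence theorem in the limit: the integral of the Paneitz term over large balls
converges, the other terms being integrable and the flux having a limit. -/
theorem tendsto_integral_paneitz (hε₀ : 0 < ε) (hε₁ : ε < 1) (hβ : ∀ q, SmoothAt β q)
    (hg : IsHomog (-1) g)
    (he : IsSymbolO (-2 + ε) fun x => β (F.coords.symm x) - (conj x.1 + g x))
    (hb : IsSymbolO (-4) fun x => S.boxb β (F.coords.symm x))
    (hgZ : ∀ x, x ≠ 0 → hZbar g x = -((√2 : ℝ) / 2) * F.pert x + κ / gauge x) :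
    Tendsto (fun Λ => ∫ p in F.inside Λ, conj (β p) * S.paneitz β p ∂S.volume) atTop
      (𝓝 (2 * (32 * (Real.pi : ℂ) ^ 2 * F.A -
        (-((∫ p, ‖S.boxb β p‖ ^ 2 ∂S.volume : ℝ) : ℂ) +
          2 * ((∫ p, S.normSqHess₁bar₁bar β p ∂S.volume : ℝ) : ℂ) +
          2 * ∫ p, S.R p * (S.normSqD₁bar β p : ℂ) ∂S.volume)))) := by
  have : LocallyCompactSpace N := ChartedSpace.locallyCompactSpace Heis N
  obtain ⟨Λ₁, h₁, hcl⟩ := F.exists_closure_outside_subset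
  set E : N → ℂ := fun p => -((‖S.boxb β p‖ ^ 2 : ℝ) : ℂ) + 2 * (S.normSqHess₁bar₁bar β p : ℂ) +
    2 * (S.R p * (S.normSqD₁bar β p : ℂ)) with hE
  set Q : N → ℂ := fun p => conj (β p) * S.paneitz β p with hQ
  have i1 : Integrable (fun p => ((‖S.boxb β p‖ ^ 2 : ℝ) : ℂ)) S.volume :=
    (F.integrable_normSq_boxb hβ hb).ofReal
  have i2 : Integrable (fun p => (S.normSqHess₁bar₁bar β p : ℂ)) S.volume :=
    (F.integrable_normSqHess hε₀ hε₁ hβ hg he).ofReal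
  have i3 := F.integrable_R_mul hε₀ hε₁ hβ hg he
  have i4 : Integrable (fun p => -((‖S.boxb β p‖ ^ 2 : ℝ) : ℂ)) S.volume := i1.neg
  have i5 : Integrable (fun p => 2 * (S.normSqHess₁bar₁bar β p : ℂ)) S.volume := i2.const_mul 2
  have i6 : Integrable (fun p => 2 * (S.R p * (S.normSqD₁bar β p : ℂ))) S.volume := i3.const_mul 2
  have i45 : Integrable (fun p => -((‖S.boxb β p‖ ^ 2 : ℝ) : ℂ) +
    2 * (S.normSqHess₁bar₁bar β p : ℂ)) S.volume := i4.add i5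
  have iE : Integrable E S.volume := i45.add i6
  have hEint : ∫ p, E p ∂S.volume = -((∫ p, ‖S.boxb β p‖ ^ 2 ∂S.volume : ℝ) : ℂ) +
      2 * ((∫ p, S.normSqHess₁bar₁bar β p ∂S.volume : ℝ) : ℂ) +
      2 * ∫ p, S.R p * (S.normSqD₁bar β p : ℂ) ∂S.volume := by
    rw [hE, integral_add i45 i6, integral_add i4 i5, integral_neg, integral_const_mul,
      integral_const_mul, integral_complex_ofReal, integral_complex_ofReal]
  rw [← hEint]
  have hβc : Continuous β := continuous_iff_continuousAt.2 fun p => (hβ p).continuousAt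
  have hPc := S.continuous_paneitz hβ
  have hQc : Continuous Q := by fun_prop
  have l1 := F.tendsto_integral_fluxPairing hε₀ hε₁ hβ hg he hb hgZ
  have l2 := F.tendsto_integral_cutoff_mul iE
  have l3 := F.tendsto_integral_paneitz_outside hε₀ hε₁ hβ hg he hb
  have l := ((l1.neg.sub l2).const_mul 2).sub l3
  rw [sub_zero, neg_neg] at l
  refine l.congr' ?_
  filter_upwards [eventually_ge_atTop Λ₁] with Λ hΛ
  have hρ : F.ρ₀ < Λ := h₁.trans_le hΛ
  have hsm : ∀ q, SmoothAt (F.cutoff Λ) q := F.smoothAt_cutoff h₁ hcl hΛ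
  have hχ : Continuous (F.cutoff Λ) := continuous_iff_continuousAt.2 fun p => (hsm p).continuousAt
  have hcs := F.hasCompactSupport_cutoff hρ
  have hm : MeasurableSet (F.inside Λ) := (F.isCompact_inside hρ).measurableSet
  have k1 : Integrable (fun p => F.cutoff Λ p * E p) S.volume :=
    iE.bdd_mul hχ.aestronglyMeasurable (Eventually.of_forall F.norm_cutoff_le)
  have k2 : Integrable (fun p => F.cutoff Λ p * Q p) S.volume :=
    (hχ.mul hQc).integrable_of_hasCompactSupport hcs.mul_right
  have k3 : Integrable (fun p => 1 / 2 * (F.cutoff Λ p * Q p)) S.volume := k2.const_mul (1 / 2)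
  have hdiv := S.integral_massIntegrand hβ hsm hcs
  -- the cut-off is `1` on `inside Λ`, so the Paneitz term there is the cut-off one minus its tail
  have hsplit : ∫ p, F.cutoff Λ p * S.massIntegrand β p ∂S.volume =
      ∫ p, F.cutoff Λ p * E p ∂S.volume + 1 / 2 * ∫ p, F.cutoff Λ p * Q p ∂S.volume := by
    rw [← integral_const_mul, ← integral_add k1 k3]
    congr 1
    ext p
    simp only [Pseudohermitian.massIntegrand, hE, hQ]
    ring
  have hin : ∫ p in F.inside Λ, F.cutoff Λ p * Q p ∂S.volume = ∫ p in F.inside Λ, Q p ∂S.volume :=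
    setIntegral_congr_fun hm fun p hp => by
      rw [F.cutoff_inside hρ hp, one_mul]
  have hio := integral_add_compl hm k2
  rw [F.compl_inside, hin] at hio
  rw [hsplit] at hdiv
  linear_combination (-2 : ℂ) * hdiv - hio

end AsymptoticallyFlat

end CRMass

end

open CRMass in
theorem proposition2p6 {N : Type*} [TopologicalSpace N] [T2Space N] [SecondCountableTopology N]
    [ChartedSpace Heis N] [IsManifold IH ∞ N] [MeasurableSpace N] [BorelSpace N]
    (S : Pseudohermitian N) (F : AsymptoticallyFlat S)
    (β : N → ℂ) (hβ : ContMDiff IH 𝓘(ℝ, ℂ) ∞ β)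
    (ε : ℝ) (hε₀ : 0 < ε) (hε₁ : ε < 1)
    (β₁ : Heis → ℂ) (hβ₁_smooth : ContDiffOn ℝ ∞ β₁ {x | x ≠ 0})
    (hβ₁_homog : ∀ r : ℝ, 0 < r → ∀ x : Heis, x ≠ 0 →
      β₁ ((r : ℂ) * x.1, r ^ 2 * x.2) = (r : ℂ)⁻¹ * β₁ x)
    (hβ_expansion : IsSymbolO (-2 + ε) fun x => β (F.coords.symm x) - (conj x.1 + β₁ x))
    (hβ_box : IsSymbolO (-4) fun x => S.boxb β (F.coords.symm x))
    (κ : ℂ)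
    (hβ₁_Zbar : ∀ x : Heis, x ≠ 0 → hZbar β₁ x =
      -(2 * (√2 : ℝ) * (Real.pi : ℂ) * (F.A : ℂ)) * ((rho x ^ (-2 : ℝ) : ℝ) : ℂ)
        + κ / ((‖x.1‖ ^ 2 : ℝ) + (x.2 : ℂ) * Complex.I)) :
    ∃ (m : ℝ) (I : ℂ),
      F.IsPMass m ∧
      Integrable (fun p => ‖S.boxb β p‖ ^ 2) S.volume ∧
      Integrable (fun p => S.normSqHess₁bar₁bar β p) S.volume ∧
      Integrable (fun p => S.R p * (S.normSqD₁bar β p : ℂ)) S.volume ∧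
      (∀ Λ : ℝ, F.ρ₀ < Λ →
        IntegrableOn (fun p => conj (β p) * S.paneitz β p) (F.inside Λ) S.volume) ∧
      Tendsto (fun Λ : ℝ => ∫ p in F.inside Λ, conj (β p) * S.paneitz β p ∂S.volume)
        atTop (𝓝 I) ∧
      2 / 3 * (m : ℂ) =
        -((∫ p, ‖S.boxb β p‖ ^ 2 ∂S.volume : ℝ) : ℂ)
        + 2 * ((∫ p, S.normSqHess₁bar₁bar β p ∂S.volume : ℝ) : ℂ)
        + 2 * ∫ p, S.R p * (S.normSqD₁bar β p : ℂ) ∂S.volume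
        + 1 / 2 * I := by
  have hβ' : ∀ q, SmoothAt β q := fun q => hβ.contMDiffAt
  have hg : IsHomog (-1) β₁ :=
    ⟨fun x hx => hβ₁_smooth.contDiffAt (isOpen_ne.mem_nhds hx), fun r hr x hx => by
      rw [dil_apply, hβ₁_homog r hr x hx, Real.rpow_neg_one]
      push_cast
      rfl⟩
  have hgZ : ∀ x, x ≠ 0 → hZbar β₁ x = -((√2 : ℝ) / 2) * F.pert x + κ / gauge x := fun x hx => by
    rw [hβ₁_Zbar x hx, AsymptoticallyFlat.pert, CRMass.gauge]
    push_cast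
    ring
  refine ⟨48 * Real.pi ^ 2 * F.A, _, F.isPMass, F.integrable_normSq_boxb hβ' hβ_box,
    F.integrable_normSqHess hε₀ hε₁ hβ' hg hβ_expansion,
    F.integrable_R_mul hε₀ hε₁ hβ' hg hβ_expansion, fun Λ hΛ => ?_,
    F.tendsto_integral_paneitz hε₀ hε₁ hβ' hg hβ_expansion hβ_box hgZ, ?_⟩
  · have hc : Continuous fun p => conj (β p) * S.paneitz β p :=
      (Complex.continuous_conj.comp hβ.continuous).mul (S.continuous_paneitz hβ')
    exact hc.continuousOn.integrableOn_compact (F.isCompact_inside hΛ)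
  · push_cast
    ring
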